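/- **Setting.** A piecewise smooth field $Z=(X,Y)$ on $\mathbb R^2$ consists of a field $X$ acting on $\{y\ge 0\}$ and a field $Y$ acting on $\{y\le 0\}$; $\Sigma=\{y=0\}$, $f(x,y)=y$, and $V.f=\langle\nabla f,V\rangle$, $V^{i}.f=\langle \nabla V^{i-1}.f,V\rangle$. On $\Sigma$ one has the sewing region $\Sigma^c$ ($X.f\cdot Y.f>0$), the escaping region $\Sigma^e$ ($X.f>0>Y.f$), the sliding region $\Sigma^s$ ($X.f<0<Y.f$) and the contact points ($X.f\cdot Y.f=0$). A contact point with $X.f=0$ is a visible (invisible) fold of $X$ if $X^2.f>0$ ($<0$); one with $Y.f=0$ is a visible (invisible) fold of $Y$ if $Y^2.f<0$ ($>0$), and a cusp of $Y$ if $Y^2.f=0\ne Y^3.f$. On $\Sigma^e\cup\Sigma^s$ Filippov's field $Z^\Sigma$ is $\left(\frac{E_2D_1-D_2E_1}{E_2-D_2},0\right)$, where $X=(D_1,D_2)$, $Y=(E_1,E_2)$. A pseudo equilibrium is a zero of $Z^\Sigma$; it is a $\Sigma$-repeller ($\Sigma$-attractor) if it lies in $\Sigma^e$ and repels (in $\Sigma^s$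 and attracts) the orbits of $Z^\Sigma$, and a $\Sigma$-saddle if it lies in $\Sigma^e$ and attracts or lies in $\Sigma^s$ and repels. A virtual pseudo equilibrium is a point $q\in\Sigma^c$ such that $X(q),Y(q)$ are linearly dependent or the line through $q+X(q)$, $q+Y(q)$ misses $\Sigma$. A trajectory is a locally finite concatenation of arcs of $X$ in $\{y\ge0\}$, of $Y$ in $\{y\le 0\}$ and of $Z^\Sigma$, run forward in time. A canard cycle is a simple closed curve $\Gamma$ made of finitely many such arcs, where arcs of $X$ and $Y$ are joined at sewing points or visible folds, arcs of $Z^\Sigma$ are joined to arcs of $X$ or $Y$ at folds or at points of $\Sigma^e\cup\Sigma^s$, two consecutive arcs are of different type (or there is just one arc, of $Z^\Sigma$), and (unless $\Gamma=\Sigma$) each component of $\Gamma\cap\Sigma$ that is not made of sewing points contains a visible fold. It is of kind I if $\Gamma\cap\Sigma\subseteq\Sigma^c$, of kind II if $\Gamma=\Sigma$, of kind III if it contains a visible fold. It is hyperbolic if it is of kind I and its first return map on a transversal segment has derivative $\neq1$, or of kind II, or of kind III with $\overline{\Sigma^e}\cap\overline{\Sigma^s}\cap\Gamma=\emptyset$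 and $\Gamma\cap\Sigma$ disjoint from $\Sigma^s$ or from $\Sigma^e$. It is an attractor if the trajectories (defined for all $t\ge0$) that start near it converge to it, and a repeller if this holds after reversal of time. Let $$Z_{\lambda,\beta}:\quad X_\lambda=\binom{1}{-x+\lambda}\ (y\ge0),\qquad Y_\beta=\binom{-1}{-x^2+\beta-\frac{\partial B}{\partial x}(x,\beta)}\ (y\le0),$$ where $B=0$ if $\beta\le0$, and for $\beta>0$: $B=0$ if $x<-\sqrt\beta$ or $x>4\sqrt\beta$, $$B=\tfrac{-3}{128\beta}(x+\sqrt\beta)^3\bigl(x^2(208+3\beta)-4x\sqrt\beta(176+15\beta)+\beta(688+93\beta)\bigr)\quad\text{if }-\sqrt\beta\le x\le\sqrt\beta,$$ $$B=\tfrac{-1}{48\beta}(x-4\sqrt\beta)^3\bigl((x^2+\beta)(-16+9\beta)-2x\sqrt\beta(16+15\beta)\bigr)\quad\text{if }\sqrt\beta<x\le4\sqrt\beta .$$ Write $a=(-\sqrt\beta,0)$, $b=(\sqrt\beta,0)$, $c=(3\sqrt\beta,0)$, $d=(\lambda,0)$, and identify $\Sigma$ with $\mathbb R$. **Phase portraits.**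 The distinguished points are the contact points and the points of $\Sigma$ joined to a visible fold of $X$ (of $Y$) by an arc of $X$ (of $Y$). Say that $Z$ and $W$ have *essentially the same phase portrait* in the square $(-r,r)^2$ if: (i) an increasing homeomorphism of $\mathbb R$ fixing $\pm r$ carries the signs of $X.f$ and $Y.f$, the folds and cusps (with their types), and the pseudo equilibria (with their types) and virtual pseudo equilibria of $Z$ on $(-r,r)$ to those of $W$; (ii) an increasing homeomorphism of $\mathbb R$ carries the distinguished points of $Z$ onto those of $W$, preserving the signs of $X.f$ and $Y.f$ and the contact types at them, and, for any two distinguished points $x,z$, whether the arc of $X$ that starts at $x$ arrives at $z$, and whether it arrives to the left of $z$; (iii) for each kind, $Z$ and $W$ have the same number of canard cycles of that kind in the square. **Theorem.** There is a function $\beta\mapsto L_1(\beta)$ such that for every $0<r\le\frac12$ there are $\lambda_0,\beta_0>0$ with $3\sqrt{\beta_0}<\lambda_0$ for which the following holds. One has $\sqrt\beta<L_1(\beta)<2\sqrt\beta$ for $0<\beta<\beta_0$. The rectangle $|\lambda|<\lambda_0$, $|\beta|<\beta_0$ is the disjoint union of the strata 1: $\beta<0$; 2, 3, 4: $\beta=0$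 and $\lambda<0$, $\lambda=0$, $\lambda>0$; and, with $\beta>0$: 5: $\lambda<-\sqrt\beta$; 6: $\lambda=-\sqrt\beta$; 7: $-\sqrt\beta<\lambda<0$; 8: $\lambda=0$; 9: $0<\lambda<\sqrt\beta$; 10: $\lambda=\sqrt\beta$; 11: $\sqrt\beta<\lambda<L_1(\beta)$; 12: $\lambda=L_1(\beta)$; 13: $L_1(\beta)<\lambda<2\sqrt\beta$; 14: $\lambda=2\sqrt\beta$; 15: $2\sqrt\beta<\lambda<3\sqrt\beta$; 16: $\lambda=3\sqrt\beta$; 17: $\lambda>3\sqrt\beta$, each of which meets every neighbourhood of $(\lambda,\beta)=(0,0)$, and two parameters of the rectangle give essentially the same phase portrait in $(-r,r)^2$ if and only if they lie in the same stratum. So there are exactly 17 distinct phase portraits. Moreover, for all parameters in the rectangle: * *Contacts.* $X.f$ vanishes on $\Sigma$ only at $d$, an invisible fold. If $\beta<0$, then $Y.f<0$ on $\Sigma$. If $\beta=0$, then $Y.f$ vanishes on $\Sigma$ only at $0$, a cusp. If $\beta>0$, then $Y.f$ vanishes on $\Sigma$ only at $a$, a visible fold, and at $b$, an invisible fold, and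 $c$ is the only point of $\Sigma$ from which an arc of $Y$ arrives at $a$. * *Regions.* $(\Sigma^e,\Sigma^s,\Sigma^c)$ is, in stratum 1: $(-\infty,\lambda),\emptyset,(\lambda,\infty)$; 2: $(-\infty,\lambda),\emptyset,(\lambda,0)\cup(0,\infty)$; 3: $(-\infty,0),\emptyset,(0,\infty)$; 4: $(-\infty,0)\cup(0,\lambda),\emptyset,(\lambda,\infty)$; 5: $(-\infty,\lambda),(a,b),(\lambda,a)\cup(b,\infty)$; 6: $(-\infty,a),(a,b),(b,\infty)$; 7–9: $(-\infty,a),(\lambda,b),(a,\lambda)\cup(b,\infty)$; 10: $(-\infty,a),\emptyset,(a,b)\cup(b,\infty)$; 11–17: $(-\infty,a)\cup(b,\lambda),\emptyset,(a,b)\cup(\lambda,\infty)$. * *Pseudo equilibria.* For $|x|<r$ the numerator $E_2D_1-D_2E_1$ of $Z^\Sigma$ has exactly one zero $p_1$ and the denominator $E_2-D_2$ exactly one zero $r_1$. In strata 3, 6, 10 one has $p_1=r_1=d$ and there are neither pseudo equilibria nor virtual pseudo equilibria with $|x|<r$. In all other strata $p_1$ is the only pseudo equilibrium and $r_1$ the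 only virtual pseudo equilibrium with $|x|<r$. In strata 7–9, $p_1\in(d,b)$ is a $\Sigma$-attractor and $r_1\in(a,d)$. In strata 1, 2, 4, 5 and 11–17, $p_1<d<r_1$ and $p_1$ is a $\Sigma$-repeller; moreover $p_1=\frac{-1+\sqrt{1+4\beta+4\lambda}}2$, $r_1=\frac{1-\sqrt{1+4\beta-4\lambda}}2$ in stratum 1, $r_1<a$ in stratum 5, and $p_1>b$ in strata 11–17. * *Canard cycles in $(-r,r)^2$.* There are none in strata 1–5 and 13–17. In strata 6–10 there is exactly one, $\Gamma$; it is of kind III and passes through $a$ and $c$. It is not hyperbolic in stratum 6, it is a hyperbolic repeller in strata 7–9, and in stratum 10 it is a repeller that encloses $b=d$, and every trajectory (defined for all $t\ge0$) that starts in its interior tends to $b$. * *Hopf-like bifurcation and collision.* Fix $\beta\in(0,\beta_0)$. For $\sqrt\beta<\lambda<L_1(\beta)$ there are exactly two canard cycles $\Gamma_1(\lambda),\Gamma_2(\lambda)$ in $(-r,r)^2$; both are of kind I, $\Gamma_1$ is an attractor, $\Gamma_2$ is a repeller, and $\Gamma_1$ lies in the interior of $\Gamma_2$. As $\lambda$ increases,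 $\Gamma_1$ grows and $\Gamma_2$ shrinks (strictly, with respect to inclusion of the curves in the interiors). In the Hausdorff distance, as $\lambda\downarrow\sqrt\beta$, $\Gamma_1\to\{b\}$ and $\Gamma_2$ tends to the cycle of stratum 10; as $\lambda\uparrow L_1(\beta)$, both tend to one curve $\Gamma_c$, which is the only canard cycle in $(-r,r)^2$ for $\lambda=L_1(\beta)$. $\Gamma_c$ is of kind I, not hyperbolic, an attractor for the trajectories in its interior and a repeller for those in its exterior. -/

import Mathlib

open Set Filter Topology

noncomputable section

/-! Planar piecewise smooth vector fields whose switching manifold is the `x`-axis. -/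

/-- A pair `Z = (X, Y)`: the field `X` acts on `{y ≥ 0}`, the field `Y` acts on `{y ≤ 0}`. -/
structure PWS where
  X : ℝ × ℝ → ℝ × ℝ
  Y : ℝ × ℝ → ℝ × ℝ

/-- The switching manifold `f = 0` for `f (x, y) = y`. -/
def switching : Set (ℝ × ℝ) := {p | p.2 = 0}

/-- `V.f`, the derivative of `f (x, y) = y` along `V`, which is the second component of `V`. -/
def lieOne (V : ℝ × ℝ → ℝ × ℝ) (p : ℝ × ℝ) : ℝ := (V p).2

/-- `V².f`. -/
def lieTwo (V : ℝ × ℝ → ℝ × ℝ) (p : ℝ × ℝ) : ℝ := fderiv ℝ (lieOne V) p (V p)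

/-- `V³.f`. -/
def lieThree (V : ℝ × ℝ → ℝ × ℝ) (p : ℝ × ℝ) : ℝ := fderiv ℝ (lieTwo V) p (V p)

/-- The bounded part of the complement of `Γ` (for a Jordan curve, its interior). -/
def insideOf (Γ : Set (ℝ × ℝ)) : Set (ℝ × ℝ) :=
  {p | p ∉ Γ ∧ Bornology.IsBounded (connectedComponentIn Γᶜ p)}

/-- The unbounded part of the complement of `Γ`. -/
def outsideOf (Γ : Set (ℝ × ℝ)) : Set (ℝ × ℝ) :=
  {p | p ∉ Γ ∧ ¬ Bornology.IsBounded (connectedComponentIn Γᶜ p)}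

/-- The open square of half-side `r` around the origin. -/
def square (r : ℝ) : Set (ℝ × ℝ) := {p | |p.1| < r ∧ |p.2| < r}

/-- The three kinds of arcs: of `X` in `{y ≥ 0}`, of `Y` in `{y ≤ 0}`, of the sliding or escaping
vector field in the switching manifold. -/
inductive ArcKind
  | upper
  | lower
  | sliding

namespace PWS

/-- Time reversal. -/
def neg (Z : PWS) : PWS := ⟨fun p => -Z.X p, fun p => -Z.Y p⟩

/-! ### The regions of the switching manifold -/

def sewing (Z : PWS) : Set (ℝ × ℝ) := {p | p ∈ switching ∧ 0 < lieOne Z.X p * lieOne Z.Y p}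

def escaping (Z : PWS) : Set (ℝ × ℝ) :=
  {p | p ∈ switching ∧ 0 < lieOne Z.X p ∧ lieOne Z.Y p < 0}

def slidingRegion (Z : PWS) : Set (ℝ × ℝ) :=
  {p | p ∈ switching ∧ lieOne Z.X p < 0 ∧ 0 < lieOne Z.Y p}

/-- The tangential (contact) points. -/
def contact (Z : PWS) : Set (ℝ × ℝ) := {p | p ∈ switching ∧ lieOne Z.X p * lieOne Z.Y p = 0}

def VisibleFoldX (Z : PWS) (p : ℝ × ℝ) : Prop :=
  p ∈ switching ∧ lieOne Z.X p = 0 ∧ 0 < lieTwo Z.X p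

def InvisibleFoldX (Z : PWS) (p : ℝ × ℝ) : Prop :=
  p ∈ switching ∧ lieOne Z.X p = 0 ∧ lieTwo Z.X p < 0

/-- `Y` acts below the switching manifold, so its fold is visible when the orbit of `Y`
through the point curves downwards. -/
def VisibleFoldY (Z : PWS) (p : ℝ × ℝ) : Prop :=
  p ∈ switching ∧ lieOne Z.Y p = 0 ∧ lieTwo Z.Y p < 0

def InvisibleFoldY (Z : PWS) (p : ℝ × ℝ) : Prop :=
  p ∈ switching ∧ lieOne Z.Y p = 0 ∧ 0 < lieTwo Z.Y p

def CuspY (Z : PWS) (p : ℝ × ℝ) : Prop :=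
  p ∈ switching ∧ lieOne Z.Y p = 0 ∧ lieTwo Z.Y p = 0 ∧ lieThree Z.Y p ≠ 0

def VisibleFold (Z : PWS) (p : ℝ × ℝ) : Prop := Z.VisibleFoldX p ∨ Z.VisibleFoldY p

def Fold (Z : PWS) (p : ℝ × ℝ) : Prop :=
  Z.VisibleFold p ∨ Z.InvisibleFoldX p ∨ Z.InvisibleFoldY p

/-! ### The sliding field and its equilibria -/

/-- Numerator of the direction function: `E₂ D₁ - D₂ E₁` for `X = (D₁, D₂)`, `Y = (E₁, E₂)`. -/
def dirNum (Z : PWS) (x : ℝ) : ℝ :=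
  (Z.Y (x, 0)).2 * (Z.X (x, 0)).1 - (Z.X (x, 0)).2 * (Z.Y (x, 0)).1

/-- Denominator of the direction function: `E₂ - D₂`. -/
def dirDen (Z : PWS) (x : ℝ) : ℝ := (Z.Y (x, 0)).2 - (Z.X (x, 0)).2

/-- Filippov's field on the escaping and sliding regions: the convex combination of `X` and `Y`
that is tangent to the switching manifold. -/
def filippov (Z : PWS) (p : ℝ × ℝ) : ℝ × ℝ :=
  (((Z.Y p).2 * (Z.X p).1 - (Z.X p).2 * (Z.Y p).1) / ((Z.Y p).2 - (Z.X p).2), 0)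

def PseudoEq (Z : PWS) (x : ℝ) : Prop :=
  (x, (0 : ℝ)) ∈ Z.escaping ∪ Z.slidingRegion ∧ Z.filippov (x, 0) = 0

/-- `x` repels the orbits of Filippov's field near `x`. -/
def FilippovRepels (Z : PWS) (x : ℝ) : Prop :=
  ∃ ε > 0, (∀ z ∈ Ioo (x - ε) x, (Z.filippov (z, 0)).1 < 0) ∧
    (∀ z ∈ Ioo x (x + ε), 0 < (Z.filippov (z, 0)).1)

/-- `x` attracts the orbits of Filippov's field near `x`. -/
def FilippovAttracts (Z : PWS) (x : ℝ) : Prop :=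
  ∃ ε > 0, (∀ z ∈ Ioo (x - ε) x, 0 < (Z.filippov (z, 0)).1) ∧
    (∀ z ∈ Ioo x (x + ε), (Z.filippov (z, 0)).1 < 0)

def SigmaRepeller (Z : PWS) (x : ℝ) : Prop :=
  Z.PseudoEq x ∧ (x, (0 : ℝ)) ∈ Z.escaping ∧ Z.FilippovRepels x

def SigmaAttractor (Z : PWS) (x : ℝ) : Prop :=
  Z.PseudoEq x ∧ (x, (0 : ℝ)) ∈ Z.slidingRegion ∧ Z.FilippovAttracts x

def SigmaSaddle (Z : PWS) (x : ℝ) : Prop :=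
  Z.PseudoEq x ∧ (((x, (0 : ℝ)) ∈ Z.escaping ∧ Z.FilippovAttracts x) ∨
    ((x, (0 : ℝ)) ∈ Z.slidingRegion ∧ Z.FilippovRepels x))

/-- Virtual pseudo equilibria: sewing points `q` at which `X q`, `Y q` are linearly dependent or
the line through `q + X q` and `q + Y q` misses the switching manifold. -/
def VirtualPseudoEq (Z : PWS) (x : ℝ) : Prop :=
  (x, (0 : ℝ)) ∈ Z.sewing ∧
    (¬ LinearIndependent ℝ ![Z.X (x, 0), Z.Y (x, 0)] ∨
      ∀ p ∈ affineSpan ℝ {(x, (0 : ℝ)) + Z.X (x, 0), (x, (0 : ℝ)) + Z.Y (x, 0)}, p ∉ switching)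

/-! ### Arcs, trajectories, canard cycles -/

/-- `γ` restricted to `[s, t]` is a nondegenerate arc of the given kind, run forward in time. -/
def IsArc (Z : PWS) (k : ArcKind) (γ : ℝ → ℝ × ℝ) (s t : ℝ) : Prop :=
  s < t ∧ ContinuousOn γ (Icc s t) ∧
    match k with
    | .upper => (∀ τ ∈ Icc s t, 0 ≤ (γ τ).2) ∧ ∀ τ ∈ Ioo s t, HasDerivAt γ (Z.X (γ τ)) τ
    | .lower => (∀ τ ∈ Icc s t, (γ τ).2 ≤ 0) ∧ ∀ τ ∈ Ioo s t, HasDerivAt γ (Z.Y (γ τ)) τ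
    | .sliding => (∀ τ ∈ Icc s t, γ τ ∈ switching) ∧
        ∀ τ ∈ Ioo s t, γ τ ∈ Z.escaping ∪ Z.slidingRegion ∧ HasDerivAt γ (Z.filippov (γ τ)) τ

/-- A forward trajectory defined for all times `≥ 0`: a locally finite concatenation of arcs. -/
def IsTrajectory (Z : PWS) (γ : ℝ → ℝ × ℝ) : Prop :=
  ∃ (t : ℕ → ℝ) (k : ℕ → ArcKind), t 0 = 0 ∧ Tendsto t atTop atTop ∧
    ∀ i, Z.IsArc (k i) γ (t i) (t (i + 1))

/-- Admissible transitions between consecutive arcs of a canard cycle: between arcs of `X` and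
arcs of `Y` at sewing points or at visible folds; between arcs of `X` or `Y` and arcs of
Filippov's field at folds or at points of the escaping or sliding region. -/
def Transition (Z : PWS) (k k' : ArcKind) (p : ℝ × ℝ) : Prop :=
  match k, k' with
  | .upper, .upper => False
  | .lower, .lower => False
  | .sliding, .sliding => False
  | .upper, .lower => p ∈ Z.sewing ∨ Z.VisibleFold p
  | .lower, .upper => p ∈ Z.sewing ∨ Z.VisibleFold p
  | _, _ => Z.Fold p ∨ p ∈ Z.escaping ∪ Z.slidingRegion

/-- Canard cycles: simple closed curves made of finitely many arcs of different kinds with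
admissible transitions (or of one arc of Filippov's field), such that, unless `Γ` is the switching
manifold, each connected component of the intersection with the switching manifold that does not
consist of sewing points contains a visible fold. -/
def IsCanardCycle (Z : PWS) (Γ : Set (ℝ × ℝ)) : Prop :=
  (∃ (n : ℕ) (t : ℕ → ℝ) (k : ℕ → ArcKind) (γ : ℝ → ℝ × ℝ),
    0 < n ∧ (∀ i < n, Z.IsArc (k i) γ (t i) (t (i + 1))) ∧
    γ (t n) = γ (t 0) ∧ InjOn γ (Ico (t 0) (t n)) ∧ Γ = γ '' Icc (t 0) (t n) ∧
    ((n = 1 ∧ k 0 = .sliding) ∨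
      (2 ≤ n ∧ ∀ i < n, Z.Transition (k i) (k ((i + 1) % n)) (γ (t (i + 1)))))) ∧
  (Γ ≠ switching → ∀ p ∈ Γ ∩ switching, p ∉ Z.sewing →
    ∃ v ∈ connectedComponentIn (Γ ∩ switching) p, Z.VisibleFold v)

def KindI (Z : PWS) (Γ : Set (ℝ × ℝ)) : Prop := Γ ∩ switching ⊆ Z.sewing

def KindII (_Z : PWS) (Γ : Set (ℝ × ℝ)) : Prop := Γ = switching

def KindIII (Z : PWS) (Γ : Set (ℝ × ℝ)) : Prop := ∃ v ∈ Γ, Z.VisibleFold v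

/-- The canard cycles contained in `U`. -/
def canardsIn (Z : PWS) (U : Set (ℝ × ℝ)) : Set (Set (ℝ × ℝ)) := {Γ | Z.IsCanardCycle Γ ∧ Γ ⊆ U}

/-- `q` is a first point of `T` on a forward trajectory that leaves `p`. -/
def FirstReturn (Z : PWS) (T : Set (ℝ × ℝ)) (p q : ℝ × ℝ) : Prop :=
  ∃ (n : ℕ) (t : ℕ → ℝ) (k : ℕ → ArcKind) (γ : ℝ → ℝ × ℝ),
    0 < n ∧ (∀ i < n, Z.IsArc (k i) γ (t i) (t (i + 1))) ∧
    γ (t 0) = p ∧ γ (t n) = q ∧ q ∈ T ∧ ∀ τ ∈ Ioo (t 0) (t n), γ τ ∉ T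

/-- A canard cycle is hyperbolic if it is of kind I and its first return map on a transversal
segment (taken inside the sewing region) has derivative different from `1`, or it is of kind II,
or it is of kind III, contains no common point of the closures of the escaping and of the sliding
region, and meets at most one of the two regions. -/
def Hyperbolic (Z : PWS) (Γ : Set (ℝ × ℝ)) : Prop :=
  (Z.KindI Γ ∧ ∃ (p ε m : ℝ) (η : ℝ → ℝ), 0 < ε ∧
      Γ ∩ (Ioo (p - ε) (p + ε) ×ˢ {0}) = {(p, 0)} ∧
      Ioo (p - ε) (p + ε) ×ˢ {0} ⊆ Z.sewing ∧
      (∀ᶠ x in 𝓝 p, Z.FirstReturn (Ioo (p - ε) (p + ε) ×ˢ {0}) (x, 0) (η x, 0)) ∧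
      HasDerivAt η m p ∧ m ≠ 1) ∨
    Z.KindII Γ ∨
    (Z.KindIII Γ ∧ closure Z.escaping ∩ closure Z.slidingRegion ∩ Γ = ∅ ∧
      (Γ ∩ switching ⊆ Z.sewing ∪ Z.escaping ∪ Z.contact ∨
        Γ ∩ switching ⊆ Z.sewing ∪ Z.slidingRegion ∪ Z.contact))

/-- `Γ` attracts the trajectories that start near `Γ` in `A`. -/
def AttractsFrom (Z : PWS) (Γ A : Set (ℝ × ℝ)) : Prop :=
  ∃ V, IsOpen V ∧ Γ ⊆ V ∧ ∀ γ, Z.IsTrajectory γ → γ 0 ∈ V ∩ A →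
    Tendsto (fun τ => Metric.infDist (γ τ) Γ) atTop (𝓝 0)

/-- `Γ` repels in `A`: it attracts in `A` for the reversed time. -/
def RepelsFrom (Z : PWS) (Γ A : Set (ℝ × ℝ)) : Prop := Z.neg.AttractsFrom Γ A

def IsAttractor (Z : PWS) (Γ : Set (ℝ × ℝ)) : Prop := Z.AttractsFrom Γ univ

def IsRepeller (Z : PWS) (Γ : Set (ℝ × ℝ)) : Prop := Z.RepelsFrom Γ univ

/-! ### Phase portraits -/

/-- Some arc of kind `k` leads from `(x, 0)` to `(z, 0)`. -/
def Joins (Z : PWS) (k : ArcKind) (x z : ℝ) : Prop :=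
  ∃ (γ : ℝ → ℝ × ℝ) (s t : ℝ), Z.IsArc k γ s t ∧ γ s = (x, 0) ∧ γ t = (z, 0)

/-- The distinguished points of the switching manifold: the contact points, and the points that
an arc of `X` or of `Y` joins to a visible fold of that field. -/
def marks (Z : PWS) : Set ℝ :=
  {x | (x, (0 : ℝ)) ∈ Z.contact ∨
    (∃ v, Z.VisibleFoldX (v, 0) ∧ (Z.Joins .upper x v ∨ Z.Joins .upper v x)) ∨
    (∃ v, Z.VisibleFoldY (v, 0) ∧ (Z.Joins .lower x v ∨ Z.Joins .lower v x))}

/-- The point `x` for `Z` has the same signs of `X.f` and `Y.f` and the same type of contact with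
the switching manifold as the point `z` for `W`. -/
def SameContact (Z W : PWS) (x z : ℝ) : Prop :=
  SignType.sign (lieOne Z.X (x, 0)) = SignType.sign (lieOne W.X (z, 0)) ∧
  SignType.sign (lieOne Z.Y (x, 0)) = SignType.sign (lieOne W.Y (z, 0)) ∧
  (Z.VisibleFoldX (x, 0) ↔ W.VisibleFoldX (z, 0)) ∧
  (Z.InvisibleFoldX (x, 0) ↔ W.InvisibleFoldX (z, 0)) ∧
  (Z.VisibleFoldY (x, 0) ↔ W.VisibleFoldY (z, 0)) ∧
  (Z.InvisibleFoldY (x, 0) ↔ W.InvisibleFoldY (z, 0)) ∧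
  (Z.CuspY (x, 0) ↔ W.CuspY (z, 0))

/-- The point `x` for `Z` is a pseudo equilibrium of the same type (real or virtual) as the point
`z` for `W`. -/
def SamePseudo (Z W : PWS) (x z : ℝ) : Prop :=
  (Z.PseudoEq x ↔ W.PseudoEq z) ∧
  (Z.SigmaRepeller x ↔ W.SigmaRepeller z) ∧
  (Z.SigmaAttractor x ↔ W.SigmaAttractor z) ∧
  (Z.SigmaSaddle x ↔ W.SigmaSaddle z) ∧
  (Z.VirtualPseudoEq x ↔ W.VirtualPseudoEq z)

/-- `Z` and `W` have essentially the same phase portrait in the square of half-side `r`: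
their switching manifolds correspond with the regions, contact points and pseudo equilibria on
them, their distinguished points are in the same order and the arcs of `X` that leave them
arrive in the same position relative to them, and they have the same numbers of canard cycles
of each kind. -/
def SamePortrait (r : ℝ) (Z W : PWS) : Prop :=
  (∃ h : ℝ ≃o ℝ, h (-r) = -r ∧ h r = r ∧
    ∀ x ∈ Ioo (-r) r, Z.SameContact W x (h x) ∧ Z.SamePseudo W x (h x)) ∧
  (∃ h : ℝ ≃o ℝ, (∀ x, x ∈ Z.marks ↔ h x ∈ W.marks) ∧
    ∀ x ∈ Z.marks, Z.SameContact W x (h x) ∧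
      ∀ z ∈ Z.marks, (Z.Joins .upper x z ↔ W.Joins .upper (h x) (h z)) ∧
        ((∃ y < z, Z.Joins .upper x y) ↔ (∃ y < h z, W.Joins .upper (h x) y))) ∧
  {Γ ∈ Z.canardsIn (square r) | Z.KindI Γ}.encard =
    {Γ ∈ W.canardsIn (square r) | W.KindI Γ}.encard ∧
  {Γ ∈ Z.canardsIn (square r) | Z.KindII Γ}.encard =
    {Γ ∈ W.canardsIn (square r) | W.KindII Γ}.encard ∧
  {Γ ∈ Z.canardsIn (square r) | Z.KindIII Γ}.encard =
    {Γ ∈ W.canardsIn (square r) | W.KindIII Γ}.encard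

/-- The escaping, sliding and sewing regions, as sets of abscissae. -/
def Regions (Z : PWS) (E S C : Set ℝ) : Prop :=
  {x : ℝ | (x, (0 : ℝ)) ∈ Z.escaping} = E ∧ {x : ℝ | (x, (0 : ℝ)) ∈ Z.slidingRegion} = S ∧
    {x : ℝ | (x, (0 : ℝ)) ∈ Z.sewing} = C

/-- For `|x| < r` the numerator of the direction function vanishes exactly at `p` and its
denominator exactly at `q`. -/
def DirZeros (Z : PWS) (r p q : ℝ) : Prop :=
  p ∈ Ioo (-r) r ∧ q ∈ Ioo (-r) r ∧
    ∀ x ∈ Ioo (-r) r, (Z.dirNum x = 0 ↔ x = p) ∧ (Z.dirDen x = 0 ↔ x = q)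

/-- The pseudo equilibria and the virtual pseudo equilibria with `|x| < r`. -/
def Pseudos (Z : PWS) (r : ℝ) (P V : Set ℝ) : Prop :=
  {x ∈ Ioo (-r) r | Z.PseudoEq x} = P ∧ {x ∈ Ioo (-r) r | Z.VirtualPseudoEq x} = V

end PWS

/-! ### The family with `μ = 0` -/

/-- The bump function `B (x, β, 0)`. -/
def bump (β x : ℝ) : ℝ :=
  if β ≤ 0 then 0
  else if x < -√β ∨ 4 * √β < x then 0
  else if x ≤ √β then
    -3 / (128 * β) * (x + √β) ^ 3 *
      (x ^ 2 * (208 + 3 * β) - 4 * x * √β * (176 + 15 * β) + β * (688 + 93 * β))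
  else
    -1 / (48 * β) * (x - 4 * √β) ^ 3 *
      ((x ^ 2 + β) * (-16 + 9 * β) - 2 * x * √β * (16 + 15 * β))

/-- The vector field `Z_{λ, β, 0}`. -/
def family (lam β : ℝ) : PWS where
  X := fun p => (1, -p.1 + lam)
  Y := fun p => (-1, -p.1 ^ 2 + β - deriv (bump β) p.1)

/-- The 17 strata of the `(λ, β)`-plane, for a given curve `λ = L β`. -/
def Stratum (L : ℝ → ℝ) (k : ℕ) (lam β : ℝ) : Prop :=
  match k with
  | 1 => β < 0
  | 2 => β = 0 ∧ lam < 0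
  | 3 => β = 0 ∧ lam = 0
  | 4 => β = 0 ∧ 0 < lam
  | 5 => 0 < β ∧ lam < -√β
  | 6 => 0 < β ∧ lam = -√β
  | 7 => 0 < β ∧ -√β < lam ∧ lam < 0
  | 8 => 0 < β ∧ lam = 0
  | 9 => 0 < β ∧ 0 < lam ∧ lam < √β
  | 10 => 0 < β ∧ lam = √β
  | 11 => 0 < β ∧ √β < lam ∧ lam < L β
  | 12 => 0 < β ∧ lam = L β
  | 13 => 0 < β ∧ L β < lam ∧ lam < 2 * √β
  | 14 => 0 < β ∧ lam = 2 * √β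
  | 15 => 0 < β ∧ 2 * √β < lam ∧ lam < 3 * √β
  | 16 => 0 < β ∧ lam = 3 * √β
  | 17 => 0 < β ∧ 3 * √β < lam
  | _ => False

end

/-! Both fields have explicit first integrals. Along an arc of `X` the quantity `y + (x - λ)² / 2`
is constant, so an upper arc that starts at `x < λ` on the switching line comes back at the
reflected point `2λ - x`. The lower field is `(-1, -G')` for a potential `G`, so `y - G(x)` is
constant along its arcs, and a lower arc from `x` back to the line at `z < x` is a horizontal chord
`G z = G x` with `G ≤ G x` in between (`upper_arc`, `lower_arc`). Since the abscissa moves with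
speed `±1`, these integrals determine the arcs and no uniqueness theorem for differential equations
is used.

For `β = s² > 0` the potential rises up to the visible fold `a = -s`, falls to the invisible fold `b
= s` and rises again, with `G(3s) = G(-s)`, which singles out `c = 3s`. For `β ≤ 0` it is strictly
increasing, no lower arc returns, and there are no cycles. A cycle of kind I alternates upper and
lower arcs; the return map `u ↦ u'` with `G u' = G(2λ - u)` is increasing, so a periodic orbit is a
fixed point (`Well.kindI_cycle`). Hence cycles of kind I are the solutions `u ∈ (-s, s)` of `M u =
λ`, where `M u` is the midpoint of the horizontal chord from `u`. The function `M` takes the value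
`s` at both ends of `[-s, s]`, increases to a maximum `L` at an interior point and then decreases
(`exists_well`). This yields no, two, one, no cycles for `λ ≤ s`, `s < λ < L`, `λ = L`, `λ > L`.
Where `M` decreases the cycle attracts, where it increases the cycle repels, and at the maximum the
return map has derivative `1` and the cycle is semistable.

That `M` has a single hump is the computational core. With midpoint `1 + e` and half length `h` in
the coordinate `x / s`, let `gap` be the difference of `G` at the two ends of the segment, divided
by `s³`. For fixed `e`, the quotient `gap / h` first decreases and then increases, so `gap` cannot
have signs `≤ 0`, `≥ 0`, `≤ 0` at three successive lengths (`gap_no_hump`). The polynomial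
inequalities behind this are certified by expansions with nonnegative coefficients in Bernstein
bases.

A cycle through the visible fold is found by going backwards from it: the fold is entered only by
the lower arc from `c`, which is entered by the upper arc from `2λ - 3s`, which for `λ < s` is
reached only by sliding from the fold. So there is exactly one such cycle, for `-s ≤ λ ≤ s`
(`Well.fold_cycle`, `Well.bigLoop_isCanardCycle`). To see that it repels for `λ > -s`, time is
reversed and the plane is reflected in the vertical axis, which gives a field of the same shape. If
`λ < s`, nearby reversed trajectories slide into the fold in finite time; if `λ = s`, those in the
interior approach it through the return map, because `M > s` on `(-s, s)`
(`Well.isRepeller_bigLoop`).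

The numerator and the denominator of Filippov's field are `λ - (g x + x)` and `(x - g x) - λ` with
`g = G'`. Since `|g'| < 1` on the square, each has one zero there, and the sign of `g λ` decides on
which side of `λ` it lies (`Balance`).

Portraits in the same stratum are matched by order isomorphisms of the line that carry one finite
increasing list of points to another. Conversely, a portrait reveals the presence of a cusp or of a
visible fold of `Y`, hence the sign of `β`; the position of `λ` relative to `a`, `b`, `c`; through
the landing points of the upper arcs from `a` and `b`, the position of `λ` relative to `0` and `2s`;
and through the number of cycles of kind I, its position relative to `L` (`Well.portrait_data`). -/

noncomputable section

/-! ### The normalized potential of the lower field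

In the coordinate `u = x / √β`, the lower field has the potential `G`, whose minimum is at `u = 1`;
`leftWell` and `rightWell` are `G (1 - t) - G 1` for `0 ≤ t ≤ 2` and `G (1 + t) - G 1` for
`0 ≤ t ≤ 3`. -/

def leftWell (β t : ℝ) : ℝ :=
  (16 + 153 / 16 * β) * t ^ 2 + (133 / 6 - 189 / 32 * β) * t ^ 3 +
    (-45 / 2 + 27 / 32 * β) * t ^ 4 + (39 / 8 + 9 / 128 * β) * t ^ 5

def leftWell₁ (β t : ℝ) : ℝ :=
  (16 + 153 / 16 * β) * (2 * t) + (133 / 6 - 189 / 32 * β) * (3 * t ^ 2) +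
    (-45 / 2 + 27 / 32 * β) * (4 * t ^ 3) + (39 / 8 + 9 / 128 * β) * (5 * t ^ 4)

def leftWell₂ (β t : ℝ) : ℝ :=
  (16 + 153 / 16 * β) * 2 + (133 / 6 - 189 / 32 * β) * (6 * t) +
    (-45 / 2 + 27 / 32 * β) * (12 * t ^ 2) + (39 / 8 + 9 / 128 * β) * (20 * t ^ 3)

def rightWell (β t : ℝ) : ℝ :=
  (16 + 153 / 16 * β) * t ^ 2 + (-4 / 3 - 113 / 16 * β) * t ^ 3 +
    (-5 / 3 + 31 / 16 * β) * t ^ 4 + (1 / 3 - 3 / 16 * β) * t ^ 5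

def rightWell₁ (β t : ℝ) : ℝ :=
  (16 + 153 / 16 * β) * (2 * t) + (-4 / 3 - 113 / 16 * β) * (3 * t ^ 2) +
    (-5 / 3 + 31 / 16 * β) * (4 * t ^ 3) + (1 / 3 - 3 / 16 * β) * (5 * t ^ 4)

def rightWell₂ (β t : ℝ) : ℝ :=
  (16 + 153 / 16 * β) * 2 + (-4 / 3 - 113 / 16 * β) * (6 * t) +
    (-5 / 3 + 31 / 16 * β) * (12 * t ^ 2) + (1 / 3 - 3 / 16 * β) * (20 * t ^ 3)

lemma hasDerivAt_quintic (a b c d t : ℝ) :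
    HasDerivAt (fun t => a * t ^ 2 + b * t ^ 3 + c * t ^ 4 + d * t ^ 5)
      (a * (2 * t) + b * (3 * t ^ 2) + c * (4 * t ^ 3) + d * (5 * t ^ 4)) t := by
  have h := ((((hasDerivAt_pow 2 t).const_mul a).add ((hasDerivAt_pow 3 t).const_mul b)).add
    ((hasDerivAt_pow 4 t).const_mul c)).add ((hasDerivAt_pow 5 t).const_mul d)
  exact h.congr_deriv (by norm_num)

lemma hasDerivAt_quintic_deriv (a b c d t : ℝ) :
    HasDerivAt (fun t => a * (2 * t) + b * (3 * t ^ 2) + c * (4 * t ^ 3) + d * (5 * t ^ 4))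
      (a * 2 + b * (6 * t) + c * (12 * t ^ 2) + d * (20 * t ^ 3)) t := by
  have h := (((((hasDerivAt_id t).const_mul 2).const_mul a).add
    (((hasDerivAt_pow 2 t).const_mul 3).const_mul b)).add
    (((hasDerivAt_pow 3 t).const_mul 4).const_mul c)).add
    (((hasDerivAt_pow 4 t).const_mul 5).const_mul d)
  exact h.congr_deriv (by norm_num; ring)

lemma hasDerivAt_leftWell (β t : ℝ) : HasDerivAt (leftWell β) (leftWell₁ β t) t :=
  hasDerivAt_quintic _ _ _ _ t

lemma hasDerivAt_leftWell₁ (β t : ℝ) : HasDerivAt (leftWell₁ β) (leftWell₂ β t) t :=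
  hasDerivAt_quintic_deriv _ _ _ _ t

lemma hasDerivAt_rightWell (β t : ℝ) : HasDerivAt (rightWell β) (rightWell₁ β t) t :=
  hasDerivAt_quintic _ _ _ _ t

lemma hasDerivAt_rightWell₁ (β t : ℝ) : HasDerivAt (rightWell₁ β) (rightWell₂ β t) t :=
  hasDerivAt_quintic_deriv _ _ _ _ t

/-- The difference of the potential at the ends of the segment with midpoint `1 + e` and half
length `h`. -/
def gap (β e h : ℝ) : ℝ := rightWell β (h + e) - leftWell β (h - e)

/-- `h ^ 2` times the derivative of `gap β e h / h`. -/
def gapSlope (β e h : ℝ) : ℝ := h * (rightWell₁ β (h + e) - leftWell₁ β (h - e)) - gap β e h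

/-- `h ^ 4` times the derivative of `gapSlope β e h / h ^ 3`. -/
def gapBend (β e h : ℝ) : ℝ :=
  h * (h * (rightWell₂ β (h + e) - leftWell₂ β (h - e))) - 3 * gapSlope β e h

lemma hasDerivAt_gap (β e h : ℝ) :
    HasDerivAt (gap β e) (rightWell₁ β (h + e) - leftWell₁ β (h - e)) h :=
  ((hasDerivAt_rightWell β (h + e)).comp_add_const h e).sub
    ((hasDerivAt_leftWell β (h - e)).comp_sub_const h e)

lemma hasDerivAt_gapSlope (β e h : ℝ) :
    HasDerivAt (gapSlope β e) (h * (rightWell₂ β (h + e) - leftWell₂ β (h - e))) h := by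
  have h1 := ((hasDerivAt_rightWell₁ β (h + e)).comp_add_const h e).sub
    ((hasDerivAt_leftWell₁ β (h - e)).comp_sub_const h e)
  refine (((hasDerivAt_id h).mul h1).sub (hasDerivAt_gap β e h)).congr_deriv ?_
  simp only [id, Pi.sub_apply]
  ring

/-! Certificates: expansions with nonnegative coefficients in Bernstein bases. -/

/-- The substitution `e = x y`, `h = y` turns the triangle `0 ≤ e ≤ h ≤ 1` into a square and makes
the factor `y ^ 3` split off; primed variables are the complements to `1`, and `b = 100 β`. -/
lemma gapSlope_bound_small {b b' x x' y y' : ℝ} (hb : 0 ≤ b) (hb' : 0 ≤ b') (hx : 0 ≤ x)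
    (hx' : 0 ≤ x') (hy : 0 ≤ y) (hy' : 0 ≤ y') (sb : b' = 1 - b) (sx : x' = 1 - x)
    (sy : y' = 1 - y) : gapSlope (b / 100) (x * y) y ≤ - y ^ 3 := by
  have key : gapSlope (b / 100) (x * y) y = - y ^ 3 - y ^ 3 * (
      b' * (x'^5 * (46 * y'^2 + 59/2 * y * y' + 5/3 * y^2) + x * x'^4 * (335/2 * y'^2 + 1295/6 * y
       * y' + 1465/24 * y^2) + x^2 * x'^3 * (210 * y'^2 + 1330/3 * y * y' + 580/3 * y^2) + x^3 *
       x'^2 * (635/6 * y'^2 + 1115/3 * y * y' + 1195/6 * y^2) + x^4 * x' * (65/3 * y'^2 + 150 * y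
       * y' + 75 * y^2) + x^5 * (13/3 * y'^2 + 106/3 * y * y' + 15 * y^2)) + b * (x'^5 *
       (73637/1600 * y'^2 + 94443/3200 * y * y' + 8003/4800 * y^2) + x * x'^4 * (107523/640 * y'^2
       + 2077979/9600 * y * y' + 2351191/38400 * y^2) + x^2 * x'^3 * (16943/80 * y'^2 +
       1069499/2400 * y * y' + 465749/2400 * y^2) + x^3 * x'^2 * (207877/1920 * y'^2 +
       1798457/4800 * y * y' + 1921129/9600 * y^2) + x^4 * x' * (5539/240 * y'^2 + 30317/200 * y *
       y' + 30189/400 * y^2) + x^5 * (5539/1200 * y'^2 + 21353/600 * y * y' + 241/16 * y^2))) := by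
    rw [sb, sx, sy]
    simp only [gapSlope, gap, leftWell, leftWell₁, rightWell, rightWell₁]
    ring
  rw [key, sub_le_self_iff]
  positivity

-- The box is `e ∈ [0, 1/5]`, `h ∈ [1, 8/5]`. Splitting off the summand `1` leaves nonnegative
-- coefficients and gives strict positivity.
set_option maxHeartbeats 2000000 in
lemma gapBend_pos_aux {b b' x x' y y' : ℝ} (hb : 0 ≤ b) (hb' : 0 ≤ b') (hx : 0 ≤ x)
    (hx' : 0 ≤ x') (hy : 0 ≤ y) (hy' : 0 ≤ y') (sb : b' = 1 - b) (sx : x' = 1 - x)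
    (sy : y' = 1 - y) : 0 < gapBend (b / 100) (x / 5) (1 + 3 / 5 * y) := by
  have key : gapBend (b / 100) (x / 5) (1 + 3 / 5 * y) = 1 + (
      b' * (x'^5 * (151/6 * y'^5 + 1001/6 * y * y'^4 + 6298/15 * y^2 * y'^3 + 36434/75 * y^3 *
       y'^2 + 89261/375 * y^4 * y' + 258913/9375 * y^5) + x * x'^4 * (3095/24 * y'^5 + 20935/24 *
       y * y'^4 + 13499/6 * y^2 * y'^3 + 80893/30 * y^3 * y'^2 + 105941/75 * y^4 * y' +
       390913/1875 * y^5) + x^2 * x'^3 * (1555/6 * y'^5 + 10739/6 * y * y'^4 + 70873/15 * y^2 *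
       y'^3 + 87547/15 * y^3 * y'^2 + 241162/75 * y^4 * y' + 1021826/1875 * y^5) + x^3 * x'^2 *
       (511/2 * y'^5 + 1804 * y * y'^4 + 97459/20 * y^2 * y'^3 + 123721/20 * y^3 * y'^2 +
       177473/50 * y^4 * y' + 824509/1250 * y^5) + x^4 * x' * (618/5 * y'^5 + 894 * y * y'^4 +
       24723/10 * y^2 * y'^3 + 6441/2 * y^3 * y'^2 + 95649/50 * y^4 * y' + 475317/1250 * y^5) +
       x^5 * (587/25 * y'^5 + 872/5 * y * y'^4 + 4943/10 * y^2 * y'^3 + 16508/25 * y^3 * y'^2 +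
       404521/1000 * y^4 * y' + 2118893/25000 * y^5)) + b * (x'^5 * (241717/9600 * y'^5 +
       1602347/9600 * y * y'^4 + 630079/1500 * y^2 * y'^3 + 911219/1875 * y^3 * y'^2 + 446449/1875
       * y^4 * y' + 6472537/234375 * y^5) + x * x'^4 * (4957193/38400 * y'^5 + 167642333/192000 *
       y * y'^4 + 540447953/240000 * y^2 * y'^3 + 129538951/48000 * y^3 * y'^2 + 106027247/75000 *
       y^4 * y' + 19561589/93750 * y^5) + x^2 * x'^3 * (12459989/48000 * y'^5 + 430181009/240000 *
       y * y'^4 + 2838659653/600000 * y^2 * y'^3 + 3506177959/600000 * y^3 * y'^2 +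
       120723623/37500 * y^4 * y' + 25577789/46875 * y^5) + x^3 * x'^2 * (20484541/80000 * y'^5 +
       36149057/20000 * y * y'^4 + 3905023789/800000 * y^2 * y'^3 + 4956567607/800000 * y^3 * y'^2
       + 284377883/80000 * y^4 * y' + 1321257679/2000000 * y^5) + x^4 * x' * (24788853/200000 *
       y'^5 + 35845449/40000 * y * y'^4 + 990985713/400000 * y^2 * y'^3 + 1290609999/400000 * y^3
       * y'^2 + 153305067/80000 * y^4 * y' + 761852487/2000000 * y^5) + x^5 * (5890223/250000 *
       y'^5 + 34980647/200000 * y * y'^4 + 198208061/400000 * y^2 * y'^3 + 66175073/100000 * y^3 *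
       y'^2 + 648513463/1600000 * y^4 * y' + 3396844403/40000000 * y^5))) := by
    rw [sb, sx, sy]
    simp only [gapBend, gapSlope, gap, leftWell, leftWell₁, leftWell₂, rightWell, rightWell₁,
      rightWell₂]
    ring
  rw [key]
  positivity

set_option maxHeartbeats 2000000 in
lemma gapSlope_pos_aux {b b' x x' y y' : ℝ} (hb : 0 ≤ b) (hb' : 0 ≤ b') (hx : 0 ≤ x)
    (hx' : 0 ≤ x') (hy : 0 ≤ y) (hy' : 0 ≤ y') (sb : b' = 1 - b) (sx : x' = 1 - x)
    (sy : y' = 1 - y) : 0 < gapSlope (b / 100) (x / 5) (8 / 5 + 3 / 5 * y) := by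
  have key : gapSlope (b / 100) (x / 5) (8 / 5 + 3 / 5 * y) = 1 + (
      b' * (x'^5 * (239969/9375 * y'^5 + 316193/1875 * y * y'^4 + 778282/1875 * y^2 * y'^3 +
       872239/1875 * y^3 * y'^2 + 828613/3750 * y^4 * y' + 247508/9375 * y^5) + x * x'^4 *
       (65003/625 * y'^5 + 90339/125 * y * y'^4 + 464353/250 * y^2 * y'^3 + 542057/250 * y^3 *
       y'^2 + 1083393/1000 * y^4 * y' + 734033/5000 * y^5) + x^2 * x'^3 * (296194/1875 * y'^5 +
       2225498/1875 * y * y'^4 + 1209353/375 * y^2 * y'^3 + 14786531/3750 * y^3 * y'^2 +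
       7762321/3750 * y^4 * y' + 578869/1875 * y^5) + x^3 * x'^2 * (400307/3750 * y'^5 +
       3435703/3750 * y * y'^4 + 4040309/1500 * y^2 * y'^3 + 26145361/7500 * y^3 * y'^2 +
       7227313/3750 * y^4 * y' + 233407/750 * y^5) + x^4 * x' * (103459/3750 * y'^5 + 1196543/3750
       * y * y'^4 + 799613/750 * y^2 * y'^3 + 2792774/1875 * y^3 * y'^2 + 1637434/1875 * y^4 * y'
       + 283907/1875 * y^5) + x^5 * (30067/75000 * y'^5 + 536083/15000 * y * y'^4 + 582029/3750 *
       y^2 * y'^3 + 912959/3750 * y^3 * y'^2 + 287867/1875 * y^4 * y' + 267473/9375 * y^5)) + b *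
       (x'^5 * (6002081/234375 * y'^5 + 7908302/46875 * y * y'^4 + 155717999/375000 * y^2 * y'^3 +
       1396041199/3000000 * y^3 * y'^2 + 1326035263/6000000 * y^4 * y' + 197938519/7500000 * y^5)
       + x * x'^4 * (650161/6250 * y'^5 + 90363017/125000 * y * y'^4 + 743178987/400000 * y^2 *
       y'^3 + 4337625287/2000000 * y^3 * y'^2 + 8668695803/8000000 * y^4 * y' + 1174209711/8000000
       * y^5) + x^2 * x'^3 * (7402987/46875 * y'^5 + 44510473/37500 * y * y'^4 + 387048337/120000
       * y^2 * y'^3 + 4732598173/1200000 * y^3 * y'^2 + 2484322583/1200000 * y^4 * y' +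
       926069521/3000000 * y^5) + x^3 * x'^2 * (639757169/6000000 * y'^5 + 5494927549/6000000 * y
       * y'^4 + 1292813191/480000 * y^2 * y'^3 + 41836164343/12000000 * y^3 * y'^2 +
       11564979259/6000000 * y^4 * y' + 1867085081/6000000 * y^5) + x^4 * x' * (164919097/6000000
       * y'^5 + 1912213517/6000000 * y * y'^4 + 255775099/240000 * y^2 * y'^3 + 1117035269/750000
       * y^3 * y'^2 + 2620015171/3000000 * y^4 * y' + 227106997/1500000 * y^5) + x^5 *
       (44659597/120000000 * y'^5 + 854997997/24000000 * y * y'^4 + 930332639/6000000 * y^2 * y'^3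
       + 292059481/1200000 * y^3 * y'^2 + 46056371/300000 * y^4 * y' + 106978427/3750000 * y^5))) := by
    rw [sb, sx, sy]
    simp only [gapSlope, gap, leftWell, leftWell₁, rightWell, rightWell₁]
    ring
  rw [key]
  positivity

/-- The range `1/5 ≤ h ≤ 11/5` is cut at `1`, `7/5` and `17/10`, with a separate certificate on each
piece and the common margin `1/10`; `gap_fifth_pos` glues the four pieces. -/
lemma gap_pos_start {b b' y y' : ℝ} (hb : 0 ≤ b) (hb' : 0 ≤ b') (hy : 0 ≤ y) (hy' : 0 ≤ y')
    (sb : b' = 1 - b) (sy : y' = 1 - y) : 0 < gap (b / 100) (1 / 5) (1/5 + 4/5 * y) := by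
  have key : gap (b / 100) (1 / 5) (1/5 + 4/5 * y) = 1 / 10 + (
      b' * ((43789/18750 * y'^5 + 79117/3750 * y * y'^4 + 110861/1875 * y^2 * y'^3 + 114413/1875 *
       y^3 * y'^2 + 98189/3750 * y^4 * y' + 3029/750 * y^5)) + b * ((8800013/3750000 * y'^5 +
       3178801/150000 * y * y'^4 + 22255033/375000 * y^2 * y'^3 + 22964653/375000 * y^3 * y'^2 +
       19711429/750000 * y^4 * y' + 3041393/750000 * y^5))) := by
    rw [sb, sy]
    simp only [gap, leftWell, rightWell]
    ring
  rw [key]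
  positivity

lemma gap_pos_mid_left {b b' y y' : ℝ} (hb : 0 ≤ b) (hb' : 0 ≤ b') (hy : 0 ≤ y) (hy' : 0 ≤ y')
    (sb : b' = 1 - b) (sy : y' = 1 - y) : 0 < gap (b / 100) (1 / 5) (1 + 2/5 * y) := by
  have key : gap (b / 100) (1 / 5) (1 + 2/5 * y) = 1 / 10 + (
      b' * ((3029/750 * y'^5 + 64493/3750 * y * y'^4 + 51701/1875 * y^2 * y'^3 + 39041/1875 * y^3
       * y'^2 + 1141/150 * y^4 * y' + 21613/18750 * y^5)) + b * ((3041393/750000 * y'^5 +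
       12954733/750000 * y * y'^4 + 10389691/375000 * y^2 * y'^3 + 15701579/750000 * y^3 * y'^2 +
       5740919/750000 * y^4 * y' + 4352411/3750000 * y^5))) := by
    rw [sb, sy]
    simp only [gap, leftWell, rightWell]
    ring
  rw [key]
  positivity

lemma gap_pos_mid_right {b b' y y' : ℝ} (hb : 0 ≤ b) (hb' : 0 ≤ b') (hy : 0 ≤ y) (hy' : 0 ≤ y')
    (sb : b' = 1 - b) (sy : y' = 1 - y) : 0 < gap (b / 100) (1 / 5) (7/5 + 3/10 * y) := by
  have key : gap (b / 100) (1 / 5) (7/5 + 3/10 * y) = 1 / 10 + (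
      b' * ((21613/18750 * y'^5 + 16429/3750 * y * y'^4 + 53089/7500 * y^2 * y'^3 + 204139/30000 *
       y^3 * y'^2 + 490547/120000 * y^4 * y' + 2693717/2400000 * y^5)) + b * ((4352411/3750000 *
       y'^5 + 331103/75000 * y * y'^4 + 85613293/12000000 * y^2 * y'^3 + 65763701/9600000 * y^3 *
       y'^2 + 788432201/192000000 * y^4 * y' + 4321409387/3840000000 * y^5))) := by
    rw [sb, sy]
    simp only [gap, leftWell, rightWell]
    ring
  rw [key]
  positivity

lemma gap_pos_end {b b' y y' : ℝ} (hb : 0 ≤ b) (hb' : 0 ≤ b') (hy : 0 ≤ y) (hy' : 0 ≤ y')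
    (sb : b' = 1 - b) (sy : y' = 1 - y) : 0 < gap (b / 100) (1 / 5) (17/10 + 1/2 * y) := by
  have key : gap (b / 100) (1 / 5) (17/10 + 1/2 * y) = 1 / 10 + (
      b' * ((2693717/2400000 * y'^5 + 978233/120000 * y * y'^4 + 781259/30000 * y^2 * y'^3 +
       304391/7500 * y^3 * y'^2 + 109709/3750 * y^4 * y' + 141389/18750 * y^5)) + b *
       ((4321409387/3840000000 * y'^5 + 1566885923/192000000 * y * y'^4 + 1250494409/48000000 *
       y^2 * y'^3 + 487103711/12000000 * y^3 * y'^2 + 5486017/187500 * y^4 * y' + 28279663/3750000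
       * y^5))) := by
    rw [sb, sy]
    simp only [gap, leftWell, rightWell]
    ring
  rw [key]
  positivity

lemma gapSlope_neg {β e h : ℝ} (hβ : β ∈ Icc (0 : ℝ) (1 / 100)) (he : 0 ≤ e) (heh : e ≤ h)
    (h0 : 0 < h) (h1 : h ≤ 1) : gapSlope β e h < 0 := by
  have := gapSlope_bound_small (b := 100 * β) (x := e / h) (y := h) (by linarith [hβ.1])
    (by linarith [hβ.2]) (by positivity) (sub_nonneg.2 ((div_le_one h0).2 heh)) h0.le
    (sub_nonneg.2 h1) rfl rfl rfl
  rw [div_mul_cancel₀ _ h0.ne', mul_div_cancel_left₀ _ (by norm_num)] at this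
  have : 0 < h ^ 3 := by positivity
  linarith

lemma gapBend_pos {β e h : ℝ} (hβ : β ∈ Icc (0 : ℝ) (1 / 100)) (he : e ∈ Icc (0 : ℝ) (1 / 5))
    (hh : h ∈ Icc (1 : ℝ) (8 / 5)) : 0 < gapBend β e h := by
  have := gapBend_pos_aux (b := 100 * β) (x := 5 * e) (y := 5 / 3 * (h - 1)) (by linarith [hβ.1])
    (by linarith [hβ.2]) (by linarith [he.1]) (sub_nonneg.2 (by linarith [he.2]))
    (by linarith [hh.1]) (sub_nonneg.2 (by linarith [hh.2])) rfl rfl rfl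
  convert this using 1
  congr 1 <;> ring

lemma gapSlope_pos {β e h : ℝ} (hβ : β ∈ Icc (0 : ℝ) (1 / 100)) (he : e ∈ Icc (0 : ℝ) (1 / 5))
    (hh : h ∈ Icc (8 / 5 : ℝ) (11 / 5)) : 0 < gapSlope β e h := by
  have := gapSlope_pos_aux (b := 100 * β) (x := 5 * e) (y := 5 / 3 * (h - 8 / 5))
    (by linarith [hβ.1]) (by linarith [hβ.2]) (by linarith [he.1])
    (sub_nonneg.2 (by linarith [he.2])) (by linarith [hh.1])
    (sub_nonneg.2 (by linarith [hh.2])) rfl rfl rfl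
  convert this using 1
  congr 1 <;> ring

/-- A midpoint at `6/5` is already too far to the right for a horizontal chord. This bounds the
midpoints from above, and it keeps `e` in the range `[0, 1/5]` of the certificates. -/
lemma gap_fifth_pos {β h : ℝ} (hβ : β ∈ Icc (0 : ℝ) (1 / 100)) (hh : h ∈ Icc (1 / 5 : ℝ) (11 / 5)) :
    0 < gap β (1 / 5) h := by
  have e0 : (100 * β) / 100 = β := by ring
  have b0 : 0 ≤ 100 * β := by linarith [hβ.1]
  have b1 : 0 ≤ 1 - 100 * β := by linarith [hβ.2]
  obtain ⟨h1, h2⟩ := hh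
  rcases le_total h 1 with c1 | c1
  · have := gap_pos_start (y := 5 / 4 * (h - 1 / 5)) b0 b1 (by linarith) (sub_nonneg.2 (by linarith))
      rfl rfl
    rw [e0] at this
    convert this using 2
    ring
  rcases le_total h (7 / 5) with c2 | c2
  · have := gap_pos_mid_left (y := 5 / 2 * (h - 1)) b0 b1 (by linarith) (sub_nonneg.2 (by linarith))
      rfl rfl
    rw [e0] at this
    convert this using 2
    ring
  rcases le_total h (17 / 10) with c3 | c3
  · have := gap_pos_mid_right (y := 10 / 3 * (h - 7 / 5)) b0 b1 (by linarith)
      (sub_nonneg.2 (by linarith)) rfl rfl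
    rw [e0] at this
    convert this using 2
    ring
  · have := gap_pos_end (y := 2 * (h - 17 / 10)) b0 b1 (by linarith)
      (sub_nonneg.2 (by linarith)) rfl rfl
    rw [e0] at this
    convert this using 2
    ring

/-- The factor `2 - h` reflects the equality of the potential at `-s` and `3s`. The strict sign says
that only the ends of `[-s, s]` have a chord with midpoint `s`. -/
lemma gap_zero_neg {β h : ℝ} (hβ : β ∈ Icc (0 : ℝ) (1 / 100)) (hh : h ∈ Ioo (0 : ℝ) 2) :
    gap β 0 h < 0 := by
  have key : gap β 0 h = -(h ^ 3 * (2 - h) * (47 / 4 - 109 / 24 * h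
    + β * (37 / 64 - 33 / 128 * h))) := by
    simp only [gap, leftWell, rightWell]
    ring
  rw [key, neg_lt_zero]
  have h1 := hh.1
  have h2 : 0 < 2 - h := by linarith [hh.2]
  have h3 : 0 < 47 / 4 - 109 / 24 * h := by linarith [hh.2]
  have h4 := hβ.1
  have h5 : 0 < 37 / 64 - 33 / 128 * h := by linarith [hh.2]
  positivity

/-- For a fixed midpoint, the gap cannot be `≤ 0`, `≥ 0`, `≤ 0` at three consecutive places. -/
lemma gap_no_hump {β e h₁ h₂ h₃ : ℝ} (hβ : β ∈ Icc (0 : ℝ) (1 / 100))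
    (he : e ∈ Icc (0 : ℝ) (1 / 5)) (h01 : 0 < h₁) (he1 : e ≤ h₁) (h12 : h₁ < h₂) (h23 : h₂ < h₃)
    (h3 : h₃ ≤ 2 + e) (g1 : gap β e h₁ ≤ 0) (g2 : 0 ≤ gap β e h₂) (g3 : gap β e h₃ ≤ 0) :
    False := by
  -- Division by `h` keeps the signs of `gap`, and the derivative of the quotient changes sign only
  -- from negative to positive, which rules out a hump.
  have hd : ∀ h : ℝ, 0 < h → HasDerivAt (fun h => gap β e h / h) (gapSlope β e h / h ^ 2) h := by
    intro h hh
    refine ((hasDerivAt_gap β e h).div (hasDerivAt_id h) hh.ne').congr_deriv ?_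
    simp only [gapSlope, id]
    ring
  -- On the middle range the sign of `gapSlope` is not known outright; after division by `h ^ 3` it
  -- is increasing, which excludes a change from `≥ 0` to `≤ 0`.
  have hd' : ∀ h : ℝ, 0 < h →
      HasDerivAt (fun h => gapSlope β e h / h ^ 3) (gapBend β e h / h ^ 4) h := by
    intro h hh
    refine ((hasDerivAt_gapSlope β e h).div (hasDerivAt_pow 3 h) (by positivity)).congr_deriv ?_
    simp only [gapBend]
    field_simp
    norm_num
    ring
  obtain ⟨ξ, hξ, eξ⟩ := exists_hasDerivAt_eq_slope (fun h => gap β e h / h)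
    (fun h => gapSlope β e h / h ^ 2) h12
    (fun h hh => (hd h (by linarith [hh.1])).continuousAt.continuousWithinAt)
    (fun h hh => hd h (by linarith [hh.1]))
  obtain ⟨ζ, hζ, eζ⟩ := exists_hasDerivAt_eq_slope (fun h => gap β e h / h)
    (fun h => gapSlope β e h / h ^ 2) h23
    (fun h hh => (hd h (by linarith [hh.1])).continuousAt.continuousWithinAt)
    (fun h hh => hd h (by linarith [hh.1]))
  have ξ0 : 0 < ξ := by linarith [hξ.1]
  have ζ0 : 0 < ζ := by linarith [hζ.1]
  have sξ : 0 ≤ gapSlope β e ξ := by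
    have : 0 ≤ gapSlope β e ξ / ξ ^ 2 := by
      rw [eξ]
      apply div_nonneg _ (by linarith)
      have a1 : gap β e h₁ / h₁ ≤ 0 := div_nonpos_of_nonpos_of_nonneg g1 h01.le
      have a2 : 0 ≤ gap β e h₂ / h₂ := div_nonneg g2 (by linarith)
      linarith
    by_contra! hc
    exact absurd this (not_le.2 (div_neg_of_neg_of_pos hc (by positivity)))
  have sζ : gapSlope β e ζ ≤ 0 := by
    have : gapSlope β e ζ / ζ ^ 2 ≤ 0 := by
      rw [eζ]
      apply div_nonpos_of_nonpos_of_nonneg _ (by linarith)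
      have a1 : gap β e h₃ / h₃ ≤ 0 := div_nonpos_of_nonpos_of_nonneg g3 (by linarith)
      have a2 : 0 ≤ gap β e h₂ / h₂ := div_nonneg g2 (by linarith)
      linarith
    by_contra! hc
    exact absurd this (not_le.2 (div_pos hc (by positivity)))
  -- The signs of `gapSlope` on `(0, 1]` and on `[8/5, 11/5]` confine both mean value points to the
  -- range where the quotient by `h ^ 3` is monotone.
  have ξ1 : 1 < ξ := by
    by_contra! hc
    exact absurd sξ (not_le.2 (gapSlope_neg hβ he.1 (by linarith [hξ.1]) ξ0 hc))
  have ζ1 : ζ < 8 / 5 := by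
    by_contra! hc
    exact absurd sζ (not_le.2 (gapSlope_pos hβ he ⟨hc, by linarith [hζ.2, he.2]⟩))
  have mono : StrictMonoOn (fun h => gapSlope β e h / h ^ 3) (Icc 1 (8 / 5)) := by
    apply strictMonoOn_of_hasDerivWithinAt_pos (f' := fun h => gapBend β e h / h ^ 4)
      (convex_Icc _ _)
    · intro h hh
      exact (hd' h (by linarith [hh.1])).continuousAt.continuousWithinAt
    · intro h hh
      rw [interior_Icc] at hh
      exact (hd' h (by linarith [hh.1])).hasDerivWithinAt
    · intro h hh
      rw [interior_Icc] at hh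
      have : 0 < h := by linarith [hh.1]
      exact div_pos (gapBend_pos hβ he ⟨hh.1.le, hh.2.le⟩) (by positivity)
  have := mono ⟨ξ1.le, by linarith [hξ.2, hζ.1]⟩ ⟨by linarith [hξ.2, hζ.1], ζ1.le⟩
    (show ξ < ζ by linarith [hξ.2, hζ.1])
  have a1 : 0 ≤ gapSlope β e ξ / ξ ^ 3 := div_nonneg sξ (by positivity)
  have a2 : gapSlope β e ζ / ζ ^ 3 ≤ 0 := div_nonpos_of_nonpos_of_nonneg sζ (by positivity)
  exact absurd this (not_lt.2 (a2.trans a1))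

/-! ### The potential of the lower field -/

lemma hasDerivAt_glue {f₁ f₂ d₁ d₂ : ℝ → ℝ} {c : ℝ} (h₁ : ∀ x, HasDerivAt f₁ (d₁ x) x)
    (h₂ : ∀ x, HasDerivAt f₂ (d₂ x) x) (hf : f₁ c = f₂ c) (hd : d₁ c = d₂ c) (x : ℝ) :
    HasDerivAt (fun x => if x ≤ c then f₁ x else f₂ x) (if x ≤ c then d₁ x else d₂ x) x := by
  rcases lt_trichotomy x c with h | h | h
  · rw [if_pos h.le]
    refine (h₁ x).congr_of_eventuallyEq ?_
    filter_upwards [Iio_mem_nhds h] with y hy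
    exact if_pos (le_of_lt hy)
  · subst h
    rw [if_pos le_rfl]
    have e₁ : HasDerivWithinAt (fun y => if y ≤ x then f₁ y else f₂ y) (d₁ x) (Iic x) x :=
      (h₁ x).hasDerivWithinAt.congr (fun y hy => if_pos hy) (if_pos le_rfl)
    have e₂ : HasDerivWithinAt (fun y => if y ≤ x then f₁ y else f₂ y) (d₁ x) (Ici x) x := by
      rw [hd]
      refine (h₂ x).hasDerivWithinAt.congr (fun y hy => ?_) ((if_pos le_rfl).trans hf)
      rcases eq_or_lt_of_le (show x ≤ y from hy) with e | e
      · subst e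
        exact (if_pos le_rfl).trans hf
      · exact if_neg (not_le.2 e)
    have := e₁.union e₂
    rwa [Iic_union_Ici, hasDerivWithinAt_univ] at this
  · rw [if_neg (not_le.2 h)]
    refine (h₂ x).congr_of_eventuallyEq ?_
    filter_upwards [Ioi_mem_nhds h] with y hy
    exact if_neg (not_le.2 hy)

/-- The function that is `f` on `(-∞, -s]`, `l` on `(-s, s]`, `r` on `(s, 4 s]` and `f` again. -/
def patch (s : ℝ) (f l r : ℝ → ℝ) (x : ℝ) : ℝ :=
  if x ≤ -s then f x else if x ≤ s then l x else if x ≤ 4 * s then r x else f x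

lemma hasDerivAt_patch {s : ℝ} {f l r f' l' r' : ℝ → ℝ} (hs : 0 < s)
    (hf : ∀ x, HasDerivAt f (f' x) x) (hl : ∀ x, HasDerivAt l (l' x) x)
    (hr : ∀ x, HasDerivAt r (r' x) x) (e₁ : f (-s) = l (-s)) (e₂ : l s = r s)
    (e₃ : r (4 * s) = f (4 * s)) (d₁ : f' (-s) = l' (-s)) (d₂ : l' s = r' s)
    (d₃ : r' (4 * s) = f' (4 * s)) (x : ℝ) :
    HasDerivAt (patch s f l r) (patch s f' l' r' x) x := by
  refine hasDerivAt_glue hf (hasDerivAt_glue hl (hasDerivAt_glue hr hf e₃ d₃) ?_ ?_) ?_ ?_ x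
  · rw [if_pos (by linarith)]; exact e₂
  · rw [if_pos (by linarith)]; exact d₂
  · rw [if_pos (by linarith)]; exact e₁
  · rw [if_pos (by linarith)]; exact d₁

/-- The potential `x ^ 3 / 3 - β x + B (x, β)` for `β = s ^ 2`. -/
def potential (s : ℝ) : ℝ → ℝ :=
  patch s (fun x => x ^ 3 / 3 - s ^ 2 * x)
    (fun x => s ^ 3 * (-110 / 3 - 27 / 4 * s ^ 2 + leftWell (s ^ 2) (1 - x / s)))
    (fun x => s ^ 3 * (-110 / 3 - 27 / 4 * s ^ 2 + rightWell (s ^ 2) (x / s - 1)))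

/-- The derivative of the potential. -/
def force (s : ℝ) : ℝ → ℝ :=
  patch s (fun x => x ^ 2 - s ^ 2) (fun x => -(s ^ 2 * leftWell₁ (s ^ 2) (1 - x / s)))
    (fun x => s ^ 2 * rightWell₁ (s ^ 2) (x / s - 1))

/-- The second derivative of the potential. -/
def force' (s : ℝ) : ℝ → ℝ :=
  patch s (fun x => 2 * x) (fun x => s * leftWell₂ (s ^ 2) (1 - x / s))
    (fun x => s * rightWell₂ (s ^ 2) (x / s - 1))

lemma hasDerivAt_potential {s : ℝ} (hs : 0 < s) (x : ℝ) :
    HasDerivAt (potential s) (force s x) x := by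
  have hs' : s ≠ 0 := hs.ne'
  apply hasDerivAt_patch hs
  · intro x
    refine (((hasDerivAt_pow 3 x).div_const 3).sub
      ((hasDerivAt_id x).const_mul (s ^ 2))).congr_deriv ?_
    norm_num
  · intro x
    have h := (hasDerivAt_leftWell (s ^ 2) (1 - x / s)).comp x
      (((hasDerivAt_id x).div_const s).const_sub 1)
    refine ((h.const_add (-110 / 3 - 27 / 4 * s ^ 2)).const_mul (s ^ 3)).congr_deriv ?_
    field_simp
  · intro x
    have h := (hasDerivAt_rightWell (s ^ 2) (x / s - 1)).comp x
      (((hasDerivAt_id x).div_const s).sub_const 1)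
    refine ((h.const_add (-110 / 3 - 27 / 4 * s ^ 2)).const_mul (s ^ 3)).congr_deriv ?_
    field_simp
  · rw [neg_div s s, div_self hs']; simp only [leftWell]; ring
  · rw [div_self hs']; simp only [leftWell, rightWell]; ring
  · rw [mul_div_cancel_right₀ _ hs']; simp only [rightWell]; ring
  · rw [neg_div s s, div_self hs']; simp only [leftWell₁]; ring
  · rw [div_self hs']; simp only [leftWell₁, rightWell₁]; ring
  · rw [mul_div_cancel_right₀ _ hs']; simp only [rightWell₁]; ring

lemma hasDerivAt_force {s : ℝ} (hs : 0 < s) (x : ℝ) :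
    HasDerivAt (force s) (force' s x) x := by
  have hs' : s ≠ 0 := hs.ne'
  apply hasDerivAt_patch hs
  · intro x
    refine ((hasDerivAt_pow 2 x).sub_const (s ^ 2)).congr_deriv ?_
    norm_num
  · intro x
    have h := (hasDerivAt_leftWell₁ (s ^ 2) (1 - x / s)).comp x
      (((hasDerivAt_id x).div_const s).const_sub 1)
    refine (h.const_mul (s ^ 2)).neg.congr_deriv ?_
    field_simp
  · intro x
    have h := (hasDerivAt_rightWell₁ (s ^ 2) (x / s - 1)).comp x
      (((hasDerivAt_id x).div_const s).sub_const 1)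
    refine (h.const_mul (s ^ 2)).congr_deriv ?_
    field_simp
  · rw [neg_div s s, div_self hs']; simp only [leftWell₁]; ring
  · rw [div_self hs']; simp only [leftWell₁, rightWell₁]; ring
  · rw [mul_div_cancel_right₀ _ hs']; simp only [rightWell₁]; ring
  · rw [neg_div s s, div_self hs']; simp only [leftWell₂]; ring
  · rw [div_self hs']; simp only [leftWell₂, rightWell₂]; ring
  · rw [mul_div_cancel_right₀ _ hs']; simp only [rightWell₂]; ring

lemma bump_eq {s : ℝ} (hs : 0 < s) :
    bump (s ^ 2) = fun x => potential s x - (x ^ 3 / 3 - s ^ 2 * x) := by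
  have hs' : s ≠ 0 := hs.ne'
  funext x
  have h2 : ¬ s ^ 2 ≤ 0 := not_le.2 (by positivity)
  simp only [bump, potential, patch, if_neg h2, Real.sqrt_sq hs.le]
  rcases lt_or_ge x (-s) with c | c
  · rw [if_pos (Or.inl c), if_pos c.le, sub_self]
  rcases lt_or_ge (4 * s) x with c' | c'
  · rw [if_pos (Or.inr c'), if_neg (by linarith), if_neg (by linarith), if_neg (by linarith),
      sub_self]
  rw [if_neg (not_or.2 ⟨not_lt.2 c, not_lt.2 c'⟩)]
  -- At `x = -s` the two definitions use different branches; the factor `(x + s) ^ 3` makes them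
  -- agree.
  rcases eq_or_lt_of_le c with e | c
  · subst e
    rw [if_pos (by linarith), if_pos le_rfl]
    ring
  rw [if_neg (not_le.2 c)]
  rcases le_or_gt x s with d | d
  · rw [if_pos d, if_pos d]
    simp only [leftWell]
    field_simp
    ring
  · rw [if_neg (not_le.2 d), if_neg (not_le.2 d), if_pos c']
    simp only [rightWell]
    field_simp
    ring

/-- The second component of the lower field is the opposite of this function. -/
def lowerForce (β : ℝ) (x : ℝ) : ℝ := if β ≤ 0 then x ^ 2 - β else force (√β) x

/-- The fields of the family: a parabolic flow above and the flow of a potential below. -/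
def potentialField (lam : ℝ) (g : ℝ → ℝ) : PWS where
  X := fun p => (1, -p.1 + lam)
  Y := fun p => (-1, -g p.1)

/-- From here on the bump function disappears: the lower field is minus the derivative of a
potential with explicit polynomial pieces. -/
lemma family_eq (lam β : ℝ) : family lam β = potentialField lam (lowerForce β) := by
  simp only [family, potentialField, PWS.mk.injEq, true_and]
  funext p
  rw [Prod.mk.injEq]
  refine ⟨rfl, ?_⟩
  rcases le_or_gt β 0 with h | h
  · have : bump β = fun _ => 0 := by
      funext x
      simp [bump, h]
    rw [this]
    simp [lowerForce, h]
    ring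
  · obtain ⟨s, hs, rfl⟩ : ∃ s : ℝ, 0 < s ∧ s ^ 2 = β := ⟨√β, Real.sqrt_pos.2 h, Real.sq_sqrt h.le⟩
    have hd : HasDerivAt (bump (s ^ 2)) (force s p.1 - (p.1 ^ 2 - s ^ 2)) p.1 := by
      rw [bump_eq hs]
      refine (hasDerivAt_potential hs p.1).sub ?_
      refine (((hasDerivAt_pow 3 p.1).div_const 3).sub
        ((hasDerivAt_id p.1).const_mul (s ^ 2))).congr_deriv ?_
      norm_num
    rw [hd.deriv, lowerForce, if_neg (not_le.2 h), Real.sqrt_sq hs.le]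
    ring

/-- The simple zeros `t = 0` and `t = 2` are the folds `b` and `a`; the remaining factor is visibly
positive. -/
lemma leftWell₁_pos {β t : ℝ} (hβ : 0 ≤ β) (ht : t ∈ Ioo (0 : ℝ) 2) : 0 < leftWell₁ β t := by
  obtain ⟨h0, h2⟩ := ht
  have h2' : 0 < 2 - t := sub_pos.2 h2
  have key : leftWell₁ β t = t * (2 - t) * (1 + 3 / 128 * (2 - t) *
      (320 + 1040 * t + β * (204 + 15 * t))) := by
    simp only [leftWell₁]; ring
  rw [key]
  positivity

/-- After the zero `t = 0` is removed, what is left is the value `2 + t` of the outer parabola plus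
a nonnegative correction that vanishes to second order at `t = 3`, where the bump ends. -/
lemma rightWell₁_pos {β t : ℝ} (hβ : β ∈ Icc (0 : ℝ) (1 / 100)) (ht : t ∈ Ioc (0 : ℝ) 3) :
    0 < rightWell₁ β t := by
  obtain ⟨h0, h2⟩ := ht
  have key : rightWell₁ β t = t * ((2 + t) + (3 - t) ^ 2 / 48 *
      (160 + 80 * t + β * (102 - 45 * t))) := by
    simp only [rightWell₁]; ring
  rw [key]
  have : 0 < 160 + 80 * t + β * (102 - 45 * t) := by nlinarith [hβ.1, hβ.2]
  positivity

lemma force_outer_left {s x : ℝ} (hs : 0 < s) (hx : x < -s) : 0 < force s x := by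
  rw [force, patch, if_pos hx.le]
  nlinarith

lemma force_inner {s x : ℝ} (hx : x ∈ Ioo (-s) s) : force s x < 0 := by
  have hs : 0 < s := by linarith [hx.1, hx.2]
  rw [force, patch, if_neg (not_le.2 hx.1), if_pos hx.2.le, neg_lt_zero]
  refine mul_pos (by positivity) (leftWell₁_pos (by positivity) ⟨?_, ?_⟩)
  · rw [sub_pos, div_lt_one hs]; exact hx.2
  · have : -1 < x / s := by rw [lt_div_iff₀ hs]; linarith [hx.1]
    linarith

lemma force_outer_right {s x : ℝ} (hs : 0 < s) (hs' : s ^ 2 ≤ 1 / 100) (hx : s < x) :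
    0 < force s x := by
  rw [force, patch, if_neg (by linarith), if_neg (by linarith)]
  split_ifs with h
  · refine mul_pos (by positivity) (rightWell₁_pos ⟨by positivity, hs'⟩ ⟨?_, ?_⟩)
    · rw [sub_pos, one_lt_div hs]; exact hx
    · rw [sub_le_iff_le_add, div_le_iff₀ hs]; linarith
  · nlinarith

lemma abs_force'_le {s x : ℝ} (hs : 0 < s) (hs' : s ^ 2 ≤ 1 / 100) (hx : x ∈ Ioc (-s) (4 * s)) :
    |force' s x| ≤ 5000 * s := by
  have h0 := sq_nonneg s
  rw [force', patch, if_neg (not_le.2 hx.1), if_pos hx.2]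
  have hl : ∀ t : ℝ, 0 ≤ t → t ≤ 2 → |leftWell₂ (s ^ 2) t| ≤ 5000 := by
    intro t h1 h2
    have e1 : t ^ 2 ≤ 4 := by nlinarith
    have e2 : t ^ 3 ≤ 8 := by nlinarith [mul_nonneg h1 h1]
    have e3 : 0 ≤ t ^ 2 := by positivity
    have e4 : 0 ≤ t ^ 3 := by positivity
    rw [leftWell₂, abs_le]
    constructor <;> nlinarith [mul_nonneg h0 h1, mul_nonneg h0 e3, mul_nonneg h0 e4,
      mul_nonneg h0 (sub_nonneg.2 h2), mul_nonneg h0 (sub_nonneg.2 e1),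
      mul_nonneg h0 (sub_nonneg.2 e2)]
  have hr : ∀ t : ℝ, 0 ≤ t → t ≤ 3 → |rightWell₂ (s ^ 2) t| ≤ 5000 := by
    intro t h1 h2
    have e1 : t ^ 2 ≤ 9 := by nlinarith
    have e2 : t ^ 3 ≤ 27 := by nlinarith [mul_nonneg h1 h1]
    have e3 : 0 ≤ t ^ 2 := by positivity
    have e4 : 0 ≤ t ^ 3 := by positivity
    rw [rightWell₂, abs_le]
    constructor <;> nlinarith [mul_nonneg h0 h1, mul_nonneg h0 e3, mul_nonneg h0 e4,
      mul_nonneg h0 (sub_nonneg.2 h2), mul_nonneg h0 (sub_nonneg.2 e1),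
      mul_nonneg h0 (sub_nonneg.2 e2)]
  have h1 : x / s ≤ 4 := by rw [div_le_iff₀ hs]; exact hx.2
  have h2 : -1 < x / s := by rw [lt_div_iff₀ hs]; linarith [hx.1]
  split_ifs with h
  · have h3 : x / s ≤ 1 := by rw [div_le_iff₀ hs]; linarith
    rw [abs_mul, abs_of_pos hs, mul_comm]
    exact mul_le_mul_of_nonneg_right (hl _ (by linarith) (by linarith)) hs.le
  · have h3 : 1 < x / s := by rw [lt_div_iff₀ hs]; linarith
    rw [abs_mul, abs_of_pos hs, mul_comm]
    exact mul_le_mul_of_nonneg_right (hr _ (by linarith) (by linarith)) hs.le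

/-- Inside the bump the crude constant `5000` times `s < 1/10000` is below `1`; outside it the
derivative is `2x`, which forces the restriction to `|x| < 1/2`. The bound makes `x + g x` and `x -
g x` increasing, hence the direction function has single zeros. -/
lemma abs_force'_lt {s x : ℝ} (hs : 0 < s) (hs' : s < 1 / 10000)
    (hx : x ∈ Ioo (-1 / 2 : ℝ) (1 / 2)) : |force' s x| < 1 := by
  by_cases h : x ∈ Ioc (-s) (4 * s)
  · have := abs_force'_le hs (by nlinarith) h
    linarith
  · have : force' s x = 2 * x := by
      rw [force', patch]
      split_ifs with h1 h2 h3
      · rfl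
      · exact absurd ⟨not_le.1 h1, by linarith⟩ h
      · exact absurd ⟨not_le.1 h1, h3⟩ h
      · rfl
    rw [this, abs_lt]
    constructor <;> linarith [hx.1, hx.2]

lemma force_left {s : ℝ} (hs : 0 < s) : force s (-s) = 0 := by
  rw [force, patch, if_pos le_rfl]; ring

lemma force_right {s : ℝ} (hs : 0 < s) : force s s = 0 := by
  rw [force, patch, if_neg (by linarith), if_pos le_rfl, div_self hs.ne']
  simp [leftWell₁]

lemma force'_left {s : ℝ} : force' s (-s) = -2 * s := by
  rw [force', patch, if_pos le_rfl]; ring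

lemma force'_right {s : ℝ} (hs : 0 < s) : 0 < force' s s := by
  rw [force', patch, if_neg (by linarith), if_pos le_rfl, div_self hs.ne']
  simp only [leftWell₂]
  norm_num
  positivity

/-- The potential in terms of the midpoint and the half length of a segment. -/
lemma potential_sub {s lam u : ℝ} (hs : 0 < s) (hu : u ∈ Icc (-s) s) (hl : s ≤ 2 * lam - u)
    (hl' : 2 * lam - u ≤ 4 * s) :
    potential s (2 * lam - u) - potential s u =
      s ^ 3 * gap (s ^ 2) (lam / s - 1) ((lam - u) / s) := by
  have hs' : s ≠ 0 := hs.ne'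
  have h1 : potential s u =
      s ^ 3 * (-110 / 3 - 27 / 4 * s ^ 2 + leftWell (s ^ 2) (1 - u / s)) := by
    rw [potential, patch]
    split_ifs with c d
    · have : u = -s := le_antisymm c hu.1
      rw [this, neg_div s s, div_self hs']; simp only [leftWell]; ring
    · rfl
    · exact absurd hu.2 d
    · exact absurd hu.2 d
  have h2 : potential s (2 * lam - u) =
      s ^ 3 * (-110 / 3 - 27 / 4 * s ^ 2 + rightWell (s ^ 2) ((2 * lam - u) / s - 1)) := by
    rw [potential, patch, if_neg (by linarith)]
    split_ifs with d
    · have : 2 * lam - u = s := le_antisymm d hl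
      rw [this, div_self hs']; simp only [leftWell, rightWell]; ring
    · rfl
  rw [h1, h2, gap]
  have e1 : (lam - u) / s + (lam / s - 1) = (2 * lam - u) / s - 1 := by field_simp; ring
  have e2 : (lam - u) / s - (lam / s - 1) = 1 - u / s := by field_simp; ring
  rw [e1, e2]
  ring

/-- The qualitative properties of the lower potential `G` with derivative `g`: it increases up to
`-s`, decreases up to `s` and increases again; `M u` is the midpoint of the horizontal chord of
its graph that starts at `u ∈ [-s, s]` and ends to the right of `s`, and `M` first increases up to
the value `L` at `c` and then decreases. -/
structure Well (s : ℝ) (g G M : ℝ → ℝ) (c L : ℝ) : Prop where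
  pos : 0 < s
  small : s < 1 / 10000
  deriv : ∀ x, HasDerivAt G (g x) x
  cont : Continuous g
  out_left : ∀ x < -s, 0 < g x
  inner : ∀ x ∈ Ioo (-s) s, g x < 0
  out_right : ∀ x, s < x → 0 < g x
  at_left : g (-s) = 0
  at_right : g s = 0
  left_eq : ∀ x ≤ -s, g x = x ^ 2 - s ^ 2
  level : G (3 * s) = G (-s)
  bend_left : ∃ k < 0, HasDerivAt g k (-s)
  bend_right : ∃ k > 0, HasDerivAt g k s
  mono_add : StrictMonoOn (fun x => g x + x) (Ioo (-1 / 2) (1 / 2))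
  mono_sub : StrictMonoOn (fun x => x - g x) (Ioo (-1 / 2) (1 / 2))
  depth : G (-s) - G s ≤ 50 * s ^ 3
  mid_left : M (-s) = s
  mid_right : M s = s
  mid_cont : ContinuousOn M (Icc (-s) s)
  c_mem : c ∈ Ioo (-s) s
  mid_mono : StrictMonoOn M (Icc (-s) c)
  mid_anti : StrictAntiOn M (Icc c s)
  mid_c : M c = L
  lt_L : s < L
  L_lt : L < 2 * s
  lt_iff : ∀ u ∈ Icc (-s) s, ∀ lam, s ≤ lam → (G (2 * lam - u) < G u ↔ lam < M u)
  gt_iff : ∀ u ∈ Icc (-s) s, ∀ lam, s ≤ lam → (G u < G (2 * lam - u) ↔ M u < lam)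

/-- The hypothesis excludes a point whose value is at most those of two points on either side of it;
applied with the maximum point as an outer point, it gives strict monotonicity on each side. -/
lemma strictMonoOn_of_strict_quasiconcave {M : ℝ → ℝ} {a b c : ℝ}
    (hM : ∀ x ∈ Icc a b, ∀ y ∈ Icc a b, ∀ z ∈ Icc a b, x < y → y < z → M x < M y ∨ M z < M y)
    (hc : c ∈ Icc a b) (hmax : ∀ x ∈ Icc a b, M x ≤ M c) :
    StrictMonoOn M (Icc a c) ∧ StrictAntiOn M (Icc c b) := by
  constructor
  · intro x hx y hy hxy
    have hx' : x ∈ Icc a b := ⟨hx.1, hx.2.trans hc.2⟩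
    have hy' : y ∈ Icc a b := ⟨hy.1, hy.2.trans hc.2⟩
    rcases eq_or_lt_of_le hy.2 with h | h
    · subst h
      by_contra! hle
      -- If `M x` equalled the maximum, an intermediate point would have to lie strictly above the
      -- maximum.
      have hm : (x + y) / 2 ∈ Icc a b := ⟨by linarith [hx.1, hy.1], by linarith [hc.2]⟩
      have := hmax _ hm
      rcases hM x hx' _ hm y hc (by linarith) (by linarith) with h' | h' <;> linarith
    · rcases hM x hx' y hy' c hc hxy h with h' | h'
      · exact h'
      · exact absurd (hmax y hy') (not_le.2 h')
  · intro x hx y hy hxy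
    have hx' : x ∈ Icc a b := ⟨hc.1.trans hx.1, hx.2⟩
    have hy' : y ∈ Icc a b := ⟨hc.1.trans hy.1, hy.2⟩
    rcases eq_or_lt_of_le hx.1 with h | h
    · subst h
      by_contra! hle
      have hm : (c + y) / 2 ∈ Icc a b := ⟨by linarith [hc.1], by linarith [hy'.2]⟩
      have := hmax _ hm
      rcases hM c hc _ hm y hy' (by linarith) (by linarith) with h' | h' <;> linarith
    · rcases hM c hc x hx' y hy' h hxy with h' | h'
      · exact absurd (hmax x hx') (not_le.2 h')
      · exact h'

/-- The midpoint `M u` comes from the intermediate value theorem between the midpoints `s`, where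
the right end is too low or level, and `6s/5`, where it is too high. All further properties of `M`
follow from the comparison of the potentials at the two ends of a segment. -/
theorem exists_well {s : ℝ} (hs : 0 < s) (hs' : s < 1 / 10000) :
    ∃ (M : ℝ → ℝ) (c L : ℝ), Well s (force s) (potential s) M c L := by
  have hβ : s ^ 2 ∈ Icc (0 : ℝ) (1 / 100) := ⟨by positivity, by nlinarith⟩
  have hs0 : s ≠ 0 := hs.ne'
  have s3 : 0 < s ^ 3 := by positivity
  have Gcont : Continuous (potential s) :=
    continuous_iff_continuousAt.2 fun x => (hasDerivAt_potential hs x).continuousAt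
  have Gmono : StrictMonoOn (potential s) (Ici s) := by
    apply strictMonoOn_of_hasDerivWithinAt_pos (convex_Ici s) Gcont.continuousOn
      (fun x _ => (hasDerivAt_potential hs x).hasDerivWithinAt)
    intro x hx
    rw [interior_Ici] at hx
    exact force_outer_right hs hβ.2 hx
  -- This is the vanishing of `gap` for `e = 0` and `h = 2`.
  have level : potential s (3 * s) = potential s (-s) := by
    have := potential_sub (lam := s) (u := -s) hs ⟨le_rfl, by linarith⟩ (by linarith) (by linarith)
    rw [show 2 * s - -s = 3 * s by ring, div_self hs0, sub_neg_eq_add, ← two_mul,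
      mul_div_cancel_right₀ _ hs0] at this
    have h0 : gap (s ^ 2) (1 - 1) 2 = 0 := by
      simp only [gap, rightWell, leftWell]; ring
    rw [h0, mul_zero] at this
    linarith
  have low : ∀ u ∈ Ioo (-s) s, potential s (2 * s - u) < potential s u := by
    intro u hu
    have := potential_sub (lam := s) hs ⟨hu.1.le, hu.2.le⟩ (by linarith [hu.2]) (by linarith [hu.1])
    rw [div_self hs0, sub_self] at this
    have h0 := gap_zero_neg (h := (s - u) / s) hβ
      ⟨div_pos (by linarith [hu.2]) hs, by rw [div_lt_iff₀ hs]; linarith [hu.1]⟩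
    have := mul_neg_of_pos_of_neg s3 h0
    linarith
  have low' : ∀ u ∈ Icc (-s) s, potential s (2 * s - u) ≤ potential s u := by
    intro u hu
    rcases eq_or_lt_of_le hu.1 with h | h
    · rw [← h, show 2 * s - -s = 3 * s by ring, level]
    rcases eq_or_lt_of_le hu.2 with h' | h'
    · rw [h', show 2 * s - s = s by ring]
    · exact (low u ⟨h, h'⟩).le
  have high : ∀ u ∈ Icc (-s) s, potential s u < potential s (2 * (6 / 5 * s) - u) := by
    intro u hu
    have := potential_sub (lam := 6 / 5 * s) hs hu (by linarith [hu.2]) (by linarith [hu.1])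
    rw [mul_div_cancel_right₀ _ hs0, show (6 / 5 - 1 : ℝ) = 1 / 5 by norm_num] at this
    have h0 := gap_fifth_pos (h := (6 / 5 * s - u) / s) hβ
      ⟨by rw [le_div_iff₀ hs]; linarith [hu.2], by rw [div_le_iff₀ hs]; linarith [hu.1]⟩
    have := mul_pos s3 h0
    linarith
  -- The value of `M` outside `[-s, s]` is the irrelevant default `0`.
  have ex : ∀ u, ∃ m, u ∈ Icc (-s) s → m ∈ Ico s (6 / 5 * s) ∧
      potential s (2 * m - u) = potential s u := by
    intro u
    by_cases hu : u ∈ Icc (-s) s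
    · have := intermediate_value_Icc (show s ≤ 6 / 5 * s by linarith)
        (f := fun m => potential s (2 * m - u)) (by fun_prop)
      obtain ⟨m, hm, e⟩ := this ⟨low' u hu, (high u hu).le⟩
      refine ⟨m, fun _ => ⟨⟨hm.1, lt_of_le_of_ne hm.2 ?_⟩, e⟩⟩
      rintro rfl
      exact absurd e (high u hu).ne'
    · exact ⟨0, fun h => absurd h hu⟩
  choose M hM using ex
  have lt_iff : ∀ u ∈ Icc (-s) s, ∀ lam, s ≤ lam →
      (potential s (2 * lam - u) < potential s u ↔ lam < M u) := by
    intro u hu lam hl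
    obtain ⟨h1, h2⟩ := hM u hu
    rw [← h2, Gmono.lt_iff_lt (mem_Ici.2 (by linarith [hu.2]))
      (mem_Ici.2 (by linarith [hu.2, h1.1]))]
    constructor <;> intro <;> linarith
  have gt_iff : ∀ u ∈ Icc (-s) s, ∀ lam, s ≤ lam →
      (potential s u < potential s (2 * lam - u) ↔ M u < lam) := by
    intro u hu lam hl
    obtain ⟨h1, h2⟩ := hM u hu
    rw [← h2, Gmono.lt_iff_lt (mem_Ici.2 (by linarith [hu.2, h1.1]))
      (mem_Ici.2 (by linarith [hu.2]))]
    constructor <;> intro <;> linarith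
  have mid_gt : ∀ u ∈ Ioo (-s) s, s < M u := fun u hu =>
    (lt_iff u ⟨hu.1.le, hu.2.le⟩ s le_rfl).1 (low u hu)
  have mid_left : M (-s) = s := by
    have hm : -s ∈ Icc (-s) s := ⟨le_rfl, by linarith⟩
    refine le_antisymm ?_ (hM _ hm).1.1
    by_contra! h
    have := (lt_iff _ hm s le_rfl).2 h
    rw [show 2 * s - -s = 3 * s by ring, level] at this
    exact lt_irrefl _ this
  have mid_right : M s = s := by
    have hm : s ∈ Icc (-s) s := ⟨by linarith, le_rfl⟩
    refine le_antisymm ?_ (hM _ hm).1.1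
    by_contra! h
    have := (lt_iff _ hm s le_rfl).2 h
    rw [show 2 * s - s = s by ring] at this
    exact lt_irrefl _ this
  -- The conditions `a < M u` and `M u < b` are strict inequalities between continuous functions of
  -- `u` by `lt_iff` and `gt_iff`, hence open; no implicit function theorem is needed, also at the
  -- ends.
  have mid_cont : ContinuousOn M (Icc (-s) s) := by
    intro u hu
    refine tendsto_order.2 ⟨fun a ha => ?_, fun b hb => ?_⟩
    · rcases lt_or_ge a s with h | h
      · filter_upwards [self_mem_nhdsWithin] with v hv
        exact h.trans_le (hM v hv).1.1
      · have h1 := (lt_iff u hu a h).2 ha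
        have h2 : ∀ᶠ v in 𝓝 u, potential s (2 * a - v) < potential s v :=
          ContinuousAt.eventually_lt (by fun_prop) (by fun_prop) h1
        filter_upwards [self_mem_nhdsWithin, nhdsWithin_le_nhds h2] with v hv h3
        exact (lt_iff v hv a h).1 h3
    · have h : s ≤ b := (hM u hu).1.1.trans hb.le
      have h1 := (gt_iff u hu b h).2 hb
      have h2 : ∀ᶠ v in 𝓝 u, potential s v < potential s (2 * b - v) :=
        ContinuousAt.eventually_lt (by fun_prop) (by fun_prop) h1
      filter_upwards [self_mem_nhdsWithin, nhdsWithin_le_nhds h2] with v hv h3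
      exact (gt_iff v hv b h).1 h3
  obtain ⟨c, hc, hmax⟩ := isCompact_Icc.exists_isMaxOn (nonempty_Icc.2 (by linarith)) mid_cont
  have h0 : (0 : ℝ) ∈ Ioo (-s) s := ⟨by linarith, hs⟩
  have hMc : s < M c := (mid_gt 0 h0).trans_le (hmax ⟨h0.1.le, h0.2.le⟩)
  have hc' : c ∈ Ioo (-s) s := by
    refine ⟨lt_of_le_of_ne hc.1 ?_, lt_of_le_of_ne hc.2 ?_⟩
    · rintro rfl; exact absurd hMc (by rw [mid_left]; exact lt_irrefl _)
    · rintro rfl; exact absurd hMc (by rw [mid_right]; exact lt_irrefl _)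
  -- With the midpoint fixed at `M y`, a failure would make the gap `≤ 0` at the half lengths of `z`
  -- and `x` and zero at that of `y` in between.
  have quasi : ∀ x ∈ Icc (-s) s, ∀ y ∈ Icc (-s) s, ∀ z ∈ Icc (-s) s, x < y → y < z →
      M x < M y ∨ M z < M y := by
    intro x hx y hy z hz hxy hyz
    by_contra! hcon
    obtain ⟨k1, k2⟩ := hcon
    have hy' : y ∈ Ioo (-s) s := ⟨hx.1.trans_lt hxy, hyz.trans_le hz.2⟩
    have hmy := mid_gt y hy'
    obtain ⟨⟨m1, m2⟩, m3⟩ := hM y hy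
    have gapsign : ∀ u ∈ Icc (-s) s, potential s (2 * M y - u) - potential s u =
        s ^ 3 * gap (s ^ 2) (M y / s - 1) ((M y - u) / s) := fun u hu =>
      potential_sub hs hu (by linarith [hu.2]) (by linarith [hu.1])
    have neg : ∀ u ∈ Icc (-s) s, M y ≤ M u → gap (s ^ 2) (M y / s - 1) ((M y - u) / s) ≤ 0 := by
      intro u hu hle
      have h1 : potential s (2 * M y - u) ≤ potential s u := by
        by_contra! h
        exact absurd ((gt_iff u hu _ m1).1 h) (not_lt.2 hle)
      have := gapsign u hu
      by_contra! h
      have := mul_pos s3 h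
      linarith
    have m4 : M y / s ≤ 6 / 5 := by rw [div_le_iff₀ hs]; exact m2.le
    have m5 : 1 ≤ M y / s := by rw [le_div_iff₀ hs]; linarith
    -- A larger left end means a smaller half length, so `z`, `y`, `x` appear in reversed order.
    refine gap_no_hump hβ (e := M y / s - 1) (h₁ := (M y - z) / s) (h₂ := (M y - y) / s)
      (h₃ := (M y - x) / s) ⟨by linarith, by linarith⟩ (div_pos (by linarith [hz.2]) hs) ?_
      (div_lt_div_of_pos_right (by linarith) hs) (div_lt_div_of_pos_right (by linarith) hs) ?_
      (neg z hz k2) ?_ (neg x hx k1)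
    · rw [sub_le_iff_le_add, ← sub_le_iff_le_add', ← sub_div, div_le_iff₀ hs]
      linarith [hz.2]
    · rw [← sub_nonneg]
      have : 2 + (M y / s - 1) - (M y - x) / s = (s + x) / s := by field_simp; ring
      rw [this]
      exact div_nonneg (by linarith [hx.1]) hs.le
    · have := gapsign y hy
      rw [m3, sub_self] at this
      rcases mul_eq_zero.1 this.symm with h | h
      · exact absurd h s3.ne'
      · exact h.ge
  obtain ⟨mono, anti⟩ := strictMonoOn_of_strict_quasiconcave quasi hc (fun x hx => hmax hx)
  have dforce : ∀ x ∈ Ioo (-1 / 2 : ℝ) (1 / 2), |force' s x| < 1 := fun x hx =>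
    abs_force'_lt hs hs' hx
  have fcont : Continuous (force s) :=
    continuous_iff_continuousAt.2 fun x => (hasDerivAt_force hs x).continuousAt
  refine ⟨M, c, M c, ?_⟩
  exact
  { pos := hs
    small := hs'
    deriv := hasDerivAt_potential hs
    cont := fcont
    out_left := fun x hx => force_outer_left hs hx
    inner := fun x hx => force_inner hx
    out_right := fun x hx => force_outer_right hs hβ.2 hx
    at_left := force_left hs
    at_right := force_right hs
    left_eq := fun x hx => by rw [force, patch, if_pos hx]
    level := level
    bend_left := ⟨_, by rw [force'_left]; linarith, hasDerivAt_force hs _⟩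
    bend_right := ⟨_, force'_right hs, hasDerivAt_force hs _⟩
    mono_add := by
      refine strictMonoOn_of_hasDerivWithinAt_pos (convex_Ioo _ _)
        (fcont.add continuous_id).continuousOn
        (fun x _ => ((hasDerivAt_force hs x).add (hasDerivAt_id x)).hasDerivWithinAt) ?_
      intro x hx
      rw [interior_Ioo] at hx
      linarith [(abs_lt.1 (dforce x hx)).1]
    mono_sub := by
      refine strictMonoOn_of_hasDerivWithinAt_pos (convex_Ioo _ _)
        (continuous_id.sub fcont).continuousOn
        (fun x _ => ((hasDerivAt_id x).sub (hasDerivAt_force hs x)).hasDerivWithinAt) ?_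
      intro x hx
      rw [interior_Ioo] at hx
      linarith [(abs_lt.1 (dforce x hx)).2]
    depth := by
      rw [potential, patch, patch, if_pos le_rfl, if_neg (by linarith), if_pos le_rfl,
        div_self hs0]
      simp only [leftWell]
      nlinarith [hβ.2, s3]
    mid_left := mid_left
    mid_right := mid_right
    mid_cont := mid_cont
    c_mem := hc'
    mid_mono := mono
    mid_anti := anti
    mid_c := rfl
    lt_L := hMc
    L_lt := (hM c hc).1.2.trans (by linarith)
    lt_iff := lt_iff
    gt_iff := gt_iff }

/-! ### Static properties of the fields -/

section Static

variable {lam s c L x k : ℝ} {g G M : ℝ → ℝ}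

lemma lieOne_X : lieOne (potentialField lam g).X (x, 0) = lam - x := by
  simp [lieOne, potentialField]; ring

lemma lieOne_Y : lieOne (potentialField lam g).Y (x, 0) = -g x := rfl

lemma lieTwo_X : lieTwo (potentialField lam g).X (x, 0) = -1 := by
  have h : HasFDerivAt (lieOne (potentialField lam g).X)
      (-(ContinuousLinearMap.fst ℝ ℝ ℝ)) (x, 0) := by
    exact (hasFDerivAt_fst (𝕜 := ℝ) (p := ((x : ℝ), (0 : ℝ)))).neg.add_const lam
  rw [lieTwo, h.fderiv]
  simp [potentialField]

lemma lieTwo_Y (h : HasDerivAt g k x) : lieTwo (potentialField lam g).Y (x, 0) = k := by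
  have h' : HasFDerivAt (lieOne (potentialField lam g).Y)
      (-(k • (ContinuousLinearMap.fst ℝ ℝ ℝ))) (x, 0) := by
    have := h.comp_hasFDerivAt (f := fun p : ℝ × ℝ => p.1) (x, (0 : ℝ))
      (ContinuousLinearMap.fst ℝ ℝ ℝ).hasFDerivAt
    exact this.neg
  rw [lieTwo, h'.fderiv]
  simp [potentialField]

lemma mem_escaping : (x, (0 : ℝ)) ∈ (potentialField lam g).escaping ↔ x < lam ∧ 0 < g x := by
  simp only [PWS.escaping, mem_ofPred_eq, lieOne_X, lieOne_Y, switching, true_and]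
  constructor <;> rintro ⟨h1, h2⟩ <;> constructor <;> linarith

lemma mem_slidingRegion :
    (x, (0 : ℝ)) ∈ (potentialField lam g).slidingRegion ↔ lam < x ∧ g x < 0 := by
  simp only [PWS.slidingRegion, mem_ofPred_eq, lieOne_X, lieOne_Y, switching, true_and]
  constructor <;> rintro ⟨h1, h2⟩ <;> constructor <;> linarith

lemma mem_sewing : (x, (0 : ℝ)) ∈ (potentialField lam g).sewing ↔
    (x < lam ∧ g x < 0) ∨ (lam < x ∧ 0 < g x) := by
  simp only [PWS.sewing, mem_ofPred_eq, lieOne_X, lieOne_Y, switching, true_and]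
  rw [mul_pos_iff]
  constructor <;> rintro (⟨h1, h2⟩ | ⟨h1, h2⟩)
  · exact Or.inl ⟨by linarith, by linarith⟩
  · exact Or.inr ⟨by linarith, by linarith⟩
  · exact Or.inl ⟨by linarith, by linarith⟩
  · exact Or.inr ⟨by linarith, by linarith⟩

lemma mem_contact : (x, (0 : ℝ)) ∈ (potentialField lam g).contact ↔ x = lam ∨ g x = 0 := by
  simp only [PWS.contact, mem_ofPred_eq, lieOne_X, lieOne_Y, switching, true_and, mul_eq_zero,
    neg_eq_zero, sub_eq_zero, eq_comm]

lemma not_visibleFoldX : ¬ (potentialField lam g).VisibleFoldX (x, 0) := by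
  rintro ⟨-, -, h⟩
  rw [lieTwo_X] at h
  linarith

lemma invisibleFoldX_iff : (potentialField lam g).InvisibleFoldX (x, 0) ↔ x = lam := by
  simp only [PWS.InvisibleFoldX, lieTwo_X, lieOne_X, switching, mem_ofPred_eq, true_and]
  constructor
  · rintro ⟨h, -⟩; linarith
  · rintro rfl; norm_num

lemma Well.zero_iff (W : Well s g G M c L) : g x = 0 ↔ x = -s ∨ x = s := by
  constructor
  · intro h
    by_contra! hc
    rcases lt_or_gt_of_ne hc.1 with h1 | h1
    · exact (W.out_left x h1).ne' h
    rcases lt_or_gt_of_ne hc.2 with h2 | h2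
    · exact (W.inner x ⟨h1, h2⟩).ne h
    · exact (W.out_right x h2).ne' h
  · rintro (rfl | rfl)
    · exact W.at_left
    · exact W.at_right

lemma Well.pos_iff (W : Well s g G M c L) : 0 < g x ↔ x < -s ∨ s < x := by
  constructor
  · intro h
    by_contra! hc
    rcases eq_or_lt_of_le hc.1 with h1 | h1
    · rw [← h1, W.at_left] at h; exact lt_irrefl _ h
    rcases eq_or_lt_of_le hc.2 with h2 | h2
    · rw [h2, W.at_right] at h; exact lt_irrefl _ h
    · exact absurd h (W.inner x ⟨h1, h2⟩).not_gt
  · rintro (h | h)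
    · exact W.out_left x h
    · exact W.out_right x h

lemma Well.neg_iff (W : Well s g G M c L) : g x < 0 ↔ x ∈ Ioo (-s) s := by
  constructor
  · intro h
    by_contra hc
    rw [mem_Ioo, not_and_or, not_lt, not_lt] at hc
    rcases hc with h1 | h1 <;> rcases eq_or_lt_of_le h1 with h2 | h2
    · rw [h2, W.at_left] at h; exact lt_irrefl _ h
    · exact absurd h (W.out_left x h2).not_gt
    · rw [← h2, W.at_right] at h; exact lt_irrefl _ h
    · exact absurd h (W.out_right x h2).not_gt
  · exact W.inner x

lemma Well.visibleFoldY_iff (W : Well s g G M c L) :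
    (potentialField lam g).VisibleFoldY (x, 0) ↔ x = -s := by
  obtain ⟨k, hk, hd⟩ := W.bend_left
  obtain ⟨k', hk', hd'⟩ := W.bend_right
  simp only [PWS.VisibleFoldY, lieOne_Y, switching, mem_ofPred_eq, true_and, neg_eq_zero]
  rw [W.zero_iff]
  constructor
  · rintro ⟨rfl | rfl, h⟩
    · rfl
    · rw [lieTwo_Y hd'] at h
      exact absurd h hk'.not_gt
  · rintro rfl
    exact ⟨Or.inl rfl, by rwa [lieTwo_Y hd]⟩

lemma Well.invisibleFoldY_iff (W : Well s g G M c L) :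
    (potentialField lam g).InvisibleFoldY (x, 0) ↔ x = s := by
  obtain ⟨k, hk, hd⟩ := W.bend_left
  obtain ⟨k', hk', hd'⟩ := W.bend_right
  simp only [PWS.InvisibleFoldY, lieOne_Y, switching, mem_ofPred_eq, true_and, neg_eq_zero]
  rw [W.zero_iff]
  constructor
  · rintro ⟨rfl | rfl, h⟩
    · rw [lieTwo_Y hd] at h
      exact absurd h hk.not_gt
    · rfl
  · rintro rfl
    exact ⟨Or.inr rfl, by rwa [lieTwo_Y hd']⟩

lemma Well.not_cuspY (W : Well s g G M c L) : ¬ (potentialField lam g).CuspY (x, 0) := by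
  obtain ⟨k, hk, hd⟩ := W.bend_left
  obtain ⟨k', hk', hd'⟩ := W.bend_right
  rintro ⟨-, h1, h2, -⟩
  rw [lieOne_Y, neg_eq_zero, W.zero_iff] at h1
  rcases h1 with rfl | rfl
  · rw [lieTwo_Y hd] at h2; exact hk.ne h2
  · rw [lieTwo_Y hd'] at h2; exact hk'.ne' h2

lemma Well.visibleFold_iff (W : Well s g G M c L) :
    (potentialField lam g).VisibleFold (x, 0) ↔ x = -s := by
  rw [PWS.VisibleFold, W.visibleFoldY_iff]
  exact ⟨fun h => h.resolve_left not_visibleFoldX, Or.inr⟩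

lemma dirNum_eq : (potentialField lam g).dirNum x = lam - (g x + x) := by
  simp [PWS.dirNum, potentialField]; ring

lemma dirDen_eq : (potentialField lam g).dirDen x = x - g x - lam := by
  simp [PWS.dirDen, potentialField]; ring

/-- The horizontal component of Filippov's field. -/
def slide (lam : ℝ) (g : ℝ → ℝ) (x : ℝ) : ℝ := (lam - (g x + x)) / (x - g x - lam)

lemma filippov_eq : (potentialField lam g).filippov (x, 0) = (slide lam g x, 0) := by
  rw [slide, ← dirNum_eq, ← dirDen_eq]; rfl

lemma Well.strictMonoOn_left (W : Well s g G M c L) : StrictMonoOn G (Iic (-s)) :=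
  strictMonoOn_of_hasDerivWithinAt_pos (convex_Iic _)
    (fun x _ => (W.deriv x).continuousAt.continuousWithinAt)
    (fun x _ => (W.deriv x).hasDerivWithinAt)
    (fun x hx => W.out_left x (by rwa [interior_Iic] at hx))

lemma Well.strictAntiOn_mid (W : Well s g G M c L) : StrictAntiOn G (Icc (-s) s) :=
  strictAntiOn_of_hasDerivWithinAt_neg (convex_Icc _ _)
    (fun x _ => (W.deriv x).continuousAt.continuousWithinAt)
    (fun x _ => (W.deriv x).hasDerivWithinAt)
    (fun x hx => W.inner x (by rwa [interior_Icc] at hx))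

lemma Well.strictMonoOn_right (W : Well s g G M c L) : StrictMonoOn G (Ici s) :=
  strictMonoOn_of_hasDerivWithinAt_pos (convex_Ici _)
    (fun x _ => (W.deriv x).continuousAt.continuousWithinAt)
    (fun x _ => (W.deriv x).hasDerivWithinAt)
    (fun x hx => W.out_right x (by rwa [interior_Ici] at hx))

lemma Well.continuous (W : Well s g G M c L) : Continuous G :=
  continuous_iff_continuousAt.2 fun x => (W.deriv x).continuousAt

/-- The end points of an arc of the lower field that returns to the switching manifold. -/
lemma Well.chord_ends (W : Well s g G M c L) {z : ℝ} (hzx : z < x) (e : G z = G x)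
    (hle : ∀ w ∈ Icc z x, G w ≤ G x) : x ∈ Ioc s (3 * s) ∧ z ∈ Ico (-s) s := by
  have hs := W.pos
  -- A lower orbit runs to the left: left of `-s` the potential only falls in that direction, so the
  -- level is never met again, while on `(-s, s]` it rises at once, which would push the orbit above
  -- the line.
  have hx : s < x := by
    by_contra! h
    rcases le_or_gt x (-s) with h1 | h1
    · exact (W.strictMonoOn_left (hzx.le.trans h1) h1 hzx).ne e
    · have hm : max z (-s) < x := max_lt hzx h1
      have := W.strictAntiOn_mid ⟨le_max_right z (-s), hm.le.trans h⟩ ⟨h1.le, h⟩ hm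
      exact absurd (hle _ ⟨le_max_left _ _, hm.le⟩) (not_le.2 this)
  have hz : z < s := by
    by_contra! h
    exact (W.strictMonoOn_right h hx.le hzx).ne e
  -- An arc that ended to the left of `-s` would pass below the local maximum at `-s`, whose level
  -- exceeds that of the end.
  have hz' : -s ≤ z := by
    by_contra! h
    have := W.strictMonoOn_left h.le (le_refl (-s)) h
    exact absurd (hle (-s) ⟨h.le, by linarith⟩) (not_le.2 (e ▸ this))
  refine ⟨⟨hx, ?_⟩, hz', hz⟩
  by_contra! h
  have h1 := W.strictMonoOn_right (show s ≤ 3 * s by linarith) hx.le h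
  rw [W.level, ← e] at h1
  rcases eq_or_lt_of_le hz' with h2 | h2
  · rw [h2] at h1; exact lt_irrefl _ h1
  · exact absurd (W.strictAntiOn_mid ⟨le_rfl, by linarith⟩ ⟨hz', hz.le⟩ h2) h1.not_gt

lemma Well.chord_lt (W : Well s g G M c L) {z w : ℝ} (hz : z ∈ Icc (-s) s) (hx : s ≤ x)
    (e : G z = G x) (hw : w ∈ Ioo z x) : G w < G x := by
  rcases le_total w s with h | h
  · rw [← e]
    exact W.strictAntiOn_mid hz ⟨hz.1.trans hw.1.le, h⟩ hw.1
  · exact W.strictMonoOn_right h hx hw.2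

end Static

/-! ### Arcs -/

lemma eq_of_hasDerivAt_zero {f : ℝ → ℝ} {a b : ℝ} (hc : ContinuousOn f (Icc a b))
    (hd : ∀ x ∈ Ioo a b, HasDerivAt f 0 x) {x : ℝ} (hx : x ∈ Icc a b) : f x = f a := by
  rcases eq_or_lt_of_le hx.1 with h | h
  · rw [h]
  obtain ⟨y, -, hy⟩ := exists_hasDerivAt_eq_slope f (fun _ => 0) h
    (hc.mono (Icc_subset_Icc_right hx.2)) (fun y hy => hd y ⟨hy.1, hy.2.trans_le hx.2⟩)
  have := (div_eq_zero_iff.1 hy.symm).resolve_right (by linarith)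
  linarith

lemma hasDerivAt_fst_comp {γ : ℝ → ℝ × ℝ} {v : ℝ × ℝ} {τ : ℝ} (h : HasDerivAt γ v τ) :
    HasDerivAt (fun τ => (γ τ).1) v.1 τ :=
  (ContinuousLinearMap.fst ℝ ℝ ℝ).hasFDerivAt.comp_hasDerivAt τ h

lemma hasDerivAt_snd_comp {γ : ℝ → ℝ × ℝ} {v : ℝ × ℝ} {τ : ℝ} (h : HasDerivAt γ v τ) :
    HasDerivAt (fun τ => (γ τ).2) v.2 τ :=
  (ContinuousLinearMap.snd ℝ ℝ ℝ).hasFDerivAt.comp_hasDerivAt τ h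

lemma PWS.IsArc.mono {Z : PWS} {k : ArcKind} {γ : ℝ → ℝ × ℝ} {a b a' b' : ℝ}
    (h : Z.IsArc k γ a b) (ha : a ≤ a') (hab : a' < b') (hb : b' ≤ b) : Z.IsArc k γ a' b' := by
  obtain ⟨-, h2, h3⟩ := h
  refine ⟨hab, h2.mono (Icc_subset_Icc ha hb), ?_⟩
  have i1 : ∀ τ ∈ Icc a' b', τ ∈ Icc a b := fun τ hτ => ⟨ha.trans hτ.1, hτ.2.trans hb⟩
  have i2 : ∀ τ ∈ Ioo a' b', τ ∈ Ioo a b := fun τ hτ => ⟨ha.trans_lt hτ.1, hτ.2.trans_le hb⟩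
  cases k
  · exact ⟨fun τ hτ => h3.1 τ (i1 τ hτ), fun τ hτ => h3.2 τ (i2 τ hτ)⟩
  · exact ⟨fun τ hτ => h3.1 τ (i1 τ hτ), fun τ hτ => h3.2 τ (i2 τ hτ)⟩
  · exact ⟨fun τ hτ => h3.1 τ (i1 τ hτ), fun τ hτ => h3.2 τ (i2 τ hτ)⟩

lemma PWS.IsArc.congr {Z : PWS} {k : ArcKind} {γ γ' : ℝ → ℝ × ℝ} {a b : ℝ}
    (h : Z.IsArc k γ a b) (e : EqOn γ' γ (Icc a b)) : Z.IsArc k γ' a b := by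
  obtain ⟨h1, h2, h3⟩ := h
  refine ⟨h1, h2.congr e, ?_⟩
  have i : ∀ τ ∈ Ioo a b, ∀ v, HasDerivAt γ v τ → HasDerivAt γ' v τ := fun τ hτ v hv =>
    hv.congr_of_eventuallyEq (by
      filter_upwards [Icc_mem_nhds hτ.1 hτ.2] with σ hσ using e hσ)
  cases k
  · refine ⟨fun τ hτ => by rw [e hτ]; exact h3.1 τ hτ, fun τ hτ => ?_⟩
    rw [e (Ioo_subset_Icc_self hτ)]; exact i τ hτ _ (h3.2 τ hτ)
  · refine ⟨fun τ hτ => by rw [e hτ]; exact h3.1 τ hτ, fun τ hτ => ?_⟩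
    rw [e (Ioo_subset_Icc_self hτ)]; exact i τ hτ _ (h3.2 τ hτ)
  · refine ⟨fun τ hτ => by rw [e hτ]; exact h3.1 τ hτ, fun τ hτ => ?_⟩
    rw [e (Ioo_subset_Icc_self hτ)]; exact ⟨(h3.2 τ hτ).1, i τ hτ _ (h3.2 τ hτ).2⟩

section Arcs

variable {lam : ℝ} {g G : ℝ → ℝ} {γ : ℝ → ℝ × ℝ} {a b : ℝ}

/-- The functions `x - τ` and `y + (x - lam)² / 2` have derivative zero along the arc, which gives
the arc in closed form. -/
lemma upper_arc (h : (potentialField lam g).IsArc .upper γ a b) {τ : ℝ} (hτ : τ ∈ Icc a b) :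
    (γ τ).1 = (γ a).1 + (τ - a) ∧
      (γ τ).2 = (γ a).2 + ((γ τ).1 - (γ a).1) * (2 * lam - (γ τ).1 - (γ a).1) / 2 := by
  obtain ⟨h1, h2, h3, h4⟩ := h
  have k1 := eq_of_hasDerivAt_zero (f := fun τ => (γ τ).1 - τ)
    (h2.fst.sub continuousOn_id)
    (fun τ hτ => ((hasDerivAt_fst_comp (h4 τ hτ)).sub (hasDerivAt_id τ)).congr_deriv
      (by simp [potentialField])) hτ
  have k2 := eq_of_hasDerivAt_zero (f := fun τ => (γ τ).2 + ((γ τ).1 - lam) ^ 2 / 2)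
    (h2.snd.add (((h2.fst.sub continuousOn_const).pow 2).div_const 2))
    (fun τ hτ => ((hasDerivAt_snd_comp (h4 τ hτ)).add
      ((((hasDerivAt_fst_comp (h4 τ hτ)).sub_const lam).pow 2).div_const 2)).congr_deriv
      (by simp [potentialField])) hτ
  exact ⟨by linarith, by linear_combination k2⟩

/-- Here `x + τ` and `y - G x` are constant. -/
lemma lower_arc (hG : ∀ x, HasDerivAt G (g x) x)
    (h : (potentialField lam g).IsArc .lower γ a b) {τ : ℝ} (hτ : τ ∈ Icc a b) :
    (γ τ).1 = (γ a).1 - (τ - a) ∧ (γ τ).2 = (γ a).2 + (G (γ τ).1 - G (γ a).1) := by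
  obtain ⟨h1, h2, h3, h4⟩ := h
  have Gc : Continuous G := continuous_iff_continuousAt.2 fun x => (hG x).continuousAt
  have k1 := eq_of_hasDerivAt_zero (f := fun τ => (γ τ).1 + τ)
    (h2.fst.add continuousOn_id)
    (fun τ hτ => ((hasDerivAt_fst_comp (h4 τ hτ)).add (hasDerivAt_id τ)).congr_deriv
      (by simp [potentialField])) hτ
  have k2 := eq_of_hasDerivAt_zero (f := fun τ => (γ τ).2 - G (γ τ).1)
    (h2.snd.sub (Gc.comp_continuousOn h2.fst))
    (fun τ hτ => ((hasDerivAt_snd_comp (h4 τ hτ)).sub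
      ((hG _).comp τ (hasDerivAt_fst_comp (h4 τ hτ)))).congr_deriv
      (by simp [potentialField])) hτ
  exact ⟨by linarith, by linarith⟩

lemma isArc_upper {x₀ : ℝ} (hab : a < b)
    (hy : ∀ x ∈ Icc x₀ (x₀ + (b - a)), 0 ≤ (x - x₀) * (2 * lam - x - x₀)) :
    (potentialField lam g).IsArc .upper
      (fun τ => (x₀ + (τ - a), (x₀ + (τ - a) - x₀) * (2 * lam - (x₀ + (τ - a)) - x₀) / 2)) a b := by
  refine ⟨hab, by fun_prop, fun τ hτ => ?_, fun τ hτ => ?_⟩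
  · exact div_nonneg (hy _ ⟨by linarith [hτ.1], by linarith [hτ.2]⟩) (by norm_num)
  · have e1 : HasDerivAt (fun τ => x₀ + (τ - a)) 1 τ :=
      ((hasDerivAt_id τ).sub_const a).const_add x₀
    have e2 := (((e1.sub_const x₀).mul ((e1.const_sub (2 * lam)).sub_const x₀)).div_const 2)
    refine (e1.prodMk e2).congr_deriv ?_
    simp only [potentialField, Prod.mk.injEq, true_and]
    ring

lemma isArc_lower {x₀ : ℝ} (hG : ∀ x, HasDerivAt G (g x) x) (hab : a < b)
    (hy : ∀ x ∈ Icc (x₀ - (b - a)) x₀, G x ≤ G x₀) :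
    (potentialField lam g).IsArc .lower
      (fun τ => (x₀ - (τ - a), G (x₀ - (τ - a)) - G x₀)) a b := by
  have Gc : Continuous G := continuous_iff_continuousAt.2 fun x => (hG x).continuousAt
  refine ⟨hab, by fun_prop, fun τ hτ => ?_, fun τ hτ => ?_⟩
  · exact sub_nonpos.2 (hy _ ⟨by linarith [hτ.2], by linarith [hτ.1]⟩)
  · have e1 : HasDerivAt (fun τ => x₀ - (τ - a)) (-1) τ :=
      ((hasDerivAt_id τ).sub_const a).const_sub x₀
    have e2 := ((hG _).comp τ e1).sub_const (G x₀)
    refine (e1.prodMk e2).congr_deriv ?_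
    simp [potentialField]

lemma joins_upper_iff {x z : ℝ} :
    (potentialField lam g).Joins .upper x z ↔ x < lam ∧ z = 2 * lam - x := by
  constructor
  · rintro ⟨γ, a, b, h, ha, hb⟩
    have hab := h.1
    obtain ⟨h1, h2⟩ := upper_arc h (right_mem_Icc.2 h.1.le)
    rw [ha, hb] at h1 h2
    simp only at h1 h2
    have hz : z - x ≠ 0 := by rw [h1]; linarith
    have : 2 * lam - z - x = 0 := by
      have : (z - x) * (2 * lam - z - x) = 0 := by linarith
      exact (mul_eq_zero.1 this).resolve_left hz
    constructor <;> linarith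
  · rintro ⟨h, rfl⟩
    refine ⟨_, 0, 2 * lam - 2 * x, isArc_upper (x₀ := x) (by linarith) ?_, ?_, ?_⟩
    · intro w hw
      exact mul_nonneg (by linarith [hw.1]) (by linarith [hw.2])
    · simp
    · simp only [Prod.mk.injEq]; constructor <;> ring

lemma joins_lower_iff {x z : ℝ} (hG : ∀ x, HasDerivAt G (g x) x) :
    (potentialField lam g).Joins .lower x z ↔ z < x ∧ G z = G x ∧ ∀ w ∈ Icc z x, G w ≤ G x := by
  constructor
  · rintro ⟨γ, a, b, h, ha, hb⟩
    have hab := h.1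
    obtain ⟨h1, h2⟩ := lower_arc hG h (right_mem_Icc.2 h.1.le)
    rw [ha, hb] at h1 h2
    simp only at h1 h2
    refine ⟨by linarith, by linarith, fun w hw => ?_⟩
    have hτ : a + (x - w) ∈ Icc a b := ⟨by linarith [hw.2], by linarith [hw.1]⟩
    obtain ⟨h3, h4⟩ := lower_arc hG h hτ
    rw [ha] at h3 h4
    simp only at h3 h4
    have h5 := h.2.2.1 _ hτ
    have : (γ (a + (x - w))).1 = w := by rw [h3]; ring
    rw [h4, this] at h5
    linarith
  · rintro ⟨h, e, hle⟩
    refine ⟨_, 0, x - z, isArc_lower (x₀ := x) hG (by linarith) ?_, ?_, ?_⟩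
    · intro w hw
      exact hle w ⟨by linarith [hw.1], hw.2⟩
    · simp
    · simp [e]

end Arcs

/-! ### Nodes of canard cycles -/

/-- The end points of an arc of the given kind between points of the switching manifold. -/
def Link (lam : ℝ) (g G : ℝ → ℝ) (k : ArcKind) (x x' : ℝ) : Prop :=
  match k with
  | .upper => x < lam ∧ x' = 2 * lam - x
  | .lower => x' < x ∧ G x' = G x ∧ ∀ w ∈ Icc x' x, G w ≤ G x
  | .sliding =>
    (x < x' ∧ ∀ w ∈ Ioo x x', (w, (0 : ℝ)) ∈ (potentialField lam g).escaping ∪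
      (potentialField lam g).slidingRegion ∧ 0 ≤ slide lam g w) ∨
    (x' < x ∧ ∀ w ∈ Ioo x' x, (w, (0 : ℝ)) ∈ (potentialField lam g).escaping ∪
      (potentialField lam g).slidingRegion ∧ slide lam g w ≤ 0)

/-- The point set of an arc of the given kind between points of the switching manifold. -/
def trace (G : ℝ → ℝ) (k : ArcKind) (x x' : ℝ) : Set (ℝ × ℝ) :=
  match k with
  | .upper => (fun w => (w, (w - x) * (x' - w) / 2)) '' Icc x x'
  | .lower => (fun w => (w, G w - G x)) '' Icc x' x
  | .sliding => (fun w => (w, 0)) '' uIcc x x'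

lemma hasDerivAt_nonneg_of_le {f : ℝ → ℝ} {d a : ℝ} (hd : HasDerivAt f d a)
    (h : ∀ᶠ x in 𝓝[>] a, f a ≤ f x) : 0 ≤ d := by
  have := (hasDerivAt_iff_tendsto_slope.1 hd).mono_left
    (nhdsWithin_mono a (show Ioi a ⊆ {a}ᶜ from fun x hx => ne_of_gt hx))
  refine ge_of_tendsto this ?_
  filter_upwards [h, self_mem_nhdsWithin] with x hx hx'
  rw [slope_def_field]
  exact div_nonneg (by linarith) (by linarith [show a < x from hx'])

section Link

variable {lam : ℝ} {g G : ℝ → ℝ} {γ : ℝ → ℝ × ℝ} {a b : ℝ}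

/-- Upper and lower arcs are graphs over the abscissa. Injectivity is needed for sliding arcs only:
it excludes rest at pseudo equilibria and makes the abscissa monotone. -/
lemma link_of_isArc (hG : ∀ x, HasDerivAt G (g x) x) {k : ArcKind}
    (h : (potentialField lam g).IsArc k γ a b) (ha : (γ a).2 = 0) (hb : (γ b).2 = 0)
    (hinj : InjOn γ (Icc a b)) :
    Link lam g G k (γ a).1 (γ b).1 ∧ γ '' Icc a b = trace G k (γ a).1 (γ b).1 := by
  have hab := h.1
  have ea : γ a = ((γ a).1, 0) := Prod.ext rfl ha
  have eb : γ b = ((γ b).1, 0) := Prod.ext rfl hb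
  cases k with
  | upper =>
    have l := joins_upper_iff.1 ⟨γ, a, b, h, ea, eb⟩
    refine ⟨l, ?_⟩
    have hb1 := (upper_arc h (right_mem_Icc.2 hab.le)).1
    have e : ∀ τ ∈ Icc a b, γ τ = ((γ a).1 + (τ - a),
        ((γ a).1 + (τ - a) - (γ a).1) * ((γ b).1 - ((γ a).1 + (τ - a))) / 2) := by
      intro τ hτ
      obtain ⟨h1, h2⟩ := upper_arc h hτ
      refine Prod.ext h1 ?_
      rw [h2, ha, h1, l.2]
      ring
    apply Subset.antisymm
    · rintro _ ⟨τ, hτ, rfl⟩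
      exact ⟨(γ a).1 + (τ - a), ⟨by linarith [hτ.1], by linarith [hτ.2]⟩, (e τ hτ).symm⟩
    · rintro _ ⟨w, hw, rfl⟩
      have hτ : a + (w - (γ a).1) ∈ Icc a b := ⟨by linarith [hw.1], by linarith [hw.2]⟩
      refine ⟨_, hτ, ?_⟩
      rw [e _ hτ]
      simp
  | lower =>
    have l := (joins_lower_iff hG).1 ⟨γ, a, b, h, ea, eb⟩
    refine ⟨l, ?_⟩
    have hb1 := (lower_arc hG h (right_mem_Icc.2 hab.le)).1
    have e : ∀ τ ∈ Icc a b, γ τ = ((γ a).1 - (τ - a), G ((γ a).1 - (τ - a)) - G (γ a).1) := by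
      intro τ hτ
      obtain ⟨h1, h2⟩ := lower_arc hG h hτ
      refine Prod.ext h1 ?_
      rw [h2, ha, h1]
      ring
    apply Subset.antisymm
    · rintro _ ⟨τ, hτ, rfl⟩
      exact ⟨(γ a).1 - (τ - a), ⟨by linarith [hτ.2], by linarith [hτ.1]⟩, (e τ hτ).symm⟩
    · rintro _ ⟨w, hw, rfl⟩
      have hτ : a + ((γ a).1 - w) ∈ Icc a b := ⟨by linarith [hw.2], by linarith [hw.1]⟩
      refine ⟨_, hτ, ?_⟩
      rw [e _ hτ]
      simp
  | sliding =>
    obtain ⟨-, hc, h3, h4⟩ := h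
    have e : ∀ τ ∈ Icc a b, γ τ = ((γ τ).1, 0) := fun τ hτ => Prod.ext rfl (h3 τ hτ)
    have hinj' : InjOn (fun τ => (γ τ).1) (Icc a b) := by
      intro τ hτ σ hσ hh
      apply hinj hτ hσ
      rw [e τ hτ, e σ hσ]
      exact Prod.ext hh rfl
    have hd : ∀ τ ∈ Ioo a b, ((γ τ).1, (0 : ℝ)) ∈ (potentialField lam g).escaping ∪
        (potentialField lam g).slidingRegion ∧
        HasDerivAt (fun τ => (γ τ).1) (slide lam g (γ τ).1) τ := by
      intro τ hτ
      obtain ⟨h5, h6⟩ := h4 τ hτ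
      have := hasDerivAt_fst_comp h6
      rw [e τ (Ioo_subset_Icc_self hτ), filippov_eq] at this
      rw [e τ (Ioo_subset_Icc_self hτ)] at h5
      exact ⟨h5, this⟩
    have img : (fun τ => (γ τ).1) '' Icc a b = uIcc (γ a).1 (γ b).1 → γ '' Icc a b =
        trace G .sliding (γ a).1 (γ b).1 := by
      intro hi
      simp only [trace]
      rw [← hi, image_image]
      exact image_congr fun τ hτ => e τ hτ
    -- A continuous injective abscissa is strictly monotone, and its direction fixes the sign of
    -- Filippov's field on the segment.
    rcases hc.fst.strictMonoOn_of_injOn_Icc' hab.le hinj' with hm | hm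
    · have hlt := hm (left_mem_Icc.2 hab.le) (right_mem_Icc.2 hab.le) hab
      refine ⟨Or.inl ⟨hlt, fun w hw => ?_⟩, img ?_⟩
      · obtain ⟨τ, hτ, rfl⟩ := intermediate_value_Ioo hab.le hc.fst hw
        refine ⟨(hd τ hτ).1, hasDerivAt_nonneg_of_le (hd τ hτ).2 ?_⟩
        filter_upwards [Ioo_mem_nhdsGT hτ.2] with σ hσ
        exact (hm (Ioo_subset_Icc_self hτ) ⟨hτ.1.le.trans hσ.1.le, hσ.2.le⟩ hσ.1).le
      · apply Subset.antisymm
        · rintro _ ⟨τ, hτ, rfl⟩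
          rw [uIcc_of_le hlt.le]
          exact ⟨hm.monotoneOn (left_mem_Icc.2 hab.le) hτ hτ.1,
            hm.monotoneOn hτ (right_mem_Icc.2 hab.le) hτ.2⟩
        · rw [uIcc_of_le hlt.le]
          exact intermediate_value_Icc hab.le hc.fst
    · have hlt := hm (left_mem_Icc.2 hab.le) (right_mem_Icc.2 hab.le) hab
      refine ⟨Or.inr ⟨hlt, fun w hw => ?_⟩, img ?_⟩
      · obtain ⟨τ, hτ, rfl⟩ := intermediate_value_Ioo' hab.le hc.fst hw
        refine ⟨(hd τ hτ).1, neg_nonneg.1 (hasDerivAt_nonneg_of_le (hd τ hτ).2.neg ?_)⟩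
        filter_upwards [Ioo_mem_nhdsGT hτ.2] with σ hσ
        exact neg_le_neg
          (hm (Ioo_subset_Icc_self hτ) ⟨hτ.1.le.trans hσ.1.le, hσ.2.le⟩ hσ.1).le
      · apply Subset.antisymm
        · rintro _ ⟨τ, hτ, rfl⟩
          rw [uIcc_of_ge hlt.le]
          exact ⟨hm.antitoneOn hτ (right_mem_Icc.2 hab.le) hτ.2,
            hm.antitoneOn (left_mem_Icc.2 hab.le) hτ hτ.1⟩
        · rw [uIcc_of_ge hlt.le]
          exact intermediate_value_Icc' hab.le hc.fst

lemma exists_mem_Icc_succ {t : ℕ → ℝ} (n : ℕ) {τ : ℝ} (h0 : t 0 ≤ τ) (hn : τ ≤ t (n + 1)) :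
    ∃ i < n + 1, τ ∈ Icc (t i) (t (i + 1)) := by
  induction n with
  | zero => exact ⟨0, by simp, h0, hn⟩
  | succ m ih =>
    rcases le_total τ (t (m + 1)) with h | h
    · obtain ⟨i, hi, h'⟩ := ih h
      exact ⟨i, by omega, h'⟩
    · exact ⟨m + 1, by omega, h, hn⟩

lemma lt_of_step_lt {t : ℕ → ℝ} {n : ℕ} (h : ∀ i < n, t i < t (i + 1)) {i j : ℕ} (hij : i < j)
    (hj : j ≤ n) : t i < t j := by
  induction j with
  | zero => omega
  | succ m ih =>
    rcases Nat.lt_succ_iff_lt_or_eq.1 hij with h1 | h1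
    · exact (ih h1 (by omega)).trans (h m (by omega))
    · subst h1; exact h i (by omega)

lemma PWS.Transition.mem_switching {Z : PWS} {k k' : ArcKind} {p : ℝ × ℝ}
    (h : Z.Transition k k' p) : p ∈ switching := by
  have v : Z.VisibleFold p → p ∈ switching := fun h => h.elim (·.1) (·.1)
  have f : Z.Fold p ∨ p ∈ Z.escaping ∪ Z.slidingRegion → p ∈ switching := by
    rintro ((h | h | h) | (h | h))
    · exact v h
    all_goals exact h.1
  cases k <;> cases k' <;> first | exact f h | exact h.elim | exact h.elim (·.1) v

lemma PWS.Transition.ne {Z : PWS} {k k' : ArcKind} {p : ℝ × ℝ} (h : Z.Transition k k' p) :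
    k ≠ k' := by
  rintro rfl
  cases k <;> exact h

/-- A cycle is unrolled to sequences of nodes and arc kinds on `ℕ` that are periodic modulo `n`,
with distinct nodes within a period. The classification can then step to predecessors and successors
without treating the base point separately. -/
lemma exists_nodes (hG : ∀ x, HasDerivAt G (g x) x) {Γ : Set (ℝ × ℝ)}
    (h : (potentialField lam g).IsCanardCycle Γ) :
    ∃ (n : ℕ) (X : ℕ → ℝ) (K : ℕ → ArcKind), 2 ≤ n ∧
      (∀ i j, i % n = j % n → X i = X j ∧ K i = K j) ∧
      (∀ i j, X i = X j → i % n = j % n) ∧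
      (∀ i, Link lam g G (K i) (X i) (X (i + 1))) ∧
      (∀ i, (potentialField lam g).Transition (K i) (K (i + 1)) (X (i + 1), 0)) ∧
      ∀ p, p ∈ Γ ↔ ∃ i, p ∈ trace G (K i) (X i) (X (i + 1)) := by
  obtain ⟨⟨n, t, k, γ, hn, harc, hclose, hinj, hΓ, hor⟩, -⟩ := h
  have hstep : ∀ i < n, t i < t (i + 1) := fun i hi => (harc i hi).1
  rcases hor with ⟨rfl, hk⟩ | ⟨hn2, htr⟩
  -- A single sliding arc is a closed path in a line, so it takes a value between its base point and
  -- its middle both on the way out and on the way back, against injectivity.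
  · exfalso
    have ha := harc 0 (by norm_num)
    rw [hk] at ha
    obtain ⟨h01, hc, h3, -⟩ := ha
    simp only [zero_add] at *
    set m := (t 0 + t 1) / 2 with hm
    have e : ∀ τ ∈ Icc (t 0) (t 1), γ τ = ((γ τ).1, 0) := fun τ hτ => Prod.ext rfl (h3 τ hτ)
    have key : ∀ τ ∈ Ico (t 0) (t 1), ∀ σ ∈ Ico (t 0) (t 1), (γ τ).1 = (γ σ).1 → τ = σ := by
      intro τ hτ σ hσ h
      apply hinj hτ hσ
      rw [e τ (Ico_subset_Icc_self hτ), e σ (Ico_subset_Icc_self hσ), h]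
    have hm0 : t 0 < m := by rw [hm]; linarith
    have hm1 : m < t 1 := by rw [hm]; linarith
    have hne : (γ (t 0)).1 ≠ (γ m).1 := fun h =>
      hm0.ne (key _ ⟨le_rfl, h01⟩ _ ⟨hm0.le, hm1⟩ h)
    set v := ((γ (t 0)).1 + (γ m).1) / 2 with hv
    have hc1 := hc.fst.mono (Icc_subset_Icc_right hm1.le)
    have hc2 := hc.fst.mono (Icc_subset_Icc_left hm0.le)
    have e1 : (γ (t 1)).1 = (γ (t 0)).1 := by rw [hclose]
    have : ∃ τ ∈ Ioo (t 0) m, ∃ σ ∈ Ioo m (t 1), (γ τ).1 = v ∧ (γ σ).1 = v := by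
      rcases lt_or_gt_of_ne hne with h | h
      · obtain ⟨τ, hτ, h1⟩ := intermediate_value_Ioo hm0.le hc1
          (show v ∈ Ioo (γ (t 0)).1 (γ m).1 from ⟨by rw [hv]; linarith, by rw [hv]; linarith⟩)
        obtain ⟨σ, hσ, h2⟩ := intermediate_value_Ioo' hm1.le hc2
          (show v ∈ Ioo (γ (t 1)).1 (γ m).1 from ⟨by rw [hv]; linarith, by rw [hv]; linarith⟩)
        exact ⟨τ, hτ, σ, hσ, h1, h2⟩
      · obtain ⟨τ, hτ, h1⟩ := intermediate_value_Ioo' hm0.le hc1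
          (show v ∈ Ioo (γ m).1 (γ (t 0)).1 from ⟨by rw [hv]; linarith, by rw [hv]; linarith⟩)
        obtain ⟨σ, hσ, h2⟩ := intermediate_value_Ioo hm1.le hc2
          (show v ∈ Ioo (γ m).1 (γ (t 1)).1 from ⟨by rw [hv]; linarith, by rw [hv]; linarith⟩)
        exact ⟨τ, hτ, σ, hσ, h1, h2⟩
    obtain ⟨τ, hτ, σ, hσ, h1, h2⟩ := this
    have := key τ ⟨hτ.1.le, hτ.2.trans hm1⟩ σ ⟨(hm0.trans hσ.1).le, hσ.2⟩ (h1.trans h2.symm)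
    linarith [hτ.2, hσ.1]
  have tlt : ∀ {i j}, i < j → j ≤ n → t i < t j := fun hij hj => lt_of_step_lt hstep hij hj
  have succ_node : ∀ i, γ (t ((i + 1) % n)) = γ (t (i % n + 1)) := by
    intro i
    have hi := Nat.mod_lt i hn
    rw [← Nat.mod_add_mod]
    rcases Nat.lt_or_ge (i % n + 1) n with h | h
    · rw [Nat.mod_eq_of_lt h]
    · have : i % n + 1 = n := by omega
      rw [this, Nat.mod_self, hclose]
  have htr' : ∀ i, (potentialField lam g).Transition (k (i % n)) (k ((i + 1) % n))
      (γ (t ((i + 1) % n))) := by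
    intro i
    have := htr (i % n) (Nat.mod_lt i hn)
    rw [Nat.mod_add_mod] at this
    rwa [succ_node]
  have hzero : ∀ i, (γ (t (i % n))).2 = 0 := by
    intro i
    have := (htr' (i + n - 1)).mem_switching
    rw [show i + n - 1 + 1 = i + n by omega, Nat.add_mod_right] at this
    exact this
  have memIco : ∀ i, t (i % n) ∈ Ico (t 0) (t n) := by
    intro i
    have hi := Nat.mod_lt i hn
    refine ⟨?_, tlt hi le_rfl⟩
    rcases Nat.eq_zero_or_pos (i % n) with h | h
    · rw [h]
    · exact (tlt h hi.le).le
  -- The last arc needs care because its end repeats the base point; since `2 ≤ n`, its start is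
  -- later than the base time.
  have arcinj : ∀ i < n, InjOn γ (Icc (t i) (t (i + 1))) := by
    intro i hi
    have h0 : t 0 ≤ t i := by
      rcases Nat.eq_zero_or_pos i with h | h
      · rw [h]
      · exact (tlt h hi.le).le
    rcases Nat.lt_or_ge (i + 1) n with h | h
    · exact hinj.mono (fun τ hτ => show τ ∈ Ico (t 0) (t n) from
        ⟨h0.trans hτ.1, hτ.2.trans_lt (tlt h le_rfl)⟩)
    · have e : i + 1 = n := by omega
      have h0' : t 0 < t i := tlt (by omega) hi.le
      rw [e]
      have aux : ∀ τ ∈ Icc (t i) (t n), τ < t n → γ τ ≠ γ (t n) := by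
        intro τ hτ hlt he
        rw [hclose] at he
        have := hinj ⟨h0.trans hτ.1, hlt⟩ ⟨le_rfl, h0'.trans (tlt hi le_rfl)⟩ he
        linarith [hτ.1]
      intro τ hτ σ hσ he
      rcases eq_or_lt_of_le hτ.2 with h1 | h1 <;> rcases eq_or_lt_of_le hσ.2 with h2 | h2
      · rw [h1, h2]
      · rw [h1] at he; exact absurd he.symm (aux σ hσ h2)
      · rw [h2] at he; exact absurd he (aux τ hτ h1)
      · exact hinj ⟨h0.trans hτ.1, h1⟩ ⟨h0.trans hσ.1, h2⟩ he
  have hlink : ∀ i, Link lam g G (k (i % n)) (γ (t (i % n))).1 (γ (t ((i + 1) % n))).1 ∧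
      γ '' Icc (t (i % n)) (t (i % n + 1)) =
        trace G (k (i % n)) (γ (t (i % n))).1 (γ (t ((i + 1) % n))).1 := by
    intro i
    have hi := Nat.mod_lt i hn
    have h2 := hzero (i + 1)
    rw [succ_node] at h2 ⊢
    exact link_of_isArc hG (harc _ hi) (hzero i) h2 (arcinj _ hi)
  refine ⟨n, fun i => (γ (t (i % n))).1, fun i => k (i % n), hn2, fun i j h => by simp only [h, and_self],
    fun i j h => ?_, fun i => (hlink i).1, fun i => ?_, fun p => ?_⟩
  · have e : γ (t (i % n)) = γ (t (j % n)) := Prod.ext h ((hzero i).trans (hzero j).symm)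
    have e' := hinj (memIco i) (memIco j) e
    have hi := Nat.mod_lt i hn
    have hj := Nat.mod_lt j hn
    rcases Nat.lt_trichotomy (i % n) (j % n) with h1 | h1 | h1
    · exact absurd e' (tlt h1 hj.le).ne
    · exact h1
    · exact absurd e' (tlt h1 hi.le).ne'
  · have : ((γ (t ((i + 1) % n))).1, (0 : ℝ)) = γ (t ((i + 1) % n)) :=
      Prod.ext rfl (hzero (i + 1)).symm
    simp only [this]
    exact htr' i
  · rw [hΓ]
    constructor
    · rintro ⟨τ, hτ, rfl⟩
      obtain ⟨i, hi, hi'⟩ := exists_mem_Icc_succ (t := t) (n - 1) hτ.1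
        (by rw [Nat.sub_add_cancel hn]; exact hτ.2)
      refine ⟨i, ?_⟩
      have hin : i % n = i := Nat.mod_eq_of_lt (by omega)
      have := (hlink i).2
      rw [← this, hin]
      exact mem_image_of_mem _ hi'
    · rintro ⟨i, hi⟩
      have := (hlink i).2
      simp only at hi
      rw [← this] at hi
      refine image_mono ?_ hi
      have hi := Nat.mod_lt i hn
      refine Icc_subset_Icc (memIco i).1 ?_
      rcases Nat.lt_or_ge (i % n + 1) n with h | h
      · exact (tlt h le_rfl).le
      · rw [show i % n + 1 = n by omega]

end Link

/-! ### Classification of the canard cycles -/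

/-- The closed curve made of an upper arc and a lower arc with the end points `a < b`. -/
def loop (G : ℝ → ℝ) (a b : ℝ) : Set (ℝ × ℝ) := trace G .upper a b ∪ trace G .lower b a

/-- The canard cycle through the visible fold `-s`: it slides from the fold to `2 lam - 3 s`, from
which an upper arc leads to `3 s`, and a lower arc back to the fold. -/
def bigLoop (s lam : ℝ) (G : ℝ → ℝ) : Set (ℝ × ℝ) :=
  trace G .sliding (-s) (2 * lam - 3 * s) ∪ trace G .upper (2 * lam - 3 * s) (3 * s) ∪
    trace G .lower (3 * s) (-s)

lemma no_lower_of_strictMono {lam : ℝ} {g G : ℝ → ℝ} (hm : StrictMono G) (x x' : ℝ) :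
    ¬ Link lam g G .lower x x' :=
  fun h => (hm h.1).ne h.2.1

/-- A nonsewing point of the cycle on the switching line forces a visible fold in its component, by
the last clause of the definition of a canard cycle. -/
lemma forall_sewing_of_no_visibleFold {Z : PWS} {Γ : Set (ℝ × ℝ)} (h : Z.IsCanardCycle Γ)
    (hne : Γ ≠ switching) (hv : ∀ x : ℝ, (x, (0 : ℝ)) ∈ Γ → ¬ Z.VisibleFold (x, 0)) :
    Z.KindI Γ := by
  intro p hp
  by_contra hns
  obtain ⟨v, hv1, hv2⟩ := h.2 hne p hp hns
  have hv3 := connectedComponentIn_subset _ _ hv1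
  have e : v = (v.1, 0) := Prod.ext rfl hv3.2
  rw [e] at hv2 hv3
  exact hv _ hv3.1 hv2

lemma ne_switching_of_subset_square {Γ : Set (ℝ × ℝ)} {r : ℝ} (h : Γ ⊆ square r) :
    Γ ≠ switching := by
  rintro rfl
  have := (h (show ((|r| : ℝ), (0 : ℝ)) ∈ switching from rfl)).1
  simp only [abs_abs] at this
  exact absurd this (not_lt.2 (le_abs_self r))

/-- The middle of a sliding segment would be both a sewing point and an escaping or sliding point.
-/
lemma kind_of_sewing {lam : ℝ} {g G : ℝ → ℝ} {Γ : Set (ℝ × ℝ)} {K : ArcKind} {x x' : ℝ}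
    (hk : (potentialField lam g).KindI Γ) (hl : Link lam g G K x x')
    (hΓ : trace G K x x' ⊆ Γ) : K ≠ .sliding := by
  rintro rfl
  have aux : ∀ w ∈ uIcc x x', (w, (0 : ℝ)) ∈ (potentialField lam g).escaping ∪
      (potentialField lam g).slidingRegion → False := by
    intro w hw h
    have := hk ⟨hΓ ⟨w, hw, rfl⟩, rfl⟩
    rw [mem_sewing] at this
    rw [mem_union, mem_escaping, mem_slidingRegion] at h
    rcases this with this | this <;> rcases h with h | h <;> linarith [this.1, this.2, h.1, h.2]
  rcases hl with ⟨h1, h2⟩ | ⟨h1, h2⟩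
  · have hm : (x + x') / 2 ∈ Ioo x x' := ⟨by linarith, by linarith⟩
    exact aux _ (by rw [uIcc_of_le h1.le]; exact Ioo_subset_Icc_self hm) (h2 _ hm).1
  · have hm : (x + x') / 2 ∈ Ioo x' x := ⟨by linarith, by linarith⟩
    exact aux _ (by rw [uIcc_of_ge h1.le]; exact Ioo_subset_Icc_self hm) (h2 _ hm).1

/-- Without lower arcs and visible folds there are no canard cycles. -/
lemma canardsIn_eq_empty_of_strictMono {lam r : ℝ} {g G : ℝ → ℝ}
    (hG : ∀ x, HasDerivAt G (g x) x) (hm : StrictMono G)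
    (hv : ∀ x : ℝ, ¬ (potentialField lam g).VisibleFold (x, 0)) :
    (potentialField lam g).canardsIn (square r) = ∅ := by
  rw [eq_empty_iff_forall_notMem]
  rintro Γ ⟨hc, hsq⟩
  have hk := forall_sewing_of_no_visibleFold hc (ne_switching_of_subset_square hsq)
    (fun x _ => hv x)
  obtain ⟨n, X, K, -, -, -, hl, ht, hΓ⟩ := exists_nodes hG hc
  have hup : ∀ i, K i = .upper := by
    intro i
    have h1 := kind_of_sewing hk (hl i) (fun p hp => (hΓ p).2 ⟨i, hp⟩)
    have h2 : K i ≠ .lower := fun h => no_lower_of_strictMono hm (X i) (X (i + 1)) (h ▸ hl i)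
    cases hK : K i
    · rfl
    · exact absurd hK h2
    · exact absurd hK h1
  exact (ht 0).ne ((hup 0).trans (hup 1).symm)

/-- This is the fact that an increasing map of an interval has no periodic points except fixed
points. -/
lemma eq_of_periodic_of_step {u : ℕ → ℝ} {n : ℕ} (hn : 1 ≤ n) (hp : u n = u 0)
    (hup : ∀ j, u j < u (j + 1) → u (j + 1) < u (j + 2))
    (hdown : ∀ j, u (j + 1) < u j → u (j + 2) < u (j + 1)) : u 1 = u 0 := by
  rcases lt_trichotomy (u 1) (u 0) with h | h | h
  · have : ∀ j, u (j + 1) < u j := fun j => by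
      induction j with
      | zero => exact h
      | succ j ih => exact hdown j ih
    exact absurd hp (strictAnti_nat_of_succ_lt this hn).ne
  · exact h
  · have : ∀ j, u j < u (j + 1) := fun j => by
      induction j with
      | zero => exact h
      | succ j ih => exact hup j ih
    exact absurd hp (strictMono_nat_of_lt_succ this hn).ne'

lemma exists_congr_ge {n : ℕ} (hn : 0 < n) (i j : ℕ) : ∃ k < n, (i + k) % n = j % n := by
  refine ⟨(j + (n - 1) * i) % n, Nat.mod_lt _ hn, ?_⟩
  rw [Nat.add_mod_mod]
  have : i + (j + (n - 1) * i) = j + n * i := by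
    obtain ⟨m, rfl⟩ : ∃ m, n = m + 1 := ⟨n - 1, by omega⟩
    simp only [Nat.add_sub_cancel]
    ring
  rw [this, Nat.add_mul_mod_self_left]

section Classification

variable {lam s c L r : ℝ} {g G M : ℝ → ℝ}

/-- A canard cycle of kind I goes around the invisible fold `s` once. -/
lemma Well.kindI_cycle (W : Well s g G M c L) {Γ : Set (ℝ × ℝ)}
    (hc : (potentialField lam g).IsCanardCycle Γ) (hk : (potentialField lam g).KindI Γ) :
    ∃ u ∈ Ioo (-s) s, u < lam ∧ s < 2 * lam - u ∧ G (2 * lam - u) = G u ∧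
      Γ = loop G u (2 * lam - u) := by
  obtain ⟨n, X, K, hn, hper, hinj, hl, ht, hΓ⟩ := exists_nodes W.deriv hc
  have hul : ∀ i, K i = .upper ∨ K i = .lower := by
    intro i
    have h1 := kind_of_sewing hk (hl i) (fun p hp => (hΓ p).2 ⟨i, hp⟩)
    cases hK : K i
    · exact Or.inl rfl
    · exact Or.inr rfl
    · exact absurd hK h1
  have up_low : ∀ i, K i = .upper → K (i + 1) = .lower := fun i h =>
    (hul (i + 1)).resolve_left fun h' => (ht i).ne (h.trans h'.symm)
  have low_up : ∀ i, K i = .lower → K (i + 1) = .upper := fun i h =>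
    (hul (i + 1)).resolve_right fun h' => (ht i).ne (h.trans h'.symm)
  obtain ⟨m, hm⟩ : ∃ m, K m = .upper := by
    rcases hul 0 with h | h
    · exact ⟨0, h⟩
    · exact ⟨1, low_up 0 h⟩
  have hup : ∀ j, K (m + 2 * j) = .upper := by
    intro j
    induction j with
    | zero => exact hm
    | succ j ih => exact low_up _ (up_low _ ih)
  have hlinks : ∀ j, X (m + 2 * j) < lam ∧ X (m + 2 * j + 1) = 2 * lam - X (m + 2 * j) ∧
      X (m + 2 * j + 1) ∈ Ioc s (3 * s) ∧ X (m + 2 * j + 2) ∈ Ico (-s) s ∧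
      G (X (m + 2 * j + 2)) = G (2 * lam - X (m + 2 * j)) := by
    intro j
    have l1 := hl (m + 2 * j)
    rw [hup j] at l1
    have l2 := hl (m + 2 * j + 1)
    rw [up_low _ (hup j)] at l2
    obtain ⟨h3, h4⟩ := W.chord_ends l2.1 l2.2.1 l2.2.2
    exact ⟨l1.1, l1.2, h3, h4, l1.2 ▸ l2.2.1⟩
  -- Every left node is also the end of a lower arc: the preceding one, reached here after whole
  -- periods to avoid subtraction of indices.
  have hu : ∀ j, X (m + 2 * j) ∈ Ico (-s) s := by
    intro j
    have h := (hlinks (j + n - 1)).2.2.2.1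
    rw [show m + 2 * (j + n - 1) + 2 = m + 2 * j + n * 2 by omega] at h
    rwa [(hper (m + 2 * j + n * 2) (m + 2 * j) (Nat.add_mul_mod_self_left _ _ _)).1] at h
  -- The return map is increasing: a larger left end gives a smaller right end and a lower level,
  -- and a lower level on the descending branch is met further to the right.
  have e2 : X (m + 2) = X m := by
    have := eq_of_periodic_of_step (u := fun j => X (m + 2 * j)) (n := n) (by omega)
      (hper _ _ (by simp)).1 ?_ ?_
    · exact this
    · intro j h
      obtain ⟨-, a1, a2, a3, a4⟩ := hlinks j
      obtain ⟨-, b1, b2, b3, b4⟩ := hlinks (j + 1)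
      have h1 := W.strictMonoOn_right (show s ≤ _ from b2.1.le) a2.1.le
        (by rw [a1, b1]; exact sub_lt_sub_left h _)
      rw [a1, b1, ← a4, ← b4] at h1
      exact (W.strictAntiOn_mid.lt_iff_gt (Ico_subset_Icc_self b3) (Ico_subset_Icc_self a3)).1 h1
    · intro j h
      obtain ⟨-, a1, a2, a3, a4⟩ := hlinks j
      obtain ⟨-, b1, b2, b3, b4⟩ := hlinks (j + 1)
      have h1 := W.strictMonoOn_right (show s ≤ _ from a2.1.le) b2.1.le
        (by rw [a1, b1]; exact sub_lt_sub_left h _)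
      rw [a1, b1, ← a4, ← b4] at h1
      exact (W.strictAntiOn_mid.lt_iff_gt (Ico_subset_Icc_self a3) (Ico_subset_Icc_self b3)).1 h1
  have hn2 : n = 2 := by
    have h1 := hinj _ _ e2
    have : n ∣ 2 := (Nat.modEq_iff_dvd' (by omega : m ≤ m + 2)).1 h1.symm |>.trans (by simp)
    exact le_antisymm (Nat.le_of_dvd (by norm_num) this) hn
  obtain ⟨h1, h2, h3, -, h5⟩ := hlinks 0
  have h4 := hu 0
  simp only [mul_zero, add_zero] at h1 h2 h3 h4 h5
  rw [e2] at h5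
  -- The fold itself is not a sewing point, so the left end lies in the open interval.
  have hne : X m ≠ -s := by
    intro h
    have hmem : (X m, (0 : ℝ)) ∈ Γ := by
      refine (hΓ _).2 ⟨m, ?_⟩
      rw [hm]
      exact ⟨X m, ⟨le_rfl, by linarith⟩, by simp⟩
    have := hk ⟨hmem, rfl⟩
    rw [mem_sewing, h, W.at_left] at this
    rcases this with this | this <;> exact lt_irrefl _ this.2
  refine ⟨X m, ⟨lt_of_le_of_ne h4.1 hne.symm, h4.2⟩, h1, h2 ▸ h3.1, h5.symm, ?_⟩
  ext p
  rw [hΓ, loop, mem_union]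
  constructor
  · rintro ⟨i, hi⟩
    obtain ⟨k, hk, e⟩ := exists_congr_ge (by omega : 0 < n) m i
    have e' : (m + k + 1) % n = (i + 1) % n := Nat.ModEq.add_right 1 e
    rw [← (hper _ _ e).1, ← (hper _ _ e).2, ← (hper _ _ e').1] at hi
    rw [hn2] at hk
    interval_cases k
    · rw [add_zero, hm, h2] at hi; exact Or.inl hi
    · rw [up_low m hm, h2, show m + 1 + 1 = m + 2 by ring, e2] at hi; exact Or.inr hi
  · rintro (h | h)
    · refine ⟨m, ?_⟩
      rw [hm, h2]; exact h
    · refine ⟨m + 1, ?_⟩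
      rw [up_low m hm, h2, show m + 1 + 1 = m + 2 by ring, e2]; exact h

lemma mem_regions : ∀ {w : ℝ}, (w, (0 : ℝ)) ∈ (potentialField lam g).escaping ∪
    (potentialField lam g).slidingRegion ↔ (w < lam ∧ 0 < g w) ∨ (lam < w ∧ g w < 0) := by
  intro w
  rw [mem_union, mem_escaping, mem_slidingRegion]

/-- The numerator is negative because `g x + x` increases and equals `-s ≥ lam` at the fold; the
denominator is positive because `g < 0` and `w > lam`. -/
lemma Well.slide_neg_of_le (W : Well s g G M c L) (hl : lam ≤ -s) {w : ℝ} (hw : w ∈ Ioo (-s) s) :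
    slide lam g w < 0 := by
  have hs := W.small
  have := W.mono_add (show -s ∈ Ioo (-1 / 2 : ℝ) (1 / 2) from
    ⟨by linarith, by linarith [W.pos]⟩) (show w ∈ Ioo (-1 / 2 : ℝ) (1 / 2) from
    ⟨by linarith [hw.1], by linarith [hw.2]⟩) hw.1
  simp only [W.at_left] at this
  exact div_neg_of_neg_of_pos (by linarith) (by linarith [W.inner w hw, hw.1])

/-- Left of the fold both signs are opposite to those of `Well.slide_neg_of_le`, so the field again
points left: away from the fold in the escaping region. -/
lemma Well.slide_neg_of_ge (W : Well s g G M c L) (hl : -s ≤ lam) {w : ℝ} (hw : w ∈ Ioo (-1 / 2) (-s)) :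
    slide lam g w < 0 := by
  have hs := W.small
  have := W.mono_add (⟨hw.1, by linarith [hw.2, W.pos]⟩ : w ∈ Ioo (-1 / 2 : ℝ) (1 / 2)) (show -s ∈ Ioo (-1 / 2 : ℝ) (1 / 2) from
    ⟨by linarith, by linarith [W.pos]⟩) hw.2
  simp only [W.at_left] at this
  exact div_neg_of_pos_of_neg (by linarith) (by linarith [W.out_left w hw.2, hw.2])

/-- The arcs that leave the visible fold. -/
lemma Well.leave_fold (W : Well s g G M c L) {K : ArcKind} {x : ℝ}
    (h : Link lam g G K (-s) x) :
    -s ≤ lam ∧ ((K = .upper ∧ -s < lam ∧ x = 2 * lam + s) ∨ (K = .sliding ∧ x < -s)) := by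
  have hs := W.pos
  cases K with
  | upper => exact ⟨h.1.le, Or.inl ⟨rfl, h.1, by linarith [h.2]⟩⟩
  | lower =>
    have := (W.chord_ends h.1 h.2.1 h.2.2).1.1
    linarith
  | sliding =>
    rcases h with ⟨h1, h2⟩ | ⟨h1, h2⟩
    · exfalso
      -- Right of the fold there is a sliding region adjacent to it only in this case, and then the
      -- field points towards the fold, so no slide can leave to the right.
      have hl : lam ≤ -s := by
        by_contra! hl
        obtain ⟨w, hw1, hw2⟩ := exists_between (lt_min h1 (lt_min hl (neg_lt_self hs)))
        rw [lt_min_iff, lt_min_iff] at hw2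
        have := W.inner w ⟨hw1, hw2.2.2⟩
        rcases mem_regions.1 (h2 w ⟨hw1, hw2.1⟩).1 with h3 | h3 <;> linarith [h3.1, h3.2]
      obtain ⟨w, hw1, hw2⟩ := exists_between (lt_min h1 (neg_lt_self hs))
      rw [lt_min_iff] at hw2
      exact absurd (h2 w ⟨hw1, hw2.1⟩).2 (not_le.2 (W.slide_neg_of_le hl ⟨hw1, hw2.2⟩))
    · refine ⟨?_, Or.inr ⟨rfl, h1⟩⟩
      by_contra! hl
      obtain ⟨w, hw1, hw2⟩ := exists_between (max_lt h1 hl)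
      rw [max_lt_iff] at hw1
      have := W.out_left w hw2
      rcases mem_regions.1 (h2 w ⟨hw1.1, hw2⟩).1 with h3 | h3 <;> linarith [h3.1, h3.2]

/-- The arcs that arrive at the visible fold, unless an arc of the same kind leaves it. -/
lemma Well.arrive_fold (W : Well s g G M c L) {K K' : ArcKind} {x x' : ℝ}
    (h : Link lam g G K x (-s)) (h' : Link lam g G K' (-s) x') (hne : K ≠ K') :
    K = .lower ∧ x = 3 * s := by
  have hs := W.pos
  obtain ⟨hl, hK'⟩ := W.leave_fold h'
  cases K with
  | upper => linarith [h.1, h.2]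
  | lower =>
    refine ⟨rfl, ?_⟩
    obtain ⟨h1, -⟩ := W.chord_ends h.1 h.2.1 h.2.2
    have e := h.2.1
    rw [← W.level] at e
    exact (W.strictMonoOn_right.injOn (show s ≤ 3 * s by linarith) h1.1.le e).symm
  | sliding =>
    exfalso
    -- If an upper arc leaves the fold, then `-s < lam`: on the left the field points away from the
    -- fold and on the right there are sewing points. If a slide leaves it, two consecutive arcs
    -- would be slides.
    rcases hK' with hK' | hK'
    · rcases h with ⟨h1, h2⟩ | ⟨h1, h2⟩
      · obtain ⟨w, hw1, hw2⟩ := exists_between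
          (max_lt h1 (show (-1 / 2 : ℝ) < -s by linarith [W.small]))
        rw [max_lt_iff] at hw1
        exact absurd (h2 w ⟨hw1.1, hw2⟩).2 (not_le.2 (W.slide_neg_of_ge hl ⟨hw1.2, hw2⟩))
      · obtain ⟨w, hw1, hw2⟩ := exists_between (lt_min h1 (lt_min hK'.2.1 (neg_lt_self hs)))
        rw [lt_min_iff, lt_min_iff] at hw2
        have := W.inner w ⟨hw1, hw2.2.2⟩
        rcases mem_regions.1 (h2 w ⟨hw1, hw2.1⟩).1 with h3 | h3 <;> linarith [h3.1, h3.2]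
    · exact hne hK'.1.symm

/-- Beyond `c` the level exceeds that of the fold, so the lower orbit passes below the fold and is
lost. -/
lemma Well.no_link_far (W : Well s g G M c L) {K : ArcKind} {x x' : ℝ} (hx : 3 * s < x)
    (hx' : lam < x) : ¬ Link lam g G K x x' := by
  have hs := W.pos
  intro h
  cases K with
  | upper => linarith [h.1]
  | lower => linarith [(W.chord_ends h.1 h.2.1 h.2.2).1.2]
  | sliding =>
    have key : ∀ w, s < w → lam < w → (w, (0 : ℝ)) ∉ (potentialField lam g).escaping ∪
        (potentialField lam g).slidingRegion := by
      intro w h1 h2 h3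
      have := W.out_right w h1
      rcases mem_regions.1 h3 with h4 | h4 <;> linarith [h4.1, h4.2]
    rcases h with ⟨h1, h2⟩ | ⟨h1, h2⟩
    · obtain ⟨w, hw1, hw2⟩ := exists_between h1
      exact key w (by linarith) (by linarith) (h2 w ⟨hw1, hw2⟩).1
    · obtain ⟨w, hw1, hw2⟩ := exists_between (max_lt h1 (max_lt hx hx'))
      rw [max_lt_iff, max_lt_iff] at hw1
      exact key w (by linarith) (by linarith) (h2 w ⟨hw1.1, hw2⟩).1

lemma Well.fold_mem_nodes (W : Well s g G M c L) {K : ArcKind} {x x' : ℝ}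
    (hl : Link lam g G K x x') (h : (-s, (0 : ℝ)) ∈ trace G K x x') : x = -s ∨ x' = -s := by
  have hs := W.pos
  cases K with
  | upper =>
    obtain ⟨w, hw, e⟩ := h
    rw [Prod.mk.injEq] at e
    obtain ⟨rfl, e⟩ := e
    rcases mul_eq_zero.1 ((div_eq_zero_iff.1 e).resolve_right (by norm_num)) with h | h
    · left; linarith
    · right; linarith
  | lower =>
    obtain ⟨w, hw, e⟩ := h
    rw [Prod.mk.injEq] at e
    obtain ⟨rfl, e⟩ := e
    obtain ⟨h1, h2⟩ := W.chord_ends hl.1 hl.2.1 hl.2.2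
    exact Or.inr (le_antisymm hw.1 h2.1)
  | sliding =>
    obtain ⟨w, hw, e⟩ := h
    rw [Prod.mk.injEq] at e
    obtain ⟨rfl, e⟩ := e
    by_contra! hne
    have key : (-s, (0 : ℝ)) ∉ (potentialField lam g).escaping ∪
        (potentialField lam g).slidingRegion := by
      intro h3
      rw [mem_regions, W.at_left] at h3
      rcases h3 with h3 | h3 <;> exact lt_irrefl _ h3.2
    rcases hl with ⟨h1, h2⟩ | ⟨h1, h2⟩
    · rw [uIcc_of_le h1.le] at hw
      exact key (h2 _ ⟨lt_of_le_of_ne hw.1 hne.1, lt_of_le_of_ne hw.2 hne.2.symm⟩).1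
    · rw [uIcc_of_ge h1.le] at hw
      exact key (h2 _ ⟨lt_of_le_of_ne hw.1 hne.2, lt_of_le_of_ne hw.2 hne.1.symm⟩).1

lemma bigLoop_eq_loop (hs : 0 < s) : bigLoop s s G = loop G (-s) (3 * s) := by
  rw [bigLoop, loop, show 2 * s - 3 * s = -s by ring]
  simp only [trace, uIcc_self, image_singleton]
  rw [union_assoc, union_eq_right, singleton_subset_iff]
  exact Or.inl ⟨-s, ⟨le_rfl, by linarith⟩, by simp⟩

/-- A canard cycle through the visible fold is `bigLoop`. -/
lemma Well.fold_cycle (W : Well s g G M c L) {Γ : Set (ℝ × ℝ)}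
    (hc : (potentialField lam g).IsCanardCycle Γ) (hsq : Γ ⊆ square r) (hr : r ≤ 1 / 2)
    (hf : (-s, (0 : ℝ)) ∈ Γ) : lam ∈ Icc (-s) s ∧ Γ = bigLoop s lam G := by
  have hs := W.pos
  obtain ⟨n, X, K, hn, hper, hinj, hl, ht, hΓ⟩ := exists_nodes W.deriv hc
  obtain ⟨j, hj⟩ : ∃ j, X j = -s := by
    obtain ⟨i, hi⟩ := (hΓ _).1 hf
    rcases W.fold_mem_nodes (hl i) hi with h | h
    exacts [⟨_, h⟩, ⟨_, h⟩]
  -- A shift by whole periods makes room for three predecessors of the fold with natural indices.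
  obtain ⟨q, hq⟩ : ∃ q, X (q + 3) = -s := by
    refine ⟨j + n * 3 - 3, ?_⟩
    rw [show j + n * 3 - 3 + 3 = j + n * 3 by omega, ← hj]
    exact (hper _ _ (Nat.add_mul_mod_self_left _ _ _)).1
  have l3 := hl (q + 3)
  rw [hq] at l3
  have l2 := hl (q + 2)
  rw [hq] at l2
  obtain ⟨hl0, hleave⟩ := W.leave_fold l3
  obtain ⟨k2, x2⟩ := W.arrive_fold l2 l3 (ht (q + 2)).ne
  -- For `lam > s` the arc that leaves the fold, upper or sliding to the left, leads after at most
  -- one more arc beyond `3s`, where nothing returns.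
  have hls : lam ≤ s := by
    by_contra! hls
    rcases hleave with ⟨-, -, h⟩ | ⟨h, h'⟩
    · have := hl (q + 4)
      rw [h] at this
      exact W.no_link_far (by linarith) (by linarith) this
    · have l4 := hl (q + 4)
      have hne := (ht (q + 3)).ne
      rw [h] at hne
      cases hK : K (q + 4) with
      | upper =>
        rw [hK] at l4
        have l5 := hl (q + 5)
        rw [l4.2] at l5
        exact W.no_link_far (by linarith) (by linarith) l5
      | lower =>
        rw [hK] at l4
        linarith [(W.chord_ends l4.1 l4.2.1 l4.2.2).1.1]
      | sliding => exact hne hK.symm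
  refine ⟨⟨hl0, hls⟩, ?_⟩
  have l1 := hl (q + 1)
  rw [x2] at l1
  have k1 : K (q + 1) = .upper := by
    have hne := (ht (q + 1)).ne
    rw [k2] at hne
    cases hK : K (q + 1) with
    | upper => rfl
    | lower => exact absurd hK hne
    | sliding =>
      exfalso
      rw [hK] at l1
      have key : ∀ w, s < w → (w, (0 : ℝ)) ∉ (potentialField lam g).escaping ∪
          (potentialField lam g).slidingRegion := by
        intro w h1 h3
        have := W.out_right w h1
        rcases mem_regions.1 h3 with h4 | h4 <;> linarith [h4.1, h4.2]
      rcases l1 with ⟨h1, h2⟩ | ⟨h1, h2⟩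
      · obtain ⟨w, hw1, hw2⟩ := exists_between (max_lt h1 (show s < 3 * s by linarith))
        rw [max_lt_iff] at hw1
        exact key w hw1.2 (h2 w ⟨hw1.1, hw2⟩).1
      · obtain ⟨w, hw1, hw2⟩ := exists_between h1
        exact key w (by linarith) (h2 w ⟨hw1, hw2⟩).1
  rw [k1] at l1
  have x1 : X (q + 1) = 2 * lam - 3 * s := by linarith [l1.2]
  rcases eq_or_lt_of_le hls with hls | hls
  · have x1' : X (q + 1) = -s := by rw [x1, hls]; ring
    have hn2 : n = 2 := by
      have h1 := hinj (q + 3) (q + 1) (hq.trans x1'.symm)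
      have : n ∣ 2 :=
        (Nat.modEq_iff_dvd' (by omega : q + 1 ≤ q + 3)).1 h1.symm |>.trans (by simp)
      exact le_antisymm (Nat.le_of_dvd (by norm_num) this) hn
    have t1 : trace G (K (q + 1)) (X (q + 1)) (X (q + 2)) = trace G .upper (-s) (3 * s) := by
      rw [k1, x1', x2]
    have t2 : trace G (K (q + 2)) (X (q + 2)) (X (q + 3)) = trace G .lower (3 * s) (-s) := by
      rw [k2, x2, hq]
    rw [hls, bigLoop_eq_loop hs, loop]
    ext p
    rw [hΓ]
    constructor
    · rintro ⟨i, hi⟩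
      obtain ⟨k, hk, e⟩ := exists_congr_ge (by omega : 0 < n) (q + 1) i
      have e' : (q + 1 + k + 1) % n = (i + 1) % n := Nat.ModEq.add_right 1 e
      rw [← (hper _ _ e).1, ← (hper _ _ e).2, ← (hper _ _ e').1] at hi
      rw [hn2] at hk
      interval_cases k
      · exact Or.inl (t1 ▸ hi)
      · exact Or.inr (t2 ▸ hi)
    · rintro (h | h)
      · exact ⟨q + 1, t1 ▸ h⟩
      · exact ⟨q + 2, t2 ▸ h⟩
  · have l0 := hl q
    rw [x1] at l0
    have notup : ∀ x, ∀ y ≤ -s, ¬ Link lam g G .upper x y := fun x y hy h => by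
      linarith [h.1, h.2]
    have notlow : ∀ x, ∀ y < -s, ¬ Link lam g G .lower x y := fun x y hy h => by
      linarith [(W.chord_ends h.1 h.2.1 h.2.2).2.1]
    have k0 : K q = .sliding := by
      have hne := (ht q).ne
      rw [k1] at hne
      cases hK : K q with
      | upper => exact absurd hK hne
      | lower => rw [hK] at l0; exact absurd l0 (notlow _ _ (by linarith))
      | sliding => rfl
    rw [k0] at l0
    have sq : ∀ i, ∀ w ∈ uIcc (X i) (X (i + 1)), K i = .sliding → -1 / 2 < w := by
      intro i w hw hK
      have : (w, (0 : ℝ)) ∈ Γ := (hΓ _).2 ⟨i, by rw [hK]; exact ⟨w, hw, rfl⟩⟩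
      have := (abs_lt.1 (hsq this).1).1
      simp only at this
      linarith
    have hx0 : 2 * lam - 3 * s < X q ∧ X q ≤ -s := by
      rcases l0 with ⟨h1, h2⟩ | ⟨h1, h2⟩
      · exfalso
        obtain ⟨w, hw1, hw2⟩ := exists_between h1
        have h3 := sq q w (by rw [x1, uIcc_of_le h1.le]; exact ⟨hw1.le, hw2.le⟩) k0
        exact absurd (h2 w ⟨hw1, hw2⟩).2 (not_le.2 (W.slide_neg_of_ge hl0 ⟨h3, by linarith⟩))
      · refine ⟨h1, ?_⟩
        by_contra! h3
        have := (h2 (-s) ⟨by linarith, h3⟩).1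
        rw [mem_regions, W.at_left] at this
        rcases this with h3 | h3 <;> exact lt_irrefl _ h3.2
    -- A start of the slide strictly left of the fold could only be entered by an upper or a lower
    -- arc; upper arcs land right of `lam ≥ -s` and lower arcs land in `[-s, s)`.
    have x0 : X q = -s := by
      by_contra hne
      have hlt : X q < -s := lt_of_le_of_ne hx0.2 hne
      obtain ⟨p, hp⟩ : ∃ p, (p + 1) % n = q % n := ⟨q + n - 1, by
        rw [show q + n - 1 + 1 = q + n by omega, Nat.add_mod_right]⟩
      have lp := hl p
      have hne := (ht p).ne
      rw [(hper _ _ hp).1] at lp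
      rw [(hper _ _ hp).2, k0] at hne
      cases hK : K p with
      | upper => rw [hK] at lp; exact notup _ _ hx0.2 lp
      | lower => rw [hK] at lp; exact notlow _ _ hlt lp
      | sliding => exact hne hK
    -- The fold recurs after three steps, so `n` divides `3`, and `n = 1` is excluded by `2 ≤ n`.
    have hn3 : n = 3 := by
      have h1 := hinj (q + 3) q (hq.trans x0.symm)
      have h3 : n ∣ 3 :=
        (Nat.modEq_iff_dvd' (by omega : q ≤ q + 3)).1 h1.symm |>.trans (by simp)
      rcases (Nat.dvd_prime Nat.prime_three).1 h3 with h | h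
      · omega
      · exact h
    have t0 : trace G (K q) (X q) (X (q + 1)) = trace G .sliding (-s) (2 * lam - 3 * s) := by
      rw [k0, x0, x1]
    have t1 : trace G (K (q + 1)) (X (q + 1)) (X (q + 2)) =
        trace G .upper (2 * lam - 3 * s) (3 * s) := by
      rw [k1, x1, x2]
    have t2 : trace G (K (q + 2)) (X (q + 2)) (X (q + 3)) = trace G .lower (3 * s) (-s) := by
      rw [k2, x2, hq]
    rw [bigLoop]
    ext p
    rw [hΓ]
    constructor
    · rintro ⟨i, hi⟩
      obtain ⟨k, hk, e⟩ := exists_congr_ge (by omega : 0 < n) q i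
      have e' : (q + k + 1) % n = (i + 1) % n := Nat.ModEq.add_right 1 e
      rw [← (hper _ _ e).1, ← (hper _ _ e).2, ← (hper _ _ e').1] at hi
      rw [hn3] at hk
      interval_cases k
      · exact Or.inl (Or.inl (t0 ▸ hi))
      · exact Or.inl (Or.inr (t1 ▸ hi))
      · exact Or.inr (t2 ▸ hi)
    · rintro ((h | h) | h)
      · exact ⟨q, t0 ▸ h⟩
      · exact ⟨q + 1, t1 ▸ h⟩
      · exact ⟨q + 2, t2 ▸ h⟩

theorem Well.cycle_cases (W : Well s g G M c L) {Γ : Set (ℝ × ℝ)} (hr : r ≤ 1 / 2)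
    (h : Γ ∈ (potentialField lam g).canardsIn (square r)) :
    (∃ u ∈ Ioo (-s) s, u < lam ∧ s < 2 * lam - u ∧ G (2 * lam - u) = G u ∧
      Γ = loop G u (2 * lam - u)) ∨ (lam ∈ Icc (-s) s ∧ Γ = bigLoop s lam G) := by
  by_cases hf : (-s, (0 : ℝ)) ∈ Γ
  · exact Or.inr (W.fold_cycle h.1 h.2 hr hf)
  · refine Or.inl (W.kindI_cycle h.1 (forall_sewing_of_no_visibleFold h.1
      (ne_switching_of_subset_square h.2) ?_))
    intro x hx hv
    rw [W.visibleFold_iff] at hv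
    exact hf (hv ▸ hx)

end Classification

/-! ### Existence of the canard cycles -/

/-- A solution of a scalar equation that runs through an interval from right to left. -/
lemma exists_decreasing_solution {f : ℝ → ℝ} {a b : ℝ} (hab : a < b)
    (hf : ContinuousOn f (Icc a b)) (hneg : ∀ x ∈ Icc a b, f x < 0) :
    ∃ T > 0, ∃ φ : ℝ → ℝ, Continuous φ ∧ StrictAnti φ ∧ φ 0 = b ∧ φ T = a ∧
      ∀ τ ∈ Ioo 0 T, HasDerivAt φ (f (φ τ)) τ := by
  -- Clamping the argument extends the field to the whole line with a bound away from zero and from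
  -- infinity.
  set F : ℝ → ℝ := fun x => f (max a (min b x)) with hF
  have hmem : ∀ x, max a (min b x) ∈ Icc a b := fun x =>
    ⟨le_max_left _ _, max_le hab.le (min_le_left _ _)⟩
  have hFc : Continuous F := hf.comp_continuous (by fun_prop) hmem
  have hFneg : ∀ x, F x < 0 := fun x => hneg _ (hmem x)
  obtain ⟨x₀, hx₀, hmin⟩ := isCompact_Icc.exists_isMinOn (nonempty_Icc.2 hab.le) hf
  set k := -(f x₀)⁻¹ with hk
  have hk0 : 0 < k := by
    rw [hk, neg_pos]; exact inv_lt_zero.2 (hneg x₀ hx₀)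
  have hFk : ∀ x, k ≤ -(F x)⁻¹ := by
    intro x
    rw [hk, neg_le_neg_iff]
    exact (inv_le_inv_of_neg (hFneg x) (hneg x₀ hx₀)).2 (hmin (hmem x))
  -- Up to sign, `m x` is the travel time from `b` to `x`; the solution is its inverse function at
  -- `-τ`. The lower bound `k` on the integrand makes `m` a bijection of the line.
  set m : ℝ → ℝ := fun x => ∫ y in b..x, -(F y)⁻¹ with hm
  have hmc : Continuous fun y => -(F y)⁻¹ := (hFc.inv₀ fun x => (hFneg x).ne).neg
  have hmd : ∀ x, HasDerivAt m (-(F x)⁻¹) x := fun x =>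
    (hmc.integral_hasStrictDerivAt b x).hasDerivAt
  have hgrow : Monotone fun x => m x - k * x := by
    apply monotone_of_hasDerivAt_nonneg (f' := fun x => -(F x)⁻¹ - k)
    · intro x
      exact ((hmd x).sub ((hasDerivAt_id x).const_mul k)).congr_deriv (by simp)
    · intro x
      exact sub_nonneg.2 (hFk x)
  have hmono : StrictMono m := by
    intro x y hxy
    have := hgrow hxy.le
    simp only at this
    nlinarith
  have htop : Tendsto m atTop atTop := by
    have h1 : Tendsto (fun x => m 0 + k * x) atTop atTop :=
      tendsto_atTop_add_const_left _ _ (tendsto_id.const_mul_atTop hk0)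
    refine tendsto_atTop_mono' _ ?_ h1
    filter_upwards [eventually_ge_atTop 0] with x hx
    have := hgrow hx
    simp only [mul_zero] at this
    linarith
  have hbot : Tendsto m atBot atBot := by
    have h1 : Tendsto (fun x => m 0 + k * x) atBot atBot :=
      tendsto_atBot_add_const_left _ _ (tendsto_id.const_mul_atBot hk0)
    refine tendsto_atBot_mono' _ ?_ h1
    filter_upwards [eventually_le_atBot 0] with x hx
    have := hgrow hx
    simp only [mul_zero] at this
    linarith
  have hmcont : Continuous m := continuous_iff_continuousAt.2 fun x => (hmd x).continuousAt
  set e : ℝ ≃o ℝ := hmono.orderIsoOfSurjective m (hmcont.surjective htop hbot) with he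
  have em : ∀ x, e x = m x := fun x => rfl
  have hmb : m b = 0 := by simp [hm]
  have hma : m a < 0 := hmb ▸ hmono hab
  refine ⟨-m a, neg_pos.2 hma, fun τ => e.symm (-τ), e.symm.continuous.comp continuous_neg,
    fun x y h => e.symm.strictMono (neg_lt_neg h), ?_, ?_, ?_⟩
  · simp only [neg_zero]
    rw [OrderIso.symm_apply_eq, em, hmb]
  · simp only [neg_neg]
    rw [OrderIso.symm_apply_eq, em]
  · intro τ hτ
    have hloc : e.symm (-τ) ∈ Icc a b := by
      constructor
      · rw [OrderIso.le_symm_apply, em]; linarith [hτ.2]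
      · rw [OrderIso.symm_apply_le, em, hmb]; linarith [hτ.1]
    have hd : HasDerivAt e.symm (-(F (e.symm (-τ)))⁻¹)⁻¹ (-τ) :=
      HasDerivAt.of_local_left_inverse e.symm.continuous.continuousAt (hmd _)
        (neg_ne_zero.2 (inv_ne_zero (hFneg _).ne))
        (Eventually.of_forall fun y => e.apply_symm_apply y)
    have h2 := hd.comp τ (hasDerivAt_neg τ)
    refine h2.congr_deriv ?_
    have : F (e.symm (-τ)) = f (e.symm (-τ)) := by
      simp only [hF]
      rw [min_eq_right hloc.2, max_eq_right hloc.1]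
    rw [← this, inv_neg, inv_inv]
    ring

section Existence

variable {lam s c L r : ℝ} {g G M : ℝ → ℝ}

/-- An upper arc followed by a lower arc. -/
lemma isCanardCycle_loop (hG : ∀ x, HasDerivAt G (g x) x) {a b : ℝ} (hab : a < b)
    (hb : b = 2 * lam - a) (e : G b = G a) (hlt : ∀ w ∈ Ioo a b, G w < G b)
    (ta : (a, (0 : ℝ)) ∈ (potentialField lam g).sewing ∨ (potentialField lam g).VisibleFold (a, 0))
    (tb : (b, (0 : ℝ)) ∈ (potentialField lam g).sewing) :
    (potentialField lam g).IsCanardCycle (loop G a b) := by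
  have hd : 0 < b - a := sub_pos.2 hab
  set γ₁ : ℝ → ℝ × ℝ := fun τ => (a + (τ - 0), (a + (τ - 0) - a) * (2 * lam - (a + (τ - 0)) - a) / 2)
    with hγ₁
  set γ₂ : ℝ → ℝ × ℝ := fun τ => (b - (τ - (b - a)), G (b - (τ - (b - a))) - G b) with hγ₂
  set γ : ℝ → ℝ × ℝ := fun τ => if τ ≤ b - a then γ₁ τ else γ₂ τ with hγ
  have e1 : EqOn γ γ₁ (Icc 0 (b - a)) := fun τ hτ => if_pos hτ.2
  have em : γ₁ (b - a) = γ₂ (b - a) := by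
    simp only [hγ₁, hγ₂, Prod.mk.injEq]
    constructor
    · ring
    · rw [hb]; ring_nf
  have e2 : EqOn γ γ₂ (Icc (b - a) (2 * (b - a))) := by
    intro τ hτ
    rcases eq_or_lt_of_le hτ.1 with h | h
    · rw [← h, ← em]; exact if_pos le_rfl
    · exact if_neg (not_le.2 h)
  have A1 : (potentialField lam g).IsArc .upper γ 0 (b - a) := by
    refine (isArc_upper (x₀ := a) hd ?_).congr e1
    intro x hx
    exact mul_nonneg (by linarith [hx.1]) (by linarith [hx.2])
  have A2 : (potentialField lam g).IsArc .lower γ (b - a) (2 * (b - a)) := by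
    refine (isArc_lower (x₀ := b) hG (by linarith) ?_).congr e2
    intro x hx
    rcases eq_or_lt_of_le hx.2 with h | h
    · rw [h]
    rcases eq_or_lt_of_le (show a ≤ x by linarith [hx.1]) with h' | h'
    · rw [← h', e]
    · exact (hlt x ⟨h', h⟩).le
  have inj1 : InjOn γ (Icc 0 (b - a)) := by
    intro τ hτ σ hσ h
    rw [e1 hτ, e1 hσ] at h
    have := congrArg Prod.fst h
    simp only [hγ₁] at this
    linarith
  have inj2 : InjOn γ (Icc (b - a) (2 * (b - a))) := by
    intro τ hτ σ hσ h
    rw [e2 hτ, e2 hσ] at h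
    have := congrArg Prod.fst h
    simp only [hγ₂] at this
    linarith
  have v0 : γ 0 = (a, 0) := by rw [e1 ⟨le_rfl, hd.le⟩]; simp [hγ₁]
  have v1 : γ (b - a) = (b, 0) := by rw [e2 ⟨le_rfl, by linarith⟩]; simp [hγ₂]
  have v2 : γ (2 * (b - a)) = (a, 0) := by
    rw [e2 ⟨by linarith, le_rfl⟩]
    have : b - (2 * (b - a) - (b - a)) = a := by ring
    simp only [hγ₂, this, e, sub_self]
  have im1 := (link_of_isArc hG A1 (by rw [v0]) (by rw [v1]) inj1).2
  have im2 := (link_of_isArc hG A2 (by rw [v1]) (by rw [v2]) inj2).2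
  rw [v0, v1] at im1
  rw [v1, v2] at im2
  have t1 : ((1 : ℕ) : ℝ) * (b - a) = b - a := by simp
  have t2 : ((2 : ℕ) : ℝ) * (b - a) = 2 * (b - a) := by norm_num
  have t0 : ((0 : ℕ) : ℝ) * (b - a) = 0 := by simp
  refine ⟨⟨2, fun i => i * (b - a), fun i => if i = 0 then .upper else .lower, γ, by norm_num,
    ?_, ?_, ?_, ?_, Or.inr ⟨le_rfl, ?_⟩⟩, ?_⟩
  · intro i hi
    interval_cases i
    · simp only [t0, zero_add, t1]; exact A1
    · simp only [t1, Nat.reduceAdd, t2]; exact A2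
  · simp only [t0, t2]; rw [v0, v2]
  · simp only [t0, t2]
    -- The two arcs are separated by height: the first is nonnegative, while the open second arc is
    -- strictly negative.
    have key : ∀ τ ∈ Ico 0 (2 * (b - a)), ∀ σ ∈ Ico 0 (2 * (b - a)), τ ≤ b - a → b - a < σ →
        γ τ ≠ γ σ := by
      intro τ hτ σ hσ h h' he
      have h1 := A1.2.2.1 τ ⟨hτ.1, h⟩
      have h2 : (γ σ).2 < 0 := by
        rw [e2 ⟨h'.le, hσ.2.le⟩]
        exact sub_neg.2 (hlt _ ⟨by linarith [hσ.2], by linarith⟩)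
      rw [he] at h1
      linarith
    intro τ hτ σ hσ h
    rcases le_or_gt τ (b - a) with h1 | h1 <;> rcases le_or_gt σ (b - a) with h2 | h2
    · exact inj1 ⟨hτ.1, h1⟩ ⟨hσ.1, h2⟩ h
    · exact absurd h (key τ hτ σ hσ h1 h2)
    · exact absurd h.symm (key σ hσ τ hτ h2 h1)
    · exact inj2 ⟨h1.le, hτ.2.le⟩ ⟨h2.le, hσ.2.le⟩ h
  · simp only [t0, t2]
    rw [loop, ← im1, ← im2, ← image_union, Icc_union_Icc_eq_Icc hd.le (by linarith)]
  · intro i hi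
    interval_cases i
    · simp only [zero_add, t1, v1]; exact Or.inl tb
    · simp only [Nat.reduceAdd, t2, v2]; exact ta
  · rintro - p ⟨hp, hp0⟩ hns
    have hp' : p = (a, 0) ∨ p = (b, 0) := by
      have hp0 : p.2 = 0 := hp0
      rcases hp with ⟨w, hw, rfl⟩ | ⟨w, hw, rfl⟩
      · simp only at hp0
        rcases mul_eq_zero.1 ((div_eq_zero_iff.1 hp0).resolve_right (by norm_num)) with h | h
        · left; rw [Prod.mk.injEq]; exact ⟨by linarith, hp0⟩
        · right; rw [Prod.mk.injEq]; exact ⟨by linarith, hp0⟩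
      · simp only at hp0
        by_cases h : w ∈ Ioo a b
        · linarith [hlt w h]
        · rcases eq_or_lt_of_le hw.1 with h1 | h1
          · left; rw [Prod.mk.injEq]; exact ⟨h1.symm, hp0⟩
          rcases eq_or_lt_of_le hw.2 with h2 | h2
          · right; rw [Prod.mk.injEq]; exact ⟨h2, hp0⟩
          · exact absurd ⟨h1, h2⟩ h
    rcases hp' with rfl | rfl
    · exact ⟨(a, 0), mem_connectedComponentIn ⟨hp, hp0⟩, ta.resolve_left hns⟩
    · exact absurd tb hns

lemma Well.level_mid (W : Well s g G M c L) {w : ℝ} (hw : w ∈ Icc (-s) (3 * s)) :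
    G s ≤ G w ∧ G w ≤ G (-s) := by
  have hs := W.pos
  rcases le_total w s with h | h
  · exact ⟨W.strictAntiOn_mid.antitoneOn ⟨hw.1, h⟩ ⟨by linarith, le_rfl⟩ h,
      W.strictAntiOn_mid.antitoneOn ⟨le_rfl, by linarith⟩ ⟨hw.1, h⟩ hw.1⟩
  · refine ⟨W.strictMonoOn_right.monotoneOn (le_refl s) h h, ?_⟩
    rw [← W.level]
    exact W.strictMonoOn_right.monotoneOn h (show s ≤ 3 * s by linarith) hw.2

lemma trace_subset_square {G : ℝ → ℝ} {K : ArcKind} {x x' r : ℝ} (hx : |x| < r / 2)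
    (hx' : |x'| < r / 2) (hr : r ≤ 1 / 2) (hG : ∀ w ∈ Icc x' x, |G w - G x| < r) :
    trace G K x x' ⊆ square r := by
  rw [abs_lt] at hx hx'
  have habs : ∀ w, x ≤ w ∨ x' ≤ w → w ≤ x' ∨ w ≤ x → |w| < r := by
    intro w h1 h2
    rw [abs_lt]
    constructor
    · rcases h1 with h | h <;> linarith
    · rcases h2 with h | h <;> linarith
  cases K with
  | upper =>
    rintro _ ⟨w, hw, rfl⟩
    refine ⟨habs w (Or.inl hw.1) (Or.inl hw.2), ?_⟩
    have h1 : 0 ≤ w - x := by linarith [hw.1]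
    have h2 : 0 ≤ x' - w := by linarith [hw.2]
    simp only
    rw [abs_of_nonneg (by positivity)]
    nlinarith
  | lower =>
    rintro _ ⟨w, hw, rfl⟩
    exact ⟨habs w (Or.inr hw.1) (Or.inr hw.2), hG w hw⟩
  | sliding =>
    rintro _ ⟨w, hw, rfl⟩
    refine ⟨?_, by simp only [abs_zero]; linarith⟩
    rcases le_total x x' with h | h
    · rw [uIcc_of_le h] at hw; exact habs w (Or.inl hw.1) (Or.inl hw.2)
    · rw [uIcc_of_ge h] at hw; exact habs w (Or.inr hw.1) (Or.inr hw.2)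

lemma Well.depth_lt (W : Well s g G M c L) (hr : 10 * s < r) {v w : ℝ}
    (hv : v ∈ Icc (-s) (3 * s)) (hw : w ∈ Icc (-s) (3 * s)) : |G w - G v| < r := by
  have h1 := W.level_mid hv
  have h2 := W.level_mid hw
  have hs := W.pos
  have h3 := W.small
  have h4 := W.depth
  have h5 : 50 * s ^ 3 < s := by
    have : s ^ 2 < 1 / 10000 := by nlinarith
    nlinarith
  rw [abs_lt]
  constructor <;> linarith [h1.1, h1.2, h2.1, h2.2]

lemma Well.loop_subset_square (W : Well s g G M c L) (hr : 10 * s < r) (hr' : r ≤ 1 / 2)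
    {a b : ℝ} (ha : a ∈ Icc (-s) (3 * s)) (hb : b ∈ Icc (-s) (3 * s)) :
    loop G a b ⊆ square r := by
  have hs := W.pos
  have ha' : |a| < r / 2 := by rw [abs_lt]; constructor <;> linarith [ha.1, ha.2]
  have hb' : |b| < r / 2 := by rw [abs_lt]; constructor <;> linarith [hb.1, hb.2]
  refine union_subset (trace_subset_square ha' hb' hr' ?_) (trace_subset_square hb' ha' hr' ?_)
  · exact fun w hw => W.depth_lt hr ha ⟨hb.1.trans hw.1, hw.2.trans ha.2⟩
  · exact fun w hw => W.depth_lt hr hb ⟨ha.1.trans hw.1, hw.2.trans hb.2⟩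

lemma Well.bigLoop_subset_square (W : Well s g G M c L) (hr : 10 * s < r) (hr' : r ≤ 1 / 2)
    (hl : lam ∈ Icc (-s) s) : bigLoop s lam G ⊆ square r := by
  have hs := W.pos
  obtain ⟨h1, h2⟩ := hl
  have ha' : |-s| < r / 2 := by rw [abs_lt]; constructor <;> linarith
  have hb' : |3 * s| < r / 2 := by rw [abs_lt]; constructor <;> linarith
  have hc' : |2 * lam - 3 * s| < r / 2 := by rw [abs_lt]; constructor <;> linarith
  refine union_subset (union_subset ?_ ?_) (trace_subset_square hb' ha' hr' ?_)
  · rintro _ ⟨w, hw, rfl⟩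
    rw [uIcc_of_ge (by linarith)] at hw
    refine ⟨?_, by simp only [abs_zero]; linarith⟩
    simp only
    rw [abs_lt]
    constructor <;> linarith [hw.1, hw.2]
  · refine trace_subset_square hc' hb' hr' ?_
    intro w hw
    linarith [hw.1, hw.2]
  · exact fun w hw => W.depth_lt hr ⟨by linarith, le_rfl⟩ hw

/-- The cycles of kind I. -/
lemma Well.loop_isCanardCycle (W : Well s g G M c L) {u : ℝ} (hu : u ∈ Ioo (-s) s)
    (hul : u < lam) (hv : s < 2 * lam - u) (e : G (2 * lam - u) = G u) :
    (potentialField lam g).IsCanardCycle (loop G u (2 * lam - u)) ∧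
      (potentialField lam g).KindI (loop G u (2 * lam - u)) := by
  have tu : (u, (0 : ℝ)) ∈ (potentialField lam g).sewing :=
    mem_sewing.2 (Or.inl ⟨hul, W.inner u hu⟩)
  have tv : (2 * lam - u, (0 : ℝ)) ∈ (potentialField lam g).sewing :=
    mem_sewing.2 (Or.inr ⟨by linarith, W.out_right _ hv⟩)
  have hc := isCanardCycle_loop W.deriv (by linarith) rfl e
    (fun w hw => W.chord_lt ⟨hu.1.le, hu.2.le⟩ hv.le e.symm hw) (Or.inl tu) tv
  refine ⟨hc, ?_⟩
  rintro p ⟨hp, hp0⟩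
  have hp0 : p.2 = 0 := hp0
  rcases hp with ⟨w, hw, rfl⟩ | ⟨w, hw, rfl⟩
  · simp only at hp0 ⊢
    rw [hp0]
    rcases mul_eq_zero.1 ((div_eq_zero_iff.1 hp0).resolve_right (by norm_num)) with h | h
    · rwa [show w = u by linarith]
    · rwa [show w = 2 * lam - u by linarith]
  · simp only at hp0 ⊢
    rw [hp0]
    rcases eq_or_lt_of_le hw.1 with h1 | h1
    · rwa [← h1]
    rcases eq_or_lt_of_le hw.2 with h2 | h2
    · rwa [h2]
    · linarith [W.chord_lt ⟨hu.1.le, hu.2.le⟩ hv.le e.symm ⟨h1, h2⟩]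

lemma Well.visibleFold (W : Well s g G M c L) : (potentialField lam g).VisibleFold (-s, 0) :=
  W.visibleFold_iff.2 rfl

lemma Well.fold_mem_bigLoop : (-s, (0 : ℝ)) ∈ bigLoop s lam G :=
  Or.inl (Or.inl ⟨-s, left_mem_uIcc, rfl⟩)

/-- On the escaping region to the left of the fold, Filippov's field extends continuously to the
fold and points to the left. -/
lemma Well.exists_slide_extension (W : Well s g G M c L) (hl : -s ≤ lam) :
    ∃ f : ℝ → ℝ, ContinuousOn f (Ioc (-1 / 2) (-s)) ∧ (∀ x ∈ Ioc (-1 / 2) (-s), f x < 0) ∧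
      ∀ x < -s, f x = slide lam g x := by
  have hs := W.pos
  have hs' := W.small
  -- For `lam = -s` numerator and denominator both vanish at the fold. Left of the fold the lower
  -- force is exactly `x² - s²`, so the common factor `x + s` cancels and the quotient extends
  -- without zero.
  rcases eq_or_lt_of_le hl with h | h
  · refine ⟨fun x => -(1 + x - s) / (1 - x + s), ?_, ?_, ?_⟩
    · refine ContinuousOn.div (by fun_prop) (by fun_prop) ?_
      intro x hx
      exact (by linarith [hx.2] : 0 < 1 - x + s).ne'
    · intro x hx
      exact div_neg_of_neg_of_pos (by linarith [hx.1]) (by linarith [hx.2])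
    · intro x hx
      have h1 : x + s ≠ 0 := by linarith
      have h2 : 1 - x + s ≠ 0 := by linarith
      rw [slide, W.left_eq x hx.le, ← h]
      rw [show -s - (x ^ 2 - s ^ 2 + x) = (x + s) * -(1 + x - s) by ring,
        show x - (x ^ 2 - s ^ 2) - -s = (x + s) * (1 - x + s) by ring, mul_div_mul_left _ _ h1]
  · have hg := W.cont
    have hneg : ∀ x ≤ -s, x - g x - lam < 0 := by
      intro x hx
      have : 0 ≤ g x := by rw [W.left_eq x hx]; nlinarith
      linarith
    refine ⟨slide lam g, ?_, ?_, fun _ _ => rfl⟩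
    · exact ContinuousOn.div (by fun_prop) (by fun_prop) fun x hx => (hneg x hx.2).ne
    · intro x hx
      rcases eq_or_lt_of_le hx.2 with h1 | h1
      · refine div_neg_of_pos_of_neg ?_ (hneg x hx.2)
        rw [h1, W.at_left]; linarith
      · exact W.slide_neg_of_ge hl ⟨hx.1, h1⟩

/-- For `lam < s` the sliding arc is the solution of the extended field from the fold to `2 lam -
3s`, which takes finite time since that field is bounded away from zero there. For `lam = s` the
slide degenerates to the fold and the cycle consists of two arcs. -/
lemma Well.bigLoop_isCanardCycle (W : Well s g G M c L) (hl : lam ∈ Icc (-s) s) :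
    (potentialField lam g).IsCanardCycle (bigLoop s lam G) := by
  have hs := W.pos
  have hs' := W.small
  have hlt : ∀ w ∈ Ioo (-s) (3 * s), G w < G (3 * s) := fun w hw =>
    W.chord_lt ⟨le_rfl, by linarith⟩ (by linarith) W.level.symm hw
  have tb : (3 * s, (0 : ℝ)) ∈ (potentialField lam g).sewing :=
    mem_sewing.2 (Or.inr ⟨by linarith [hl.2], W.out_right _ (by linarith)⟩)
  rcases eq_or_lt_of_le hl.2 with rfl | hls
  · rw [bigLoop_eq_loop hs]
    exact isCanardCycle_loop W.deriv (by linarith) (by ring) W.level hlt (Or.inr W.visibleFold) tb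
  set z := 2 * lam - 3 * s with hz
  have hzs : z < -s := by linarith
  have hl1 := hl.1
  obtain ⟨f, hfc, hfneg, hfeq⟩ := W.exists_slide_extension hl.1
  have hsub : ∀ x ∈ Icc z (-s), x ∈ Ioc (-1 / 2) (-s) := fun x hx =>
    ⟨by linarith [hx.1], hx.2⟩
  obtain ⟨T, hT, φ, φc, φa, φ0, φT, φd⟩ := exists_decreasing_solution hzs
    (hfc.mono hsub) (fun x hx => hfneg x (hsub x hx))
  set w := 3 * s - z with hw
  have hw0 : 0 < w := by linarith
  set γ₁ : ℝ → ℝ × ℝ := fun τ => (z + (τ - T), (z + (τ - T) - z) * (2 * lam - (z + (τ - T)) - z) / 2)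
    with hγ₁
  set γ₂ : ℝ → ℝ × ℝ := fun τ => (3 * s - (τ - (T + w)), G (3 * s - (τ - (T + w))) - G (3 * s))
    with hγ₂
  set γ : ℝ → ℝ × ℝ := fun τ => if τ ≤ T then (φ τ, 0) else if τ ≤ T + w then γ₁ τ else γ₂ τ with hγ
  set T₃ := T + w + 4 * s with hT₃
  have e0 : EqOn γ (fun τ => (φ τ, 0)) (Icc 0 T) := fun τ hτ => if_pos hτ.2
  have e1 : EqOn γ γ₁ (Icc T (T + w)) := by
    intro τ hτ
    rcases eq_or_lt_of_le hτ.1 with h | h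
    · rw [← h]
      refine (if_pos le_rfl).trans ?_
      simp [hγ₁, φT]
    · exact (if_neg (not_le.2 h)).trans (if_pos hτ.2)
  have e2 : EqOn γ γ₂ (Icc (T + w) T₃) := by
    intro τ hτ
    rcases eq_or_lt_of_le hτ.1 with h | h
    · rw [← h, e1 ⟨by linarith, le_rfl⟩]
      simp only [hγ₁, hγ₂, Prod.mk.injEq, hw, hz]
      constructor
      · ring
      · ring_nf
    · exact (if_neg (by linarith)).trans (if_neg (not_le.2 h))
  have hφmem : ∀ τ ∈ Ioo 0 T, φ τ ∈ Ioo z (-s) := fun τ hτ =>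
    ⟨φT ▸ φa hτ.2, φ0 ▸ φa hτ.1⟩
  have A0 : (potentialField lam g).IsArc .sliding γ 0 T := by
    refine PWS.IsArc.congr (γ := fun τ => (φ τ, 0)) ⟨hT, by fun_prop, fun τ _ => rfl, ?_⟩ e0
    intro τ hτ
    have hm := hφmem τ hτ
    refine ⟨Or.inl (mem_escaping.2 ⟨by linarith [hm.2], W.out_left _ hm.2⟩), ?_⟩
    rw [filippov_eq, ← hfeq _ hm.2]
    exact (φd τ hτ).prodMk (hasDerivAt_const τ (0 : ℝ))
  have A1 : (potentialField lam g).IsArc .upper γ T (T + w) := by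
    refine (isArc_upper (x₀ := z) (by linarith) ?_).congr e1
    intro x hx
    exact mul_nonneg (by linarith [hx.1]) (by linarith [hx.2])
  have A2 : (potentialField lam g).IsArc .lower γ (T + w) T₃ := by
    refine (isArc_lower (x₀ := 3 * s) W.deriv (by linarith) ?_).congr e2
    intro x hx
    rw [W.level]
    exact (W.level_mid ⟨by linarith [hx.1], hx.2⟩).2
  have inj0 : InjOn γ (Icc 0 T) := by
    intro τ hτ σ hσ h
    rw [e0 hτ, e0 hσ] at h
    exact φa.injective (congrArg Prod.fst h)
  have inj1 : InjOn γ (Icc T (T + w)) := by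
    intro τ hτ σ hσ h
    rw [e1 hτ, e1 hσ] at h
    have := congrArg Prod.fst h
    simp only [hγ₁] at this
    linarith
  have inj2 : InjOn γ (Icc (T + w) T₃) := by
    intro τ hτ σ hσ h
    rw [e2 hτ, e2 hσ] at h
    have := congrArg Prod.fst h
    simp only [hγ₂] at this
    linarith
  have v0 : γ 0 = (-s, 0) := by rw [e0 ⟨le_rfl, hT.le⟩]; simp [φ0]
  have v1 : γ T = (z, 0) := by rw [e0 ⟨hT.le, le_rfl⟩]; simp [φT]
  have v2 : γ (T + w) = (3 * s, 0) := by rw [e2 ⟨le_rfl, by linarith⟩]; simp [hγ₂]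
  have v3 : γ T₃ = (-s, 0) := by
    rw [e2 ⟨by linarith, le_rfl⟩]
    have : 3 * s - (T₃ - (T + w)) = -s := by rw [hT₃]; ring
    simp only [hγ₂, this, W.level, sub_self]
  have im0 := (link_of_isArc W.deriv A0 (by rw [v0]) (by rw [v1]) inj0).2
  have im1 := (link_of_isArc W.deriv A1 (by rw [v1]) (by rw [v2]) inj1).2
  have im2 := (link_of_isArc W.deriv A2 (by rw [v2]) (by rw [v3]) inj2).2
  rw [v0, v1] at im0
  rw [v1, v2] at im1
  rw [v2, v3] at im2
  set t : ℕ → ℝ := fun i => if i = 0 then 0 else if i = 1 then T else if i = 2 then T + w else T₃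
    with ht
  have t0 : t 0 = 0 := rfl
  have t1 : t 1 = T := rfl
  have t2 : t 2 = T + w := rfl
  have t3 : t 3 = T₃ := rfl
  refine ⟨⟨3, t, fun i => if i = 0 then .sliding else if i = 1 then .upper else .lower, γ,
    by norm_num, ?_, ?_, ?_, ?_, Or.inr ⟨by norm_num, ?_⟩⟩, ?_⟩
  · intro i hi
    interval_cases i
    exacts [A0, A1, A2]
  · rw [t3, t0, v3, v0]
  · rw [t0, t3]
    -- Injectivity follows from the heights: zero on the slide, positive inside the upper arc,
    -- negative inside the lower arc; the point `3s` lies to the right of the slide.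
    have s0 : ∀ τ ∈ Icc 0 T, (γ τ).2 = 0 := fun τ hτ => by rw [e0 hτ]
    have s1 : ∀ τ ∈ Ioo T (T + w), 0 < (γ τ).2 := by
      intro τ hτ
      rw [e1 (Ioo_subset_Icc_self hτ)]
      refine div_pos (mul_pos ?_ ?_) (by norm_num)
      · linarith [hτ.1]
      · linarith [hτ.2]
    have s2 : ∀ τ ∈ Ioo (T + w) T₃, (γ τ).2 < 0 := by
      intro τ hτ
      rw [e2 (Ioo_subset_Icc_self hτ)]
      exact sub_neg.2 (hlt _ ⟨by linarith [hτ.2], by linarith [hτ.1]⟩)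
    have s3 : ∀ τ ∈ Icc 0 T, γ τ ≠ γ (T + w) := by
      intro τ hτ h
      rw [e0 hτ, v2] at h
      have h1 := congrArg Prod.fst h
      have h2 : φ τ ≤ φ 0 := φa.antitone hτ.1
      simp only at h1
      linarith
    have cases3 : ∀ τ ∈ Ico 0 T₃, τ ∈ Icc 0 T ∨ τ ∈ Ioo T (T + w) ∨ τ = T + w ∨
        τ ∈ Ioo (T + w) T₃ := by
      intro τ hτ
      rcases le_or_gt τ T with h | h
      · exact Or.inl ⟨hτ.1, h⟩
      rcases lt_trichotomy τ (T + w) with h' | h' | h'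
      · exact Or.inr (Or.inl ⟨h, h'⟩)
      · exact Or.inr (Or.inr (Or.inl h'))
      · exact Or.inr (Or.inr (Or.inr ⟨h', hτ.2⟩))
    have zw : (γ (T + w)).2 = 0 := by rw [v2]
    intro τ hτ σ hσ h
    have h2 : (γ τ).2 = (γ σ).2 := by rw [h]
    rcases cases3 τ hτ with a | a | a | a <;> rcases cases3 σ hσ with b | b | b | b
    · exact inj0 a b h
    · linarith [s0 τ a, s1 σ b]
    · rw [b] at h; exact absurd h (s3 τ a)
    · linarith [s0 τ a, s2 σ b]
    · linarith [s1 τ a, s0 σ b]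
    · exact inj1 (Ioo_subset_Icc_self a) (Ioo_subset_Icc_self b) h
    · rw [b] at h2; linarith [s1 τ a]
    · linarith [s1 τ a, s2 σ b]
    · rw [a] at h; exact absurd h.symm (s3 σ b)
    · rw [a] at h2; linarith [s1 σ b]
    · rw [a, b]
    · rw [a] at h2; linarith [s2 σ b]
    · linarith [s2 τ a, s0 σ b]
    · linarith [s2 τ a, s1 σ b]
    · rw [b] at h2; linarith [s2 τ a]
    · exact inj2 (Ioo_subset_Icc_self a) (Ioo_subset_Icc_self b) h
  · rw [t0, t3, bigLoop, ← im0, ← im1, ← im2, ← image_union, ← image_union,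
      Icc_union_Icc_eq_Icc hT.le (by linarith), Icc_union_Icc_eq_Icc (by linarith) (by linarith)]
  · intro i hi
    interval_cases i
    · simp only [zero_add, t1, v1]
      exact Or.inr (Or.inl (mem_escaping.2 ⟨by linarith, W.out_left _ hzs⟩))
    · simp only [Nat.reduceAdd, t2, v2]
      exact Or.inl tb
    · simp only [Nat.reduceAdd, t3, v3]
      exact Or.inl (Or.inl W.visibleFold)
  · rintro - p ⟨hp, hp0⟩ hns
    have hp1 : p.2 = 0 := hp0
    refine ⟨(-s, 0), ?_, W.visibleFold⟩
    -- Every nonsewing point of the cycle on the line lies on the slide, which is connected and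
    -- contains the fold.
    have hpre : IsPreconnected (trace G .sliding (-s) z) :=
      isPreconnected_uIcc.image _ (by fun_prop)
    have hps : p ∈ trace G .sliding (-s) z := by
      rcases hp with (hp | ⟨x, hx, rfl⟩) | ⟨x, hx, rfl⟩
      · exact hp
      · have hp2 : (x, (0 : ℝ)) ∉ (potentialField lam g).sewing := by
          intro h; apply hns; simp only at hp1 ⊢; rw [hp1]; exact h
        simp only at hp1 ⊢
        rw [hp1]
        rcases mul_eq_zero.1 ((div_eq_zero_iff.1 hp1).resolve_right (by norm_num)) with h | h
        · rw [show x = z by linarith]; exact ⟨z, right_mem_uIcc, rfl⟩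
        · rw [show x = 3 * s by linarith] at hp2; exact absurd tb hp2
      · have hp2 : (x, (0 : ℝ)) ∉ (potentialField lam g).sewing := by
          intro h; apply hns; simp only at hp1 ⊢; rw [hp1]; exact h
        simp only at hp1 ⊢
        rw [hp1]
        rcases eq_or_lt_of_le hx.1 with h1 | h1
        · rw [← h1]; exact ⟨-s, left_mem_uIcc, rfl⟩
        rcases eq_or_lt_of_le hx.2 with h2 | h2
        · rw [h2] at hp2; exact absurd tb hp2
        · linarith [hlt x ⟨h1, h2⟩]
    refine hpre.subset_connectedComponentIn hps ?_ ⟨-s, left_mem_uIcc, rfl⟩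
    rintro _ ⟨x, hx, rfl⟩
    exact ⟨Or.inl (Or.inl ⟨x, hx, rfl⟩), rfl⟩

end Existence

/-! ### The interior of a loop, nested loops, convergence of loops -/

section LoopGeometry

variable {lam s c L r : ℝ} {g G M : ℝ → ℝ}

lemma upper_mem_Icc_iff {a b : ℝ} {p : ℝ × ℝ} :
    p ∈ trace G .upper a b ↔ p.1 ∈ Icc a b ∧ p.2 = (p.1 - a) * (b - p.1) / 2 := by
  constructor
  · rintro ⟨w, hw, rfl⟩; exact ⟨hw, rfl⟩
  · rintro ⟨h, e⟩; exact ⟨p.1, h, Prod.ext rfl e.symm⟩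

lemma lower_mem_Icc_iff {a b : ℝ} {p : ℝ × ℝ} :
    p ∈ trace G .lower b a ↔ p.1 ∈ Icc a b ∧ p.2 = G p.1 - G b := by
  constructor
  · rintro ⟨w, hw, rfl⟩; exact ⟨hw, rfl⟩
  · rintro ⟨h, e⟩; exact ⟨p.1, h, Prod.ext rfl e.symm⟩

lemma mem_loop_iff {a b : ℝ} {p : ℝ × ℝ} :
    p ∈ loop G a b ↔ p.1 ∈ Icc a b ∧ (p.2 = (p.1 - a) * (b - p.1) / 2 ∨ p.2 = G p.1 - G b) := by
  rw [loop, mem_union, upper_mem_Icc_iff, lower_mem_Icc_iff, ← and_or_left]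

/-- The domain between the two arcs of a loop. -/
def loopDomain (G : ℝ → ℝ) (a b : ℝ) : Set (ℝ × ℝ) :=
  {p | p.1 ∈ Ioo a b ∧ G p.1 - G b < p.2 ∧ p.2 < (p.1 - a) * (b - p.1) / 2}

lemma isOpen_loopDomain (hG : Continuous G) (a b : ℝ) : IsOpen (loopDomain G a b) := by
  have h1 : IsOpen {p : ℝ × ℝ | p.1 ∈ Ioo a b} := isOpen_Ioo.preimage continuous_fst
  have h2 : IsOpen {p : ℝ × ℝ | G p.1 - G b < p.2} :=
    isOpen_lt (by fun_prop) (by fun_prop)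
  have h3 : IsOpen {p : ℝ × ℝ | p.2 < (p.1 - a) * (b - p.1) / 2} :=
    isOpen_lt (by fun_prop) (by fun_prop)
  exact h1.inter (h2.inter h3)

lemma closure_loopDomain_subset (hG : Continuous G) {a b : ℝ} (e : G a = G b) :
    closure (loopDomain G a b) ⊆ loopDomain G a b ∪ loop G a b := by
  intro p hp
  have hc : IsClosed {p : ℝ × ℝ | p.1 ∈ Icc a b ∧ G p.1 - G b ≤ p.2 ∧
      p.2 ≤ (p.1 - a) * (b - p.1) / 2} := by
    have h2 : IsClosed {p : ℝ × ℝ | G p.1 - G b ≤ p.2} := isClosed_le (by fun_prop) (by fun_prop)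
    have h3 : IsClosed {p : ℝ × ℝ | p.2 ≤ (p.1 - a) * (b - p.1) / 2} :=
      isClosed_le (by fun_prop) (by fun_prop)
    exact (isClosed_Icc.preimage continuous_fst).inter (h2.inter h3)
  have hsub : loopDomain G a b ⊆ {p : ℝ × ℝ | p.1 ∈ Icc a b ∧ G p.1 - G b ≤ p.2 ∧
      p.2 ≤ (p.1 - a) * (b - p.1) / 2} :=
    fun p hp => ⟨Ioo_subset_Icc_self hp.1, hp.2.1.le, hp.2.2.le⟩
  obtain ⟨h1, h2, h3⟩ := closure_minimal hsub hc hp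
  rcases eq_or_lt_of_le h2 with h2 | h2
  · exact Or.inr (mem_loop_iff.2 ⟨h1, Or.inr h2.symm⟩)
  rcases eq_or_lt_of_le h3 with h3 | h3
  · exact Or.inr (mem_loop_iff.2 ⟨h1, Or.inl h3⟩)
  refine Or.inl ⟨⟨lt_of_le_of_ne h1.1 fun h => ?_, lt_of_le_of_ne h1.2 fun h => ?_⟩, h2, h3⟩
  · rw [← h] at h2 h3; rw [e] at h2; linarith
  · rw [h] at h2 h3; linarith

lemma bounded_of_abs_lt {A : Set (ℝ × ℝ)} {C : ℝ} (h : ∀ p ∈ A, |p.1| ≤ C ∧ |p.2| ≤ C) :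
    Bornology.IsBounded A := by
  refine isBounded_iff_forall_norm_le.2 ⟨C, fun p hp => ?_⟩
  rw [Prod.norm_def]
  exact max_le (h p hp).1 (h p hp).2

lemma bounded_loopDomain (hG : Continuous G) (a b : ℝ) :
    Bornology.IsBounded (loopDomain G a b) := by
  obtain ⟨m, hm⟩ := (isCompact_Icc (a := a) (b := b)).bddBelow_image hG.continuousOn
  have hm' : ∀ x ∈ Icc a b, m ≤ G x := fun x hx => hm ⟨x, hx, rfl⟩
  refine bounded_of_abs_lt (C := |a| + |b| + |m - G b| + (b - a) ^ 2) ?_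
  rintro p ⟨h1, h2, h3⟩
  have h4 := hm' _ (Ioo_subset_Icc_self h1)
  have := abs_nonneg (m - G b)
  have := neg_abs_le (m - G b)
  have := neg_abs_le a
  have := le_abs_self b
  have := abs_nonneg a
  have := abs_nonneg b
  have h5 := h1.1
  have h6 := h1.2
  have : (p.1 - a) * (b - p.1) / 2 ≤ (b - a) ^ 2 := by nlinarith
  have := sq_nonneg (b - a)
  constructor <;> rw [abs_le] <;> constructor <;> linarith

lemma not_bounded_of_ray {A : Set (ℝ × ℝ)} {p : ℝ × ℝ} {σ : ℝ} (hσ : σ ≠ 0)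
    (h : ∀ t ≥ 0, (p.1, p.2 + t * σ) ∈ A) : ¬ Bornology.IsBounded A := by
  intro hb
  obtain ⟨C, hC⟩ := isBounded_iff_forall_norm_le.1 hb
  have h1 := hC _ (h ((C + |p.2| + 1) / |σ|) (by
    have := (norm_nonneg _).trans (hC _ (h 0 le_rfl)); positivity))
  have h2 : |p.2 + (C + |p.2| + 1) / |σ| * σ| ≤ C := (norm_snd_le _).trans h1
  have h3 : |(C + |p.2| + 1) / |σ| * σ| = C + |p.2| + 1 := by
    have := (norm_nonneg _).trans (hC _ (h 0 le_rfl))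
    rw [abs_mul, abs_div, abs_abs, div_mul_cancel₀ _ (abs_ne_zero.2 hσ),
      abs_of_nonneg (by positivity)]
  have h4 := abs_sub_abs_le_abs_sub ((C + |p.2| + 1) / |σ| * σ) (-p.2)
  rw [abs_neg, sub_neg_eq_add, add_comm _ p.2, h3] at h4
  linarith

/-- A vertical ray that avoids the curve lies in the component of its initial point, which is
therefore unbounded. -/
lemma outside_of_ray {Γ : Set (ℝ × ℝ)} {p : ℝ × ℝ} {σ : ℝ} (hσ : σ ≠ 0)
    (h : ∀ t ≥ 0, (p.1, p.2 + t * σ) ∉ Γ) :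
    ¬ Bornology.IsBounded (connectedComponentIn Γᶜ p) := by
  refine not_bounded_of_ray hσ (p := p) fun t ht => ?_
  have hpre : IsPreconnected ((fun t : ℝ => (p.1, p.2 + t * σ)) '' Ici 0) :=
    isPreconnected_Ici.image _ (by fun_prop)
  refine hpre.subset_connectedComponentIn ⟨0, le_refl (0 : ℝ), by simp⟩ ?_ ⟨t, ht, rfl⟩
  rintro _ ⟨t, ht, rfl⟩
  exact h t ht

lemma disjoint_loopDomain {a b : ℝ} {p : ℝ × ℝ} (h : p ∈ loopDomain G a b) : p ∉ loop G a b := by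
  rw [mem_loop_iff]
  rintro ⟨-, h' | h'⟩
  · exact h.2.2.ne h'
  · exact h.2.1.ne' h'

/-- Points off the domain and the curve escape along a vertical ray. Conversely, the domain is
bounded and open and its closure adds only points of the curve, so no component of the complement
can leave it. No Jordan curve theorem is needed. -/
lemma insideOf_loop (hG : Continuous G) {a b : ℝ} (e : G a = G b)
    (hle : ∀ w ∈ Icc a b, G w ≤ G b) : insideOf (loop G a b) = loopDomain G a b := by
  ext p
  constructor
  · rintro ⟨h1, h2⟩
    by_contra hp
    by_cases hx : p.1 ∈ Icc a b
    · have hu : 0 ≤ (p.1 - a) * (b - p.1) / 2 := by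
        have := sub_nonneg.2 hx.1
        have := sub_nonneg.2 hx.2
        positivity
      have hl := hle _ hx
      rcases lt_or_ge ((p.1 - a) * (b - p.1) / 2) p.2 with h3 | h3
      · refine outside_of_ray one_ne_zero (fun t ht h => ?_) h2
        rw [mem_loop_iff] at h
        simp only at h
        rcases h.2 with h | h <;> linarith
      rcases lt_or_ge p.2 (G p.1 - G b) with h4 | h4
      · refine outside_of_ray (neg_ne_zero.2 one_ne_zero) (fun t ht h => ?_) h2
        rw [mem_loop_iff] at h
        simp only at h
        rcases h.2 with h | h <;> linarith
      rw [mem_loop_iff] at h1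
      push Not at h1
      have h5 := h1 hx
      apply hp
      have h6 := lt_of_le_of_ne h3 h5.1
      have h7 := lt_of_le_of_ne h4 h5.2.symm
      refine ⟨⟨lt_of_le_of_ne hx.1 fun h => ?_, lt_of_le_of_ne hx.2 fun h => ?_⟩, h7, h6⟩
      · rw [← h] at h6 h7; rw [e] at h7; linarith
      · rw [h] at h6 h7; linarith
    · refine outside_of_ray one_ne_zero (fun t ht h => ?_) h2
      exact hx (mem_loop_iff.1 h).1
  · intro hp
    refine ⟨disjoint_loopDomain hp, (bounded_loopDomain hG a b).subset ?_⟩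
    have hpre : IsPreconnected (connectedComponentIn (loop G a b)ᶜ p) :=
      isPreconnected_connectedComponentIn
    have hsub := connectedComponentIn_subset (loop G a b)ᶜ p
    refine hpre.subset_left_of_subset_union (isOpen_loopDomain hG a b)
      (isClosed_closure (s := loopDomain G a b)).isOpen_compl
      (disjoint_left.2 fun q hq hq' => hq' (subset_closure hq)) ?_
      ⟨p, mem_connectedComponentIn (disjoint_loopDomain hp), hp⟩
    intro q hq
    by_cases h : q ∈ closure (loopDomain G a b)
    · exact Or.inl ((closure_loopDomain_subset hG e h).resolve_right (hsub hq))
    · exact Or.inr h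

/-- Nested ends give nested parabolas, and the higher level at the outer end puts the outer lower
arc below the inner one. -/
lemma loop_subset_loopDomain {a b a' b' : ℝ} (ha : a' < a) (hb : b < b')
    (hlt : ∀ w ∈ Ioo a' b', G w < G b') (e : G b < G b') (hle : ∀ w ∈ Icc a b, G w ≤ G b) :
    loop G a b ⊆ loopDomain G a' b' := by
  intro p hp
  obtain ⟨⟨h1, h2⟩, h⟩ := mem_loop_iff.1 hp
  have h3 := hlt p.1 ⟨by linarith, by linarith⟩
  have h4 := hle p.1 ⟨h1, h2⟩
  have h5 : 0 ≤ (p.1 - a) * (b - p.1) := mul_nonneg (by linarith) (by linarith)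
  have h6 : (p.1 - a) * (b - p.1) < (p.1 - a') * (b' - p.1) := by nlinarith
  refine ⟨⟨by linarith, by linarith⟩, ?_⟩
  rcases h with h | h <;> rw [h] <;> constructor <;> linarith

lemma loop_self (b : ℝ) : loop G b b = {(b, 0)} := by
  simp [loop, trace]

/-- The two parametrizations of the sides of a loop. -/
lemma loop_eq_image {a b : ℝ} (hab : a ≤ b) : loop G a b =
    (fun τ : ℝ => (a + τ * (b - a), τ * (b - a) * ((1 - τ) * (b - a)) / 2)) '' Icc 0 1 ∪
    (fun τ : ℝ => (a + τ * (b - a), G (a + τ * (b - a)) - G b)) '' Icc 0 1 := by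
  have key : (fun τ : ℝ => a + τ * (b - a)) '' Icc 0 1 = Icc a b := by
    rw [← segment_eq_Icc hab, segment_eq_image']
    simp only [smul_eq_mul]
  simp only [loop, trace]
  rw [← key, image_image, image_image]
  congr 1
  refine image_congr fun τ _ => Prod.ext rfl ?_
  simp only
  ring

/-- Both sides are parametrized over `[0, 1]` jointly continuously in the ends and the parameter,
hence uniformly by compactness. The limit may be a single point. -/
lemma tendsto_hausdorff_loop (hG : Continuous G) {ι : Type*} {l : Filter ι} {a b : ι → ℝ}
    {a₀ b₀ : ℝ} (ha : Tendsto a l (𝓝 a₀)) (hb : Tendsto b l (𝓝 b₀)) (h₀ : a₀ ≤ b₀)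
    (hab : ∀ᶠ i in l, a i ≤ b i) :
    Tendsto (fun i => Metric.hausdorffEDist (loop G (a i) (b i)) (loop G a₀ b₀)) l (𝓝 0) := by
  set U : ℝ × ℝ → ℝ → ℝ × ℝ := fun q τ =>
    (q.1 + τ * (q.2 - q.1), τ * (q.2 - q.1) * ((1 - τ) * (q.2 - q.1)) / 2) with hU
  set V : ℝ × ℝ → ℝ → ℝ × ℝ := fun q τ =>
    (q.1 + τ * (q.2 - q.1), G (q.1 + τ * (q.2 - q.1)) - G q.2) with hV
  have hlim : Tendsto (fun i => (a i, b i)) l (𝓝 (a₀, b₀)) := ha.prodMk_nhds hb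
  have unif : ∀ F : ℝ × ℝ → ℝ → ℝ × ℝ, Continuous F.uncurry → ∀ ε > 0, ∀ᶠ i in l,
      ∀ τ ∈ Icc (0 : ℝ) 1, edist (F (a i, b i) τ) (F (a₀, b₀) τ) ≤ ε := by
    intro F hF ε hε
    obtain ⟨v, hv, h⟩ := (isCompact_Icc (a := (0 : ℝ)) (b := 1)).mem_uniformity_of_prod
      (s := univ) (f := F) (q := (a₀, b₀)) hF.continuousOn (mem_univ _)
      (edist_mem_uniformity hε)
    rw [nhdsWithin_univ] at hv
    filter_upwards [hlim hv] with i hi τ hτ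
    exact (h _ hi τ hτ).le
  rw [ENNReal.tendsto_nhds_zero]
  intro ε hε
  filter_upwards [unif U (by rw [hU]; simp only [Function.uncurry_def]; fun_prop) ε hε,
    unif V (by rw [hV]; simp only [Function.uncurry_def]; fun_prop) ε hε, hab] with i h1 h2 h3
  rw [loop_eq_image h3, loop_eq_image h₀]
  refine Metric.hausdorffEDist_le_of_mem_edist ?_ ?_
  · rintro _ (⟨τ, hτ, rfl⟩ | ⟨τ, hτ, rfl⟩)
    · exact ⟨_, Or.inl ⟨τ, hτ, rfl⟩, h1 τ hτ⟩
    · exact ⟨_, Or.inr ⟨τ, hτ, rfl⟩, h2 τ hτ⟩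
  · rintro _ (⟨τ, hτ, rfl⟩ | ⟨τ, hτ, rfl⟩)
    · exact ⟨_, Or.inl ⟨τ, hτ, rfl⟩, by rw [edist_comm]; exact h1 τ hτ⟩
    · exact ⟨_, Or.inr ⟨τ, hτ, rfl⟩, by rw [edist_comm]; exact h2 τ hτ⟩

/-- The inverse of an increasing continuous function on a compact interval. -/
lemma exists_increasing_inverse {M : ℝ → ℝ} {a b : ℝ} (hab : a < b)
    (hm : StrictMonoOn M (Icc a b)) (hc : ContinuousOn M (Icc a b)) :
    ∃ u : ℝ → ℝ, (∀ y ∈ Ioo (M a) (M b), u y ∈ Ioo a b ∧ M (u y) = y) ∧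
      Tendsto u (𝓝[>] M a) (𝓝 a) ∧ Tendsto u (𝓝[<] M b) (𝓝 b) := by
  have hex : ∀ y, ∃ x, y ∈ Ioo (M a) (M b) → x ∈ Ioo a b ∧ M x = y := by
    intro y
    by_cases hy : y ∈ Ioo (M a) (M b)
    · obtain ⟨x, hx, rfl⟩ := intermediate_value_Ioo hab.le hc hy
      exact ⟨x, fun _ => ⟨hx, rfl⟩⟩
    · exact ⟨0, fun h => absurd h hy⟩
  choose u hu using hex
  have hMab := hm (left_mem_Icc.2 hab.le) (right_mem_Icc.2 hab.le) hab
  refine ⟨u, hu, ?_, ?_⟩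
  · rw [tendsto_order]
    constructor
    · intro z hz
      filter_upwards [Ioo_mem_nhdsGT hMab] with y hy
      exact hz.trans (hu y hy).1.1
    · intro z hz
      have hmem : min z b ∈ Icc a b := ⟨le_min hz.le hab.le, min_le_right _ _⟩
      have h1 : M a < M (min z b) := hm (left_mem_Icc.2 hab.le) hmem (lt_min hz hab)
      filter_upwards [Ioo_mem_nhdsGT hMab, Ioo_mem_nhdsGT h1] with y hy hy'
      obtain ⟨h2, h3⟩ := hu y hy
      refine lt_of_lt_of_le ((hm.lt_iff_lt (Ioo_subset_Icc_self h2) hmem).1 ?_) (min_le_left _ _)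
      rw [h3]
      exact hy'.2
  · rw [tendsto_order]
    constructor
    · intro z hz
      have hmem : max z a ∈ Icc a b := ⟨le_max_right _ _, max_le hz.le hab.le⟩
      have h1 : M (max z a) < M b := hm hmem (right_mem_Icc.2 hab.le) (max_lt hz hab)
      filter_upwards [Ioo_mem_nhdsLT hMab, Ioo_mem_nhdsLT h1] with y hy hy'
      obtain ⟨h2, h3⟩ := hu y hy
      refine lt_of_le_of_lt (le_max_left z a) ((hm.lt_iff_lt hmem (Ioo_subset_Icc_self h2)).1 ?_)
      rw [h3]
      exact hy'.1
    · intro z hz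
      filter_upwards [Ioo_mem_nhdsLT hMab] with y hy
      exact (hu y hy).1.2.trans hz

/-- The inverse of a decreasing continuous function on a compact interval. -/
lemma exists_decreasing_inverse {M : ℝ → ℝ} {a b : ℝ} (hab : a < b)
    (hm : StrictAntiOn M (Icc a b)) (hc : ContinuousOn M (Icc a b)) :
    ∃ u : ℝ → ℝ, (∀ y ∈ Ioo (M b) (M a), u y ∈ Ioo a b ∧ M (u y) = y) ∧
      Tendsto u (𝓝[>] M b) (𝓝 b) ∧ Tendsto u (𝓝[<] M a) (𝓝 a) := by
  have hmem : ∀ x ∈ Icc (-b) (-a), -x ∈ Icc a b := fun x hx =>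
    ⟨by linarith [hx.2], by linarith [hx.1]⟩
  obtain ⟨u, h1, h2, h3⟩ := exists_increasing_inverse (M := fun x => M (-x)) (neg_lt_neg hab)
    (fun x hx y hy h => hm (hmem y hy) (hmem x hx) (neg_lt_neg h))
    (hc.comp continuousOn_neg hmem)
  simp only [neg_neg] at h1 h2 h3
  refine ⟨fun y => -u y, fun y hy => ⟨?_, (h1 y hy).2⟩, ?_, ?_⟩
  · have := (h1 y hy).1
    exact ⟨by linarith [this.2], by linarith [this.1]⟩
  · simpa using h2.neg
  · simpa using h3.neg

end LoopGeometry

/-! ### Following trajectories -/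

/-- `γ` is a concatenation of arcs on `[a, b]`: some arc starts at each time. -/
def PWS.Runs (Z : PWS) (γ : ℝ → ℝ × ℝ) (a b : ℝ) : Prop :=
  ContinuousOn γ (Icc a b) ∧ ∀ t ∈ Ico a b, ∃ k, ∃ t' > t, Z.IsArc k γ t t'

lemma PWS.runs_of_arcs {Z : PWS} {t : ℕ → ℝ} {k : ℕ → ArcKind} {γ : ℝ → ℝ × ℝ} {n : ℕ}
    (h : ∀ i < n, Z.IsArc (k i) γ (t i) (t (i + 1))) : Z.Runs γ (t 0) (t n) := by
  induction n with
  | zero => exact ⟨by simp, by simp⟩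
  | succ n ih =>
    obtain ⟨h1, h2⟩ := ih fun i hi => h i (by omega)
    have h3 := h n (by omega)
    have h4 : t 0 ≤ t n := by
      rcases Nat.eq_zero_or_pos n with rfl | hn
      · exact le_rfl
      · exact (lt_of_step_lt (fun i hi => (h i (by omega)).1) hn le_rfl).le
    constructor
    · rw [← Icc_union_Icc_eq_Icc h4 h3.1.le]
      exact h1.union_of_isClosed h3.2.1 isClosed_Icc isClosed_Icc
    · intro τ hτ
      rcases lt_or_ge τ (t n) with h5 | h5
      · exact h2 τ ⟨hτ.1, h5⟩
      · exact ⟨k n, t (n + 1), hτ.2, h3.mono h5 hτ.2 le_rfl⟩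

lemma PWS.Runs.mono {Z : PWS} {γ : ℝ → ℝ × ℝ} {a b a' b' : ℝ} (h : Z.Runs γ a b) (ha : a ≤ a')
    (hb : b' ≤ b) : Z.Runs γ a' b' :=
  ⟨h.1.mono (Icc_subset_Icc ha hb), fun t ht => h.2 t ⟨ha.trans ht.1, ht.2.trans_le hb⟩⟩

lemma PWS.IsTrajectory.runs {Z : PWS} {γ : ℝ → ℝ × ℝ} (h : Z.IsTrajectory γ) {a : ℝ} (ha : 0 ≤ a)
    (b : ℝ) : Z.Runs γ a b := by
  obtain ⟨t, k, h0, h1, h2⟩ := h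
  obtain ⟨n, hn⟩ := (h1.eventually_ge_atTop b).exists
  exact (PWS.runs_of_arcs (n := n) fun i _ => h2 i).mono (h0 ▸ ha) hn

/-- The set of agreement is closed and extends to the right of each of its points. This replaces
uniqueness of solutions: it suffices to know at each time which kind of arc can start there. -/
lemma eqOn_of_step {γ δ : ℝ → ℝ × ℝ} {a b : ℝ} (hγ : ContinuousOn γ (Icc a b))
    (hδ : ContinuousOn δ (Icc a b)) (h0 : γ a = δ a)
    (step : ∀ t ∈ Ico a b, γ t = δ t → ∃ t' > t, ∀ σ ∈ Icc t t', γ σ = δ σ) :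
    EqOn γ δ (Icc a b) := by
  have hcl : IsClosed ({t | γ t = δ t} ∩ Icc a b) := by
    have : {t | γ t = δ t} ∩ Icc a b = Icc a b ∩ (fun t => γ t - δ t) ⁻¹' {0} := by
      ext t
      simp [sub_eq_zero, and_comm]
    rw [this]
    exact (hγ.sub hδ).preimage_isClosed_of_isClosed isClosed_Icc isClosed_singleton
  refine hcl.Icc_subset_of_forall_exists_gt h0 ?_
  rintro t ⟨ht, ht'⟩ y hy
  obtain ⟨t', h1, h2⟩ := step t ht' ht
  have h3 : t < min t' y := lt_min h1 hy
  exact ⟨min t' y, h2 _ ⟨h3.le, min_le_left _ _⟩, h3, min_le_right _ _⟩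

section Follow

variable {lam : ℝ} {g G : ℝ → ℝ} {γ : ℝ → ℝ × ℝ} {a b : ℝ}

lemma nonneg_of_le_left {x d : ℝ} (hd : HasDerivAt G d x) {ε : ℝ} (hε : 0 < ε)
    (h : ∀ w ∈ Ioo (x - ε) x, G w ≤ G x) : 0 ≤ d := by
  have h1 : HasDerivAt (fun τ => -G (x - τ)) d 0 := by
    have h2 : HasDerivAt (fun τ : ℝ => x - τ) (-1) 0 := (hasDerivAt_id 0).const_sub x
    have h3 : HasDerivAt G d (x - 0) := by rwa [sub_zero]
    exact ((h3.comp 0 h2).neg).congr_deriv (by ring)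
  refine hasDerivAt_nonneg_of_le h1 ?_
  filter_upwards [Ioo_mem_nhdsGT hε] with τ hτ
  have := h (x - τ) ⟨by linarith [hτ.2], by linarith [hτ.1]⟩
  simp only [sub_zero]
  linarith

/-- The parabola from a point at or to the right of its vertex goes below the line at once. -/
lemma not_upper_of_le {x : ℝ} (hx : lam ≤ x) (ha : γ a = (x, 0)) :
    ¬ (potentialField lam g).IsArc .upper γ a b := by
  intro h
  obtain ⟨h1, h2⟩ := upper_arc h (right_mem_Icc.2 h.1.le)
  have h3 := h.2.2.1 b (right_mem_Icc.2 h.1.le)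
  have h4 := h.1
  rw [ha] at h1 h2
  simp only at h1 h2
  rw [h2, h1] at h3
  nlinarith [mul_pos (sub_pos.2 h4) (sub_pos.2 h4),
    mul_nonneg (sub_nonneg.2 h4.le) (sub_nonneg.2 hx)]

/-- The lower orbit runs left, where a negative derivative makes the potential larger, so it would
leave the lower half plane. -/
lemma not_lower_of_neg (hG : ∀ x, HasDerivAt G (g x) x) {x : ℝ} (hx : g x < 0)
    (ha : γ a = (x, 0)) : ¬ (potentialField lam g).IsArc .lower γ a b := by
  intro h
  have h0 := h.1
  refine absurd (nonneg_of_le_left (hG x) (sub_pos.2 h.1) fun w hw => ?_) (not_le.2 hx)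
  have hτ : a + (x - w) ∈ Icc a b := ⟨by linarith [hw.2], by linarith [hw.1]⟩
  obtain ⟨h1, h2⟩ := lower_arc hG h hτ
  have h3 := h.2.2.1 _ hτ
  rw [ha] at h1 h2
  simp only at h1 h2
  rw [show x - (a + (x - w) - a) = w by ring] at h1
  rw [h1] at h2
  linarith

lemma not_sliding_of_eventually {x : ℝ}
    (hx : ∀ᶠ w in 𝓝 x, (w, (0 : ℝ)) ∉ (potentialField lam g).escaping ∪
      (potentialField lam g).slidingRegion) (ha : γ a = (x, 0)) :
    ¬ (potentialField lam g).IsArc .sliding γ a b := by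
  rintro ⟨hab, hc, hs, hd⟩
  have hlim : Tendsto (fun τ => (γ τ).1) (𝓝[>] a) (𝓝 x) := by
    have h1 : ContinuousWithinAt γ (Icc a b) a := hc a (left_mem_Icc.2 hab.le)
    have h2 := (continuous_fst.continuousAt.comp_continuousWithinAt h1).tendsto
    simp only [Function.comp_apply, ha] at h2
    refine h2.mono_left ?_
    rw [← nhdsWithin_Ioo_eq_nhdsGT hab]
    exact nhdsWithin_mono _ Ioo_subset_Icc_self
  obtain ⟨τ, h1, h2⟩ := ((hlim.eventually hx).and (Ioo_mem_nhdsGT hab)).exists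
  have h4 : γ τ = ((γ τ).1, 0) := Prod.ext rfl (hs τ (Ioo_subset_Icc_self h2))
  exact h1 (h4 ▸ (hd τ h2).1)

lemma not_sliding_of_sewing (hg : Continuous g) {x : ℝ}
    (hx : (x < lam ∧ g x < 0) ∨ (lam < x ∧ 0 < g x)) (ha : γ a = (x, 0)) :
    ¬ (potentialField lam g).IsArc .sliding γ a b := by
  refine not_sliding_of_eventually ?_ ha
  simp only [mem_regions]
  rcases hx with h | h
  · filter_upwards [Iio_mem_nhds h.1, hg.continuousAt.eventually (Iio_mem_nhds h.2)] with w h1 h2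
    have h1 : w < lam := h1
    have h2 : g w < 0 := h2
    rintro (h3 | h3) <;> linarith [h3.1, h3.2]
  · filter_upwards [Ioi_mem_nhds h.1, hg.continuousAt.eventually (Ioi_mem_nhds h.2)] with w h1 h2
    have h1 : lam < w := h1
    have h2 : 0 < g w := h2
    rintro (h3 | h3) <;> linarith [h3.1, h3.2]

/-- Together with `arc_eq_lower` and `arc_eq_sliding` this gives forward determinism off the
escaping region and the contact points, which makes the continuation of a trajectory explicit. -/
lemma arc_eq_upper (hG : ∀ x, HasDerivAt G (g x) x) (hg : Continuous g) {k : ArcKind} {x y : ℝ}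
    (ha : γ a = (x, y)) (h : 0 < y ∨ (y = 0 ∧ x < lam ∧ g x < 0))
    (hk : (potentialField lam g).IsArc k γ a b) : k = .upper := by
  have h0 := left_mem_Icc.2 hk.1.le
  cases k with
  | upper => rfl
  | lower =>
    exfalso
    rcases h with h | ⟨rfl, h1, h2⟩
    · have := hk.2.2.1 a h0; rw [ha] at this; simp only at this; linarith
    · exact not_lower_of_neg hG h2 ha hk
  | sliding =>
    exfalso
    rcases h with h | ⟨rfl, h1, h2⟩
    · have : (γ a).2 = 0 := hk.2.2.1 a h0
      rw [ha] at this; simp only at this; linarith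
    · exact not_sliding_of_sewing hg (Or.inl ⟨h1, h2⟩) ha hk

lemma arc_eq_lower (hg : Continuous g) {k : ArcKind} {x y : ℝ}
    (ha : γ a = (x, y)) (h : y < 0 ∨ (y = 0 ∧ lam < x ∧ 0 < g x))
    (hk : (potentialField lam g).IsArc k γ a b) : k = .lower := by
  have h0 := left_mem_Icc.2 hk.1.le
  cases k with
  | lower => rfl
  | upper =>
    exfalso
    rcases h with h | ⟨rfl, h1, h2⟩
    · have := hk.2.2.1 a h0; rw [ha] at this; simp only at this; linarith
    · exact not_upper_of_le h1.le ha hk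
  | sliding =>
    exfalso
    rcases h with h | ⟨rfl, h1, h2⟩
    · have : (γ a).2 = 0 := hk.2.2.1 a h0
      rw [ha] at this; simp only at this; linarith
    · exact not_sliding_of_sewing hg (Or.inr ⟨h1, h2⟩) ha hk

lemma arc_eq_sliding (hG : ∀ x, HasDerivAt G (g x) x) {k : ArcKind} {x : ℝ}
    (ha : γ a = (x, 0)) (h1 : lam < x) (h2 : g x < 0)
    (hk : (potentialField lam g).IsArc k γ a b) : k = .sliding := by
  cases k with
  | sliding => rfl
  | upper => exact absurd hk (not_upper_of_le h1.le ha)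
  | lower => exact absurd hk (not_lower_of_neg hG h2 ha)

/-- The part of an orbit of the upper field over `[x, z]`. -/
lemma follow_upper (hG : ∀ x, HasDerivAt G (g x) x) (hg : Continuous g) {x y z : ℝ}
    (hr : (potentialField lam g).Runs γ a (a + (z - x))) (ha : γ a = (x, y))
    (h : 0 < y ∨ (y = 0 ∧ x < lam ∧ g x < 0))
    (hpos : ∀ w ∈ Ioo x z, 0 < y + (w - x) * (2 * lam - w - x) / 2) :
    ∀ w ∈ Icc x z, γ (a + (w - x)) = (w, y + (w - x) * (2 * lam - w - x) / 2) := by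
  have key := eqOn_of_step (γ := γ) (a := a) (b := a + (z - x))
    (δ := fun τ => (x + (τ - a), y + (x + (τ - a) - x) * (2 * lam - (x + (τ - a)) - x) / 2))
    hr.1 (by fun_prop) (by rw [ha]; simp) ?_
  · intro w hw
    rw [key ⟨by linarith [hw.1], by linarith [hw.2]⟩]
    simp only [Prod.mk.injEq]
    constructor <;> ring_nf
  · intro t ht e
    obtain ⟨k, t', htt', hk⟩ := hr.2 t ht
    have hk' : k = .upper := by
      refine arc_eq_upper hG hg e ?_ hk
      rcases eq_or_lt_of_le ht.1 with h' | h'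
      · subst h'
        simpa using h
      · exact Or.inl (hpos _ ⟨by linarith, by linarith [ht.2]⟩)
    subst hk'
    refine ⟨t', htt', fun σ hσ => ?_⟩
    obtain ⟨h1, h2⟩ := upper_arc hk hσ
    rw [e] at h1 h2
    simp only at h1 h2
    refine Prod.ext ?_ ?_
    · rw [h1]; ring
    · rw [h2, h1]; ring

/-- The part of an orbit of the lower field over `[z, x]`. -/
lemma follow_lower (hG : ∀ x, HasDerivAt G (g x) x) (hg : Continuous g) {x y z : ℝ}
    (hr : (potentialField lam g).Runs γ a (a + (x - z))) (ha : γ a = (x, y))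
    (h : ∀ k, ∀ t' > a, (potentialField lam g).IsArc k γ a t' → k = .lower)
    (hneg : ∀ w ∈ Ioo z x, y + (G w - G x) < 0) :
    ∀ w ∈ Icc z x, γ (a + (x - w)) = (w, y + (G w - G x)) := by
  have Gc : Continuous G := continuous_iff_continuousAt.2 fun x => (hG x).continuousAt
  have key := eqOn_of_step (γ := γ) (a := a) (b := a + (x - z))
    (δ := fun τ => (x - (τ - a), y + (G (x - (τ - a)) - G x)))
    hr.1 (by fun_prop) (by rw [ha]; simp) ?_
  · intro w hw
    rw [key ⟨by linarith [hw.2], by linarith [hw.1]⟩]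
    simp only [add_sub_cancel_left, sub_sub_cancel]
  · intro t ht e
    obtain ⟨k, t', htt', hk⟩ := hr.2 t ht
    have hk' : k = .lower := by
      rcases eq_or_lt_of_le ht.1 with h' | h'
      · subst h'
        exact h k t' htt' hk
      · exact arc_eq_lower hg e (Or.inl (hneg _ ⟨by linarith [ht.2], by linarith⟩)) hk
    subst hk'
    refine ⟨t', htt', fun σ hσ => ?_⟩
    obtain ⟨h1, h2⟩ := lower_arc hG hk hσ
    rw [e] at h1 h2
    simp only at h1 h2
    have h3 : (γ σ).1 = x - (σ - a) := by rw [h1]; ring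
    refine Prod.ext h3 ?_
    rw [h2, h3]; ring

/-- An orbit of the upper field that starts at a sewing point. -/
lemma follow_up (hG : ∀ x, HasDerivAt G (g x) x) (hg : Continuous g) {x : ℝ}
    (hx : x < lam) (hgx : g x < 0) (hr : (potentialField lam g).Runs γ a (a + 2 * (lam - x)))
    (ha : γ a = (x, 0)) :
    γ (a + 2 * (lam - x)) = (2 * lam - x, 0) ∧
      ∀ τ ∈ Icc a (a + 2 * (lam - x)), γ τ ∈ trace G .upper x (2 * lam - x) := by
  have key := follow_upper hG hg (z := 2 * lam - x) (y := 0)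
    (by rwa [show a + (2 * lam - x - x) = a + 2 * (lam - x) by ring]) ha
    (Or.inr ⟨rfl, hx, hgx⟩) (fun w hw => by
      have := mul_pos (sub_pos.2 hw.1) (sub_pos.2 hw.2)
      rw [show 2 * lam - w - x = 2 * lam - x - w by ring]
      linarith)
  constructor
  · have := key (2 * lam - x) ⟨by linarith, le_rfl⟩
    rw [show a + (2 * lam - x - x) = a + 2 * (lam - x) by ring] at this
    rw [this]
    simp
  · intro τ hτ
    have := key (x + (τ - a)) ⟨by linarith [hτ.1], by linarith [hτ.2]⟩
    rw [show a + (x + (τ - a) - x) = τ by ring] at this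
    rw [this, upper_mem_Icc_iff]
    refine ⟨⟨by simp only; linarith [hτ.1], by simp only; linarith [hτ.2]⟩, by simp only; ring⟩

/-- An orbit of the lower field that starts on the switching manifold. -/
lemma follow_down (hG : ∀ x, HasDerivAt G (g x) x) (hg : Continuous g) {x z : ℝ} (hzx : z < x)
    (h : ∀ k, ∀ t' > a, (potentialField lam g).IsArc k γ a t' → k = .lower)
    (hr : (potentialField lam g).Runs γ a (a + (x - z)))
    (ha : γ a = (x, 0)) (e : G z = G x) (hlt : ∀ w ∈ Ioo z x, G w < G x) :
    γ (a + (x - z)) = (z, 0) ∧ ∀ τ ∈ Icc a (a + (x - z)), γ τ ∈ trace G .lower x z := by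
  have key := follow_lower hG hg hr ha h (fun w hw => by linarith [hlt w hw])
  constructor
  · rw [key z ⟨le_rfl, hzx.le⟩, e]; simp
  · intro τ hτ
    have := key (x - (τ - a)) ⟨by linarith [hτ.2], by linarith [hτ.1]⟩
    rw [sub_sub_cancel, add_sub_cancel] at this
    rw [this, lower_mem_Icc_iff]
    exact ⟨⟨by simp only; linarith [hτ.2], by simp only; linarith [hτ.1]⟩, by simp only; ring⟩

/-- An orbit that starts above the switching manifold returns to it. -/
lemma reach_of_pos (hG : ∀ x, HasDerivAt G (g x) x) (hg : Continuous g)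
    {x y : ℝ} (hr : ∀ b, (potentialField lam g).Runs γ a b) (ha : γ a = (x, y)) (hy : 0 < y) :
    ∃ t ≥ a, ∃ z > lam, γ t = (z, 0) ∧ (z - lam) ^ 2 = (x - lam) ^ 2 + 2 * y := by
  have hpos : 0 < (x - lam) ^ 2 + 2 * y := by positivity
  -- The first integral of `X` says that the parabola meets the line at distance `ρ` from its axis.
  set ρ := √((x - lam) ^ 2 + 2 * y) with hρ
  have hρ0 : 0 < ρ := Real.sqrt_pos.2 hpos
  have hρ2 : ρ ^ 2 = (x - lam) ^ 2 + 2 * y := Real.sq_sqrt hpos.le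
  have h1 := abs_lt_of_sq_lt_sq (show (x - lam) ^ 2 < ρ ^ 2 by linarith) hρ0.le
  rw [abs_lt] at h1
  have key := follow_upper hG hg (z := lam + ρ) (hr _) ha (Or.inl hy) (fun w hw => by
    have := mul_pos (show 0 < w - lam + ρ by linarith [hw.1]) (show 0 < lam + ρ - w by linarith [hw.2])
    nlinarith) (lam + ρ) ⟨by linarith, le_rfl⟩
  refine ⟨a + (lam + ρ - x), by linarith, lam + ρ, by linarith, ?_, by rw [← hρ2]; ring⟩
  rw [key]
  refine Prod.ext rfl ?_
  simp only
  nlinarith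

end Follow

/-! ### Return maps of the trajectories around a valley of the potential -/

/-- `G` decreases on `[A, m]` and increases on `[m, B]`. -/
structure Valley (g G : ℝ → ℝ) (A m B : ℝ) : Prop where
  lt_left : A < m
  lt_right : m < B
  deriv : ∀ x, HasDerivAt G (g x) x
  cont : Continuous g
  neg : ∀ x ∈ Ioo A m, g x < 0
  pos : ∀ x ∈ Ioo m B, 0 < g x

namespace Valley

variable {lam A m B : ℝ} {g G : ℝ → ℝ} {γ : ℝ → ℝ × ℝ} {T : ℝ}

lemma continuous (V : Valley g G A m B) : Continuous G :=
  continuous_iff_continuousAt.2 fun x => (V.deriv x).continuousAt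

lemma anti (V : Valley g G A m B) : StrictAntiOn G (Icc A m) :=
  strictAntiOn_of_hasDerivWithinAt_neg (convex_Icc _ _) V.continuous.continuousOn
    (fun x _ => (V.deriv x).hasDerivWithinAt)
    (fun x hx => V.neg x (by rwa [interior_Icc] at hx))

lemma mono (V : Valley g G A m B) : StrictMonoOn G (Icc m B) :=
  strictMonoOn_of_hasDerivWithinAt_pos (convex_Icc _ _) V.continuous.continuousOn
    (fun x _ => (V.deriv x).hasDerivWithinAt)
    (fun x hx => V.pos x (by rwa [interior_Icc] at hx))

lemma lt_left_end (V : Valley g G A m B) {u x w : ℝ} (hu : A ≤ u) (hx : x ≤ B)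
    (h : x ≤ m ∨ G x ≤ G u) (hw : w ∈ Ioo u x) : G w < G u := by
  rcases le_or_gt w m with h1 | h1
  · exact V.anti ⟨hu, by linarith [hw.1]⟩ ⟨by linarith [hw.1], h1⟩ hw.1
  · have h2 := V.mono ⟨h1.le, by linarith [hw.2]⟩ ⟨by linarith [hw.2], hx⟩ hw.2
    rcases h with h | h
    · linarith [hw.2]
    · linarith

/-- From a point on the right of the valley to the point of the same level on its left. -/
lemma follow_down (V : Valley g G A m B) {u z : ℝ} (hu : u ∈ Icc A m) (hz : z ∈ Ioc m B)
    (h : ∀ k, ∀ t' > T, (potentialField lam g).IsArc k γ T t' → k = .lower)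
    (e : G u = G z) (hr : (potentialField lam g).Runs γ T (T + (z - u))) (ha : γ T = (z, 0)) :
    γ (T + (z - u)) = (u, 0) ∧ ∀ τ ∈ Icc T (T + (z - u)), γ τ ∈ trace G .lower z u :=
  _root_.follow_down V.deriv V.cont (hu.2.trans_lt hz.1) h hr ha e
    fun _ hw => e ▸ V.lt_left_end hu.1 hz.2 (Or.inr e.ge) hw

lemma arc_lower (V : Valley g G A m B) {z : ℝ} (hz : z ∈ Ioo m B) (hl : lam < z)
    (ha : γ T = (z, 0)) : ∀ k, ∀ t' > T, (potentialField lam g).IsArc k γ T t' → k = .lower :=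
  fun _ _ _ hk => arc_eq_lower V.cont ha (Or.inr ⟨rfl, hl, V.pos z hz⟩) hk

/-- One turn around the valley. -/
lemma follow_turn (V : Valley g G A m B) {u u' : ℝ} (hu : u ∈ Ioo A m)
    (hz : 2 * lam - u ∈ Ioo m B) (hu' : u' ∈ Icc A m) (e : G u' = G (2 * lam - u))
    (hr : (potentialField lam g).Runs γ T (T + 2 * (lam - u) + (2 * lam - u - u')))
    (ha : γ T = (u, 0)) :
    γ (T + 2 * (lam - u) + (2 * lam - u - u')) = (u', 0) ∧
      ∀ τ ∈ Icc T (T + 2 * (lam - u) + (2 * lam - u - u')),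
        γ τ ∈ trace G .upper u (2 * lam - u) ∪ trace G .lower (2 * lam - u) u' := by
  have hl : u < lam := by linarith [hu.2, hz.1]
  have h1 : u' < 2 * lam - u := hu'.2.trans_lt hz.1
  obtain ⟨a1, a2⟩ := follow_up V.deriv V.cont hl (V.neg u hu) (hr.mono le_rfl (by linarith)) ha
  obtain ⟨b1, b2⟩ := V.follow_down hu' ⟨hz.1, hz.2.le⟩
    (V.arc_lower hz (by linarith) a1) e (hr.mono (by linarith) le_rfl) a1
  refine ⟨b1, fun τ hτ => ?_⟩
  rcases le_total τ (T + 2 * (lam - u)) with h | h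
  · exact Or.inl (a2 τ ⟨hτ.1, h⟩)
  · exact Or.inr (b2 τ ⟨h, hτ.2⟩)

/-- A trajectory whose returns to the section converge to `x` converges to the loop through `x`. -/
lemma tendsto_of_returns (V : Valley g G A m B) {u : ℕ → ℝ} {x : ℝ}
    (hu : ∀ n, u n ∈ Ioo A m) (hz : ∀ n, 2 * lam - u n ∈ Ioo m B)
    (e : ∀ n, G (u (n + 1)) = G (2 * lam - u n)) (hlim : Tendsto u atTop (𝓝 x))
    (hr : ∀ b, (potentialField lam g).Runs γ T b) (ha : γ T = (u 0, 0))
    (hne : (∃ κ > 0, ∀ n, κ ≤ 2 * (lam - u n)) ∨ ∀ t ≥ T, γ t ≠ (x, 0)) :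
    Tendsto (fun τ => Metric.infDist (γ τ) (loop G x (2 * lam - x))) atTop (𝓝 0) := by
  set d : ℕ → ℝ := fun n => 2 * (lam - u n) + (2 * lam - u n - u (n + 1)) with hd
  set t : ℕ → ℝ := fun n => T + ∑ i ∈ Finset.range n, d i with ht
  have ht0 : t 0 = T := by simp [ht]
  have hts : ∀ n, t (n + 1) = t n + 2 * (lam - u n) + (2 * lam - u n - u (n + 1)) := by
    intro n
    simp only [ht, Finset.sum_range_succ, hd]
    ring
  have hd1 : ∀ n, 0 < 2 * (lam - u n) := fun n => by linarith [(hu n).2, (hz n).1]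
  have hd2 : ∀ n, 0 < 2 * lam - u n - u (n + 1) := fun n => by
    linarith [(hu (n + 1)).2, (hz n).1]
  have hmono : StrictMono t := strictMono_nat_of_lt_succ fun n => by
    rw [hts]; linarith [hd1 n, hd2 n]
  have htT : ∀ n, T ≤ t n := fun n => ht0 ▸ hmono.monotone (Nat.zero_le n)
  have turn : ∀ n, γ (t n) = (u n, 0) → γ (t (n + 1)) = (u (n + 1), 0) ∧
      ∀ τ ∈ Icc (t n) (t (n + 1)), γ τ ∈ trace G .upper (u n) (2 * lam - u n) ∪
        trace G .lower (2 * lam - u n) (u (n + 1)) := by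
    intro n hn
    rw [hts]
    exact V.follow_turn (hu n) (hz n) (Ioo_subset_Icc_self (hu (n + 1))) (e n)
      ((hr _).mono (htT n) le_rfl) hn
  have node : ∀ n, γ (t n) = (u n, 0) := by
    intro n
    induction n with
    | zero => rw [ht0, ha]
    | succ n ih => exact (turn n ih).1
  -- Infinitely many turns must take infinite time. Either each turn lasts at least `κ`, or the
  -- times of the turns accumulate at a finite time when the trajectory sits at the limit point,
  -- which the second alternative forbids.
  have htop : Tendsto t atTop atTop := by
    rcases hne with ⟨κ, hκ, hκ'⟩ | hne
    · have : ∀ n : ℕ, T + n * κ ≤ t n := by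
        intro n
        induction n with
        | zero => simp [ht0]
        | succ n ih =>
          rw [hts]; push_cast; linarith [hκ' n, hd2 n]
      exact tendsto_atTop_mono this (tendsto_atTop_add_const_left _ _
        (tendsto_natCast_atTop_atTop.atTop_mul_const hκ))
    · rcases tendsto_atTop_of_monotone hmono.monotone with h | ⟨l, hl⟩
      · exact h
      · exfalso
        have hle : ∀ n, t n ≤ l := hmono.monotone.ge_of_tendsto hl
        have hTl : T ≤ l := (htT 0).trans (hle 0)
        have hc : ContinuousWithinAt γ (Icc T l) l := (hr l).1 l ⟨hTl, le_rfl⟩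
        have h1 : Tendsto t atTop (𝓝[Icc T l] l) := tendsto_nhdsWithin_iff.2
          ⟨hl, Eventually.of_forall fun n => ⟨htT n, hle n⟩⟩
        have h2 : Tendsto (fun n => γ (t n)) atTop (𝓝 (γ l)) := hc.tendsto.comp h1
        have h3 : Tendsto (fun n => γ (t n)) atTop (𝓝 (x, 0)) := by
          simp only [node]
          exact hlim.prodMk_nhds tendsto_const_nhds
        exact hne l hTl (tendsto_nhds_unique h2 h3)
  have hx0 : x ≤ 2 * lam - x := by
    have h1 : x ≤ m := le_of_tendsto hlim (Eventually.of_forall fun n => (hu n).2.le)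
    have h2 : m ≤ 2 * lam - x := ge_of_tendsto (hlim.const_sub (2 * lam))
      (Eventually.of_forall fun n => (hz n).1.le)
    linarith
  have hlimz : Tendsto (fun n => 2 * lam - u n) atTop (𝓝 (2 * lam - x)) :=
    hlim.const_sub (2 * lam)
  -- A turn is not closed: its upper arc lies on the loop with ends `u n` and `2 lam - u n`, its
  -- lower arc on the one with ends `u (n + 1)` and `2 lam - u n`. Both loops converge to the limit
  -- loop.
  have k1 := tendsto_hausdorff_loop V.continuous hlim hlimz hx0
    (Eventually.of_forall fun n => by linarith [hd1 n])
  have k2 := tendsto_hausdorff_loop V.continuous ((tendsto_add_atTop_iff_nat 1).2 hlim) hlimz hx0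
    (Eventually.of_forall fun n => by linarith [hd2 n])
  rw [Metric.tendsto_atTop]
  intro ε hε
  have hε' : (0 : ENNReal) < ENNReal.ofReal ε := ENNReal.ofReal_pos.2 hε
  obtain ⟨N, hN⟩ := eventually_atTop.1 ((k1.eventually (gt_mem_nhds hε')).and
    (k2.eventually (gt_mem_nhds hε')))
  refine ⟨t N, fun τ hτ => ?_⟩
  obtain ⟨n₁, hn₁⟩ := (htop.eventually_gt_atTop τ).exists
  obtain ⟨n, hn, h1, h2⟩ : ∃ n, N ≤ n ∧ t n ≤ τ ∧ τ ≤ t (n + 1) := by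
    have hex : ∃ n, τ < t n := ⟨n₁, hn₁⟩
    classical
    have h1 := Nat.find_spec hex
    have h2 : N < Nat.find hex := by
      by_contra! h
      exact absurd (hmono.monotone h) (not_le.2 (hτ.trans_lt h1))
    refine ⟨Nat.find hex - 1, by omega, ?_, ?_⟩
    · exact not_lt.1 (Nat.find_min hex (by omega))
    · rw [Nat.sub_add_cancel (by omega)]; exact h1.le
  obtain ⟨j1, j2⟩ := hN n hn
  have j3 : Metric.infEDist (γ τ) (loop G x (2 * lam - x)) < ENNReal.ofReal ε := by
    rcases (turn n (node n)).2 τ ⟨h1, h2⟩ with h | h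
    · have h' : γ τ ∈ loop G (u n) (2 * lam - u n) := Or.inl h
      exact (Metric.infEDist_le_hausdorffEDist_of_mem h').trans_lt j1
    · have h' : γ τ ∈ loop G (u (n + 1)) (2 * lam - u n) := Or.inr h
      exact (Metric.infEDist_le_hausdorffEDist_of_mem h').trans_lt j2
  rw [dist_zero_right, Real.norm_of_nonneg Metric.infDist_nonneg, Metric.infDist]
  exact (ENNReal.toReal_lt_of_lt_ofReal j3)

lemma tendsto_stay (V : Valley g G A m B) {x : ℝ} (hx : x ∈ Ioo A m)
    (hz : 2 * lam - x ∈ Ioo m B) (e : G x = G (2 * lam - x))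
    (hr : ∀ b, (potentialField lam g).Runs γ T b) (ha : γ T = (x, 0)) :
    Tendsto (fun τ => Metric.infDist (γ τ) (loop G x (2 * lam - x))) atTop (𝓝 0) :=
  V.tendsto_of_returns (u := fun _ => x) (fun _ => hx) (fun _ => hz) (fun _ => e)
    tendsto_const_nhds hr ha
    (Or.inl ⟨2 * (lam - x), by linarith [hx.2, hz.1], fun _ => le_rfl⟩)

lemma exists_orbit {S : Set ℝ} {R : ℝ → ℝ → Prop} (step : ∀ u ∈ S, ∃ u' ∈ S, R u u') {u₀ : ℝ}
    (h₀ : u₀ ∈ S) : ∃ u : ℕ → ℝ, u 0 = u₀ ∧ ∀ n, u n ∈ S ∧ R (u n) (u (n + 1)) := by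
  choose! f hf hf' using step
  have hmem : ∀ n, f^[n] u₀ ∈ S := by
    intro n
    induction n with
    | zero => exact h₀
    | succ n ih => rw [Function.iterate_succ_apply']; exact hf _ ih
  refine ⟨fun n => f^[n] u₀, rfl, fun n => ⟨hmem n, ?_⟩⟩
  simp only [Function.iterate_succ_apply']
  exact hf' _ (hmem n)

/-- Convergence from the outside. -/
lemma tendsto_up (V : Valley g G A m B) {x u₀ : ℝ} (hA : A < u₀) (hu : u₀ < x) (hm : x ≤ m)
    (hm' : m ≤ 2 * lam - x) (hB : 2 * lam - u₀ < B) (e : G x = G (2 * lam - x))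
    (hD : ∀ u ∈ Ico u₀ x, G (2 * lam - u) < G u)
    (hr : ∀ b, (potentialField lam g).Runs γ T b) (ha : γ T = (u₀, 0))
    (hne : x < m ∨ ∀ t ≥ T, γ t ≠ (x, 0)) :
    Tendsto (fun τ => Metric.infDist (γ τ) (loop G x (2 * lam - x))) atTop (𝓝 0) := by
  -- The right end lies below the level of `u` but above that of the fixed point, so the return lies
  -- strictly between `u` and `x`.
  obtain ⟨u, hu0, hS⟩ := exists_orbit (S := Ico u₀ x)
    (R := fun u u' => u < u' ∧ G u' = G (2 * lam - u)) (fun u hu => by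
      have h1 := hD u hu
      have h2 : G x < G (2 * lam - u) := by
        rw [e]
        exact V.mono ⟨hm', by linarith [hu.1, hu.2]⟩ ⟨by linarith [hu.2], by linarith [hu.1]⟩
          (by linarith [hu.2])
      obtain ⟨u', h3, h4⟩ := intermediate_value_Ioo' hu.2.le V.continuous.continuousOn ⟨h2, h1⟩
      exact ⟨u', ⟨by linarith [h3.1, hu.1], h3.2⟩, h3.1, h4⟩) ⟨le_rfl, hu⟩
  have hmono : Monotone u := monotone_nat_of_le_succ fun n => (hS n).2.1.le
  have hbdd : BddAbove (range u) := ⟨x, by rintro _ ⟨n, rfl⟩; exact (hS n).1.2.le⟩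
  have hlim := tendsto_atTop_ciSup hmono hbdd
  set l := ⨆ n, u n with hl
  have h1 : u₀ ≤ l := ge_of_tendsto hlim (Eventually.of_forall fun n => (hS n).1.1)
  have h2 : l ≤ x := le_of_tendsto hlim (Eventually.of_forall fun n => (hS n).1.2.le)
  have h3 : G l = G (2 * lam - l) := by
    refine tendsto_nhds_unique ((V.continuous.tendsto l).comp ((tendsto_add_atTop_iff_nat 1).2 hlim))
      (((V.continuous.tendsto _).comp (hlim.const_sub (2 * lam))).congr fun n => ?_)
    exact (hS n).2.2.symm
  -- The limit of the monotone returns is a fixed point, and `hD` leaves `x` as the only one.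
  have h4 : l = x := by
    by_contra h
    exact (hD l ⟨h1, lt_of_le_of_ne h2 h⟩).ne h3.symm
  rw [h4] at hlim
  refine V.tendsto_of_returns (fun n => ⟨by linarith [(hS n).1.1], by linarith [(hS n).1.2]⟩)
    (fun n => ⟨by linarith [(hS n).1.2], by linarith [(hS n).1.1]⟩)
    (fun n => (hS n).2.2) hlim hr (by rw [hu0]; exact ha) ?_
  refine hne.imp_left fun h => ⟨2 * (lam - x), by linarith, fun n => ?_⟩
  linarith [(hS n).1.2]

/-- Convergence from the inside. -/
lemma tendsto_down (V : Valley g G A m B) {x u₀ : ℝ} (hA : A ≤ x) (hu : x < u₀) (hm : u₀ < m)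
    (hm' : m < 2 * lam - u₀) (hB : 2 * lam - x ≤ B) (e : G x = G (2 * lam - x))
    (hD : ∀ u ∈ Ioc x u₀, G u < G (2 * lam - u))
    (hr : ∀ b, (potentialField lam g).Runs γ T b) (ha : γ T = (u₀, 0)) :
    Tendsto (fun τ => Metric.infDist (γ τ) (loop G x (2 * lam - x))) atTop (𝓝 0) := by
  obtain ⟨u, hu0, hS⟩ := exists_orbit (S := Ioc x u₀)
    (R := fun u u' => u' < u ∧ G u' = G (2 * lam - u)) (fun u hu => by
      have h1 := hD u hu
      have h2 : G (2 * lam - u) < G x := by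
        rw [e]
        exact V.mono ⟨by linarith [hu.2], by linarith [hu.1]⟩ ⟨by linarith [hu.1, hu.2], hB⟩
          (by linarith [hu.1])
      obtain ⟨u', h3, h4⟩ := intermediate_value_Ioo' hu.1.le V.continuous.continuousOn ⟨h1, h2⟩
      exact ⟨u', ⟨h3.1, by linarith [h3.2, hu.2]⟩, h3.2, h4⟩) ⟨hu, le_rfl⟩
  have hmono : Antitone u := antitone_nat_of_succ_le fun n => (hS n).2.1.le
  have hbdd : BddBelow (range u) := ⟨x, by rintro _ ⟨n, rfl⟩; exact (hS n).1.1.le⟩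
  have hlim := tendsto_atTop_ciInf hmono hbdd
  set l := ⨅ n, u n with hl
  have h1 : x ≤ l := ge_of_tendsto hlim (Eventually.of_forall fun n => (hS n).1.1.le)
  have h2 : l ≤ u₀ := le_of_tendsto hlim (Eventually.of_forall fun n => (hS n).1.2)
  have h3 : G l = G (2 * lam - l) := by
    refine tendsto_nhds_unique ((V.continuous.tendsto l).comp ((tendsto_add_atTop_iff_nat 1).2 hlim))
      (((V.continuous.tendsto _).comp (hlim.const_sub (2 * lam))).congr fun n => ?_)
    exact (hS n).2.2.symm
  have h4 : l = x := by
    by_contra h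
    exact (hD l ⟨lt_of_le_of_ne h1 (Ne.symm h), h2⟩).ne h3
  rw [h4] at hlim
  refine V.tendsto_of_returns (fun n => ⟨by linarith [(hS n).1.1], by linarith [(hS n).1.2]⟩)
    (fun n => ⟨by linarith [(hS n).1.2], by linarith [(hS n).1.1]⟩)
    (fun n => (hS n).2.2) hlim hr (by rw [hu0]; exact ha) ?_
  exact Or.inl ⟨2 * (lam - u₀), by linarith, fun n => by linarith [(hS n).1.2]⟩

end Valley

/-! ### Trajectories near a loop around a valley reach a section -/

lemma isOpen_imp {X : Type*} [TopologicalSpace X] {P Q : X → Prop} (hP : IsClosed {p | P p})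
    (hQ : IsOpen {p | Q p}) : IsOpen {p | P p → Q p} := by
  have : {p | P p → Q p} = {p | P p}ᶜ ∪ {p | Q p} := by
    ext p
    exact imp_iff_not_or
  rw [this]
  exact hP.isOpen_compl.union hQ

lemma lt_of_sq_lt {a b : ℝ} (h : a ^ 2 < b ^ 2) (hb : 0 ≤ b) : a < b :=
  lt_of_pow_lt_pow_left₀ 2 hb h

namespace Valley

variable {lam A m B : ℝ} {g G : ℝ → ℝ} {γ : ℝ → ℝ × ℝ} {T : ℝ}

lemma exists_left (V : Valley g G A m B) {ℓ : ℝ} (h : G m < ℓ) (h' : ℓ < G A) :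
    ∃ u ∈ Ioo A m, G u = ℓ :=
  intermediate_value_Ioo' V.lt_left.le V.continuous.continuousOn ⟨h, h'⟩

lemma bottom_le (V : Valley g G A m B) {x : ℝ} (hx : x ∈ Icc A B) : G m ≤ G x := by
  rcases le_total x m with h | h
  · exact V.anti.antitoneOn ⟨hx.1, h⟩ ⟨V.lt_left.le, le_rfl⟩ h
  · exact V.mono.monotoneOn ⟨le_rfl, V.lt_right.le⟩ ⟨h, hx.2⟩ h

lemma reach_neg (V : Valley g G A m B) {x y u : ℝ} (hx : x ∈ Ioc A B) (hy : y < 0)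
    (hu : u ∈ Ioo A m) (e : G u = G x - y) (hr : ∀ b, (potentialField lam g).Runs γ T b)
    (ha : γ T = (x, y)) : ∃ t ≥ T, γ t = (u, 0) := by
  have hux : u < x := by
    by_contra! h
    have := V.anti.antitoneOn ⟨hx.1.le, h.trans hu.2.le⟩ (Ioo_subset_Icc_self hu) h
    linarith
  have key := follow_lower V.deriv V.cont (hr _) ha (fun _ _ _ hk => arc_eq_lower V.cont ha
    (Or.inl hy) hk) (fun w hw => by
      have := V.lt_left_end hu.1.le hx.2 (Or.inr (by linarith)) hw
      linarith) u ⟨le_rfl, hux.le⟩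
  refine ⟨T + (x - u), by linarith, ?_⟩
  rw [key, e]
  simp

lemma reach_right (V : Valley g G A m B) {z u : ℝ} (hz : z ∈ Ioo m B) (hl : lam < z)
    (hu : u ∈ Icc A m) (e : G u = G z) (hr : ∀ b, (potentialField lam g).Runs γ T b)
    (ha : γ T = (z, 0)) : ∃ t ≥ T, γ t = (u, 0) :=
  ⟨T + (z - u), by linarith [hu.2, hz.1],
    (V.follow_down hu ⟨hz.1, hz.2.le⟩ (V.arc_lower hz hl ha) e (hr _) ha).1⟩

/-- A neighbourhood of a loop around a valley from which all trajectories reach a given part of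
the section; they stay on the side of the loop on which they start. -/
lemma reach_section (V : Valley g G A m B) {x δ : ℝ} (hx : x ∈ Ioo A m)
    (hz : 2 * lam - x ∈ Ioo m B) (e : G x = G (2 * lam - x)) (hδ : 0 < δ) :
    ∃ U, IsOpen U ∧ loop G x (2 * lam - x) ⊆ U ∧
      ∀ γ, (∀ b, (potentialField lam g).Runs γ 0 b) → γ 0 ∈ U →
        ∃ T ≥ 0, ∃ u ∈ Ioo (x - δ) (x + δ), γ T = (u, 0) ∧
          (γ 0 ∈ loopDomain G x (2 * lam - x) → x < u) ∧
          (γ 0 ∉ loop G x (2 * lam - x) → γ 0 ∉ loopDomain G x (2 * lam - x) → u < x) := by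
  set z := 2 * lam - x with hzdef
  have hV := V.continuous
  obtain ⟨δ₁, d0, d1, d2, d3⟩ : ∃ δ₁ > 0, δ₁ ≤ δ ∧ A < x - δ₁ ∧ x + δ₁ < m := by
    refine ⟨min δ (min ((x - A) / 2) ((m - x) / 2)), ?_, min_le_left _ _, ?_, ?_⟩
    · have := hx.1; have := hx.2
      refine lt_min hδ (lt_min ?_ ?_) <;> linarith
    · have := (min_le_right δ (min ((x - A) / 2) ((m - x) / 2))).trans (min_le_left _ _)
      linarith [hx.1]
    · have := (min_le_right δ (min ((x - A) / 2) ((m - x) / 2))).trans (min_le_right _ _)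
      linarith [hx.2]
  have m1 : x - δ₁ ∈ Icc A m := ⟨d2.le, by linarith⟩
  have m2 : x + δ₁ ∈ Icc A m := ⟨by linarith, d3.le⟩
  have hxI := Ioo_subset_Icc_self hx
  have l1 : G (x + δ₁) < G x := V.anti hxI m2 (by linarith)
  have l2 : G x < G (x - δ₁) := V.anti m1 hxI (by linarith)
  have l3 : G m < G (x + δ₁) := V.anti m2 ⟨V.lt_left.le, le_rfl⟩ d3
  have l4 : G (x - δ₁) < G A := V.anti ⟨le_rfl, V.lt_left.le⟩ m1 d2
  obtain ⟨δ₂, f0, f1, f2, f3, f4⟩ : ∃ δ₂ > 0, δ₂ ≤ δ₁ ∧ m < z - δ₂ ∧ z + δ₂ < B ∧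
      ∀ w ∈ Ioo (z - δ₂) (z + δ₂), G (x + δ₁) < G w ∧ G w < G (x - δ₁) := by
    have h1 : ∀ᶠ w in 𝓝 z, G (x + δ₁) < G w ∧ G w < G (x - δ₁) :=
      hV.continuousAt.eventually (Ioo_mem_nhds (by rw [← e]; exact l1) (by rw [← e]; exact l2))
    obtain ⟨ε, hε, h2⟩ := Metric.eventually_nhds_iff.1 h1
    have h3 := hz.1; have h4 := hz.2
    refine ⟨min (min ε δ₁) (min ((z - m) / 2) ((B - z) / 2)), ?_,
      (min_le_left _ _).trans (min_le_right _ _), ?_, ?_, fun w hw => h2 ?_⟩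
    · refine lt_min (lt_min hε d0) (lt_min ?_ ?_) <;> linarith
    · have := (min_le_right (min ε δ₁) (min ((z - m) / 2) ((B - z) / 2))).trans (min_le_left _ _)
      linarith
    · have := (min_le_right (min ε δ₁) (min ((z - m) / 2) ((B - z) / 2))).trans (min_le_right _ _)
      linarith
    · have := (min_le_left (min ε δ₁) (min ((z - m) / 2) ((B - z) / 2))).trans (min_le_left _ _)
      rw [Real.dist_eq, abs_lt]
      constructor <;> linarith [hw.1, hw.2]
  have hl1 : lam < z - δ₂ := by linarith
  have hxz : x < z := by linarith
  -- the section point of a given level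
  have sec : ∀ ℓ, G (x + δ₁) < ℓ → ℓ < G (x - δ₁) →
      ∃ u ∈ Ioo (x - δ₁) (x + δ₁), u ∈ Ioo A m ∧ G u = ℓ ∧ (ℓ < G x → x < u) ∧
        (G x < ℓ → u < x) := by
    intro ℓ h1 h2
    obtain ⟨u, hu, rfl⟩ := V.exists_left (l3.trans h1) (h2.trans l4)
    have huI := Ioo_subset_Icc_self hu
    exact ⟨u, ⟨(V.anti.lt_iff_gt huI m1).1 h2, (V.anti.lt_iff_gt m2 huI).1 h1⟩, hu, rfl,
      fun h => (V.anti.lt_iff_gt huI hxI).1 h, fun h => (V.anti.lt_iff_gt hxI huI).1 h⟩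
  have hmid : ∀ w, A < w → w < B → G w < G x → w ∈ Ioo x z := by
    intro w h1 h2 h3
    constructor
    · by_contra! h
      exact absurd (V.anti.antitoneOn ⟨h1.le, h.trans hx.2.le⟩ hxI h) (not_le.2 h3)
    · by_contra! h
      refine absurd (V.mono.monotoneOn ⟨hz.1.le, hz.2.le⟩ ⟨hz.1.le.trans h, h2.le⟩ h)
        (not_le.2 (e ▸ h3))
  have hlt : ∀ w ∈ Ioo x z, G w < G x := fun w hw =>
    V.lt_left_end hx.1.le hz.2.le (Or.inr e.ge) hw
  -- The neighbourhood prescribes the first integrals: above the line that of `X`, which fixes the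
  -- landing point near `z`; below the line that of `Y`, which fixes the landing point near `x`. On
  -- the line both conditions hold, so the set is open.
  refine ⟨{p | 0 ≤ p.2 → (z - δ₂ - lam) ^ 2 < (p.1 - lam) ^ 2 + 2 * p.2 ∧
      (p.1 - lam) ^ 2 + 2 * p.2 < (z + δ₂ - lam) ^ 2} ∩
    {p | p.2 ≤ 0 → (x - δ₁ < p.1 ∧ p.1 < z + δ₂) ∧
      (G (x + δ₁) < G p.1 - p.2 ∧ G p.1 - p.2 < G (x - δ₁))}, IsOpen.inter ?_ ?_, ?_, ?_⟩
  · refine isOpen_imp (isClosed_le continuous_const continuous_snd) (IsOpen.inter ?_ ?_)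
    · exact isOpen_lt (f := fun _ : ℝ × ℝ => (z - δ₂ - lam) ^ 2)
        (g := fun p : ℝ × ℝ => (p.1 - lam) ^ 2 + 2 * p.2) (by fun_prop) (by fun_prop)
    · exact isOpen_lt (f := fun p : ℝ × ℝ => (p.1 - lam) ^ 2 + 2 * p.2)
        (g := fun _ : ℝ × ℝ => (z + δ₂ - lam) ^ 2) (by fun_prop) (by fun_prop)
  · refine isOpen_imp (isClosed_le continuous_snd continuous_const)
      (IsOpen.inter (isOpen_Ioo.preimage continuous_fst) ?_)
    exact isOpen_Ioo.preimage (f := fun p : ℝ × ℝ => G p.1 - p.2) (by fun_prop)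
  · intro p hp
    obtain ⟨h1, h2⟩ := mem_loop_iff.1 hp
    have q1 : (z - δ₂ - lam) ^ 2 < (z - lam) ^ 2 := by nlinarith
    have q2 : (z - lam) ^ 2 < (z + δ₂ - lam) ^ 2 := by nlinarith
    have q3 : (p.1 - lam) ^ 2 + (p.1 - x) * (z - p.1) = (z - lam) ^ 2 := by rw [hzdef]; ring
    have hu : 0 ≤ (p.1 - x) * (z - p.1) := mul_nonneg (by linarith [h1.1]) (by linarith [h1.2])
    have hends : (p.1 = x ∨ p.1 = z) ∨ p.1 ∈ Ioo x z := by
      rcases eq_or_lt_of_le h1.1 with h | h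
      · exact Or.inl (Or.inl h.symm)
      rcases eq_or_lt_of_le h1.2 with h' | h'
      · exact Or.inl (Or.inr h')
      · exact Or.inr ⟨h, h'⟩
    constructor
    · intro h0
      have : 2 * p.2 = (p.1 - x) * (z - p.1) := by
        rcases h2 with h2 | h2
        · rw [h2]; ring
        · rcases hends with (h | h) | h
          · rw [h, ← e] at h2; rw [h2, h]; ring
          · rw [h] at h2; rw [h2, h]; ring
          · linarith [hlt _ h]
      rw [this, q3]
      exact ⟨q1, q2⟩
    · intro h0
      have : G p.1 - p.2 = G x := by
        rcases h2 with h2 | h2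
        · rcases hends with (h | h) | h
          · rw [h2, h]; ring
          · rw [h2, h, e]; ring
          · have := mul_pos (sub_pos.2 h.1) (sub_pos.2 h.2)
            linarith
        · rw [h2, e]; ring
      rw [this]
      exact ⟨⟨by linarith [h1.1], by linarith [h1.2]⟩, l1, l2⟩
  · rintro γ hr ⟨hU1, hU2⟩
    obtain ⟨p, q, hpq⟩ : ∃ p q, γ 0 = (p, q) := ⟨(γ 0).1, (γ 0).2, rfl⟩
    rw [hpq] at hU1 hU2 ⊢
    simp only [mem_ofPred_eq] at hU1 hU2
    have widen : ∀ {u}, u ∈ Ioo (x - δ₁) (x + δ₁) → u ∈ Ioo (x - δ) (x + δ) := fun hu =>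
      ⟨by linarith [hu.1], by linarith [hu.2]⟩
    have hid : (p - lam) ^ 2 + (p - x) * (z - p) = (z - lam) ^ 2 := by rw [hzdef]; ring
    -- the point lies on the loop or inside when its level is not larger than that of the loop
    have hclosed : p ∈ Icc x z → G p - G z ≤ q → q ≤ (p - x) * (z - p) / 2 →
        (p, q) ∉ loop G x z → (p, q) ∈ loopDomain G x z := by
      intro h1 h2 h3 h4
      rw [mem_loop_iff] at h4
      simp only [h1, true_and, not_or] at h4
      have h5 := lt_of_le_of_ne h3 h4.1
      have h6 := lt_of_le_of_ne h2 (Ne.symm h4.2)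
      refine ⟨⟨lt_of_le_of_ne h1.1 fun h => ?_, lt_of_le_of_ne h1.2 fun h => ?_⟩, h6, h5⟩
      · simp only at h; rw [← h, ← e] at h6; rw [← h] at h5; linarith
      · simp only at h; rw [h] at h5 h6; linarith
    -- Once at the right end, one lower arc leads to the section. The descending branch reverses the
    -- order, so inside and outside are preserved.
    have fromRight : ∀ t ≥ 0, ∀ w ∈ Ioo (z - δ₂) (z + δ₂), γ t = (w, 0) →
        ((p, q) ∈ loopDomain G x z → w < z) →
        ((p, q) ∉ loop G x z → (p, q) ∉ loopDomain G x z → z < w) →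
        ∃ T ≥ 0, ∃ u ∈ Ioo (x - δ) (x + δ), γ T = (u, 0) ∧
          ((p, q) ∈ loopDomain G x z → x < u) ∧
          ((p, q) ∉ loop G x z → (p, q) ∉ loopDomain G x z → u < x) := by
      intro t ht w hw hγ hi ho
      obtain ⟨u, hu, huI, eu, k1, k2⟩ := sec (G w) (f4 w hw).1 (f4 w hw).2
      have hwI : w ∈ Ioo m B := ⟨by linarith [hw.1], by linarith [hw.2]⟩
      obtain ⟨t', ht', hγ'⟩ := V.reach_right hwI (by linarith [hw.1]) (Ioo_subset_Icc_self huI) eu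
        (fun b => (hr b).mono ht le_rfl) hγ
      refine ⟨t', by linarith, u, widen hu, hγ', fun h => k1 ?_, fun h h' => k2 ?_⟩
      · rw [e]
        exact V.mono (Ioo_subset_Icc_self hwI) (Ioo_subset_Icc_self hz) (hi h)
      · rw [e]
        exact V.mono (Ioo_subset_Icc_self hz) (Ioo_subset_Icc_self hwI) (ho h h')
    rcases lt_trichotomy q 0 with hq | hq | hq
    · obtain ⟨hp, hℓ⟩ := hU2 hq.le
      obtain ⟨u, hu, huI, eu, k1, k2⟩ := sec (G p - q) hℓ.1 hℓ.2
      obtain ⟨t, ht, hγ⟩ := V.reach_neg ⟨by linarith [hp.1], by linarith [hp.2]⟩ hq huI eu hr hpq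
      refine ⟨t, ht, u, widen hu, hγ, fun h => k1 ?_, fun h h' => k2 ?_⟩
      · have := h.2.1
        simp only at this
        linarith
      · by_contra! hle
        have hpI := hmid p (by linarith [hp.1]) (by linarith [hp.2]) (by linarith)
        refine h' (hclosed (Ioo_subset_Icc_self hpI) (by linarith) ?_ h)
        have := mul_pos (sub_pos.2 hpI.1) (sub_pos.2 hpI.2)
        linarith
    · subst hq
      obtain ⟨hp, hℓ⟩ := hU2 le_rfl
      obtain ⟨hp1, hp2⟩ := hU1 le_rfl
      rw [mul_zero, add_zero] at hp1 hp2
      have hside : (p, (0 : ℝ)) ∉ loop G x z → (p, (0 : ℝ)) ∉ loopDomain G x z →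
          p < x ∨ z < p := by
        intro h h'
        by_contra! hc
        refine h' (hclosed hc ?_ ?_ h)
        · rcases eq_or_lt_of_le hc.1 with h1 | h1
          · rw [← h1, e, sub_self]
          rcases eq_or_lt_of_le hc.2 with h2 | h2
          · rw [h2, sub_self]
          · linarith [hlt p ⟨h1, h2⟩]
        · have := mul_nonneg (sub_nonneg.2 hc.1) (sub_nonneg.2 hc.2)
          linarith
      rcases le_total lam p with hlp | hlp
      · have hpz : p ∈ Ioo (z - δ₂) (z + δ₂) :=
          ⟨by linarith [lt_of_sq_lt hp1 (by linarith)], by linarith [lt_of_sq_lt hp2 (by linarith)]⟩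
        refine fromRight 0 le_rfl p hpz hpq (fun h => h.1.2) fun h h' => ?_
        exact (hside h h').resolve_left (by linarith [hpz.1])
      · have hpx : p ∈ Ioo (x - δ₂) (x + δ₂) := by
          rw [show (p - lam) ^ 2 = (lam - p) ^ 2 by ring] at hp1 hp2
          exact ⟨by linarith [lt_of_sq_lt hp2 (by linarith)],
            by linarith [lt_of_sq_lt hp1 (by linarith)]⟩
        refine ⟨0, le_rfl, p, ⟨by linarith [hpx.1], by linarith [hpx.2]⟩, hpq, fun h => h.1.1,
          fun h h' => (hside h h').resolve_right (by linarith [hpx.2])⟩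
    · obtain ⟨hp1, hp2⟩ := hU1 hq.le
      obtain ⟨t, ht, w, hw, hγ, ew⟩ := reach_of_pos V.deriv V.cont hr hpq hq
      rw [← ew] at hp1 hp2
      have hwz : w ∈ Ioo (z - δ₂) (z + δ₂) :=
        ⟨by linarith [lt_of_sq_lt hp1 (by linarith)], by linarith [lt_of_sq_lt hp2 (by linarith)]⟩
      refine fromRight t ht w hwz hγ (fun h => ?_) fun h h' => ?_
      · have h2 := h.2.2
        simp only at h2
        linarith [lt_of_sq_lt (show (w - lam) ^ 2 < (z - lam) ^ 2 by linarith) (by linarith)]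
      · by_contra! hle
        have h3 : (p - lam) ^ 2 + 2 * q ≤ (z - lam) ^ 2 := by
          rw [← ew]; exact pow_le_pow_left₀ (by linarith) (by linarith) 2
        have h4 : p ∈ Icc x z := by
          have := abs_le_of_sq_le_sq (show (p - lam) ^ 2 ≤ (z - lam) ^ 2 by linarith) (by linarith)
          rw [abs_le] at this
          exact ⟨by linarith [this.1], by linarith [this.2]⟩
        have h5 : G p ≤ G x := by
          rcases eq_or_lt_of_le h4.1 with h1 | h1
          · rw [← h1]
          rcases eq_or_lt_of_le h4.2 with h2 | h2
          · rw [h2, e]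
          · exact (hlt p ⟨h1, h2⟩).le
        exact h' (hclosed h4 (by linarith) (by linarith) h)

theorem attractsFrom_inside (V : Valley g G A m B) {x δ : ℝ} (hx : x ∈ Ioo A m)
    (hz : 2 * lam - x ∈ Ioo m B) (e : G x = G (2 * lam - x)) (hδ : 0 < δ)
    (hD : ∀ u ∈ Ioo x (x + δ), G u < G (2 * lam - u)) :
    (potentialField lam g).AttractsFrom (loop G x (2 * lam - x))
      (loopDomain G x (2 * lam - x)) := by
  obtain ⟨U, hU, hΓ, h⟩ := V.reach_section hx hz e
    (show 0 < min δ (min (m - x) (2 * lam - x - m)) from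
      lt_min hδ (lt_min (sub_pos.2 hx.2) (sub_pos.2 hz.1)))
  refine ⟨U, hU, hΓ, fun γ hγ h0 => ?_⟩
  obtain ⟨T, hT, u, hu, hγT, hi, -⟩ := h γ (fun b => hγ.runs le_rfl b) h0.1
  have hxu := hi h0.2
  have h1 := (lt_min_iff.1 (show u - x < min δ (min (m - x) (2 * lam - x - m)) by linarith [hu.2]))
  have h2 := lt_min_iff.1 h1.2
  exact V.tendsto_down hx.1.le hxu (by linarith) (by linarith) hz.2.le e
    (fun w hw => hD w ⟨hw.1, by linarith [hw.2]⟩) (fun b => hγ.runs hT b) hγT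

theorem attractsFrom_outside (V : Valley g G A m B) {x δ : ℝ} (hx : x ∈ Ioo A m)
    (hz : 2 * lam - x ∈ Ioo m B) (e : G x = G (2 * lam - x)) (hδ : 0 < δ)
    (hD : ∀ u ∈ Ioo (x - δ) x, G (2 * lam - u) < G u) :
    (potentialField lam g).AttractsFrom (loop G x (2 * lam - x))
      {p | p ∉ loop G x (2 * lam - x) ∧ p ∉ loopDomain G x (2 * lam - x)} := by
  obtain ⟨U, hU, hΓ, h⟩ := V.reach_section hx hz e
    (show 0 < min δ (min (x - A) (B - (2 * lam - x))) from
      lt_min hδ (lt_min (sub_pos.2 hx.1) (sub_pos.2 hz.2)))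
  refine ⟨U, hU, hΓ, fun γ hγ h0 => ?_⟩
  obtain ⟨T, hT, u, hu, hγT, -, ho⟩ := h γ (fun b => hγ.runs le_rfl b) h0.1
  have hxu := ho h0.2.1 h0.2.2
  have h1 := (lt_min_iff.1 (show x - u < min δ (min (x - A) (B - (2 * lam - x))) by
    linarith [hu.1]))
  have h2 := lt_min_iff.1 h1.2
  exact V.tendsto_up (by linarith) hxu hx.2.le hz.1.le (by linarith) e
    (fun w hw => hD w ⟨by linarith [hw.1], hw.2⟩) (fun b => hγ.runs hT b) hγT (Or.inl hx.2)

theorem isAttractor_loop (V : Valley g G A m B) {x δ : ℝ} (hx : x ∈ Ioo A m)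
    (hz : 2 * lam - x ∈ Ioo m B) (e : G x = G (2 * lam - x)) (hδ : 0 < δ)
    (hD : ∀ u ∈ Ioo x (x + δ), G u < G (2 * lam - u))
    (hD' : ∀ u ∈ Ioo (x - δ) x, G (2 * lam - u) < G u) :
    (potentialField lam g).IsAttractor (loop G x (2 * lam - x)) := by
  obtain ⟨U, hU, hΓ, h⟩ := V.reach_section hx hz e
    (show 0 < min (min δ (min (m - x) (2 * lam - x - m))) (min (x - A) (B - (2 * lam - x))) from
      lt_min (lt_min hδ (lt_min (sub_pos.2 hx.2) (sub_pos.2 hz.1)))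
        (lt_min (sub_pos.2 hx.1) (sub_pos.2 hz.2)))
  refine ⟨U, hU, hΓ, fun γ hγ h0 => ?_⟩
  obtain ⟨T, hT, u, hu, hγT, -, -⟩ := h γ (fun b => hγ.runs le_rfl b) h0.1
  have hr := fun b => hγ.runs hT b
  rcases lt_trichotomy u x with hxu | hxu | hxu
  · have h1 := lt_min_iff.1 (show x - u < _ by linarith [hu.1])
    have h2 := lt_min_iff.1 h1.1
    have h3 := lt_min_iff.1 h1.2
    exact V.tendsto_up (by linarith) hxu hx.2.le hz.1.le (by linarith) e
      (fun w hw => hD' w ⟨by linarith [hw.1], hw.2⟩) hr hγT (Or.inl hx.2)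
  · exact V.tendsto_stay hx hz e hr (hxu ▸ hγT)
  · have h1 := lt_min_iff.1 (show u - x < _ by linarith [hu.2])
    have h2 := lt_min_iff.1 h1.1
    have h3 := lt_min_iff.1 h2.2
    exact V.tendsto_down hx.1.le hxu (by linarith) (by linarith) hz.2.le e
      (fun w hw => hD w ⟨hw.1, by linarith [hw.2]⟩) hr hγT

end Valley

/-! ### Time reversal -/

/-- The reflection in the vertical axis. -/
def reflect (p : ℝ × ℝ) : ℝ × ℝ := (-p.1, p.2)

lemma reflect_reflect (p : ℝ × ℝ) : reflect (reflect p) = p := by simp [reflect]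

lemma continuous_reflect : Continuous reflect := by unfold reflect; fun_prop

lemma isometry_reflect : Isometry reflect := by
  refine Isometry.of_dist_eq fun p q => ?_
  simp only [reflect, Prod.dist_eq, dist_neg_neg]

/-- The field reflected in the vertical axis. -/
def PWS.mirror (Z : PWS) : PWS := ⟨fun p => reflect (Z.X (reflect p)), fun p => reflect (Z.Y (reflect p))⟩

lemma PWS.mem_mirror {Z : PWS} {p : ℝ × ℝ} (h : p ∈ Z.escaping ∪ Z.slidingRegion) :
    reflect p ∈ Z.mirror.escaping ∪ Z.mirror.slidingRegion := by
  simpa [PWS.escaping, PWS.slidingRegion, PWS.mirror, reflect, switching, lieOne] using h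

/-- The reflection changes the sign of the horizontal components, hence of the numerator, and leaves
the vertical components in the denominator alone. -/
lemma PWS.filippov_mirror (Z : PWS) (p : ℝ × ℝ) :
    Z.mirror.filippov (reflect p) = reflect (Z.filippov p) := by
  simp only [PWS.filippov, PWS.mirror, reflect_reflect]
  simp only [reflect, Prod.mk.injEq, and_true]
  rw [← neg_div]
  congr 1
  ring

lemma hasDerivAt_reflect {γ : ℝ → ℝ × ℝ} {v : ℝ × ℝ} {τ : ℝ} (h : HasDerivAt γ v τ) :
    HasDerivAt (fun τ => reflect (γ τ)) (reflect v) τ :=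
  (hasDerivAt_fst_comp h).neg.prodMk (hasDerivAt_snd_comp h)

lemma PWS.IsArc.mirror {Z : PWS} {k : ArcKind} {γ : ℝ → ℝ × ℝ} {a b : ℝ} (h : Z.IsArc k γ a b) :
    Z.mirror.IsArc k (fun τ => reflect (γ τ)) a b := by
  obtain ⟨h1, h2, h3⟩ := h
  refine ⟨h1, continuous_reflect.comp_continuousOn h2, ?_⟩
  cases k with
  | upper =>
    refine ⟨h3.1, fun τ hτ => (hasDerivAt_reflect (h3.2 τ hτ)).congr_deriv ?_⟩
    simp only [PWS.mirror, reflect_reflect]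
  | lower =>
    refine ⟨h3.1, fun τ hτ => (hasDerivAt_reflect (h3.2 τ hτ)).congr_deriv ?_⟩
    simp only [PWS.mirror, reflect_reflect]
  | sliding =>
    exact ⟨h3.1, fun τ hτ => ⟨PWS.mem_mirror (h3.2 τ hτ).1,
      (hasDerivAt_reflect (h3.2 τ hτ).2).congr_deriv (Z.filippov_mirror _).symm⟩⟩

lemma PWS.AttractsFrom.of_mirror {Z : PWS} {Γ Γ' A A' : Set (ℝ × ℝ)}
    (h : Z.mirror.AttractsFrom Γ' A') (hΓ : ∀ p, p ∈ Γ ↔ reflect p ∈ Γ')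
    (hA : ∀ p ∈ A, reflect p ∈ A') : Z.AttractsFrom Γ A := by
  obtain ⟨V, hV, hΓV, hγ⟩ := h
  have hΓ' : Γ' = reflect '' Γ := by
    ext p
    constructor
    · intro hp
      exact ⟨reflect p, (hΓ _).2 (by rwa [reflect_reflect]), reflect_reflect p⟩
    · rintro ⟨q, hq, rfl⟩
      exact (hΓ q).1 hq
  refine ⟨reflect ⁻¹' V, hV.preimage continuous_reflect, fun p hp => hΓV ((hΓ p).1 hp),
    fun γ ht h0 => ?_⟩
  obtain ⟨t, k, h1, h2, h3⟩ := ht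
  have := hγ (fun τ => reflect (γ τ)) ⟨t, k, h1, h2, fun i => (h3 i).mirror⟩ ⟨h0.1, hA _ h0.2⟩
  rw [hΓ'] at this
  simpa only [Metric.infDist_image isometry_reflect] using this

/-- Time reversal turns the horizontal speeds around and the reflection turns them back, so the
family is preserved with parameter `-lam` and potential `x ↦ G (-x)`. Thus statements about
repulsion reduce to statements about attraction. -/
lemma mirror_neg_potentialField (lam : ℝ) (g : ℝ → ℝ) :
    (potentialField lam g).neg.mirror = potentialField (-lam) fun x => -g (-x) := by
  rw [PWS.mirror, potentialField, PWS.mk.injEq]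
  constructor
  · funext p
    simp [PWS.neg, potentialField, reflect, add_comm]
  · funext p
    simp [PWS.neg, potentialField, reflect]

/-! ### Stability of the cycles of kind I from the monotonicity of the midpoint function -/

section KindI

variable {lam s c L r : ℝ} {g G M : ℝ → ℝ}

lemma repelsFrom_of_mirror {Γ Γ' A A' : Set (ℝ × ℝ)}
    (h : (potentialField (-lam) fun x => -g (-x)).AttractsFrom Γ' A')
    (hΓ : ∀ p, p ∈ Γ ↔ reflect p ∈ Γ') (hA : ∀ p ∈ A, reflect p ∈ A') :
    (potentialField lam g).RepelsFrom Γ A := by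
  rw [← mirror_neg_potentialField] at h
  exact h.of_mirror hΓ hA

lemma Well.valley (W : Well s g G M c L) {B : ℝ} (hB : s < B) : Valley g G (-s) s B where
  lt_left := by linarith [W.pos]
  lt_right := hB
  deriv := W.deriv
  cont := W.cont
  neg := W.inner
  pos := fun x hx => W.out_right x hx.1

lemma Well.valley_mirror (W : Well s g G M c L) {B : ℝ} (hB : s < B) :
    Valley (fun x => -g (-x)) (fun x => G (-x)) (-B) (-s) s where
  lt_left := by linarith
  lt_right := by linarith [W.pos]
  deriv := fun x => ((W.deriv (-x)).comp x (hasDerivAt_neg x)).congr_deriv (by simp)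
  cont := by have := W.cont; fun_prop
  neg := fun x hx => neg_neg_of_pos (W.out_right _ (by linarith [hx.2]))
  pos := fun x hx => neg_pos_of_neg (W.inner _ ⟨by linarith [hx.2], by linarith [hx.1]⟩)

lemma mem_loop_reflect {a b : ℝ} (e : G a = G b) (p : ℝ × ℝ) :
    p ∈ loop G a b ↔ reflect p ∈ loop (fun x => G (-x)) (-b) (-a) := by
  simp only [mem_loop_iff, reflect, mem_Icc, neg_le_neg_iff, neg_neg, e]
  rw [and_comm (a := a ≤ p.1), show (-p.1 - -b) * (-a - -p.1) / 2 = (p.1 - a) * (b - p.1) / 2 by ring]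

lemma mem_loopDomain_reflect {a b : ℝ} (e : G a = G b) (p : ℝ × ℝ) :
    p ∈ loopDomain G a b ↔ reflect p ∈ loopDomain (fun x => G (-x)) (-b) (-a) := by
  simp only [loopDomain, reflect, mem_Ioo, mem_ofPred_eq, neg_lt_neg_iff, neg_neg, e]
  rw [and_comm (a := a < p.1), show (-p.1 - -b) * (-a - -p.1) / 2 = (p.1 - a) * (b - p.1) / 2 by ring]

lemma Well.level_eq_iff (W : Well s g G M c L) {u : ℝ} (hu : u ∈ Icc (-s) s) (hl : s ≤ lam) :
    G (2 * lam - u) = G u ↔ M u = lam := by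
  have h1 := W.lt_iff u hu lam hl
  have h2 := W.gt_iff u hu lam hl
  constructor
  · intro e
    rw [e] at h1 h2
    exact le_antisymm (not_lt.1 fun h => lt_irrefl _ (h1.2 h))
      (not_lt.1 fun h => lt_irrefl _ (h2.2 h))
  · intro e
    rw [e] at h1 h2
    exact le_antisymm (not_lt.1 fun h => lt_irrefl _ (h2.1 h))
      (not_lt.1 fun h => lt_irrefl _ (h1.1 h))

lemma Well.mid_gt (W : Well s g G M c L) {u : ℝ} (hu : u ∈ Ioo (-s) s) : s < M u := by
  rcases le_total u c with h | h
  · have := W.mid_mono ⟨le_rfl, W.c_mem.1.le⟩ ⟨hu.1.le, h⟩ hu.1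
    rwa [W.mid_left] at this
  · have := W.mid_anti ⟨h, hu.2.le⟩ ⟨W.c_mem.2.le, le_rfl⟩ hu.2
    rwa [W.mid_right] at this

lemma Well.mid_lt (W : Well s g G M c L) {u : ℝ} (hu : u ∈ Icc (-s) s) (hne : u ≠ c) :
    M u < L := by
  rw [← W.mid_c]
  rcases lt_or_gt_of_ne hne with h | h
  · exact W.mid_mono ⟨hu.1, h.le⟩ ⟨W.c_mem.1.le, le_rfl⟩ h
  · exact W.mid_anti ⟨le_rfl, W.c_mem.2.le⟩ ⟨h.le, hu.2⟩ h

section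

variable {u : ℝ}

lemma Well.chord_eq (W : Well s g G M c L) (hu : u ∈ Ioo (-s) s)
    (hl : s < lam) (e : M u = lam) :
    G u = G (2 * lam - u) :=
  ((W.level_eq_iff (Ioo_subset_Icc_self hu) hl.le).2 e).symm

lemma Well.insideOf_loop (W : Well s g G M c L) (hu : u ∈ Ioo (-s) s)
    (hl : s < lam) (e : M u = lam) :
    insideOf (loop G u (2 * lam - u)) = loopDomain G u (2 * lam - u) := by
  refine _root_.insideOf_loop W.continuous (W.chord_eq hu hl e) fun w hw => ?_
  rcases eq_or_lt_of_le hw.1 with h1 | h1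
  · rw [← h1, W.chord_eq hu hl e]
  rcases eq_or_lt_of_le hw.2 with h2 | h2
  · rw [h2]
  · exact (W.chord_lt (Ioo_subset_Icc_self hu) (by linarith [hu.2]) (W.chord_eq hu hl e)
      ⟨h1, h2⟩).le

lemma Well.outsideOf_loop (W : Well s g G M c L) (hu : u ∈ Ioo (-s) s)
    (hl : s < lam) (e : M u = lam) : outsideOf (loop G u (2 * lam - u)) =
    {p | p ∉ loop G u (2 * lam - u) ∧ p ∉ loopDomain G u (2 * lam - u)} := by
  rw [← W.insideOf_loop hu hl e]
  ext p
  simp only [outsideOf, insideOf, mem_ofPred_eq]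
  tauto

lemma Well.attracts_inside (W : Well s g G M c L) (hu : u ∈ Ioo (-s) s)
    (hl : s < lam) (e : M u = lam) {δ : ℝ} (hδ : 0 < δ) (hδ' : u + δ ≤ s)
    (hD : ∀ w ∈ Ioo u (u + δ), M w < lam) :
    (potentialField lam g).AttractsFrom (loop G u (2 * lam - u))
      (insideOf (loop G u (2 * lam - u))) := by
  rw [W.insideOf_loop hu hl e]
  have hz : s < 2 * lam - u := by linarith [hu.2]
  exact (W.valley (show s < 2 * lam - u + 1 by linarith)).attractsFrom_inside hu
    ⟨hz, by linarith⟩ (W.chord_eq hu hl e) hδ fun w hw =>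
      (W.gt_iff w ⟨by linarith [hw.1, hu.1], by linarith [hw.2]⟩ lam hl.le).2 (hD w hw)

lemma Well.isAttractor_loop (W : Well s g G M c L) (hu : u ∈ Ioo (-s) s)
    (hl : s < lam) (e : M u = lam) {δ : ℝ} (hδ : 0 < δ) (hδ' : u + δ ≤ s) (hδ'' : -s ≤ u - δ)
    (hD : ∀ w ∈ Ioo u (u + δ), M w < lam) (hD' : ∀ w ∈ Ioo (u - δ) u, lam < M w) :
    (potentialField lam g).IsAttractor (loop G u (2 * lam - u)) := by
  have hz : s < 2 * lam - u := by linarith [hu.2]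
  exact (W.valley (show s < 2 * lam - u + 1 by linarith)).isAttractor_loop hu
    ⟨hz, by linarith⟩ (W.chord_eq hu hl e) hδ
    (fun w hw =>
      (W.gt_iff w ⟨by linarith [hw.1, hu.1], by linarith [hw.2]⟩ lam hl.le).2 (hD w hw))
    (fun w hw =>
      (W.lt_iff w ⟨by linarith [hw.1], by linarith [hw.2, hu.2]⟩ lam hl.le).2 (hD' w hw))

lemma Well.repels_outside (W : Well s g G M c L) (hu : u ∈ Ioo (-s) s)
    (hl : s < lam) (e : M u = lam) {δ : ℝ} (hδ : 0 < δ) (hδ'' : -s ≤ u - δ)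
    (hD : ∀ w ∈ Ioo (u - δ) u, M w < lam) :
    (potentialField lam g).RepelsFrom (loop G u (2 * lam - u))
      (outsideOf (loop G u (2 * lam - u))) := by
  rw [W.outsideOf_loop hu hl e]
  have hz : s < 2 * lam - u := by linarith [hu.2]
  have he := W.chord_eq hu hl e
  have key := (W.valley_mirror (show s < 2 * lam - u + 1 by linarith)).attractsFrom_outside
    (lam := -lam) (x := -(2 * lam - u)) (δ := δ) ⟨by linarith, by linarith⟩
    ⟨by linarith [hu.2], by linarith [hu.1]⟩
    (by rw [neg_neg, show -(2 * -lam - -(2 * lam - u)) = u by ring, he]) hδ fun w hw => by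
      rw [show -(2 * -lam - w) = 2 * lam - -w by ring,
        show -w = 2 * lam - (2 * lam + w) by ring, sub_sub_cancel]
      -- In the mirror the roles of the ends are exchanged, and `w` near the mirrored right end
      -- corresponds to the left end `2 lam + w` of the original segment.
      have h1 : 2 * lam + w ∈ Ioo (u - δ) u := ⟨by linarith [hw.1], by linarith [hw.2]⟩
      exact (W.gt_iff _ ⟨by linarith [h1.1], by linarith [h1.2, hu.2]⟩ lam hl.le).2 (hD _ h1)
  rw [show 2 * -lam - -(2 * lam - u) = -u by ring] at key
  exact repelsFrom_of_mirror key (mem_loop_reflect he) fun p hp =>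
    ⟨fun h => hp.1 ((mem_loop_reflect he p).2 h), fun h => hp.2 ((mem_loopDomain_reflect he p).2 h)⟩

lemma Well.isRepeller_loop (W : Well s g G M c L) (hu : u ∈ Ioo (-s) s)
    (hl : s < lam) (e : M u = lam) {δ : ℝ} (hδ : 0 < δ) (hδ' : u + δ ≤ s) (hδ'' : -s ≤ u - δ)
    (hD : ∀ w ∈ Ioo (u - δ) u, M w < lam) (hD' : ∀ w ∈ Ioo u (u + δ), lam < M w) :
    (potentialField lam g).IsRepeller (loop G u (2 * lam - u)) := by
  have hz : s < 2 * lam - u := by linarith [hu.2]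
  have he := W.chord_eq hu hl e
  have key := (W.valley_mirror (show s < 2 * lam - u + 1 by linarith)).isAttractor_loop
    (lam := -lam) (x := -(2 * lam - u)) (δ := δ) ⟨by linarith, by linarith⟩
    ⟨by linarith [hu.2], by linarith [hu.1]⟩
    (by rw [neg_neg, show -(2 * -lam - -(2 * lam - u)) = u by ring, he]) hδ
    (fun w hw => by
      rw [show -(2 * -lam - w) = 2 * lam - -w by ring,
        show -w = 2 * lam - (2 * lam + w) by ring, sub_sub_cancel]
      have h1 : 2 * lam + w ∈ Ioo u (u + δ) := ⟨by linarith [hw.1], by linarith [hw.2]⟩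
      exact (W.lt_iff _ ⟨by linarith [h1.1, hu.1], by linarith [h1.2]⟩ lam hl.le).2 (hD' _ h1))
    (fun w hw => by
      rw [show -(2 * -lam - w) = 2 * lam - -w by ring,
        show -w = 2 * lam - (2 * lam + w) by ring, sub_sub_cancel]
      have h1 : 2 * lam + w ∈ Ioo (u - δ) u := ⟨by linarith [hw.1], by linarith [hw.2]⟩
      exact (W.gt_iff _ ⟨by linarith [h1.1], by linarith [h1.2, hu.2]⟩ lam hl.le).2 (hD _ h1))
  rw [show 2 * -lam - -(2 * lam - u) = -u by ring] at key
  exact repelsFrom_of_mirror key (mem_loop_reflect he) fun p _ => mem_univ _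

end

/-- The cycle whose left end lies on the decreasing branch of the midpoint function. -/
lemma Well.isAttractor_right (W : Well s g G M c L) (hl : s < lam) {u : ℝ} (hu : u ∈ Ioo c s)
    (e : M u = lam) : (potentialField lam g).IsAttractor (loop G u (2 * lam - u)) := by
  have hc := W.c_mem
  have hu' : u ∈ Icc c s := Ioo_subset_Icc_self hu
  have h1 : min (u - c) (s - u) ≤ u - c := min_le_left _ _
  have h2 : min (u - c) (s - u) ≤ s - u := min_le_right _ _
  refine W.isAttractor_loop ⟨hc.1.trans hu.1, hu.2⟩ hl e (δ := min (u - c) (s - u))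
    (lt_min (sub_pos.2 hu.1) (sub_pos.2 hu.2)) (by linarith) (by linarith [hc.1]) ?_ ?_
  · intro w hw
    rw [← e]
    exact W.mid_anti hu' ⟨by linarith [hw.1, hu.1], by linarith [hw.2]⟩ hw.1
  · intro w hw
    rw [← e]
    exact W.mid_anti ⟨by linarith [hw.1], by linarith [hw.2, hu.2]⟩ hu' hw.2

/-- The cycle whose left end lies on the increasing branch of the midpoint function. -/
lemma Well.isRepeller_left (W : Well s g G M c L) (hl : s < lam) {u : ℝ} (hu : u ∈ Ioo (-s) c)
    (e : M u = lam) : (potentialField lam g).IsRepeller (loop G u (2 * lam - u)) := by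
  have hc := W.c_mem
  have hu' : u ∈ Icc (-s) c := Ioo_subset_Icc_self hu
  have h1 : min (u + s) (c - u) ≤ u + s := min_le_left _ _
  have h2 : min (u + s) (c - u) ≤ c - u := min_le_right _ _
  refine W.isRepeller_loop ⟨hu.1, hu.2.trans hc.2⟩ hl e (δ := min (u + s) (c - u))
    (lt_min (by linarith [hu.1]) (sub_pos.2 hu.2)) (by linarith [hc.2]) (by linarith) ?_ ?_
  · intro w hw
    rw [← e]
    exact W.mid_mono ⟨by linarith [hw.1], by linarith [hw.2, hu.2]⟩ hu' hw.2
  · intro w hw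
    rw [← e]
    exact W.mid_mono hu' ⟨by linarith [hw.1, hu.1], by linarith [hw.2]⟩ hw.1

/-- Since `M < L` on both sides of `c`, the returns move to the left on both sides: towards the
cycle from the interior, away from it in the exterior. -/
lemma Well.semistable (W : Well s g G M c L) :
    (potentialField L g).AttractsFrom (loop G c (2 * L - c)) (insideOf (loop G c (2 * L - c))) ∧
    (potentialField L g).RepelsFrom (loop G c (2 * L - c)) (outsideOf (loop G c (2 * L - c))) := by
  have hc := W.c_mem
  constructor
  · exact W.attracts_inside hc W.lt_L W.mid_c (δ := s - c) (by linarith [hc.2]) (by linarith)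
      fun w hw => W.mid_lt ⟨by linarith [hw.1, hc.1], by linarith [hw.2]⟩ hw.1.ne'
  · exact W.repels_outside hc W.lt_L W.mid_c (δ := c + s) (by linarith [hc.1]) (by linarith)
      fun w hw => W.mid_lt ⟨by linarith [hw.1], by linarith [hw.2, hc.2]⟩ hw.2.ne

end KindI

/-! ### The focus of the grazing parameter and the semistable cycle -/

namespace Valley

variable {lam A m B : ℝ} {g G : ℝ → ℝ} {T : Set (ℝ × ℝ)} {q : ℝ × ℝ}

lemma _root_.PWS.FirstReturn.exists_runs {Z : PWS} {p : ℝ × ℝ} (h : Z.FirstReturn T p q) :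
    ∃ γ a b, a < b ∧ Z.Runs γ a b ∧ γ a = p ∧ γ b = q ∧ q ∈ T ∧ ∀ τ ∈ Ioo a b, γ τ ∉ T := by
  obtain ⟨n, t, k, γ, hn, h1, h2, h3, h4, h5⟩ := h
  exact ⟨γ, t 0, t n, lt_of_step_lt (fun i hi => (h1 i hi).1) hn le_rfl, PWS.runs_of_arcs h1, h2,
    h3, h4, h5⟩

/-- The first return to a section on the left of a valley. -/
lemma firstReturn_left (V : Valley g G A m B) {x u : ℝ} (hT : T ⊆ switching) (hx : x ∈ Ioo A m)
    (hz : 2 * lam - x ∈ Ioo m B) (hzT : (2 * lam - x, (0 : ℝ)) ∉ T) (hu : u ∈ Ioo A m)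
    (e : G u = G (2 * lam - x)) (huT : (u, (0 : ℝ)) ∈ T)
    (h : (potentialField lam g).FirstReturn T (x, 0) q) : q = (u, 0) := by
  obtain ⟨γ, a, b, hab, hr, ha, hb, hq, hτ⟩ := h.exists_runs
  have hl : x < lam := by linarith [hx.2, hz.1]
  have hpos : ∀ w ∈ Ioo x (2 * lam - x), 0 < 0 + (w - x) * (2 * lam - w - x) / 2 := fun w hw => by
    have := mul_pos (sub_pos.2 hw.1) (show 0 < 2 * lam - w - x by linarith [hw.2])
    linarith
  -- A return before the end of the upper arc is impossible: its interior is above the line and its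
  -- end is not in the section.
  have h1 : a + 2 * (lam - x) < b := by
    by_contra! hle
    have key := follow_upper V.deriv V.cont (z := x + (b - a)) (hr.mono le_rfl (by linarith)) ha
      (Or.inr ⟨rfl, hl, V.neg x hx⟩) (fun w hw => hpos w ⟨hw.1, by linarith [hw.2]⟩)
      (x + (b - a)) ⟨by linarith, le_rfl⟩
    rw [add_sub_cancel_left, add_sub_cancel, hb] at key
    rw [key] at hq
    have h0 : (0 : ℝ) + (b - a) * (2 * lam - (x + (b - a)) - x) / 2 = 0 := hT hq
    have h2 : 2 * lam - (x + (b - a)) - x = 0 := by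
      have : (b - a) * (2 * lam - (x + (b - a)) - x) = 0 := by linarith
      exact (mul_eq_zero.1 this).resolve_left (by linarith)
    rw [h0, show x + (b - a) = 2 * lam - x by linarith] at hq
    exact hzT hq
  have a1 := (follow_up V.deriv V.cont hl (V.neg x hx) (hr.mono le_rfl h1.le) ha).1
  have hlow := V.arc_lower hz (by linarith) a1
  have huz : u < 2 * lam - x := by linarith [hu.2, hz.1]
  have hlt : ∀ w ∈ Ioo u (2 * lam - x), G w < G (2 * lam - x) := fun w hw =>
    e ▸ V.lt_left_end hu.1.le hz.2.le (Or.inr e.ge) hw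
  have h2 : a + 2 * (lam - x) + (2 * lam - x - u) ≤ b := by
    by_contra! hlt'
    have key := follow_lower V.deriv V.cont (z := 2 * lam - x - (b - (a + 2 * (lam - x))))
      (hr.mono (by linarith) (by linarith)) a1 hlow
      (fun w hw => by linarith [hlt w ⟨by linarith [hw.1], hw.2⟩]) _ ⟨le_rfl, by linarith⟩
    rw [sub_sub_cancel, add_sub_cancel, hb] at key
    rw [key] at hq
    have h0 : (0 : ℝ) + (G (2 * lam - x - (b - (a + 2 * (lam - x)))) - G (2 * lam - x)) = 0 := hT hq
    linarith [hlt (2 * lam - x - (b - (a + 2 * (lam - x)))) ⟨by linarith, by linarith⟩]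
  have a2 := (V.follow_down (Ioo_subset_Icc_self hu) ⟨hz.1, hz.2.le⟩ hlow e
    (hr.mono (by linarith) h2) a1).1
  rcases eq_or_lt_of_le h2 with h3 | h3
  · rw [← hb, ← h3, a2]
  · exact absurd (a2 ▸ huT) (hτ _ ⟨by linarith, h3⟩)

/-- The first return to a section on the right of a valley. -/
lemma firstReturn_right (V : Valley g G A m B) {x u : ℝ} (hT : T ⊆ switching) (hx : x ∈ Ioo m B)
    (hl : lam < x) (hu : u ∈ Ioo A m) (hul : u < lam) (e : G u = G x) (huT : (u, (0 : ℝ)) ∉ T)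
    (hzT : (2 * lam - u, (0 : ℝ)) ∈ T)
    (h : (potentialField lam g).FirstReturn T (x, 0) q) : q = (2 * lam - u, 0) := by
  obtain ⟨γ, a, b, hab, hr, ha, hb, hq, hτ⟩ := h.exists_runs
  have hlow := V.arc_lower hx hl ha
  have hux : u < x := by linarith [hu.2, hx.1]
  have hlt : ∀ w ∈ Ioo u x, G w < G x := fun w hw =>
    e ▸ V.lt_left_end hu.1.le hx.2.le (Or.inr e.ge) hw
  have h1 : a + (x - u) < b := by
    by_contra! hle
    have key := follow_lower V.deriv V.cont (z := x - (b - a))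
      (hr.mono le_rfl (by linarith)) ha hlow
      (fun w hw => by linarith [hlt w ⟨by linarith [hw.1], hw.2⟩]) _ ⟨le_rfl, by linarith⟩
    rw [sub_sub_cancel, add_sub_cancel, hb] at key
    rw [key] at hq
    have h0 : (0 : ℝ) + (G (x - (b - a)) - G x) = 0 := hT hq
    rcases eq_or_lt_of_le (show u ≤ x - (b - a) by linarith) with h2 | h2
    · rw [h0, ← h2] at hq; exact huT hq
    · linarith [hlt (x - (b - a)) ⟨h2, by linarith⟩]
  have a1 := (V.follow_down (Ioo_subset_Icc_self hu) ⟨hx.1, hx.2.le⟩ hlow e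
    (hr.mono le_rfl h1.le) ha).1
  have hpos : ∀ w ∈ Ioo u (2 * lam - u), 0 < 0 + (w - u) * (2 * lam - w - u) / 2 := fun w hw => by
    have := mul_pos (sub_pos.2 hw.1) (show 0 < 2 * lam - w - u by linarith [hw.2])
    linarith
  have h2 : a + (x - u) + 2 * (lam - u) ≤ b := by
    by_contra! hlt'
    have key := follow_upper V.deriv V.cont (z := u + (b - (a + (x - u))))
      (hr.mono (by linarith) (by linarith)) a1
      (Or.inr ⟨rfl, hul, V.neg u hu⟩) (fun w hw => hpos w ⟨hw.1, by linarith [hw.2]⟩)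
      (u + (b - (a + (x - u)))) ⟨by linarith, le_rfl⟩
    rw [add_sub_cancel_left, add_sub_cancel, hb] at key
    rw [key] at hq
    have h0 : (0 : ℝ) + (b - (a + (x - u))) * (2 * lam - (u + (b - (a + (x - u)))) - u) / 2 = 0 :=
      hT hq
    have := mul_pos (show 0 < b - (a + (x - u)) by linarith)
      (show 0 < 2 * lam - (u + (b - (a + (x - u)))) - u by linarith)
    linarith
  have a2 := (follow_up V.deriv V.cont hul (V.neg u hu) (hr.mono (by linarith) h2) a1).1
  rcases eq_or_lt_of_le h2 with h3 | h3
  · rw [← hb, ← h3, a2]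
  · exact absurd (a2 ▸ hzT) (hτ _ ⟨by linarith, h3⟩)

end Valley

section

variable {lam s c L r : ℝ} {g G M : ℝ → ℝ}

/-- At a fold one of the two vertical components vanishes, so it is not a sewing point. -/
lemma PWS.KindI.not_kindIII {Z : PWS} {Γ : Set (ℝ × ℝ)} (h : Z.KindI Γ) : ¬ Z.KindIII Γ := by
  rintro ⟨v, hv, (hf | hf)⟩ <;> have := (h ⟨hv, hf.1⟩).2 <;> rw [hf.2.1] at this <;> simp at this

/-- Differentiation of `G (η x) = G (2L - x)` gives `g c · η' = -g (2L - c)`, and criticality of the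
gap at `c` makes the right side `g c`. The section may lie at either end of the cycle, and both
cases are needed. -/
lemma Well.semistable_not_hyperbolic (W : Well s g G M c L) :
    ¬ (potentialField L g).Hyperbolic (loop G c (2 * L - c)) := by
  have hc := W.c_mem
  have hL := W.lt_L
  have hs := W.pos
  have hz : s < 2 * L - c := by linarith [hc.2]
  have e := W.chord_eq hc hL W.mid_c
  have V := W.valley (show s < 2 * L - c + 1 by linarith)
  -- Because `M ≤ L`, the function `G (2L - u) - G u` is nonnegative near `c` and vanishes at `c`.
  have hmin : -g (2 * L - c) - g c = 0 := by
    have h1 : HasDerivAt (fun u => G (2 * L - u)) (-g (2 * L - c)) c :=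
      ((W.deriv (2 * L - c)).comp c ((hasDerivAt_id c).const_sub (2 * L))).congr_deriv (by simp)
    refine IsLocalMin.hasDerivAt_eq_zero ?_ (h1.sub (W.deriv c))
    filter_upwards [Icc_mem_nhds hc.1 hc.2] with u hu
    have h2 : M u ≤ L := by
      by_cases h : u = c
      · rw [h, W.mid_c]
      · exact (W.mid_lt hu h).le
    have := not_lt.2 h2
    rw [← W.lt_iff u hu L hL.le] at this
    simp only [Pi.sub_apply]
    linarith
  have hk : (potentialField L g).KindI (loop G c (2 * L - c)) :=
    (W.loop_isCanardCycle hc (by linarith [hc.2]) hz e.symm).2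
  rintro (⟨-, p, ε, μ, η, hε, hΓ, hS, hret, hd, hμ⟩ | hII | hIII)
  · have hp : p = c ∨ p = 2 * L - c := by
      have h1 : (p, (0 : ℝ)) ∈ loop G c (2 * L - c) := by
        have : (p, (0 : ℝ)) ∈ ({(p, 0)} : Set (ℝ × ℝ)) := rfl
        rw [← hΓ] at this
        exact this.1
      obtain ⟨h2, h3⟩ := mem_loop_iff.1 h1
      simp only at h2 h3
      by_contra! hne
      have h4 : p ∈ Ioo c (2 * L - c) := ⟨lt_of_le_of_ne h2.1 hne.1.symm, lt_of_le_of_ne h2.2 hne.2⟩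
      rcases h3 with h3 | h3
      · linarith [mul_pos (sub_pos.2 h4.1) (sub_pos.2 h4.2)]
      · linarith [W.chord_lt (Ioo_subset_Icc_self hc) hz.le e h4]
    -- The section consists of sewing points while `s` is a contact point between the two ends;
    -- hence the section contains only one of them.
    have hsT : s ∉ Ioo (p - ε) (p + ε) := fun h => by
      have := hS (show (s, (0 : ℝ)) ∈ Ioo (p - ε) (p + ε) ×ˢ {0} from ⟨h, rfl⟩)
      rw [mem_sewing, W.at_right] at this
      rcases this with h | h <;> linarith [h.2]
    have hT : Ioo (p - ε) (p + ε) ×ˢ {0} ⊆ switching := fun q hq => hq.2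
    have mT : ∀ {w : ℝ}, (w, (0 : ℝ)) ∈ Ioo (p - ε) (p + ε) ×ˢ {(0 : ℝ)} ↔ w ∈ Ioo (p - ε) (p + ε) :=
      fun {w} => ⟨fun h => h.1, fun h => ⟨h, rfl⟩⟩
    -- section points of levels close to that of the cycle
    obtain ⟨δ, hδ, hδε, hδ1, hδ2⟩ : ∃ δ > 0, δ ≤ ε ∧ -s < c - δ ∧ c + δ < s := by
      refine ⟨min ε (min ((c + s) / 2) ((s - c) / 2)), lt_min hε (lt_min ?_ ?_),
        min_le_left _ _, ?_, ?_⟩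
      · linarith [hc.1]
      · linarith [hc.2]
      · have := (min_le_right ε (min ((c + s) / 2) ((s - c) / 2))).trans (min_le_left _ _)
        linarith [hc.1]
      · have := (min_le_right ε (min ((c + s) / 2) ((s - c) / 2))).trans (min_le_right _ _)
        linarith [hc.2]
    have hsec : ∀ {x₀ : ℝ} {φ : ℝ → ℝ}, ContinuousAt φ x₀ → φ x₀ = G c →
        ∀ᶠ x in 𝓝 x₀, ∃ u ∈ Ioo (c - δ) (c + δ), G u = φ x := by
      intro x₀ φ hφ h0
      have h1 : G (c + δ) < φ x₀ := h0 ▸ V.anti ⟨hc.1.le, hc.2.le⟩ ⟨by linarith, hδ2.le⟩ (by linarith)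
      have h2 : φ x₀ < G (c - δ) := h0 ▸ V.anti ⟨hδ1.le, by linarith⟩ ⟨hc.1.le, hc.2.le⟩ (by linarith)
      filter_upwards [hφ.eventually (Ioo_mem_nhds h1 h2)] with x hx
      exact intermediate_value_Ioo' (by linarith) V.continuous.continuousOn hx
    have hgc : g c < 0 := W.inner c hc
    have hGc := V.continuous
    rcases hp with rfl | rfl
    · have hps : p + ε ≤ s := by
        by_contra! h
        exact hsT ⟨by linarith [hc.2], h⟩
      have hz' : ∀ᶠ x in 𝓝 p, x ∈ Ioo (-s) s ∧ 2 * L - x ∈ Ioo s (2 * L - p + 1) :=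
        Filter.Eventually.and (Ioo_mem_nhds hc.1 hc.2) <|
          (show ContinuousAt (fun x => 2 * L - x) p by fun_prop).eventually
            (Ioo_mem_nhds hz (by linarith))
      -- `FirstReturn` is only a relation, so the value of `η` has to be identified with the return
      -- point given by the level.
      have key : ∀ᶠ x in 𝓝 p, η x ∈ Ioo (p - δ) (p + δ) ∧ G (η x) = G (2 * L - x) := by
        filter_upwards [hret, hz', hsec (φ := fun x => G (2 * L - x)) (by fun_prop) e.symm]
          with x h1 h2 h3
        obtain ⟨u, hu, hu'⟩ := h3
        have h4 := V.firstReturn_left hT h2.1 h2.2 (fun h => by linarith [(mT.1 h).2, h2.2.1])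
          ⟨by linarith [hu.1], by linarith [hu.2]⟩ hu'
          (mT.2 ⟨by linarith [hu.1], by linarith [hu.2]⟩) h1
        rw [Prod.mk.injEq] at h4
        rw [h4.1]
        exact ⟨hu, hu'⟩
      obtain ⟨k1, k2⟩ := key.self_of_nhds
      have hη : η p = p := by
        rw [← e] at k2
        exact V.anti.injOn ⟨by linarith [k1.1], by linarith [k1.2]⟩ ⟨hc.1.le, hc.2.le⟩ k2
      have d1 : HasDerivAt (fun x => G (η x)) (g p * μ) p := by
        have h3 : HasDerivAt G (g p) (η p) := by rw [hη]; exact W.deriv p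
        exact h3.comp p hd
      have d2 : HasDerivAt (fun x => G (2 * L - x)) (-g (2 * L - p)) p :=
        ((W.deriv (2 * L - p)).comp p ((hasDerivAt_id p).const_sub (2 * L))).congr_deriv (by simp)
      have := d1.unique (d2.congr_of_eventuallyEq (key.mono fun x hx => hx.2))
      exact hμ (mul_left_cancel₀ hgc.ne (by linarith))
    · have hps : s ≤ 2 * L - c - ε := by
        by_contra! h
        exact hsT ⟨h, by linarith⟩
      have hz' : ∀ᶠ x in 𝓝 (2 * L - c), x ∈ Ioo s (2 * L - c + 1) ∧ L < x :=
        Filter.Eventually.and (Ioo_mem_nhds hz (lt_add_one _)) (Ioi_mem_nhds (by linarith [hc.2]))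
      have key : ∀ᶠ x in 𝓝 (2 * L - c), 2 * L - η x ∈ Ioo (c - δ) (c + δ) ∧
          G (2 * L - η x) = G x := by
        filter_upwards [hret, hz', hsec hGc.continuousAt e.symm] with x h1 h2 h3
        obtain ⟨u, hu, hu'⟩ := h3
        have h4 := V.firstReturn_right hT h2.1 h2.2 ⟨by linarith [hu.1], by linarith [hu.2]⟩
          (by linarith [hu.2]) hu' (fun h => by linarith [(mT.1 h).1, hu.2])
          (mT.2 ⟨by linarith [hu.2], by linarith [hu.1]⟩) h1
        rw [Prod.mk.injEq] at h4
        rw [h4.1, sub_sub_cancel]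
        exact ⟨hu, hu'⟩
      obtain ⟨k1, k2⟩ := key.self_of_nhds
      have hη : 2 * L - η (2 * L - c) = c := by
        rw [← e] at k2
        exact V.anti.injOn ⟨by linarith [k1.1], by linarith [k1.2]⟩ ⟨hc.1.le, hc.2.le⟩ k2
      have d1 : HasDerivAt (fun x => G (2 * L - η x)) (g c * -μ) (2 * L - c) := by
        have h3 : HasDerivAt G (g c) (2 * L - η (2 * L - c)) := by rw [hη]; exact W.deriv c
        exact h3.comp (2 * L - c) (hd.const_sub (2 * L))
      have := d1.unique ((W.deriv (2 * L - c)).congr_of_eventuallyEq (key.mono fun x hx => hx.2))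
      exact hμ (mul_left_cancel₀ hgc.ne (by linarith))
  · have h1 : (c - 1, (0 : ℝ)) ∈ loop G c (2 * L - c) := by
      rw [show loop G c (2 * L - c) = switching from hII]; rfl
    have := (mem_loop_iff.1 h1).1.1
    simp only at this
    linarith
  · exact hk.not_kindIII hIII.1

/-- At the parameter `s` no trajectory passes through the point `s`. -/
lemma Well.ne_of_runs (W : Well s g G M c L) {γ : ℝ → ℝ × ℝ} {T : ℝ}
    (hr : ∀ b, (potentialField s g).Runs γ T b) : ∀ t ≥ T, γ t ≠ (s, 0) := by
  intro t ht e
  have hs := W.pos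
  obtain ⟨k, t', htt', hk⟩ := (hr (t + 1)).2 t ⟨ht, by linarith⟩
  cases k with
  | upper => exact not_upper_of_le le_rfl e hk
  | lower =>
    -- The time is short enough that the orbit has not yet left the descending branch, on which the
    -- potential exceeds that at `s`.
    obtain ⟨w, hw, hw'⟩ : ∃ w < t', t < w ∧ w < t + 2 * s := by
      refine ⟨min ((t + t') / 2) (t + s), (min_le_left _ _).trans_lt (by linarith),
        lt_min (by linarith) (by linarith), (min_le_right _ _).trans_lt (by linarith)⟩
    obtain ⟨h1, h2⟩ := lower_arc W.deriv hk (τ := w) ⟨hw'.1.le, hw.le⟩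
    have h3 := hk.2.2.1 w ⟨hw'.1.le, hw.le⟩
    rw [e] at h1 h2
    simp only at h1 h2
    have := W.strictAntiOn_mid (a := s - (w - t)) (b := s) ⟨by linarith, by linarith⟩
      ⟨by linarith, le_rfl⟩ (by linarith)
    rw [h1] at h2
    linarith
  | sliding =>
    refine not_sliding_of_eventually ?_ e hk
    filter_upwards [Ioi_mem_nhds (show -s < s by linarith)] with w hw
    have hw : -s < w := hw
    rw [mem_regions, W.pos_iff, W.neg_iff]
    rintro (⟨h1, h2 | h2⟩ | ⟨h1, h2⟩)
    · linarith
    · linarith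
    · linarith [h2.2]

/-- After reaching the left half of the section, the returns increase to `s` because `M > s` on
`(-s, s)`. The turns become arbitrarily short, so `Well.ne_of_runs` is needed to exclude
accumulation in finite time; the limit loop is the point `s`. -/
lemma Well.tendsto_focus (W : Well s g G M c L) {γ : ℝ → ℝ × ℝ}
    (hγ : (potentialField s g).IsTrajectory γ) (h0 : γ 0 ∈ loopDomain G (-s) (3 * s)) :
    Tendsto γ atTop (𝓝 (s, 0)) := by
  have hs := W.pos
  have hr := fun b => hγ.runs le_rfl b
  have V := W.valley (show s < 4 * s by linarith)
  have V' := W.valley (show s < 3 * s by linarith)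
  obtain ⟨p, q, hpq⟩ : ∃ p q, γ 0 = (p, q) := ⟨(γ 0).1, (γ 0).2, rfl⟩
  rw [hpq] at h0
  obtain ⟨h1, h2, h3⟩ := h0
  simp only at h1 h2 h3
  have right : ∀ t ≥ 0, ∀ z ∈ Ioo s (3 * s), γ t = (z, 0) →
      ∃ T ≥ 0, ∃ u ∈ Ioo (-s) s, γ T = (u, 0) := by
    intro t ht z hz hγt
    obtain ⟨u, hu, e⟩ := V'.exists_left (ℓ := G z)
      (V'.mono ⟨le_rfl, by linarith⟩ ⟨hz.1.le, hz.2.le⟩ hz.1)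
      (by rw [← W.level]; exact V'.mono ⟨hz.1.le, hz.2.le⟩ ⟨by linarith, le_rfl⟩ hz.2)
    obtain ⟨t', ht', h⟩ := V'.reach_right hz hz.1 (Ioo_subset_Icc_self hu) e
      (fun b => hγ.runs ht b) hγt
    exact ⟨t', by linarith, u, hu, h⟩
  obtain ⟨T, hT, u, hu, hγT⟩ : ∃ T ≥ 0, ∃ u ∈ Ioo (-s) s, γ T = (u, 0) := by
    rcases lt_trichotomy q 0 with hq | hq | hq
    · obtain ⟨u, hu, e⟩ := V'.exists_left (ℓ := G p - q)
        (by linarith [V'.bottom_le (Ioo_subset_Icc_self h1)]) (by rw [← W.level]; linarith)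
      obtain ⟨t', ht', h⟩ := V'.reach_neg ⟨h1.1, h1.2.le⟩ hq hu e hr hpq
      exact ⟨t', ht', u, hu, h⟩
    · subst hq
      rcases lt_trichotomy p s with h | h | h
      · exact ⟨0, le_rfl, p, ⟨h1.1, h⟩, hpq⟩
      · exact absurd (h ▸ hpq) (W.ne_of_runs hr 0 le_rfl)
      · exact right 0 le_rfl p ⟨h, h1.2⟩ hpq
    · obtain ⟨t, ht, z, hz, hγt, e⟩ := reach_of_pos W.deriv W.cont hr hpq hq
      refine right t ht z ⟨hz, ?_⟩ hγt
      linarith [lt_of_sq_lt (show (z - s) ^ 2 < (2 * s) ^ 2 by rw [e]; linarith) (by linarith)]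
  have hr' := fun b => hγ.runs hT b
  have key := V.tendsto_up hu.1 hu.2 le_rfl (by linarith) (by linarith [hu.1]) (by ring_nf)
    (fun w hw => (W.lt_iff w ⟨by linarith [hw.1, hu.1], hw.2.le⟩ s le_rfl).2
      (W.mid_gt ⟨by linarith [hw.1, hu.1], hw.2⟩)) hr' hγT (Or.inr (W.ne_of_runs hr'))
  rw [show 2 * s - s = s by ring, loop_self] at key
  simp only [Metric.infDist_singleton] at key
  exact tendsto_iff_dist_tendsto_zero.2 key

end

/-! ### Cycles through the visible fold repel -/

section Sliding

variable {lam s x₁ κ : ℝ} {g G : ℝ → ℝ} {γ : ℝ → ℝ × ℝ} {a b : ℝ}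

/-- Along a sliding arc the abscissa moves at least with the given speed. -/
lemma slide_le (h : (potentialField lam g).IsArc .sliding γ a b)
    (hs : ∀ τ ∈ Ioo a b, slide lam g (γ τ).1 ≤ -κ) : (γ b).1 ≤ (γ a).1 - κ * (b - a) := by
  obtain ⟨hab, hc, h1, h2⟩ := h
  obtain ⟨τ, hτ, e⟩ := exists_hasDerivAt_eq_slope (fun τ => (γ τ).1)
    (fun τ => slide lam g (γ τ).1) hab hc.fst (fun τ hτ => by
      refine (hasDerivAt_fst_comp (h2 τ hτ).2).congr_deriv ?_
      rw [show γ τ = ((γ τ).1, 0) from Prod.ext rfl (h1 τ (Ioo_subset_Icc_self hτ)), filippov_eq])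
  have h3 := hs τ hτ
  rw [e, div_le_iff₀ (sub_pos.2 hab)] at h3
  linarith

/-- The speed bound forces arrival at `s` within time `(x - s) / κ`; before that only sliding arcs
can start. -/
lemma slide_reach (hG : ∀ x, HasDerivAt G (g x) x) (hls : lam < s) (hκ : 0 < κ)
    (hneg : ∀ w ∈ Ioo s x₁, g w < 0) (hslide : ∀ w ∈ Ioo s x₁, slide lam g w ≤ -κ) {x : ℝ}
    (hx : x ∈ Ico s x₁) (hr : ∀ b, (potentialField lam g).Runs γ a b) (ha : γ a = (x, 0)) :
    ∃ t ≥ a, γ t = (s, 0) ∧ ∀ τ ∈ Icc a t, ∃ w ∈ Icc s x, γ τ = (w, 0) := by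
  -- As long as the end is not hit, the trajectory stays on the segment and loses abscissa at rate
  -- at least `κ`, a closed condition that propagates to the right.
  have core : ∀ N, (∀ τ ∈ Icc a N, γ τ ≠ (s, 0)) →
      Icc a N ⊆ {τ | γ τ ∈ {p : ℝ × ℝ | p.2 = 0 ∧ s ≤ p.1} ∧ (γ τ).1 + κ * (τ - a) ≤ x} := by
    intro N hN
    have hc := (hr N).1
    refine IsClosed.Icc_subset_of_forall_exists_gt ?_ ?_ ?_
    · have e1 : {τ | γ τ ∈ {p : ℝ × ℝ | p.2 = 0 ∧ s ≤ p.1} ∧ (γ τ).1 + κ * (τ - a) ≤ x} ∩ Icc a N =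
          (Icc a N ∩ γ ⁻¹' {p : ℝ × ℝ | p.2 = 0 ∧ s ≤ p.1}) ∩
          (Icc a N ∩ (fun τ => (γ τ).1 + κ * (τ - a)) ⁻¹' Iic x) := by
        ext τ
        simp only [mem_inter_iff, mem_preimage, mem_ofPred_eq, mem_Iic]
        tauto
      rw [e1]
      refine (hc.preimage_isClosed_of_isClosed isClosed_Icc ?_).inter
        (ContinuousOn.preimage_isClosed_of_isClosed ?_ isClosed_Icc isClosed_Iic)
      · exact (isClosed_eq continuous_snd continuous_const).inter
          (isClosed_le continuous_const continuous_fst)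
      · exact hc.fst.add (by fun_prop)
    · simp [ha, hx.1]
    · rintro t ⟨⟨⟨h1, h2⟩, h3⟩, ht⟩ y hy
      have eγ : γ t = ((γ t).1, 0) := Prod.ext rfl h1
      have h4 : s < (γ t).1 := lt_of_le_of_ne h2 fun h => hN t ⟨ht.1, ht.2.le⟩ (by rw [eγ, ← h])
      have h5 : (γ t).1 < x₁ := by
        nlinarith [mul_nonneg hκ.le (sub_nonneg.2 ht.1), hx.2]
      obtain ⟨k, t', htt', hk⟩ := (hr N).2 t ht
      have hk' := arc_eq_sliding hG eγ (hls.trans h4) (hneg _ ⟨h4, h5⟩) hk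
      subst hk'
      have hcont : ContinuousWithinAt (fun τ => (γ τ).1) (Icc t t') t :=
        hk.2.1.fst t (left_mem_Icc.2 htt'.le)
      have hev : ∀ᶠ τ in 𝓝[>] t, (γ τ).1 ∈ Ioo s x₁ := by
        have := hcont.eventually (Ioo_mem_nhds h4 h5)
        rw [nhdsWithin_Icc_eq_nhdsGE htt'] at this
        exact this.filter_mono (nhdsWithin_mono _ Ioi_subset_Ici_self)
      obtain ⟨c, hc1, hc2⟩ := (mem_nhdsGT_iff_exists_Ioo_subset (a := t)).1 hev
      have hc1 : t < c := hc1
      set q := min ((t + c) / 2) (min t' y) with hq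
      have q1 : t < q := lt_min (by linarith) (lt_min htt' hy)
      have q2 : q < c := (min_le_left _ _).trans_lt (by linarith)
      have q3 : q ≤ t' := (min_le_right _ _).trans (min_le_left _ _)
      have q4 : q ≤ y := (min_le_right _ _).trans (min_le_right _ _)
      have hle := slide_le (κ := κ) (hk.mono le_rfl q1 q3) fun τ hτ =>
        hslide _ (hc2 ⟨hτ.1, hτ.2.trans q2⟩)
      have h6 : (γ q).1 ∈ Ioo s x₁ := hc2 ⟨q1, q2⟩
      exact ⟨q, ⟨⟨hk.2.2.1 q ⟨q1.le, q3⟩, h6.1.le⟩, by linarith⟩, q1, q4⟩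
  set N := a + (x - s) / κ with hN
  have haN : a ≤ N := by
    have := div_nonneg (sub_nonneg.2 hx.1) hκ.le
    linarith
  obtain ⟨τ₀, hτ₀, e₀⟩ : ∃ τ ∈ Icc a N, γ τ = (s, 0) := by
    by_contra! h
    obtain ⟨⟨h1, h2⟩, h3⟩ := core N h (right_mem_Icc.2 haN)
    have h4 : κ * (N - a) = x - s := by rw [hN]; field_simp; ring
    rw [h4] at h3
    exact h N (right_mem_Icc.2 haN) (Prod.ext (by simp only; linarith) h1)
  have hcpt : IsCompact (Icc a N ∩ γ ⁻¹' {(s, 0)}) :=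
    isCompact_Icc.of_isClosed_subset
      ((hr N).1.preimage_isClosed_of_isClosed isClosed_Icc isClosed_singleton) inter_subset_left
  obtain ⟨t, ⟨ht, ht'⟩, hmin⟩ := hcpt.exists_isLeast ⟨τ₀, hτ₀, e₀⟩
  have ht' : γ t = (s, 0) := ht'
  refine ⟨t, ht.1, ht', fun τ hτ => ?_⟩
  rcases eq_or_lt_of_le hτ.2 with h | h
  · exact ⟨s, ⟨le_rfl, hx.1⟩, by rw [h, ht']⟩
  · obtain ⟨⟨h1, h2⟩, h3⟩ := core τ (fun σ hσ e => absurd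
      (hmin ⟨⟨hσ.1, by linarith [hσ.2, ht.2]⟩, e⟩) (not_le.2 (hσ.2.trans_lt h)))
      (right_mem_Icc.2 hτ.1)
    exact ⟨_, ⟨h2, by nlinarith [mul_nonneg hκ.le (sub_nonneg.2 hτ.1)]⟩, Prod.ext rfl h1⟩

/-- From a visible fold at the end of a sliding segment only the lower field leaves. -/
lemma arc_eq_lower_of_fold (hls : lam < s) (hκ : 0 < κ) {x₀ : ℝ}
    (hx₀ : x₀ < s) (hx₁ : s < x₁) (hpos : ∀ w ∈ Ioo x₀ s, 0 < g w) (hgs : g s = 0)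
    (hslide : ∀ w ∈ Ioo s x₁, slide lam g w ≤ -κ)
    (ha : γ a = (s, 0)) {k : ArcKind} (hk : (potentialField lam g).IsArc k γ a b) : k = .lower := by
  cases k with
  | lower => rfl
  | upper => exact absurd hk (not_upper_of_le hls.le ha)
  | sliding =>
    exfalso
    have hcont : ContinuousWithinAt (fun τ => (γ τ).1) (Icc a b) a :=
      hk.2.1.fst a (left_mem_Icc.2 hk.1.le)
    have hev : ∀ᶠ τ in 𝓝[>] a, (γ τ).1 ∈ Ioo (max x₀ lam) x₁ := by
      have := hcont.eventually (Ioo_mem_nhds (a := max x₀ lam) (b := x₁)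
        (by simp only [ha]; exact max_lt hx₀ hls) (by simp only [ha]; exact hx₁))
      rw [nhdsWithin_Icc_eq_nhdsGE hk.1] at this
      exact this.filter_mono (nhdsWithin_mono _ Ioi_subset_Ici_self)
    obtain ⟨c, hc1, hc2⟩ := (mem_nhdsGT_iff_exists_Ioo_subset (a := a)).1 hev
    have hc1 : a < c := hc1
    -- A slide near the fold must run to its right, since between `lam` and the fold there are
    -- sewing points; but there the field pushes it back to the left.
    have hgt : ∀ τ ∈ Ioo a (min b c), (γ τ).1 ∈ Ioo s x₁ := by
      intro τ hτ
      have h1 : (γ τ).1 ∈ Ioo (max x₀ lam) x₁ := hc2 ⟨hτ.1, hτ.2.trans_le (min_le_right _ _)⟩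
      have h2 : τ ∈ Ioo a b := ⟨hτ.1, hτ.2.trans_le (min_le_left _ _)⟩
      have h3 := (hk.2.2.2 τ h2).1
      rw [show γ τ = ((γ τ).1, 0) from Prod.ext rfl (hk.2.2.1 τ (Ioo_subset_Icc_self h2)),
        mem_regions] at h3
      refine ⟨?_, h1.2⟩
      have h4 := max_lt_iff.1 h1.1
      rcases h3 with h3 | h3
      · linarith [h3.1]
      · by_contra! hle
        rcases eq_or_lt_of_le hle with h | h
        · rw [h, hgs] at h3; exact lt_irrefl _ h3.2
        · linarith [hpos _ ⟨h4.1, h⟩, h3.2]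
    have hab := hk.1
    have hm : a < min b c := lt_min hk.1 hc1
    have h5 := slide_le (κ := κ) (hk.mono (b' := (a + min b c) / 2) le_rfl (by linarith)
      (by linarith [min_le_left b c])) fun τ hτ => hslide _ (hgt τ ⟨hτ.1, by linarith [hτ.2]⟩)
    rw [ha] at h5
    simp only at h5
    have h6 := (hgt ((a + min b c) / 2) ⟨by linarith, by linarith⟩).1
    nlinarith [mul_pos hκ (show 0 < (a + min b c) / 2 - a by linarith)]

end Sliding

section Capture

variable {lam s c L r : ℝ} {g G M : ℝ → ℝ}

lemma slide_mirror (x : ℝ) : slide (-lam) (fun x => -g (-x)) x = slide lam g (-x) := by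
  rw [slide, slide, ← neg_div_neg_eq]
  congr 1 <;> ring

/-- The bound is a maximum over a compact segment. It needs `-s < lam`, which keeps the denominator
away from zero up to the fold. -/
lemma Well.slide_bound (W : Well s g G M c L) (hl : -s < lam) :
    ∃ κ > 0, ∀ w ∈ Icc s (1 / 4), slide (-lam) (fun x => -g (-x)) w ≤ -κ := by
  have hs := W.pos
  have hs' := W.small
  have hgc := W.cont
  have hden : ∀ w ∈ Icc s (1 / 4 : ℝ), -w - g (-w) - lam ≠ 0 := by
    intro w hw
    have : 0 ≤ g (-w) := by
      rcases eq_or_lt_of_le hw.1 with h | h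
      · rw [← h, W.at_left]
      · exact (W.out_left _ (by linarith)).le
    have := hw.1
    exact ne_of_lt (by linarith)
  have hcont : ContinuousOn (fun w => slide lam g (-w)) (Icc s (1 / 4)) := by
    unfold slide
    exact ContinuousOn.div (by fun_prop) (by fun_prop) hden
  obtain ⟨x, hx, hmax⟩ := isCompact_Icc.exists_isMaxOn (nonempty_Icc.2 (by linarith)) hcont
  have hneg : slide lam g (-x) < 0 := by
    rcases eq_or_lt_of_le hx.1 with h | h
    · rw [← h, slide, W.at_left]
      exact div_neg_of_pos_of_neg (by linarith) (by linarith)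
    · exact W.slide_neg_of_ge hl.le ⟨by linarith [hx.2], by linarith⟩
  refine ⟨-slide lam g (-x), by linarith, fun w hw => ?_⟩
  rw [slide_mirror, neg_neg]
  exact hmax hw

/-- The mirror image of `bigLoop`, for the mirrored potential. -/
def bigLoopMirror (s l : ℝ) (H : ℝ → ℝ) : Set (ℝ × ℝ) :=
  trace H .sliding s (2 * l + 3 * s) ∪ trace H .upper (-(3 * s)) (2 * l + 3 * s) ∪
    trace H .lower s (-(3 * s))

lemma mem_sliding_iff {G : ℝ → ℝ} {a b : ℝ} {p : ℝ × ℝ} :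
    p ∈ trace G .sliding a b ↔ p.1 ∈ uIcc a b ∧ p.2 = 0 := by
  constructor
  · rintro ⟨w, hw, rfl⟩; exact ⟨hw, rfl⟩
  · rintro ⟨h, e⟩; exact ⟨p.1, h, Prod.ext rfl e.symm⟩

lemma Well.mem_bigLoop_mirror (W : Well s g G M c L) (p : ℝ × ℝ) :
    p ∈ bigLoop s lam G ↔ reflect p ∈ bigLoopMirror s (-lam) fun x => G (-x) := by
  have h : -p.1 ∈ uIcc s (2 * -lam + 3 * s) ↔ p.1 ∈ uIcc (-s) (2 * lam - 3 * s) := by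
    simp only [mem_uIcc]
    constructor <;> rintro (h | h) <;> first
      | exact Or.inl ⟨by linarith [h.1, h.2], by linarith [h.1, h.2]⟩
      | exact Or.inr ⟨by linarith [h.1, h.2], by linarith [h.1, h.2]⟩
  have h' : -p.1 ∈ Icc (-(3 * s)) (2 * -lam + 3 * s) ↔ p.1 ∈ Icc (2 * lam - 3 * s) (3 * s) := by
    constructor <;> intro h <;> exact ⟨by linarith [h.1, h.2], by linarith [h.1, h.2]⟩
  have h'' : -p.1 ∈ Icc (-(3 * s)) s ↔ p.1 ∈ Icc (-s) (3 * s) := by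
    constructor <;> intro h <;> exact ⟨by linarith [h.1, h.2], by linarith [h.1, h.2]⟩
  simp only [bigLoop, bigLoopMirror, mem_union, mem_sliding_iff, upper_mem_Icc_iff,
    lower_mem_Icc_iff, reflect, h, h', h'', neg_neg, W.level]
  rw [show (-p.1 - -(3 * s)) * (2 * -lam + 3 * s - -p.1) / 2 =
    (p.1 - (2 * lam - 3 * s)) * (3 * s - p.1) / 2 by ring]

variable {h H : ℝ → ℝ} {l κ x₁ B : ℝ} {γ : ℝ → ℝ × ℝ} {T : ℝ}

/-- A sliding segment on the right of a visible fold `s` with valley on the left. -/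
structure Funnel (s l κ x₁ : ℝ) (h H : ℝ → ℝ) : Prop where
  pos : 0 < s
  valley : Valley h H (-(4 * s)) (-s) s
  level : H (-(3 * s)) = H s
  left : -s ≤ l
  right : l < s
  speed : 0 < κ
  at_fold : h s = 0
  neg : ∀ w ∈ Ioo s x₁, h w < 0
  slide_le : ∀ w ∈ Ioo s x₁, slide l h w ≤ -κ
  far : 2 * l + 3 * s < x₁

namespace Funnel

/-- From the fold the motion is forced: lower arc to `-3s`, upper arc to `2l + 3s`, slide back to
the fold. -/
lemma turn (F : Funnel s l κ x₁ h H)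
    (hr : ∀ b, (potentialField l h).Runs γ T b) (ha : γ T = (s, 0)) :
    ∃ t ≥ T + 4 * s, γ t = (s, 0) ∧ ∀ τ ∈ Icc T t, γ τ ∈ bigLoopMirror s l H := by
  have V := F.valley
  have hs := F.pos
  have hl := F.left
  obtain ⟨a1, a2⟩ := V.follow_down (T := T) (lam := l) (u := -(3 * s)) ⟨by linarith, by linarith⟩
    ⟨by linarith, le_rfl⟩ (fun k t' _ hk => arc_eq_lower_of_fold F.right F.speed
      (show -s < s by linarith) (show s < x₁ by linarith [F.far]) V.pos F.at_fold F.slide_le ha hk)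
    F.level (hr _) ha
  rw [sub_neg_eq_add, show T + (s + 3 * s) = T + 4 * s by ring] at a1 a2
  obtain ⟨b1, b2⟩ := follow_up V.deriv V.cont (show -(3 * s) < l by linarith)
    (V.neg _ ⟨by linarith, by linarith⟩) ((hr _).mono (by linarith) le_rfl) a1
  rw [show 2 * l - -(3 * s) = 2 * l + 3 * s by ring] at b1 b2
  set T₂ := T + 4 * s + 2 * (l - -(3 * s)) with hT₂
  have hT : T + 4 * s ≤ T₂ := by linarith
  obtain ⟨t, ht, c1, c2⟩ := slide_reach V.deriv F.right F.speed F.neg F.slide_le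
    (x := 2 * l + 3 * s) ⟨by linarith, F.far⟩ (fun b => (hr b).mono (by linarith) le_rfl) b1
  refine ⟨t, hT.trans ht, c1, fun τ hτ => ?_⟩
  rcases le_total τ (T + 4 * s) with h1 | h1
  · exact Or.inr (a2 τ ⟨hτ.1, h1⟩)
  rcases le_total τ T₂ with h2 | h2
  · exact Or.inl (Or.inr (b2 τ ⟨h1, h2⟩))
  · obtain ⟨w, hw, e⟩ := c2 τ ⟨h2, hτ.2⟩
    exact Or.inl (Or.inl ⟨w, by rwa [uIcc_of_le (by linarith)], e.symm⟩)

/-- Each turn takes at least the time `4s` of its lower arc, so the turns cover all later times and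
the distance to the cycle is zero. -/
lemma stay (F : Funnel s l κ x₁ h H)
    (hr : ∀ b, (potentialField l h).Runs γ T b) (ha : γ T = (s, 0)) :
    Tendsto (fun τ => Metric.infDist (γ τ) (bigLoopMirror s l H)) atTop (𝓝 0) := by
  have hs := F.pos
  have key : ∀ n : ℕ, ∃ t ≥ T + n * (4 * s), γ t = (s, 0) ∧
      ∀ τ ∈ Icc T t, γ τ ∈ bigLoopMirror s l H := by
    intro n
    induction n with
    | zero =>
      obtain ⟨t, ht, -, h⟩ := F.turn hr ha
      exact ⟨T, by simp, ha, fun τ hτ => h τ ⟨hτ.1, by linarith [hτ.2]⟩⟩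
    | succ n ih =>
      obtain ⟨t, ht, e, h1⟩ := ih
      have hTt : T ≤ t := by
        have : (0 : ℝ) ≤ n * (4 * s) := by positivity
        linarith
      obtain ⟨t', ht', e', h2⟩ := F.turn (fun b => (hr b).mono hTt le_rfl) e
      refine ⟨t', by push_cast; linarith, e', fun τ hτ => ?_⟩
      rcases le_total τ t with h3 | h3
      · exact h1 τ ⟨hτ.1, h3⟩
      · exact h2 τ ⟨h3, hτ.2⟩
  refine tendsto_const_nhds.congr' ?_
  filter_upwards [eventually_ge_atTop T] with τ hτ
  obtain ⟨n, hn⟩ := exists_nat_gt ((τ - T) / (4 * s))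
  obtain ⟨t, ht, -, h1⟩ := key n
  rw [div_lt_iff₀ (by linarith)] at hn
  exact (Metric.infDist_zero_of_mem (h1 τ ⟨hτ, by linarith⟩)).symm

/-- All trajectories that start near the cycle reach the fold, or a point of the section inside
the cycle from which the upper field does not lead to the sliding segment. -/
lemma reach (F : Funnel s l κ x₁ h H)
    {δ : ℝ} (hδ : 0 < δ) (hδs : δ < s) (hδx : 2 * l + 3 * s + δ < x₁) :
    ∃ U, IsOpen U ∧ bigLoopMirror s l H ⊆ U ∧
      ∀ γ, (∀ b, (potentialField l h).Runs γ 0 b) → γ 0 ∈ U → ∃ T ≥ 0, γ T = (s, 0) ∨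
        ∃ u ∈ Ioo (-(3 * s) - δ) (-(3 * s) + δ), 2 * l - u < s ∧ γ T = (u, 0) := by
  have V := F.valley
  have hV := V.continuous
  have hs := F.pos
  have hl := F.left
  have hls := F.right
  have hlevel := F.level
  have hx₁ : s < x₁ := by linarith
  have hanti : StrictAntiOn H (Ico s x₁) :=
    strictAntiOn_of_hasDerivWithinAt_neg (convex_Ico _ _) hV.continuousOn
      (fun x _ => (V.deriv x).hasDerivWithinAt)
      (fun x hx => F.neg x (by rwa [interior_Ico] at hx))
  have m3 : -(3 * s) ∈ Icc (-(4 * s)) (-s) := ⟨by linarith, by linarith⟩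
  have m1 : -(3 * s) - δ ∈ Icc (-(4 * s)) (-s) := ⟨by linarith, by linarith⟩
  have m2 : -(3 * s) + δ ∈ Icc (-(4 * s)) (-s) := ⟨by linarith, by linarith⟩
  have m0 : -s ∈ Icc (-(4 * s)) (-s) := ⟨by linarith, le_rfl⟩
  have g1 : H s < H (-(3 * s) - δ) := hlevel ▸ V.anti m1 m3 (by linarith)
  have g2 : H (-(3 * s) + δ) < H s := hlevel ▸ V.anti m3 m2 (by linarith)
  have g4 : H (-s) < H (-(3 * s) + δ) := V.anti m2 m0 (by linarith)
  have g5 : H (-(3 * s) - δ) < H (-(4 * s)) := V.anti ⟨le_rfl, by linarith⟩ m1 (by linarith)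
  obtain ⟨η, hη, hηδ, hηl, hη'⟩ : ∃ η > 0, η ≤ δ ∧ η < s - l ∧ H (-(3 * s) + δ) < H (s - η) := by
    have h1 : ∀ᶠ w in 𝓝[>] (0 : ℝ), H (-(3 * s) + δ) < H (s - w) := by
      have : ContinuousAt (fun w => H (s - w)) 0 := by fun_prop
      exact (this.eventually (Ioi_mem_nhds (by simpa only [sub_zero] using g2))).filter_mono nhdsWithin_le_nhds
    obtain ⟨w, ⟨h2, h3⟩, h4⟩ := ((h1.and (Ioo_mem_nhdsGT hδ)).and
      (Ioo_mem_nhdsGT (sub_pos.2 hls))).exists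
    exact ⟨w, h3.1, h3.2.le, h4.2, h2⟩
  have m4 : s - η ∈ Icc (-s) s := ⟨by linarith, by linarith⟩
  have ms : s ∈ Icc (-s) s := ⟨by linarith, le_rfl⟩
  have g3 : H (s - η) < H s := V.mono m4 ms (by linarith)
  set e := 2 * l + 3 * s with he
  have hes : s ≤ e := by linarith
  have sec : ∀ ℓ, H (s - η) < ℓ → ℓ < H (-(3 * s) - δ) →
      ∃ u ∈ Ioo (-(3 * s) - δ) (-(3 * s) + δ), H u = ℓ := fun ℓ h1 h2 =>
    intermediate_value_Ioo' (by linarith) hV.continuousOn ⟨by linarith, h2⟩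
  have mem : ∀ {u}, u ∈ Ioo (-(3 * s) - δ) (-(3 * s) + δ) → u ∈ Ioo (-(4 * s)) (-s) := fun hu =>
    ⟨by linarith [hu.1], by linarith [hu.2]⟩
  have hlow : ∀ w, -(4 * s) ≤ w → w ≤ s → H (s - η) < H w → w < -(3 * s) + δ ∨ s - η < w := by
    intro w h1 h2 h3
    by_contra! hc
    rcases le_total w (-s) with h4 | h4
    · have := V.anti.antitoneOn m2 ⟨h1, h4⟩ hc.1
      linarith
    · have := V.mono.monotoneOn ⟨h4, h2⟩ m4 hc.2
      linarith
  -- The first integrals describe the neighbourhood again. A lower bound on the level is imposed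
  -- only for `p.1 ≤ s`, because below the sliding segment the lower orbits rise to that segment.
  refine ⟨{p | 0 ≤ p.2 → (s - η - l) ^ 2 < (p.1 - l) ^ 2 + 2 * p.2 ∧
      (p.1 - l) ^ 2 + 2 * p.2 < (e + δ - l) ^ 2} ∩
    {p | p.2 ≤ 0 → (-(3 * s) - δ < p.1 ∧ p.1 < e + δ) ∧ H p.1 - p.2 < H (-(3 * s) - δ) ∧
      (p.1 ≤ s → H (s - η) < H p.1 - p.2)}, IsOpen.inter ?_ ?_, ?_, ?_⟩
  · refine isOpen_imp (isClosed_le continuous_const continuous_snd) ?_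
    exact isOpen_Ioo.preimage (f := fun p : ℝ × ℝ => (p.1 - l) ^ 2 + 2 * p.2) (by fun_prop)
  · refine isOpen_imp (isClosed_le continuous_snd continuous_const)
      (IsOpen.inter (isOpen_Ioo.preimage continuous_fst) (IsOpen.inter ?_ ?_))
    · exact isOpen_Iio.preimage (f := fun p : ℝ × ℝ => H p.1 - p.2) (by fun_prop)
    · refine isOpen_imp (isClosed_le continuous_fst continuous_const) ?_
      exact isOpen_Ioi.preimage (f := fun p : ℝ × ℝ => H p.1 - p.2) (by fun_prop)
  · have q2 : (s - η - l) ^ 2 < (s - l) ^ 2 := pow_lt_pow_left₀ (by linarith) (by linarith) two_ne_zero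
    have q3 : (s - l) ^ 2 ≤ (e - l) ^ 2 := pow_le_pow_left₀ (by linarith) (by linarith) 2
    have q4 : (e - l) ^ 2 < (e + δ - l) ^ 2 :=
      pow_lt_pow_left₀ (by linarith) (by linarith) two_ne_zero
    have q5 : (-(3 * s) - l) ^ 2 = (e - l) ^ 2 := by rw [he]; ring
    intro p hp
    rcases hp with (hp | hp) | hp
    · obtain ⟨h1, h2⟩ := mem_sliding_iff.1 hp
      rw [uIcc_of_le hes] at h1
      have h3 : (s - l) ^ 2 ≤ (p.1 - l) ^ 2 := pow_le_pow_left₀ (by linarith) (by linarith [h1.1]) 2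
      have h4 : (p.1 - l) ^ 2 ≤ (e - l) ^ 2 :=
        pow_le_pow_left₀ (by linarith [h1.1]) (by linarith [h1.2]) 2
      have h5 : H p.1 ≤ H s :=
        hanti.antitoneOn ⟨le_rfl, hx₁⟩ ⟨h1.1, by linarith [h1.2]⟩ h1.1
      refine ⟨fun _ => ?_, fun _ => ⟨⟨by linarith [h1.1], by linarith [h1.2]⟩, ?_, fun h => ?_⟩⟩
      · rw [h2]; constructor <;> linarith
      · rw [h2]; linarith
      · rw [h2, le_antisymm h h1.1, sub_zero]; exact g3
    · obtain ⟨h1, h2⟩ := upper_mem_Icc_iff.1 hp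
      have h3 : (p.1 - l) ^ 2 + 2 * p.2 = (e - l) ^ 2 := by rw [h2, he]; ring
      refine ⟨fun _ => ?_, fun h0 => ?_⟩
      · rw [h3]; constructor <;> linarith
      · have h4 : p.1 = -(3 * s) ∨ p.1 = e := by
          by_contra! hne
          have := mul_pos (sub_pos.2 (lt_of_le_of_ne h1.1 hne.1.symm))
            (sub_pos.2 (lt_of_le_of_ne h1.2 hne.2))
          linarith
        have h5 : p.2 = 0 := by rcases h4 with h | h <;> rw [h2, h] <;> ring
        rw [h5, sub_zero]
        rcases h4 with h | h
        · rw [h, hlevel]; exact ⟨⟨by linarith, by linarith⟩, g1, fun _ => g3⟩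
        · rw [h]
          have h6 := hanti.antitoneOn ⟨le_rfl, hx₁⟩ ⟨hes, by linarith⟩ hes
          exact ⟨⟨by linarith, by linarith⟩, by linarith, fun h7 => by
            rw [le_antisymm h7 hes]; exact g3⟩
    · obtain ⟨h1, h2⟩ := lower_mem_Icc_iff.1 hp
      have h3 : H p.1 - p.2 = H s := by rw [h2]; ring
      refine ⟨fun h0 => ?_, fun _ => ?_⟩
      · have h4 : p.1 = -(3 * s) ∨ p.1 = s := by
          by_contra! hne
          have := V.lt_left_end m3.1 le_rfl (Or.inr hlevel.ge)
            ⟨lt_of_le_of_ne h1.1 hne.1.symm, lt_of_le_of_ne h1.2 hne.2⟩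
          linarith
        rcases h4 with h | h
        · rw [h, hlevel] at h2; rw [h, h2, sub_self, mul_zero, add_zero, q5]
          constructor <;> linarith
        · rw [h] at h2; rw [h, h2, sub_self, mul_zero, add_zero]
          constructor <;> linarith
      · rw [h3]
        exact ⟨⟨by linarith [h1.1], by linarith [h1.2]⟩, g1, fun _ => g3⟩
  · rintro γ hr ⟨hU1, hU2⟩
    have left : ∀ t ≥ 0, ∀ u ∈ Ioo (-(3 * s) - δ) (-(3 * s) + δ), γ t = (u, 0) →
        ∃ T ≥ 0, γ T = (s, 0) ∨
        ∃ u ∈ Ioo (-(3 * s) - δ) (-(3 * s) + δ), 2 * l - u < s ∧ γ T = (u, 0) := by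
      intro t ht u hu hγ
      rcases lt_or_ge (2 * l - u) s with h1 | h1
      · exact ⟨t, ht, Or.inr ⟨u, hu, h1, hγ⟩⟩
      have hul : u < l := by linarith [hu.2]
      have a1 := (follow_up V.deriv V.cont hul (V.neg u (mem hu)) ((hr _).mono ht le_rfl) hγ).1
      obtain ⟨t', ht', e', -⟩ := slide_reach V.deriv F.right F.speed F.neg F.slide_le
        (x := 2 * l - u) ⟨h1, by linarith [hu.1]⟩ (fun b => (hr b).mono (by linarith) le_rfl) a1
      exact ⟨t', by linarith, Or.inl e'⟩
    have right : ∀ t ≥ 0, ∀ z ∈ Ioo (s - η) (e + δ), γ t = (z, 0) → ∃ T ≥ 0, γ T = (s, 0) ∨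
        ∃ u ∈ Ioo (-(3 * s) - δ) (-(3 * s) + δ), 2 * l - u < s ∧ γ T = (u, 0) := by
      intro t ht z hz hγ
      rcases lt_or_ge z s with h1 | h1
      · have mz : z ∈ Ioo (-s) s := ⟨by linarith [hz.1], h1⟩
        have k1 : H z < H s := V.mono (Ioo_subset_Icc_self mz) ms h1
        have k2 : H (s - η) < H z := V.mono m4 (Ioo_subset_Icc_self mz) hz.1
        obtain ⟨u, hu, eu⟩ := sec (H z) k2 (by linarith)
        obtain ⟨t', ht', h2⟩ := V.reach_right mz (by linarith [hz.1])
          (Ioo_subset_Icc_self (mem hu)) eu (fun b => (hr b).mono ht le_rfl) hγ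
        exact left t' (by linarith) u hu h2
      · obtain ⟨t', ht', e', -⟩ := slide_reach V.deriv F.right F.speed F.neg F.slide_le
          (x := z) ⟨h1, by linarith [hz.2]⟩ (fun b => (hr b).mono ht le_rfl) hγ
        exact ⟨t', by linarith, Or.inl e'⟩
    obtain ⟨p, q, hpq⟩ : ∃ p q, γ 0 = (p, q) := ⟨(γ 0).1, (γ 0).2, rfl⟩
    rw [hpq] at hU1 hU2
    simp only [mem_ofPred_eq] at hU1 hU2
    rcases lt_trichotomy q 0 with hq | hq | hq
    · obtain ⟨hp, h1, h2⟩ := hU2 hq.le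
      rcases le_or_gt p s with hps | hps
      · obtain ⟨u, hu, eu⟩ := sec (H p - q) (h2 hps) h1
        obtain ⟨t, ht, hγ⟩ := V.reach_neg ⟨by linarith [hp.1], hps⟩ hq (mem hu) eu hr hpq
        exact left t ht u hu hγ
      · have mp : p ∈ Ico s x₁ := ⟨hps.le, by linarith [hp.2]⟩
        have hlow' : ∀ k, ∀ t' > 0, (potentialField l h).IsArc k γ 0 t' → k = .lower :=
          fun _ _ _ hk => arc_eq_lower V.cont hpq (Or.inl hq) hk
        -- The level decides: at most that of the fold, the orbit hits the sliding segment; above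
        -- it, the orbit passes below the fold and reaches the left section.
        rcases le_or_gt (H p - q) (H s) with h3 | h3
        · obtain ⟨w, hw, ew⟩ := intermediate_value_Icc' hps.le hV.continuousOn
            (show H p - q ∈ Icc (H p) (H s) from ⟨by linarith, h3⟩)
          have key := follow_lower V.deriv V.cont (z := w) (hr _) hpq hlow' (fun v hv => by
            have := hanti ⟨hw.1, by linarith [hw.2, mp.2]⟩
              (show v ∈ Ico s x₁ from ⟨by linarith [hw.1, hv.1], by linarith [hv.2, mp.2]⟩) hv.1
            linarith) w ⟨le_rfl, hw.2⟩
          rw [ew, show q + (H p - q - H p) = 0 by ring] at key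
          exact right _ (by linarith [hw.2]) w ⟨by linarith [hw.1], by linarith [hw.2, hp.2]⟩ key
        · obtain ⟨u, hu, eu⟩ := sec (H p - q) (by linarith) h1
          have hu' := mem hu
          have key := follow_lower V.deriv V.cont (z := u) (hr _) hpq hlow' (fun v hv => by
            rcases lt_or_ge v s with h4 | h4
            · have := V.lt_left_end hu'.1.le le_rfl (Or.inr (by linarith)) ⟨hv.1, h4⟩
              linarith
            · have := hanti.antitoneOn ⟨le_rfl, hx₁⟩
                (show v ∈ Ico s x₁ from ⟨h4, by linarith [hv.2, mp.2]⟩) h4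
              linarith) u ⟨le_rfl, by linarith [hu.2]⟩
          rw [eu, show q + (H p - q - H p) = 0 by ring] at key
          exact left _ (by linarith [hu.2]) u hu key
    · subst hq
      obtain ⟨hp, h1, h2⟩ := hU2 le_rfl
      rw [sub_zero] at h1 h2
      rcases lt_or_ge p s with hps | hps
      · rcases hlow p (by linarith [hp.1]) hps.le (h2 hps.le) with h3 | h3
        · exact left 0 le_rfl p ⟨hp.1, h3⟩ hpq
        · exact right 0 le_rfl p ⟨h3, hp.2⟩ hpq
      · exact right 0 le_rfl p ⟨by linarith, hp.2⟩ hpq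
    · obtain ⟨h1, h2⟩ := hU1 hq.le
      obtain ⟨t, ht, z, hz, hγ, ez⟩ := reach_of_pos V.deriv V.cont hr hpq hq
      rw [← ez] at h1 h2
      exact right t ht z ⟨by linarith [lt_of_sq_lt h1 (by linarith)],
        by linarith [lt_of_sq_lt h2 (by linarith)]⟩ hγ

end Funnel

lemma Well.funnel (W : Well s g G M c L) (hl : lam ∈ Ioc (-s) s) :
    ∃ κ, Funnel s (-lam) κ (1 / 4) (fun x => -g (-x)) fun x => G (-x) := by
  have hs := W.pos
  have hs' := W.small
  obtain ⟨κ, hκ, hslide⟩ := W.slide_bound hl.1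
  refine ⟨κ, hs, W.valley_mirror (by linarith), ?_, by linarith [hl.2], by linarith [hl.1], hκ, ?_,
    fun w hw => ?_, fun w hw => hslide w (Ioo_subset_Icc_self hw), by linarith [hl.1]⟩
  · simp only [neg_neg]; exact W.level
  · simp only [W.at_left, neg_zero]
  · exact neg_neg_of_pos (W.out_left _ (by linarith [hw.1]))

/-- The cycle through the visible fold repels. -/
theorem Well.isRepeller_bigLoop (W : Well s g G M c L) (hl : lam ∈ Ioc (-s) s) :
    (potentialField lam g).IsRepeller (bigLoop s lam G) := by
  have hs := W.pos
  have hs' := W.small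
  obtain ⟨κ, F⟩ := W.funnel hl
  suffices h : (potentialField (-lam) fun x => -g (-x)).AttractsFrom
      (bigLoopMirror s (-lam) fun x => G (-x)) univ from
    repelsFrom_of_mirror h W.mem_bigLoop_mirror fun _ _ => mem_univ _
  rcases eq_or_lt_of_le hl.2 with rfl | hlt
  · obtain ⟨U, hU, hΓ, hreach⟩ := F.reach (δ := lam / 2) (by linarith) (by linarith) (by linarith)
    refine ⟨U, hU, hΓ, fun γ hγ h0 => ?_⟩
    obtain ⟨T, hT, h1 | ⟨u, hu, hus, h1⟩⟩ := hreach γ (fun b => hγ.runs le_rfl b) h0.1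
    · exact F.stay (fun b => hγ.runs hT b) h1
    · have key := F.valley.tendsto_down (x := -(3 * lam)) (by linarith) (by linarith) (by linarith [hu.2])
        (by linarith [hu.2]) (by linarith) (by rw [F.level]; ring_nf) (fun w hw => by
          have h2 := (W.lt_iff (2 * lam + w) ⟨by linarith [hw.1], by linarith [hw.2, hu.2]⟩ lam le_rfl).2
            (W.mid_gt ⟨by linarith [hw.1], by linarith [hw.2, hu.2]⟩)
          rw [show 2 * lam - (2 * lam + w) = -w by ring] at h2
          rwa [show -(2 * -lam - w) = 2 * lam + w by ring]) (fun b => hγ.runs hT b) h1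
      have e : bigLoopMirror lam (-lam) (fun x => G (-x)) =
          loop (fun x => G (-x)) (-(3 * lam)) (2 * -lam - -(3 * lam)) := by
        rw [bigLoopMirror, loop, show 2 * -lam + 3 * lam = lam by ring,
          show 2 * -lam - -(3 * lam) = lam by ring, union_assoc, union_eq_right]
        simp only [trace, uIcc_self, image_singleton, singleton_subset_iff]
        exact Or.inl ⟨lam, ⟨by linarith, le_rfl⟩, by simp⟩
      rw [e]
      exact key
  -- With `δ ≤ 2 (s - lam)` every upper arc from the section lands on the sliding segment, so all
  -- nearby trajectories are captured in finite time.
  · have hδ : 0 < min (s / 2) (2 * (s - lam)) := lt_min (by linarith) (by linarith)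
    have h2 := min_le_left (s / 2) (2 * (s - lam))
    have h3 := min_le_right (s / 2) (2 * (s - lam))
    obtain ⟨U, hU, hΓ, hreach⟩ := F.reach hδ (by linarith) (by linarith [hl.1])
    refine ⟨U, hU, hΓ, fun γ hγ h0 => ?_⟩
    obtain ⟨T, hT, h1 | ⟨u, hu, hus, h1⟩⟩ := hreach γ (fun b => hγ.runs le_rfl b) h0.1
    · exact F.stay (fun b => hγ.runs hT b) h1
    · linarith [hu.2]

end Capture

/-! ### The set of canard cycles for each position of the parameter -/

section CanardSets

variable {lam lam' s c L r u u' : ℝ} {g G M : ℝ → ℝ}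

lemma Well.canardsIn_of_lt (W : Well s g G M c L) (hr : r ≤ 1 / 2) (hl : lam < -s) :
    (potentialField lam g).canardsIn (square r) = ∅ := by
  rw [eq_empty_iff_forall_notMem]
  intro Γ h
  rcases W.cycle_cases hr h with ⟨u, hu, hul, -⟩ | ⟨h, -⟩
  · linarith [hu.1]
  · linarith [h.1]

/-- A cycle of kind I would have midpoint `lam ≤ s`, while every chord from the open interval has
midpoint larger than `s`. -/
lemma Well.canardsIn_of_mem (W : Well s g G M c L) (hr : 10 * s < r) (hr' : r ≤ 1 / 2)
    (hl : lam ∈ Icc (-s) s) :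
    (potentialField lam g).canardsIn (square r) = {bigLoop s lam G} := by
  ext Γ
  constructor
  · intro h
    rcases W.cycle_cases hr' h with ⟨u, hu, hul, hv, e, -⟩ | ⟨-, h⟩
    · have h1 := (W.lt_iff u (Ioo_subset_Icc_self hu) s le_rfl).2 (W.mid_gt hu)
      have h2 := W.strictMonoOn_right.monotoneOn hv.le
        (show s ≤ 2 * s - u by linarith [hu.2]) (by linarith [hl.2])
      linarith
    · exact h
  · rintro rfl
    exact ⟨W.bigLoop_isCanardCycle hl, W.bigLoop_subset_square hr hr' hl⟩

lemma Well.chord_lt_right (W : Well s g G M c L) (hu : u ∈ Ioo (-s) s) (hl : s < lam)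
    (e : M u = lam) : ∀ w ∈ Ioo u (2 * lam - u), G w < G (2 * lam - u) := fun _ hw =>
  W.chord_lt (Ioo_subset_Icc_self hu) (by linarith [hu.2]) (W.chord_eq hu hl e) hw

lemma Well.chord_le_right (W : Well s g G M c L) (hu : u ∈ Ioo (-s) s) (hl : s < lam)
    (e : M u = lam) : ∀ w ∈ Icc u (2 * lam - u), G w ≤ G (2 * lam - u) := by
  intro w hw
  rcases eq_or_lt_of_le hw.1 with h1 | h1
  · rw [← h1, W.chord_eq hu hl e]
  rcases eq_or_lt_of_le hw.2 with h2 | h2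
  · rw [h2]
  · exact (W.chord_lt_right hu hl e w ⟨h1, h2⟩).le

lemma Well.mem_canardsIn (W : Well s g G M c L) (hr : 10 * s < r) (hr' : r ≤ 1 / 2)
    (hl : s < lam) {Γ : Set (ℝ × ℝ)} :
    Γ ∈ (potentialField lam g).canardsIn (square r) ↔
      ∃ u ∈ Ioo (-s) s, M u = lam ∧ Γ = loop G u (2 * lam - u) := by
  constructor
  · intro h
    rcases W.cycle_cases hr' h with ⟨u, hu, hul, hv, e, h⟩ | ⟨h, -⟩
    · exact ⟨u, hu, (W.level_eq_iff (Ioo_subset_Icc_self hu) hl.le).1 e, h⟩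
    · linarith [h.2]
  · rintro ⟨u, hu, e, rfl⟩
    have he := W.chord_eq hu hl e
    obtain ⟨h1, -⟩ := W.chord_ends (z := u) (x := 2 * lam - u) (by linarith [hu.2]) he
      (W.chord_le_right hu hl e)
    exact ⟨(W.loop_isCanardCycle hu (by linarith [hu.2]) h1.1 he.symm).1,
      W.loop_subset_square hr hr' ⟨hu.1.le, by linarith [hu.2, W.pos]⟩
        ⟨by linarith [h1.1, W.pos], h1.2⟩⟩

lemma Well.kindI_loop (W : Well s g G M c L) (hu : u ∈ Ioo (-s) s) (hl : s < lam)
    (e : M u = lam) : (potentialField lam g).KindI (loop G u (2 * lam - u)) :=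
  (W.loop_isCanardCycle hu (by linarith [hu.2]) (by linarith [hu.2]) (W.chord_eq hu hl e).symm).2

/-- The left ends alone decide the nesting: a smaller left end means a higher level and hence a
larger right end, even for different parameters. -/
lemma Well.loop_subset_insideOf (W : Well s g G M c L) (hu : u ∈ Ioo (-s) s)
    (hu' : u' ∈ Ioo (-s) s) (hl : s < lam) (hl' : s < lam') (e : M u = lam) (e' : M u' = lam')
    (h : u' < u) : loop G u (2 * lam - u) ⊆ insideOf (loop G u' (2 * lam' - u')) := by
  rw [W.insideOf_loop hu' hl' e']
  have h1 := W.strictAntiOn_mid (Ioo_subset_Icc_self hu') (Ioo_subset_Icc_self hu) h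
  rw [W.chord_eq hu hl e, W.chord_eq hu' hl' e'] at h1
  have h2 := (W.strictMonoOn_right.lt_iff_lt (show s ≤ 2 * lam - u by linarith [hu.2])
    (show s ≤ 2 * lam' - u' by linarith [hu'.2])).1 h1
  exact loop_subset_loopDomain h h2 (W.chord_lt_right hu' hl' e') h1 (W.chord_le_right hu hl e)

lemma Well.canardsIn_of_gt (W : Well s g G M c L) (hr : 10 * s < r) (hr' : r ≤ 1 / 2)
    (hl : L < lam) : (potentialField lam g).canardsIn (square r) = ∅ := by
  rw [eq_empty_iff_forall_notMem]
  intro Γ h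
  obtain ⟨u, hu, e, -⟩ := (W.mem_canardsIn hr hr' (W.lt_L.trans hl)).1 h
  rcases eq_or_ne u c with rfl | hne
  · rw [W.mid_c] at e; exact hl.ne e
  · linarith [W.mid_lt (Ioo_subset_Icc_self hu) hne]

lemma Well.canardsIn_collision (W : Well s g G M c L) (hr : 10 * s < r) (hr' : r ≤ 1 / 2) :
    (potentialField L g).canardsIn (square r) = {loop G c (2 * L - c)} := by
  ext Γ
  rw [W.mem_canardsIn hr hr' W.lt_L]
  constructor
  · rintro ⟨u, hu, e, rfl⟩
    rcases eq_or_ne u c with rfl | hne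
    · rfl
    · exact absurd e (W.mid_lt (Ioo_subset_Icc_self hu) hne).ne
  · rintro rfl
    exact ⟨c, W.c_mem, W.mid_c, rfl⟩

lemma Well.bigLoop_kindIII (W : Well s g G M c L) : (potentialField lam g).KindIII (bigLoop s lam G) :=
  ⟨_, Well.fold_mem_bigLoop, W.visibleFold⟩

lemma Well.bigLoop_ne_switching (W : Well s g G M c L) (hr : 10 * s < r) (hr' : r ≤ 1 / 2)
    (hl : lam ∈ Icc (-s) s) : bigLoop s lam G ≠ switching :=
  ne_switching_of_subset_square (W.bigLoop_subset_square hr hr' hl)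

lemma Well.right_mem_bigLoop (W : Well s g G M c L) : (3 * s, (0 : ℝ)) ∈ bigLoop s lam G :=
  Or.inr ⟨3 * s, ⟨by linarith [W.pos], le_rfl⟩, by simp⟩

/-- For `lam = -s` escaping and sliding region meet at the fold, which lies on the cycle. -/
lemma Well.bigLoop_not_hyperbolic (W : Well s g G M c L) (hr : 10 * s < r) (hr' : r ≤ 1 / 2) :
    ¬ (potentialField (-s) g).Hyperbolic (bigLoop s (-s) G) := by
  have hs := W.pos
  rintro (⟨h, -⟩ | h | ⟨-, h, -⟩)
  · exact h.not_kindIII W.bigLoop_kindIII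
  · exact W.bigLoop_ne_switching hr hr' ⟨le_rfl, by linarith⟩ h
  · have hc : Continuous fun x : ℝ => (x, (0 : ℝ)) := by fun_prop
    refine eq_empty_iff_forall_notMem.1 h (-s, 0) ⟨⟨?_, ?_⟩, Well.fold_mem_bigLoop⟩
    · exact map_mem_closure (f := fun x : ℝ => (x, (0 : ℝ))) hc (s := Iio (-s)) (by rw [closure_Iio]; exact le_refl (-s)) fun x hx =>
        mem_escaping.2 ⟨hx, W.out_left x hx⟩
    · exact map_mem_closure (f := fun x : ℝ => (x, (0 : ℝ))) hc (s := Ioo (-s) s)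
        (by rw [closure_Ioo (by linarith)]; exact ⟨le_rfl, by linarith⟩) fun x hx =>
        mem_slidingRegion.2 ⟨hx.1, W.inner x hx⟩

/-- The interval between the fold and `lam` is sewing and separates the closures of the escaping and
sliding regions; the slide of the cycle runs in the escaping one. -/
lemma Well.bigLoop_hyperbolic (W : Well s g G M c L) (hl : lam ∈ Ioo (-s) s) :
    (potentialField lam g).Hyperbolic (bigLoop s lam G) := by
  have hs := W.pos
  refine Or.inr (Or.inr ⟨W.bigLoop_kindIII, ?_, Or.inl ?_⟩)
  · have h1 : (potentialField lam g).escaping ⊆ {p | p.1 ≤ -s} := by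
      rintro ⟨x, y⟩ h
      obtain rfl : y = 0 := h.1
      obtain ⟨h1, h2⟩ := mem_escaping.1 h
      rcases W.pos_iff.1 h2 with h | h
      · exact h.le
      · linarith [hl.2]
    have h2 : (potentialField lam g).slidingRegion ⊆ {p | lam ≤ p.1} := by
      rintro ⟨x, y⟩ h
      obtain rfl : y = 0 := h.1
      exact (mem_slidingRegion.1 h).1.le
    rw [eq_empty_iff_forall_notMem]
    rintro p ⟨⟨h3, h4⟩, -⟩
    have h5 := closure_minimal h1 (isClosed_le continuous_fst continuous_const) h3
    have h6 := closure_minimal h2 (isClosed_le continuous_const continuous_fst) h4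
    simp only [mem_ofPred_eq] at h5 h6
    linarith [hl.1]
  · have hright : (3 * s, (0 : ℝ)) ∈ (potentialField lam g).sewing :=
      mem_sewing.2 (Or.inr ⟨by linarith [hl.2], W.out_right _ (by linarith)⟩)
    have hfold : (-s, (0 : ℝ)) ∈ (potentialField lam g).contact :=
      mem_contact.2 (Or.inr W.at_left)
    have hesc : ∀ x < -s, (x, (0 : ℝ)) ∈ (potentialField lam g).escaping := fun x hx =>
      mem_escaping.2 ⟨hx.trans hl.1, W.out_left x hx⟩
    rintro ⟨x, y⟩ ⟨h, hy⟩
    obtain rfl : y = 0 := hy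
    rcases h with (h | h) | h
    · rw [mem_sliding_iff, uIcc_of_ge (by linarith [hl.2])] at h
      rcases eq_or_lt_of_le h.1.2 with h | h
      · simp only at h; rw [h]; exact Or.inr hfold
      · exact Or.inl (Or.inr (hesc x h))
    · rw [upper_mem_Icc_iff] at h
      simp only at h
      have h2 : (x - (2 * lam - 3 * s)) * (3 * s - x) = 0 := by linarith [h.2]
      rcases mul_eq_zero.1 h2 with h3 | h3
      · exact Or.inl (Or.inr (hesc x (by linarith [hl.2])))
      · obtain rfl : x = 3 * s := by linarith
        exact Or.inl (Or.inl hright)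
    · rw [lower_mem_Icc_iff] at h
      obtain ⟨⟨h1, h2⟩, h3⟩ := h
      simp only at h1 h2 h3
      rcases eq_or_lt_of_le h1 with h | h1
      · rw [← h]; exact Or.inr hfold
      rcases eq_or_lt_of_le h2 with h | h2
      · rw [h]; exact Or.inl (Or.inl hright)
      have := W.chord_lt ⟨le_rfl, by linarith⟩ (by linarith) W.level.symm ⟨h1, h2⟩
      linarith

lemma Well.insideOf_bigLoop (W : Well s g G M c L) :
    insideOf (bigLoop s s G) = loopDomain G (-s) (3 * s) := by
  have hs := W.pos
  rw [bigLoop_eq_loop hs]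
  exact _root_.insideOf_loop W.continuous W.level.symm fun w hw => by
    rw [W.level]; exact (W.level_mid hw).2

lemma Well.focus_mem_insideOf (W : Well s g G M c L) : (s, (0 : ℝ)) ∈ insideOf (bigLoop s s G) := by
  have hs := W.pos
  rw [W.insideOf_bigLoop]
  refine ⟨⟨by linarith, by linarith⟩, ?_, ?_⟩
  · have := W.chord_lt ⟨le_rfl, by linarith⟩ (by linarith) W.level.symm
      (show s ∈ Ioo (-s) (3 * s) from ⟨by linarith, by linarith⟩)
    simp only; linarith
  · simp only
    exact div_pos (mul_pos (by linarith) (by linarith)) two_pos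

/-- Birth, growth and collision of two canard cycles of kind I. -/
theorem Well.two_cycles (W : Well s g G M c L) (hr : 10 * s < r) (hr' : r ≤ 1 / 2) :
    ∃ Γ₁ Γ₂ : ℝ → Set (ℝ × ℝ),
      (∀ lam ∈ Ioo s L,
        (potentialField lam g).canardsIn (square r) = {Γ₁ lam, Γ₂ lam} ∧
        (potentialField lam g).KindI (Γ₁ lam) ∧ (potentialField lam g).KindI (Γ₂ lam) ∧
        (potentialField lam g).IsAttractor (Γ₁ lam) ∧ (potentialField lam g).IsRepeller (Γ₂ lam) ∧
        Γ₁ lam ⊆ insideOf (Γ₂ lam)) ∧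
      (∀ lam ∈ Ioo s L, ∀ lam' ∈ Ioo s L, lam < lam' →
        Γ₁ lam ⊆ insideOf (Γ₁ lam') ∧ Γ₂ lam' ⊆ insideOf (Γ₂ lam)) ∧
      Tendsto (fun lam => Metric.hausdorffEDist (Γ₁ lam) {(s, 0)}) (𝓝[>] s) (𝓝 0) ∧
      Tendsto (fun lam => Metric.hausdorffEDist (Γ₂ lam) (bigLoop s s G)) (𝓝[>] s) (𝓝 0) ∧
      Tendsto (fun lam => Metric.hausdorffEDist (Γ₁ lam) (loop G c (2 * L - c))) (𝓝[<] L) (𝓝 0) ∧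
      Tendsto (fun lam => Metric.hausdorffEDist (Γ₂ lam) (loop G c (2 * L - c))) (𝓝[<] L) (𝓝 0) := by
  have hs := W.pos
  have hc := W.c_mem
  -- The two cycles are the two inverse branches of the midpoint function; their monotonicity and
  -- end limits give growth, birth and collision.
  obtain ⟨u₁, h1, h1a, h1b⟩ := exists_decreasing_inverse hc.2 W.mid_anti
    (W.mid_cont.mono (Icc_subset_Icc_left hc.1.le))
  obtain ⟨u₂, h2, h2a, h2b⟩ := exists_increasing_inverse hc.1 W.mid_mono
    (W.mid_cont.mono (Icc_subset_Icc_right hc.2.le))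
  rw [W.mid_c, W.mid_right] at h1
  rw [W.mid_c, W.mid_left] at h2
  rw [W.mid_right] at h1a
  rw [W.mid_left] at h2a
  rw [W.mid_c] at h1b h2b
  have m1 : ∀ lam ∈ Ioo s L, u₁ lam ∈ Ioo (-s) s := fun lam h =>
    ⟨hc.1.trans (h1 lam h).1.1, (h1 lam h).1.2⟩
  have m2 : ∀ lam ∈ Ioo s L, u₂ lam ∈ Ioo (-s) s := fun lam h =>
    ⟨(h2 lam h).1.1, (h2 lam h).1.2.trans hc.2⟩
  have id1 : Tendsto (fun lam : ℝ => lam) (𝓝[>] s) (𝓝 s) := tendsto_id.mono_left nhdsWithin_le_nhds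
  have id2 : Tendsto (fun lam : ℝ => lam) (𝓝[<] L) (𝓝 L) := tendsto_id.mono_left nhdsWithin_le_nhds
  have ev1 : ∀ᶠ lam in 𝓝[>] s, lam ∈ Ioo s L := Ioo_mem_nhdsGT W.lt_L
  have ev2 : ∀ᶠ lam in 𝓝[<] L, lam ∈ Ioo s L := Ioo_mem_nhdsLT W.lt_L
  have ord1 : ∀ lam ∈ Ioo s L, u₁ lam ≤ 2 * lam - u₁ lam := fun lam h => by
    linarith [(m1 lam h).2, h.1]
  have ord2 : ∀ lam ∈ Ioo s L, u₂ lam ≤ 2 * lam - u₂ lam := fun lam h => by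
    linarith [(m2 lam h).2, h.1]
  refine ⟨fun lam => loop G (u₁ lam) (2 * lam - u₁ lam),
    fun lam => loop G (u₂ lam) (2 * lam - u₂ lam), fun lam h => ⟨?_, ?_, ?_, ?_, ?_, ?_⟩,
    fun lam h lam' h' hlt => ⟨?_, ?_⟩, ?_, ?_, ?_, ?_⟩
  · ext Γ
    rw [W.mem_canardsIn hr hr' h.1, mem_insert_iff, mem_singleton_iff]
    constructor
    · rintro ⟨u, hu, e, rfl⟩
      rcases lt_trichotomy u c with h' | rfl | h'
      · right
        rw [W.mid_mono.injOn ⟨hu.1.le, h'.le⟩ (Ioo_subset_Icc_self (h2 lam h).1)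
          (e.trans (h2 lam h).2.symm)]
      · exact absurd (W.mid_c.symm.trans e) h.2.ne'
      · left
        rw [W.mid_anti.injOn ⟨h'.le, hu.2.le⟩ (Ioo_subset_Icc_self (h1 lam h).1)
          (e.trans (h1 lam h).2.symm)]
    · rintro (rfl | rfl)
      · exact ⟨_, m1 lam h, (h1 lam h).2, rfl⟩
      · exact ⟨_, m2 lam h, (h2 lam h).2, rfl⟩
  · exact W.kindI_loop (m1 lam h) h.1 (h1 lam h).2
  · exact W.kindI_loop (m2 lam h) h.1 (h2 lam h).2
  · exact W.isAttractor_right h.1 (h1 lam h).1 (h1 lam h).2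
  · exact W.isRepeller_left h.1 (h2 lam h).1 (h2 lam h).2
  · exact W.loop_subset_insideOf (m1 lam h) (m2 lam h) h.1 h.1 (h1 lam h).2 (h2 lam h).2
      ((h2 lam h).1.2.trans (h1 lam h).1.1)
  · refine W.loop_subset_insideOf (m1 lam h) (m1 lam' h') h.1 h'.1 (h1 lam h).2 (h1 lam' h').2 ?_
    refine (W.mid_anti.lt_iff_gt (Ioo_subset_Icc_self (h1 lam h).1)
      (Ioo_subset_Icc_self (h1 lam' h').1)).1 ?_
    rwa [(h1 lam h).2, (h1 lam' h').2]
  · refine W.loop_subset_insideOf (m2 lam' h') (m2 lam h) h'.1 h.1 (h2 lam' h').2 (h2 lam h).2 ?_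
    refine (W.mid_mono.lt_iff_lt (Ioo_subset_Icc_self (h2 lam h).1)
      (Ioo_subset_Icc_self (h2 lam' h').1)).1 ?_
    rwa [(h2 lam h).2, (h2 lam' h').2]
  · have := tendsto_hausdorff_loop W.continuous h1a ((id1.const_mul 2).sub h1a) (by linarith)
      (ev1.mono ord1)
    rwa [show 2 * s - s = s by ring, loop_self] at this
  · have := tendsto_hausdorff_loop W.continuous h2a ((id1.const_mul 2).sub h2a) (by linarith)
      (ev1.mono ord2)
    rwa [show 2 * s - -s = 3 * s by ring, ← bigLoop_eq_loop hs] at this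
  · exact tendsto_hausdorff_loop W.continuous h1b ((id2.const_mul 2).sub h1b)
      (by linarith [hc.2, W.lt_L]) (ev2.mono ord1)
  · exact tendsto_hausdorff_loop W.continuous h2b ((id2.const_mul 2).sub h2b)
      (by linarith [hc.2, W.lt_L]) (ev2.mono ord2)

end CanardSets

/-! ### Pseudo equilibria, real and virtual -/

section Equilibria

variable {lam r p q x : ℝ} {g : ℝ → ℝ}

/-- Membership in the escaping or sliding region is automatic: the equation makes `g x = lam - x`,
whose sign matches the side of `lam`. -/
lemma pseudoEq_iff : (potentialField lam g).PseudoEq x ↔ g x + x = lam ∧ x ≠ lam := by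
  rw [PWS.PseudoEq, mem_regions, filippov_eq, slide]
  simp only [Prod.mk_eq_zero, and_true, div_eq_zero_iff]
  constructor
  · rintro ⟨h, h'⟩
    have : lam - (g x + x) = 0 := h'.resolve_right (by rcases h with h | h <;> linarith [h.1, h.2])
    exact ⟨by linarith, by rcases h with h | h; exacts [h.1.ne, h.1.ne']⟩
  · rintro ⟨e, h⟩
    refine ⟨?_, Or.inl (by linarith)⟩
    rcases lt_or_gt_of_ne h with h | h
    · exact Or.inl ⟨h, by linarith⟩
    · exact Or.inr ⟨h, by linarith⟩

/-- At sewing points the two vectors are always independent, because `lam - x` and `g x` have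
opposite signs. So the line must be horizontal, at height `lam - x ≠ 0`. -/
lemma virtualPseudoEq_iff :
    (potentialField lam g).VirtualPseudoEq x ↔ x - g x = lam ∧ x ≠ lam := by
  rw [PWS.VirtualPseudoEq, mem_sewing]
  have line : ∀ t : ℝ, AffineMap.lineMap ((x, (0 : ℝ)) + (potentialField lam g).X (x, 0))
      ((x, (0 : ℝ)) + (potentialField lam g).Y (x, 0)) t
      = (x + 1 - 2 * t, lam - x - t * (lam - x + g x)) := by
    intro t
    simp only [potentialField, AffineMap.lineMap_apply, vsub_eq_sub, vadd_eq_add, Prod.mk_add_mk,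
      Prod.mk_sub_mk, Prod.smul_mk, smul_eq_mul, Prod.mk.injEq]
    constructor <;> ring
  constructor
  · rintro ⟨h, h' | h'⟩
    · exfalso
      refine h' (LinearIndependent.pair_iff.2 fun a b hab => ?_)
      simp only [potentialField, Prod.smul_mk, smul_eq_mul, Prod.mk_add_mk, Prod.mk_eq_zero] at hab
      obtain ⟨h1, h2⟩ := hab
      obtain rfl : a = b := by linarith
      have h3 : a * (-x + lam - g x) = 0 := by linarith
      have h4 := (mul_eq_zero.1 h3).resolve_right
        (by rcases h with h | h <;> linarith [h.1, h.2])
      exact ⟨h4, h4⟩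
    · refine ⟨?_, by rcases h with h | h; exacts [h.1.ne, h.1.ne']⟩
      by_contra hne
      have hne' : lam - x + g x ≠ 0 := fun h => hne (by linarith)
      refine h' _ (AffineMap.lineMap_mem_affineSpan_pair ((lam - x) / (lam - x + g x)) _ _) ?_
      rw [line]
      simp only [switching, mem_ofPred_eq]
      field_simp
      ring
  · rintro ⟨e, h⟩
    refine ⟨?_, Or.inr fun z hz hz' => ?_⟩
    · rcases lt_or_gt_of_ne h with h | h
      · exact Or.inl ⟨h, by linarith⟩
      · exact Or.inr ⟨h, by linarith⟩
    · obtain ⟨t, rfl⟩ := mem_affineSpan_pair_iff_exists_lineMap_eq.1 hz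
      rw [line] at hz'
      simp only [switching, mem_ofPred_eq] at hz'
      rw [show lam - x + g x = 0 by linarith] at hz'
      exact h (by linarith)

/-- `p` is the zero of the numerator and `q` the zero of the denominator of the direction
function. -/
structure Balance (lam r : ℝ) (g : ℝ → ℝ) (p q : ℝ) : Prop where
  le : r ≤ 1 / 2
  add : StrictMonoOn (fun x => g x + x) (Ioo (-1 / 2) (1 / 2))
  sub : StrictMonoOn (fun x => x - g x) (Ioo (-1 / 2) (1 / 2))
  mem : lam ∈ Ioo (-r) r
  num_mem : p ∈ Ioo (-r) r
  den_mem : q ∈ Ioo (-r) r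
  num_eq : g p + p = lam
  den_eq : q - g q = lam

namespace Balance

lemma inner (B : Balance lam r g p q) (hx : x ∈ Ioo (-r) r) : x ∈ Ioo (-1 / 2 : ℝ) (1 / 2) :=
  ⟨by linarith [hx.1, B.le], by linarith [hx.2, B.le]⟩

lemma lt_num_iff (B : Balance lam r g p q) (hx : x ∈ Ioo (-r) r) : x < p ↔ g x + x < lam := by
  have := B.add.lt_iff_lt (B.inner hx) (B.inner B.num_mem)
  simp only [B.num_eq] at this
  exact this.symm

lemma num_lt_iff (B : Balance lam r g p q) (hx : x ∈ Ioo (-r) r) : p < x ↔ lam < g x + x := by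
  have := B.add.lt_iff_lt (B.inner B.num_mem) (B.inner hx)
  simp only [B.num_eq] at this
  exact this.symm

lemma lt_den_iff (B : Balance lam r g p q) (hx : x ∈ Ioo (-r) r) : x < q ↔ x - g x < lam := by
  have := B.sub.lt_iff_lt (B.inner hx) (B.inner B.den_mem)
  simp only [B.den_eq] at this
  exact this.symm

lemma den_lt_iff (B : Balance lam r g p q) (hx : x ∈ Ioo (-r) r) : q < x ↔ lam < x - g x := by
  have := B.sub.lt_iff_lt (B.inner B.den_mem) (B.inner hx)
  simp only [B.den_eq] at this
  exact this.symm

lemma num_iff (B : Balance lam r g p q) (hx : x ∈ Ioo (-r) r) : g x + x = lam ↔ x = p := by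
  rw [le_antisymm_iff, le_antisymm_iff, ← not_lt, ← not_lt, ← not_lt, ← not_lt, B.lt_num_iff hx,
    B.num_lt_iff hx]

lemma den_iff (B : Balance lam r g p q) (hx : x ∈ Ioo (-r) r) : x - g x = lam ↔ x = q := by
  rw [le_antisymm_iff, le_antisymm_iff, ← not_lt, ← not_lt, ← not_lt, ← not_lt, B.lt_den_iff hx,
    B.den_lt_iff hx]

/-- At `x = lam` both monotone functions deviate from `lam` by `g lam`, in opposite directions. So
the sign of `g lam` orders `p`, `lam`, `q`. -/
lemma of_pos (B : Balance lam r g p q) (h : 0 < g lam) : p < lam ∧ lam < q :=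
  ⟨(B.num_lt_iff B.mem).2 (by linarith), (B.lt_den_iff B.mem).2 (by linarith)⟩

lemma of_neg (B : Balance lam r g p q) (h : g lam < 0) : lam < p ∧ q < lam :=
  ⟨(B.lt_num_iff B.mem).2 (by linarith), (B.den_lt_iff B.mem).2 (by linarith)⟩

lemma of_zero (B : Balance lam r g p q) (h : g lam = 0) : p = lam ∧ q = lam :=
  ⟨((B.num_iff B.mem).1 (by linarith)).symm, ((B.den_iff B.mem).1 (by linarith)).symm⟩

lemma lt_or_eq_or_gt (B : Balance lam r g p q)
    : (p < lam ∧ lam < q) ∨ (p = lam ∧ q = lam) ∨ (lam < p ∧ q < lam) := by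
  rcases lt_trichotomy (g lam) 0 with h | h | h
  · exact Or.inr (Or.inr (B.of_neg h))
  · exact Or.inr (Or.inl (B.of_zero h))
  · exact Or.inl (B.of_pos h)

lemma dirZeros (B : Balance lam r g p q) : (potentialField lam g).DirZeros r p q := by
  refine ⟨B.num_mem, B.den_mem, fun x hx => ?_⟩
  rw [dirNum_eq, dirDen_eq, ← B.num_iff hx, ← B.den_iff hx]
  constructor <;> constructor <;> intro h <;> linarith

lemma pseudo_iff (B : Balance lam r g p q) (hx : x ∈ Ioo (-r) r) :
    (potentialField lam g).PseudoEq x ↔ x = p ∧ p ≠ lam := by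
  rw [pseudoEq_iff, B.num_iff hx]
  constructor <;> rintro ⟨rfl, h⟩ <;> exact ⟨rfl, h⟩

lemma virtual_iff (B : Balance lam r g p q) (hx : x ∈ Ioo (-r) r) :
    (potentialField lam g).VirtualPseudoEq x ↔ x = q ∧ q ≠ lam := by
  rw [virtualPseudoEq_iff, B.den_iff hx]
  constructor <;> rintro ⟨rfl, h⟩ <;> exact ⟨rfl, h⟩

/-- Near `p` the denominator keeps its sign, since its zero is on the other side of `lam`, and the
numerator changes sign. -/
lemma repels (B : Balance lam r g p q) (h : p < lam) : (potentialField lam g).FilippovRepels p := by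
  have hq : lam < q := by
    rcases B.lt_or_eq_or_gt with h' | h' | h'
    exacts [h'.2, absurd h'.1 h.ne, absurd h'.1 h.not_gt]
  have hp := B.num_mem
  have hq' := B.den_mem
  have h1 : min (p + r) (q - p) ≤ p + r := min_le_left _ _
  have h2 : min (p + r) (q - p) ≤ q - p := min_le_right _ _
  refine ⟨min (p + r) (q - p), lt_min (by linarith [hp.1]) (by linarith), fun z hz => ?_,
    fun z hz => ?_⟩ <;> rw [filippov_eq, slide]
  · have hz' : z ∈ Ioo (-r) r := ⟨by linarith [hz.1], by linarith [hz.2, hp.2]⟩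
    exact div_neg_of_pos_of_neg (by linarith [(B.lt_num_iff hz').1 hz.2])
      (by linarith [(B.lt_den_iff hz').1 (by linarith [hz.2])])
  · have hz' : z ∈ Ioo (-r) r := ⟨by linarith [hz.1, hp.1], by linarith [hz.2, hq'.2]⟩
    exact div_pos_of_neg_of_neg (by linarith [(B.num_lt_iff hz').1 hz.1])
      (by linarith [(B.lt_den_iff hz').1 (by linarith [hz.2])])

lemma attracts (B : Balance lam r g p q)
    (h : lam < p) : (potentialField lam g).FilippovAttracts p := by
  have hq : q < lam := by
    rcases B.lt_or_eq_or_gt with h' | h' | h'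
    exacts [absurd h'.1 h.not_gt, absurd h'.1 h.ne', h'.2]
  have hp := B.num_mem
  have hq' := B.den_mem
  have h1 : min (r - p) (p - q) ≤ r - p := min_le_left _ _
  have h2 : min (r - p) (p - q) ≤ p - q := min_le_right _ _
  refine ⟨min (r - p) (p - q), lt_min (by linarith [hp.2]) (by linarith), fun z hz => ?_,
    fun z hz => ?_⟩ <;> rw [filippov_eq, slide]
  · have hz' : z ∈ Ioo (-r) r := ⟨by linarith [hz.1, hq'.1], by linarith [hz.2, hp.2]⟩
    exact div_pos (by linarith [(B.lt_num_iff hz').1 hz.2])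
      (by linarith [(B.den_lt_iff hz').1 (by linarith [hz.1])])
  · have hz' : z ∈ Ioo (-r) r := ⟨by linarith [hz.1, hp.1], by linarith [hz.2]⟩
    exact div_neg_of_neg_of_pos (by linarith [(B.num_lt_iff hz').1 hz.1])
      (by linarith [(B.den_lt_iff hz').1 (by linarith [hz.1])])

lemma sigmaRepeller (B : Balance lam r g p q)
    (h : p < lam) : (potentialField lam g).SigmaRepeller p :=
  ⟨(B.pseudo_iff B.num_mem).2 ⟨rfl, h.ne⟩, mem_escaping.2 ⟨h, by linarith [B.num_eq]⟩, B.repels h⟩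

lemma sigmaAttractor (B : Balance lam r g p q)
    (h : lam < p) : (potentialField lam g).SigmaAttractor p :=
  ⟨(B.pseudo_iff B.num_mem).2 ⟨rfl, h.ne'⟩, mem_slidingRegion.2 ⟨h, by linarith [B.num_eq]⟩,
    B.attracts h⟩

lemma sigmaRepeller_iff (B : Balance lam r g p q) (hx : x ∈ Ioo (-r) r) :
    (potentialField lam g).SigmaRepeller x ↔ x = p ∧ p < lam := by
  constructor
  · rintro ⟨h1, h2, -⟩
    obtain ⟨rfl, -⟩ := (B.pseudo_iff hx).1 h1
    exact ⟨rfl, (mem_escaping.1 h2).1⟩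
  · rintro ⟨rfl, h⟩
    exact B.sigmaRepeller h

lemma sigmaAttractor_iff (B : Balance lam r g p q) (hx : x ∈ Ioo (-r) r) :
    (potentialField lam g).SigmaAttractor x ↔ x = p ∧ lam < p := by
  constructor
  · rintro ⟨h1, h2, -⟩
    obtain ⟨rfl, -⟩ := (B.pseudo_iff hx).1 h1
    exact ⟨rfl, (mem_slidingRegion.1 h2).1⟩
  · rintro ⟨rfl, h⟩
    exact B.sigmaAttractor h

lemma not_sigmaSaddle (B : Balance lam r g p q)
    (hx : x ∈ Ioo (-r) r) : ¬ (potentialField lam g).SigmaSaddle x := by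
  have key : ¬ ((potentialField lam g).FilippovAttracts x ∧
      (potentialField lam g).FilippovRepels x) := by
    rintro ⟨⟨ε, hε, h1, -⟩, ⟨δ, hδ, h2, -⟩⟩
    have hm : 0 < min ε δ := lt_min hε hδ
    have h3 : min ε δ ≤ ε := min_le_left _ _
    have h4 : min ε δ ≤ δ := min_le_right _ _
    have h5 := h1 (x - min ε δ / 2) ⟨by linarith, by linarith⟩
    have h6 := h2 (x - min ε δ / 2) ⟨by linarith, by linarith⟩
    exact h5.not_gt h6
  rintro ⟨h1, h⟩
  obtain ⟨rfl, -⟩ := (B.pseudo_iff hx).1 h1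
  rcases h with ⟨h, h'⟩ | ⟨h, h'⟩
  · exact key ⟨h', B.repels (mem_escaping.1 h).1⟩
  · exact key ⟨B.attracts (mem_slidingRegion.1 h).1, h'⟩

lemma pseudos_of_zero (B : Balance lam r g p q)
    (h : g lam = 0) : (potentialField lam g).Pseudos r ∅ ∅ := by
  obtain ⟨h1, h2⟩ := B.of_zero h
  constructor <;> rw [eq_empty_iff_forall_notMem] <;> rintro x ⟨hx, h⟩
  · exact ((B.pseudo_iff hx).1 h).2 h1
  · exact ((B.virtual_iff hx).1 h).2 h2

lemma pseudos_of_ne (B : Balance lam r g p q)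
    (h : g lam ≠ 0) : (potentialField lam g).Pseudos r {p} {q} := by
  have hne : p ≠ lam ∧ q ≠ lam := by
    rcases lt_or_gt_of_ne h with h | h
    · exact ⟨(B.of_neg h).1.ne', (B.of_neg h).2.ne⟩
    · exact ⟨(B.of_pos h).1.ne, (B.of_pos h).2.ne'⟩
  constructor <;> ext x <;> rw [mem_singleton_iff] <;> constructor
  · rintro ⟨hx, h⟩; exact ((B.pseudo_iff hx).1 h).1
  · rintro rfl; exact ⟨B.num_mem, (B.pseudo_iff B.num_mem).2 ⟨rfl, hne.1⟩⟩
  · rintro ⟨hx, h⟩; exact ((B.virtual_iff hx).1 h).1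
  · rintro rfl; exact ⟨B.den_mem, (B.virtual_iff B.den_mem).2 ⟨rfl, hne.2⟩⟩

/-- Order isomorphisms that match the zeros of the direction functions match the pseudo
equilibria. -/
lemma samePseudo (B : Balance lam r g p q)
    {lam' p' q' : ℝ} {g' : ℝ → ℝ} (B' : Balance lam' r g' p' q') {h : ℝ ≃o ℝ}
    (hl : h lam = lam') (hp : h p = p') (hq : h q = q') (h0 : h (-r) = -r) (h1 : h r = r)
    (hx : x ∈ Ioo (-r) r) :
    (potentialField lam g).SamePseudo (potentialField lam' g') x (h x) := by
  have hx' : h x ∈ Ioo (-r) r :=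
    ⟨by rw [← h0]; exact h.lt_iff_lt.2 hx.1, by rw [← h1]; exact h.lt_iff_lt.2 hx.2⟩
  refine ⟨?_, ?_, ?_, ?_, ?_⟩
  · rw [B.pseudo_iff hx, B'.pseudo_iff hx', ← hl, ← hp, h.injective.eq_iff, h.injective.ne_iff]
  · rw [B.sigmaRepeller_iff hx, B'.sigmaRepeller_iff hx', ← hl, ← hp, h.injective.eq_iff,
      h.lt_iff_lt]
  · rw [B.sigmaAttractor_iff hx, B'.sigmaAttractor_iff hx', ← hl, ← hp, h.injective.eq_iff,
      h.lt_iff_lt]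
  · exact iff_of_false (B.not_sigmaSaddle hx) (B'.not_sigmaSaddle hx')
  · rw [B.virtual_iff hx, B'.virtual_iff hx', ← hl, ← hq, h.injective.eq_iff, h.injective.ne_iff]

end Balance

/-- Both zeros come from the intermediate value theorem on `[-ρ, ρ]`, at whose ends `g` is
nonnegative and at most `ρ / 2`. -/
lemma exists_balance {ρ : ℝ} (hc : Continuous g)
    (ha : StrictMonoOn (fun x => g x + x) (Ioo (-1 / 2) (1 / 2)))
    (hs : StrictMonoOn (fun x => x - g x) (Ioo (-1 / 2) (1 / 2)))
    (hρ : 0 < ρ) (hρr : ρ < r) (hr : r ≤ 1 / 2) (h1 : g ρ ∈ Icc 0 (ρ / 2))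
    (h2 : g (-ρ) ∈ Icc 0 (ρ / 2)) (hl : lam ∈ Ioo (-(ρ / 2)) (ρ / 2)) :
    ∃ p q, Balance lam r g p q := by
  have hsub : Icc (-ρ) ρ ⊆ Ioo (-r) r := fun x hx => ⟨by linarith [hx.1], by linarith [hx.2]⟩
  obtain ⟨p, hp, ep⟩ := intermediate_value_Icc (show -ρ ≤ ρ by linarith)
    (f := fun x => g x + x) (by fun_prop)
    (show lam ∈ Icc _ _ from ⟨by linarith [h2.2, hl.1], by linarith [h1.1, hl.2]⟩)
  obtain ⟨q, hq, eq⟩ := intermediate_value_Icc (show -ρ ≤ ρ by linarith)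
    (f := fun x => x - g x) (by fun_prop)
    (show lam ∈ Icc _ _ from ⟨by linarith [h2.1, hl.1], by linarith [h1.2, hl.2]⟩)
  exact ⟨p, q, hr, ha, hs, ⟨by linarith [hl.1], by linarith [hl.2]⟩, hsub hp, hsub hq, ep, eq⟩

end Equilibria

/-! ### The lower fields without folds -/

section Parabola

variable {lam lam' β r x : ℝ}

lemma lowerForce_of_nonpos (h : β ≤ 0) : lowerForce β = fun x => x ^ 2 - β := by
  funext x; rw [lowerForce, if_pos h]

lemma lowerForce_of_pos (h : 0 < β) : lowerForce β = force √β := by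
  funext x; rw [lowerForce, if_neg (not_le.2 h)]

lemma force_far {s x : ℝ} (hs : 0 < s) (hx : 4 * s < |x|) : force s x = x ^ 2 - s ^ 2 := by
  rw [force, patch]
  rcases lt_abs.1 hx with h | h
  · rw [if_neg (by linarith), if_neg (by linarith), if_neg (by linarith)]
  · rw [if_pos (by linarith)]

lemma parabola_add : StrictMonoOn (fun x : ℝ => x ^ 2 - β + x) (Ioo (-1 / 2) (1 / 2)) := by
  intro x hx y hy hxy
  have := mul_pos (sub_pos.2 hxy) (show 0 < x + y + 1 by linarith [hx.1, hy.1])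
  simp only
  nlinarith

lemma parabola_sub : StrictMonoOn (fun x : ℝ => x - (x ^ 2 - β)) (Ioo (-1 / 2) (1 / 2)) := by
  intro x hx y hy hxy
  have := mul_pos (sub_pos.2 hxy) (show 0 < 1 - x - y by linarith [hx.2, hy.2])
  simp only
  nlinarith

lemma lieTwo_parabola (p : ℝ × ℝ) :
    lieTwo (potentialField lam fun x => x ^ 2 - β).Y p = 2 * p.1 := by
  have h : HasFDerivAt (lieOne (potentialField lam fun x => x ^ 2 - β).Y)
      (-((2 * p.1) • (ContinuousLinearMap.fst ℝ ℝ ℝ))) p := by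
    have h1 : HasDerivAt (fun x : ℝ => x ^ 2 - β) (2 * p.1) p.1 :=
      ((hasDerivAt_pow 2 p.1).sub_const β).congr_deriv (by simp)
    exact (h1.comp_hasFDerivAt (f := fun p : ℝ × ℝ => p.1) p
      (ContinuousLinearMap.fst ℝ ℝ ℝ).hasFDerivAt).neg
  rw [lieTwo, h.fderiv]
  simp [potentialField]

lemma lieThree_parabola (p : ℝ × ℝ) :
    lieThree (potentialField lam fun x => x ^ 2 - β).Y p = -2 := by
  have h : HasFDerivAt (lieTwo (potentialField lam fun x => x ^ 2 - β).Y)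
      ((2 : ℝ) • (ContinuousLinearMap.fst ℝ ℝ ℝ)) p := by
    rw [show lieTwo (potentialField lam fun x => x ^ 2 - β).Y = fun p => 2 * p.1 from
      funext lieTwo_parabola]
    exact (ContinuousLinearMap.fst ℝ ℝ ℝ).hasFDerivAt.const_mul 2
  rw [lieThree, h.fderiv]
  simp [potentialField]

lemma parabola_not_visibleFoldY (hβ : β ≤ 0) :
    ¬ (potentialField lam fun x => x ^ 2 - β).VisibleFoldY (x, 0) := by
  rintro ⟨-, h1, h2⟩
  rw [lieOne_Y] at h1
  rw [lieTwo_parabola] at h2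
  simp only at h1 h2
  nlinarith [mul_pos_of_neg_of_neg h2 h2]

lemma parabola_not_invisibleFoldY (hβ : β ≤ 0) :
    ¬ (potentialField lam fun x => x ^ 2 - β).InvisibleFoldY (x, 0) := by
  rintro ⟨-, h1, h2⟩
  rw [lieOne_Y] at h1
  rw [lieTwo_parabola] at h2
  simp only at h1 h2
  nlinarith [mul_pos h2 h2]

lemma parabola_cuspY_iff :
    (potentialField lam fun x => x ^ 2 - β).CuspY (x, 0) ↔ x = 0 ∧ β = 0 := by
  rw [PWS.CuspY, lieOne_Y, lieTwo_parabola, lieThree_parabola]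
  constructor
  · rintro ⟨-, h1, h2, -⟩
    simp only at h1 h2
    obtain rfl : x = 0 := by linarith
    exact ⟨rfl, by linarith⟩
  · rintro ⟨rfl, rfl⟩
    exact ⟨rfl, by norm_num, by norm_num, by norm_num⟩

lemma parabola_not_visibleFold (hβ : β ≤ 0) :
    ¬ (potentialField lam fun x => x ^ 2 - β).VisibleFold (x, 0) := by
  rintro (h | h)
  · exact not_visibleFoldX h
  · exact parabola_not_visibleFoldY hβ h

lemma parabola_canardsIn (hβ : β ≤ 0) :
    (potentialField lam fun x => x ^ 2 - β).canardsIn (square r) = ∅ := by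
  refine canardsIn_eq_empty_of_strictMono (G := fun x => x ^ 3 / 3 - β * x) (fun x => ?_) ?_
    fun x => parabola_not_visibleFold hβ
  · exact (((hasDerivAt_pow 3 x).div_const 3).sub ((hasDerivAt_id x).const_mul β)).congr_deriv
      (by norm_num)
  · intro x y hxy
    -- The product equals `4 (y ^ 3 - x ^ 3)`.
    have h1 : 0 < (y - x) * (3 * (x + y) ^ 2 + (y - x) ^ 2) :=
      mul_pos (sub_pos.2 hxy) (by have := sub_pos.2 hxy; positivity)
    have h2 := mul_nonneg (neg_nonneg.2 hβ) (sub_pos.2 hxy).le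
    simp only
    nlinarith

lemma parabola_marks (hβ : β ≤ 0) :
    x ∈ (potentialField lam fun x => x ^ 2 - β).marks ↔ x = lam ∨ (x = 0 ∧ β = 0) := by
  simp only [PWS.marks, mem_ofPred_eq, mem_contact, not_visibleFoldX,
    parabola_not_visibleFoldY hβ, false_and, exists_const, or_false]
  refine or_congr Iff.rfl ⟨fun h => ?_, ?_⟩
  · have h1 := sq_nonneg x
    exact ⟨by rw [← pow_eq_zero_iff two_ne_zero]; linarith, by linarith⟩
  · rintro ⟨rfl, rfl⟩; norm_num

end Parabola

/-! ### Comparison of contacts and marks -/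

lemma sign_eq_of_iff {a b : ℝ} (h1 : 0 < a ↔ 0 < b) (h2 : a < 0 ↔ b < 0) :
    SignType.sign a = SignType.sign b := by
  rcases lt_trichotomy a 0 with h | rfl | h
  · rw [sign_neg h, sign_neg (h2.1 h)]
  · have : b = 0 := le_antisymm (not_lt.1 (mt h1.2 (lt_irrefl _))) (not_lt.1 (mt h2.2 (lt_irrefl _)))
    rw [this]
  · rw [sign_pos h, sign_pos (h1.1 h)]

section Compare

variable {lam lam' β β' r s s' c c' L L' x p q p' q' : ℝ} {g g' G G' M M' : ℝ → ℝ} {h : ℝ ≃o ℝ}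

lemma sameContact_of (hl : h lam = lam') (hpos : 0 < g x ↔ 0 < g' (h x))
    (hneg : g x < 0 ↔ g' (h x) < 0)
    (hv : (potentialField lam g).VisibleFoldY (x, 0) ↔
      (potentialField lam' g').VisibleFoldY (h x, 0))
    (hi : (potentialField lam g).InvisibleFoldY (x, 0) ↔
      (potentialField lam' g').InvisibleFoldY (h x, 0))
    (hc : (potentialField lam g).CuspY (x, 0) ↔ (potentialField lam' g').CuspY (h x, 0)) :
    (potentialField lam g).SameContact (potentialField lam' g') x (h x) := by
  refine ⟨?_, ?_, ?_, ?_, hv, hi, hc⟩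
  · rw [lieOne_X, lieOne_X, ← hl]
    exact sign_eq_of_iff (by rw [sub_pos, sub_pos, h.lt_iff_lt])
      (by rw [sub_neg, sub_neg, h.lt_iff_lt])
  · rw [lieOne_Y, lieOne_Y]
    exact sign_eq_of_iff (by rwa [neg_pos, neg_pos]) (by rwa [neg_lt_zero, neg_lt_zero])
  · exact iff_of_false not_visibleFoldX not_visibleFoldX
  · rw [invisibleFoldX_iff, invisibleFoldX_iff, ← hl, h.injective.eq_iff]

lemma parabola_sameContact (hβ : β ≤ 0) (hβ' : β' ≤ 0) (h0 : β = 0 ↔ β' = 0)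
    (hl : h lam = lam') (hz : β = 0 → h 0 = 0) :
    (potentialField lam fun x => x ^ 2 - β).SameContact
      (potentialField lam' fun x => x ^ 2 - β') x (h x) := by
  have key : ∀ {y b : ℝ}, b ≤ 0 → (0 < y ^ 2 - b ↔ ¬ (y = 0 ∧ b = 0)) := by
    intro y b hb
    constructor
    · rintro h ⟨rfl, rfl⟩; norm_num at h
    · intro h
      rcases eq_or_lt_of_le hb with rfl | hb
      · have : y ≠ 0 := fun hy => h ⟨hy, rfl⟩
        have := pow_pos (abs_pos.2 this) 2
        rwa [sq_abs, ← sub_zero (y ^ 2)] at this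
      · linarith [sq_nonneg y]
  have key' : (x = 0 ∧ β = 0) ↔ (h x = 0 ∧ β' = 0) := by
    rw [← h0]
    refine and_congr_left fun hb => ?_
    constructor
    · rintro rfl; exact hz hb
    · intro hx; exact h.injective (hx.trans (hz hb).symm)
  refine sameContact_of hl ?_ ?_ ?_ ?_ ?_
  · rw [key hβ, key hβ', key']
  · exact iff_of_false (by linarith [sq_nonneg x]) (by linarith [sq_nonneg (h x)])
  · exact iff_of_false (parabola_not_visibleFoldY hβ) (parabola_not_visibleFoldY hβ')
  · exact iff_of_false (parabola_not_invisibleFoldY hβ) (parabola_not_invisibleFoldY hβ')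
  · rw [parabola_cuspY_iff, parabola_cuspY_iff, key']

lemma Well.sameContact (W : Well s g G M c L) (W' : Well s' g' G' M' c' L') (hl : h lam = lam')
    (ha : h (-s) = -s') (hb : h s = s') :
    (potentialField lam g).SameContact (potentialField lam' g') x (h x) := by
  refine sameContact_of hl ?_ ?_ ?_ ?_ (iff_of_false W.not_cuspY W'.not_cuspY)
  · rw [W.pos_iff, W'.pos_iff, ← ha, ← hb, h.lt_iff_lt, h.lt_iff_lt]
  · rw [W.neg_iff, W'.neg_iff, ← ha, ← hb, mem_Ioo, mem_Ioo, h.lt_iff_lt, h.lt_iff_lt]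
  · rw [W.visibleFoldY_iff, W'.visibleFoldY_iff, ← ha, h.injective.eq_iff]
  · rw [W.invisibleFoldY_iff, W'.invisibleFoldY_iff, ← hb, h.injective.eq_iff]

lemma Well.joins_fold_iff (W : Well s g G M c L) :
    (potentialField lam g).Joins .lower x (-s) ↔ x = 3 * s := by
  have hs := W.pos
  rw [joins_lower_iff W.deriv]
  constructor
  · rintro ⟨h1, h2, h3⟩
    obtain ⟨h4, -⟩ := W.chord_ends h1 h2 h3
    refine W.strictMonoOn_right.injOn h4.1.le (show s ≤ 3 * s by linarith) ?_
    rw [← h2, W.level]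
  · rintro rfl
    exact ⟨by linarith, W.level.symm, fun w hw => by rw [W.level]; exact (W.level_mid hw).2⟩

/-- The upper field has no visible fold, and no lower arc from the visible fold `-s` returns, so
only `3s` is added to the contact points. -/
lemma Well.mem_marks (W : Well s g G M c L) :
    x ∈ (potentialField lam g).marks ↔ x = lam ∨ x = -s ∨ x = s ∨ x = 3 * s := by
  simp only [PWS.marks, mem_ofPred_eq, mem_contact, not_visibleFoldX, W.visibleFoldY_iff,
    false_and, exists_const, false_or, exists_eq_left, W.joins_fold_iff, W.zero_iff]
  have : ¬ (potentialField lam g).Joins .lower (-s) x := by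
    rw [joins_lower_iff W.deriv]
    rintro ⟨h1, h2, -⟩
    exact (W.strictMonoOn_left h1.le (le_refl (-s)) h1).ne h2
  simp only [this, or_false, or_assoc]

lemma sameContact_fold (h : (potentialField lam g).SameContact (potentialField lam' g') lam x) :
    x = lam' :=
  invisibleFoldX_iff.1 (h.2.2.2.1.1 (invisibleFoldX_iff.2 rfl))

lemma Well.sameContact_left (W : Well s g G M c L) (W' : Well s' g' G' M' c' L')
    (h : (potentialField lam g).SameContact (potentialField lam' g') (-s) x) : x = -s' :=
  W'.visibleFoldY_iff.1 (h.2.2.2.2.1.1 (W.visibleFoldY_iff.2 rfl))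

lemma Well.sameContact_right (W : Well s g G M c L) (W' : Well s' g' G' M' c' L')
    (h : (potentialField lam g).SameContact (potentialField lam' g') s x) : x = s' :=
  W'.invisibleFoldY_iff.1 (h.2.2.2.2.2.1.1 (W.invisibleFoldY_iff.2 rfl))

/-! ### Counting canard cycles -/

/-- Equal numbers of canard cycles of each kind. -/
def PWS.SameCount (r : ℝ) (Z W : PWS) : Prop :=
  {Γ ∈ Z.canardsIn (square r) | Z.KindI Γ}.encard =
    {Γ ∈ W.canardsIn (square r) | W.KindI Γ}.encard ∧
  {Γ ∈ Z.canardsIn (square r) | Z.KindII Γ}.encard =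
    {Γ ∈ W.canardsIn (square r) | W.KindII Γ}.encard ∧
  {Γ ∈ Z.canardsIn (square r) | Z.KindIII Γ}.encard =
    {Γ ∈ W.canardsIn (square r) | W.KindIII Γ}.encard

lemma PWS.kindII_eq_empty (Z : PWS) : {Γ ∈ Z.canardsIn (square r) | Z.KindII Γ} = ∅ := by
  rw [eq_empty_iff_forall_notMem]
  rintro Γ ⟨h, h'⟩
  exact ne_switching_of_subset_square h.2 h'

lemma PWS.kindI_eq {Z : PWS} (h : ∀ Γ ∈ Z.canardsIn (square r), Z.KindI Γ) :
    {Γ ∈ Z.canardsIn (square r) | Z.KindI Γ} = Z.canardsIn (square r) :=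
  sep_eq_self_iff_mem_true.2 h

lemma PWS.kindIII_eq_empty {Z : PWS} (h : ∀ Γ ∈ Z.canardsIn (square r), Z.KindI Γ) :
    {Γ ∈ Z.canardsIn (square r) | Z.KindIII Γ} = ∅ := by
  rw [eq_empty_iff_forall_notMem]
  rintro Γ ⟨h1, h2⟩
  exact (h Γ h1).not_kindIII h2

lemma PWS.sameCount_of_kindI {Z W : PWS} (h : ∀ Γ ∈ Z.canardsIn (square r), Z.KindI Γ)
    (h' : ∀ Γ ∈ W.canardsIn (square r), W.KindI Γ)
    (e : (Z.canardsIn (square r)).encard = (W.canardsIn (square r)).encard) :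
    Z.SameCount r W := by
  rw [PWS.SameCount, kindI_eq h, kindI_eq h', kindII_eq_empty, kindII_eq_empty, kindIII_eq_empty h,
    kindIII_eq_empty h']
  exact ⟨e, rfl, rfl⟩

lemma PWS.sameCount_of_empty {Z W : PWS} (h : Z.canardsIn (square r) = ∅)
    (h' : W.canardsIn (square r) = ∅) : Z.SameCount r W :=
  sameCount_of_kindI (by simp [h]) (by simp [h']) (by rw [h, h'])

lemma PWS.sameCount_of_kindIII {Z W : PWS} {Γ Γ' : Set (ℝ × ℝ)}
    (h : Z.canardsIn (square r) = {Γ}) (h' : W.canardsIn (square r) = {Γ'}) (hΓ : Z.KindIII Γ)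
    (hΓ' : W.KindIII Γ') : Z.SameCount r W := by
  have key : ∀ {Z : PWS} {Γ}, Z.canardsIn (square r) = {Γ} → Z.KindIII Γ →
      {Γ ∈ Z.canardsIn (square r) | Z.KindI Γ} = ∅ ∧
        {Γ ∈ Z.canardsIn (square r) | Z.KindIII Γ} = {Γ} := by
    intro Z Γ h hΓ
    rw [h]
    refine ⟨?_, sep_eq_self_iff_mem_true.2 (by simpa using hΓ)⟩
    rw [eq_empty_iff_forall_notMem]
    rintro _ ⟨rfl, h2⟩
    exact h2.not_kindIII hΓ
  rw [PWS.SameCount, (key h hΓ).1, (key h hΓ).2, (key h' hΓ').1, (key h' hΓ').2, kindII_eq_empty,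
    kindII_eq_empty, encard_singleton, encard_singleton]
  exact ⟨rfl, rfl, rfl⟩

lemma Well.kindI_of_gt (W : Well s g G M c L) (hr : 10 * s < r) (hr' : r ≤ 1 / 2) (hl : s < lam) :
    ∀ Γ ∈ (potentialField lam g).canardsIn (square r), (potentialField lam g).KindI Γ := by
  intro Γ h
  obtain ⟨u, hu, e, rfl⟩ := (W.mem_canardsIn hr hr' hl).1 h
  exact W.kindI_loop hu hl e

lemma Well.encard_of_lt (W : Well s g G M c L) (hr : 10 * s < r) (hr' : r ≤ 1 / 2)
    (hl : lam ∈ Ioo s L) : ((potentialField lam g).canardsIn (square r)).encard = 2 := by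
  obtain ⟨Γ₁, Γ₂, h, -⟩ := W.two_cycles hr hr'
  obtain ⟨h1, -, -, -, -, h2⟩ := h lam hl
  rw [h1]
  refine encard_pair fun e => ?_
  have h3 : Γ₁ lam ∈ (potentialField lam g).canardsIn (square r) := by rw [h1]; exact mem_insert _ _
  obtain ⟨u, hu, -, h4⟩ := (W.mem_canardsIn hr hr' hl.1).1 h3
  have h5 : (u, (0 : ℝ)) ∈ Γ₁ lam := by
    rw [h4, mem_loop_iff]
    exact ⟨⟨le_rfl, by linarith [hu.2, hl.1]⟩, Or.inl (by simp)⟩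
  have h6 := h2 h5
  rw [← e] at h6
  exact h6.1 h5

/-- The numbers of cycles are `2`, `1`, `0` for `lam` below, at and above the threshold, so the
count determines the position. -/
lemma Well.encard_eq_iff (W : Well s g G M c L) (W' : Well s' g' G' M' c' L') (hr : 10 * s < r)
    (hrs : 10 * s' < r) (hr' : r ≤ 1 / 2) (hl : s < lam) (hl' : s' < lam') :
    ((potentialField lam g).canardsIn (square r)).encard =
      ((potentialField lam' g').canardsIn (square r)).encard ↔
    ((lam < L ↔ lam' < L') ∧ (lam = L ↔ lam' = L')) := by
  have key : ∀ {s lam L c : ℝ} {g G M : ℝ → ℝ}, Well s g G M c L → 10 * s < r → s < lam →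
      ((potentialField lam g).canardsIn (square r)).encard =
        if lam < L then 2 else if lam = L then 1 else 0 := by
    intro s lam L c g G M W hr hl
    split_ifs with h1 h2
    · exact W.encard_of_lt hr hr' ⟨hl, h1⟩
    · rw [h2, W.canardsIn_collision hr hr', encard_singleton]
    · rw [W.canardsIn_of_gt hr hr' (lt_of_le_of_ne (not_lt.1 h1) (Ne.symm h2)), encard_empty]
  rw [key W hr hl, key W' hrs hl']
  constructor
  · intro h
    split_ifs at h with h1 h2 h3 h4 h5 h6 h7 h8 <;> simp_all [ne_of_lt, not_lt_of_ge]
  · rintro ⟨h1, h2⟩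
    simp only [h1, h2]

/-! ### Order isomorphisms of the line -/

/-- The map is the identity above `a` and linear below it. It corrects the image of one further
point without disturbing points already matched. -/
lemma exists_orderIso_kink {a b b' : ℝ} (hb : b < a) (hb' : b' < a) :
    ∃ h : ℝ ≃o ℝ, h b = b' ∧ ∀ x, a ≤ x → h x = x := by
  have hm : 0 < (a - b') / (a - b) := div_pos (sub_pos.2 hb') (sub_pos.2 hb)
  set m := (a - b') / (a - b) with hm'
  set f : ℝ → ℝ := fun x => max x a + m * (min x a - a) with hf
  have f1 : ∀ x, a ≤ x → f x = x := fun x hx => by simp [hf, max_eq_left hx, min_eq_right hx]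
  have f2 : ∀ x, x ≤ a → f x = a + m * (x - a) := fun x hx => by
    simp [hf, max_eq_right hx, min_eq_left hx]
  have mono : StrictMono f := by
    intro x y hxy
    rcases le_total a x with h | h
    · rw [f1 x h, f1 y (h.trans hxy.le)]; exact hxy
    rcases le_total a y with h' | h'
    · rw [f2 x h, f1 y h']
      rcases eq_or_lt_of_le h with h1 | h1
      · rw [h1] at hxy ⊢; linarith
      · have := mul_pos hm (sub_pos.2 h1); linarith
    · rw [f2 x h, f2 y h']
      have := mul_lt_mul_of_pos_left hxy hm; linarith
  have surj : Function.Surjective f := by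
    intro y
    rcases le_total a y with h | h
    · exact ⟨y, f1 y h⟩
    · refine ⟨a + (y - a) / m, ?_⟩
      rw [f2 _ (by linarith [div_nonpos_of_nonpos_of_nonneg (sub_nonpos.2 h) hm.le])]
      field_simp
      ring
  refine ⟨StrictMono.orderIsoOfSurjective f mono surj, ?_, f1⟩
  change f b = b'
  rw [f2 b hb.le, hm']
  have : a - b ≠ 0 := (sub_pos.2 hb).ne'
  field_simp
  ring

/-- Two increasing finite sequences are matched by an order isomorphism of the line. -/
lemma exists_orderIso : ∀ l : List (ℝ × ℝ),
    l.IsChain (fun p q => p.1 < q.1 ∧ p.2 < q.2) → ∃ h : ℝ ≃o ℝ, ∀ p ∈ l, h p.1 = p.2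
  | [], _ => ⟨OrderIso.refl ℝ, by simp⟩
  | [p], _ => ⟨OrderIso.addRight (p.2 - p.1), by simp⟩
  | p :: q :: l, hl => by
    rw [List.isChain_cons_cons] at hl
    obtain ⟨h, hh⟩ := exists_orderIso (q :: l) hl.2
    have hq : h q.1 = q.2 := hh q (by simp)
    obtain ⟨k, k1, k2⟩ := exists_orderIso_kink (a := q.2) (b := h p.1) (b' := p.2)
      (by rw [← hq]; exact h.lt_iff_lt.2 hl.1.1) hl.1.2
    refine ⟨h.trans k, ?_⟩
    have : IsTrans (ℝ × ℝ) (fun p q => p.1 < q.1 ∧ p.2 < q.2) :=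
      ⟨fun a b c h h' => ⟨h.1.trans h'.1, h.2.trans h'.2⟩⟩
    have hpw := List.isChain_iff_pairwise.1 hl.2
    rw [List.pairwise_cons] at hpw
    intro p' hp'
    rcases List.mem_cons.1 hp' with rfl | hp'
    · exact k1
    · rw [OrderIso.trans_apply, hh p' hp']
      refine k2 _ ?_
      rcases List.mem_cons.1 hp' with rfl | hp'
      · exact le_rfl
      · exact (hpw.1 p' hp').2.le

end Compare

/-! ### Building equivalences of portraits and reading off invariants -/

section Portraits

variable {lam lam' β β' r s s' c c' L L' x p q p' q' : ℝ} {g g' G G' M M' : ℝ → ℝ}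

lemma joins_upper_match {k : ℝ ≃o ℝ} (kl : k lam = lam')
    (hx : x < lam → k (2 * lam - x) = 2 * lam' - k x) (z : ℝ) :
    ((potentialField lam g).Joins .upper x z ↔ (potentialField lam' g').Joins .upper (k x) (k z)) ∧
    ((∃ y < z, (potentialField lam g).Joins .upper x y) ↔
      ∃ y < k z, (potentialField lam' g').Joins .upper (k x) y) := by
  have e : k x < lam' ↔ x < lam := by rw [← kl, k.lt_iff_lt]
  simp only [joins_upper_iff, e]
  constructor
  · refine and_congr_right fun h => ?_
    rw [← hx h, k.injective.eq_iff]
  · constructor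
    · rintro ⟨y, hy, h, rfl⟩
      exact ⟨_, by rw [← hx h]; exact k.lt_iff_lt.2 hy, h, rfl⟩
    · rintro ⟨y, hy, h, rfl⟩
      rw [← hx h, k.lt_iff_lt] at hy
      exact ⟨_, hy, h, rfl⟩

/-- Two independent lists suffice, because the definition uses two homeomorphisms: one matches the
zeros `p`, `q` and the ends of the square, the other matches the marks and the landing points of the
upper arcs from them. The memberships default to tactics since the lists are explicit at each use.
-/
lemma Well.samePortrait (W : Well s g G M c L) (W' : Well s' g' G' M' c' L')
    (B : Balance lam r g p q) (B' : Balance lam' r g' p' q') {l l' : List (ℝ × ℝ)}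
    (hl : l.IsChain (fun p q => p.1 < q.1 ∧ p.2 < q.2))
    (hl' : l'.IsChain (fun p q => p.1 < q.1 ∧ p.2 < q.2))
    (count : (potentialField lam g).SameCount r (potentialField lam' g'))
    (m₀ : (-r, -r) ∈ l := by simp) (m₁ : (r, r) ∈ l := by simp)
    (mlam : (lam, lam') ∈ l := by simp) (mp : (p, p') ∈ l := by simp)
    (mq : (q, q') ∈ l := by simp) (ma : (-s, -s') ∈ l := by simp) (mb : (s, s') ∈ l := by simp)
    (nlam : (lam, lam') ∈ l' := by simp) (na : (-s, -s') ∈ l' := by simp)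
    (nb : (s, s') ∈ l' := by simp) (nc : (3 * s, 3 * s') ∈ l' := by simp)
    (ra : -s < lam → (2 * lam + s, 2 * lam' + s') ∈ l' := by
      intro _; first | (exfalso; linarith) | (simp; done) | (ring_nf; simp))
    (rb : s < lam → (2 * lam - s, 2 * lam' - s') ∈ l' := by
      intro _; first | (exfalso; linarith) | (simp; done) | (ring_nf; simp))
    (rc : 3 * s < lam → (2 * lam - 3 * s, 2 * lam' - 3 * s') ∈ l' := by
      intro _; first | (exfalso; linarith) | (simp; done) | (ring_nf; simp)) :
    (potentialField lam g).SamePortrait r (potentialField lam' g') := by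
  obtain ⟨h, hh⟩ := exists_orderIso l hl
  obtain ⟨k, hk⟩ := exists_orderIso l' hl'
  refine ⟨⟨h, hh _ m₀, hh _ m₁, fun x hx => ⟨W.sameContact W' (hh _ mlam) (hh _ ma) (hh _ mb),
    B.samePseudo B' (hh _ mlam) (hh _ mp) (hh _ mq) (hh _ m₀) (hh _ m₁) hx⟩⟩,
    ⟨k, fun x => ?_, fun x hx => ⟨W.sameContact W' (hk _ nlam) (hk _ na) (hk _ nb), fun z _ =>
      joins_upper_match (hk _ nlam) (fun hxl => ?_) z⟩⟩, count⟩
  · have e : ∀ {a b : ℝ}, (a, b) ∈ l' → (k x = b ↔ x = a) := fun {a b} hab => by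
      rw [← show k a = b from hk _ hab, k.injective.eq_iff]
    rw [W.mem_marks, W'.mem_marks, e nlam, e na, e nb, e nc]
  · rcases W.mem_marks.1 hx with rfl | rfl | rfl | rfl
    · exact absurd hxl (lt_irrefl _)
    · rw [show k (-s) = -s' from hk _ na, sub_neg_eq_add, sub_neg_eq_add]; exact hk _ (ra hxl)
    · rw [show k x = s' from hk _ nb]; exact hk _ (rb hxl)
    · rw [show k (3 * s) = 3 * s' from hk _ nc]; exact hk _ (rc hxl)

lemma parabola_samePortrait (hβ : β ≤ 0) (hβ' : β' ≤ 0) (e : β = 0 ↔ β' = 0)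
    (B : Balance lam r (fun x => x ^ 2 - β) p q) (B' : Balance lam' r (fun x => x ^ 2 - β') p' q')
    {l l' : List (ℝ × ℝ)} (hl : l.IsChain (fun p q => p.1 < q.1 ∧ p.2 < q.2))
    (hl' : l'.IsChain (fun p q => p.1 < q.1 ∧ p.2 < q.2))
    (m₀ : (-r, -r) ∈ l := by simp) (m₁ : (r, r) ∈ l := by simp)
    (mlam : (lam, lam') ∈ l := by simp) (mp : (p, p') ∈ l := by simp)
    (mq : (q, q') ∈ l := by simp) (mz : β = 0 → ((0 : ℝ), (0 : ℝ)) ∈ l := by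
      intro _; first | (exfalso; linarith) | (simp; done))
    (nlam : (lam, lam') ∈ l' := by simp) (nz : β = 0 → ((0 : ℝ), (0 : ℝ)) ∈ l' := by
      intro _; first | (exfalso; linarith) | (simp; done))
    (rz : β = 0 → 0 < lam → (2 * lam, 2 * lam') ∈ l' := by
      intro _ _; first | (exfalso; linarith) | (simp; done)) :
    (potentialField lam fun x => x ^ 2 - β).SamePortrait r
      (potentialField lam' fun x => x ^ 2 - β') := by
  obtain ⟨h, hh⟩ := exists_orderIso l hl
  obtain ⟨k, hk⟩ := exists_orderIso l' hl'
  refine ⟨⟨h, hh _ m₀, hh _ m₁, fun x hx => ⟨parabola_sameContact hβ hβ' e (hh _ mlam)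
    fun hb => hh _ (mz hb), B.samePseudo B' (hh _ mlam) (hh _ mp) (hh _ mq) (hh _ m₀) (hh _ m₁) hx⟩⟩,
    ⟨k, fun x => ?_, fun x hx => ⟨parabola_sameContact hβ hβ' e (hk _ nlam)
    fun hb => hk _ (nz hb), fun z _ => joins_upper_match (hk _ nlam) (fun hxl => ?_) z⟩⟩,
    PWS.sameCount_of_empty (parabola_canardsIn hβ) (parabola_canardsIn hβ')⟩
  · rw [parabola_marks hβ, parabola_marks hβ', ← e, ← show k lam = lam' from hk _ nlam,
      k.injective.eq_iff]
    refine or_congr Iff.rfl (and_congr_left fun hb => ?_)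
    have := hk _ (nz hb)
    simp only at this
    rw [← k.injective.eq_iff (a := x), this]
  · rcases (parabola_marks hβ).1 hx with rfl | ⟨rfl, hb⟩
    · exact absurd hxl (lt_irrefl _)
    · rw [show k 0 = 0 from hk _ (nz hb), sub_zero, sub_zero]
      exact hk _ (rz hb hxl)

lemma PWS.SamePortrait.exists_iff {Z W : PWS} (h : Z.SamePortrait r W) {P Q : ℝ → Prop}
    (hPQ : ∀ x z, Z.SameContact W x z → (P x ↔ Q z)) :
    (∃ x ∈ Ioo (-r) r, P x) ↔ ∃ x ∈ Ioo (-r) r, Q x := by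
  obtain ⟨⟨h, h0, h1, hh⟩, -⟩ := h
  constructor
  · rintro ⟨x, hx, hP⟩
    exact ⟨h x, ⟨by rw [← h0]; exact h.lt_iff_lt.2 hx.1, by rw [← h1]; exact h.lt_iff_lt.2 hx.2⟩,
      (hPQ _ _ (hh x hx).1).1 hP⟩
  · rintro ⟨x, hx, hP⟩
    have hx' : h.symm x ∈ Ioo (-r) r :=
      ⟨h.lt_iff_lt.1 (by rw [h0, OrderIso.apply_symm_apply]; exact hx.1),
        h.lt_iff_lt.1 (by rw [h1, OrderIso.apply_symm_apply]; exact hx.2)⟩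
    refine ⟨h.symm x, hx', (hPQ _ _ (hh _ hx').1).2 ?_⟩
    rwa [OrderIso.apply_symm_apply]

lemma parabola_portrait_data (hr : 0 < r) (hl : lam ∈ Ioo (-r) r)
    (h : (potentialField lam fun x => x ^ 2).SamePortrait r (potentialField lam' fun x => x ^ 2)) :
    (lam < 0 ↔ lam' < 0) ∧ (lam = 0 ↔ lam' = 0) := by
  obtain ⟨⟨h, -, -, hh⟩, -⟩ := h
  have h1 : h lam = lam' := sameContact_fold (hh lam hl).1
  have h2 : h 0 = 0 := by
    have := (hh 0 ⟨by linarith, hr⟩).1.2.2.2.2.2.2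
    have e : (fun x : ℝ => x ^ 2) = fun x => x ^ 2 - 0 := by funext x; rw [sub_zero]
    rw [e, parabola_cuspY_iff, parabola_cuspY_iff] at this
    exact (this.1 ⟨rfl, rfl⟩).1
  rw [← h1]
  constructor
  · rw [← h.lt_iff_lt, h2]
  · rw [← h.injective.eq_iff, h2]

/-- What the phase portrait tells about the position of `lam`. -/
lemma Well.portrait_data (W : Well s g G M c L) (W' : Well s' g' G' M' c' L')
    (hr : 10 * s < r) (hrs : 10 * s' < r) (hr' : r ≤ 1 / 2) (hl : lam ∈ Ioo (-r) r)
    (h : (potentialField lam g).SamePortrait r (potentialField lam' g')) :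
    ((lam < -s ↔ lam' < -s') ∧ (lam = -s ↔ lam' = -s') ∧ (lam < s ↔ lam' < s') ∧
      (lam = s ↔ lam' = s')) ∧
    (-s < lam → -s' < lam' → (lam < 0 ↔ lam' < 0) ∧ (lam = 0 ↔ lam' = 0)) ∧
    (s < lam → s' < lam' → ((lam < L ↔ lam' < L') ∧ (lam = L ↔ lam' = L')) ∧
      (lam < 2 * s ↔ lam' < 2 * s') ∧ (lam = 2 * s ↔ lam' = 2 * s') ∧
      (lam < 3 * s ↔ lam' < 3 * s') ∧ (lam = 3 * s ↔ lam' = 3 * s')) := by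
  have hs := W.pos
  have hs' := W'.pos
  obtain ⟨⟨h, -, -, hh⟩, ⟨k, hk, kk⟩, hc, -⟩ := h
  have h1 : h lam = lam' := sameContact_fold (hh lam hl).1
  have h2 : h (-s) = -s' := W.sameContact_left W' (hh _ ⟨by linarith, by linarith⟩).1
  have h3 : h s = s' := W.sameContact_right W' (hh _ ⟨by linarith, by linarith⟩).1
  have k1 : k lam = lam' := sameContact_fold (kk lam (W.mem_marks.2 (by simp))).1
  have ma : -s ∈ (potentialField lam g).marks := W.mem_marks.2 (by simp)
  have mb : s ∈ (potentialField lam g).marks := W.mem_marks.2 (by simp)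
  have mc : 3 * s ∈ (potentialField lam g).marks := W.mem_marks.2 (by simp)
  have k2 : k (-s) = -s' := W.sameContact_left W' (kk _ ma).1
  have k3 : k s = s' := W.sameContact_right W' (kk _ mb).1
  -- The point `c` has no contact type of its own; it is identified as the remaining mark, with
  -- attention to the case that it coincides with `lam`.
  have k4 : k (3 * s) = 3 * s' := by
    have e1 : k (3 * s) ≠ -s' := by rw [← k2]; exact k.injective.ne (by linarith)
    have e2 : k (3 * s) ≠ s' := by
      intro h; rw [← k3] at h; linarith [k.injective h]
    have e3 : k (k.symm (3 * s')) = 3 * s' := k.apply_symm_apply _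
    have e4 := (hk (k.symm (3 * s'))).2 (by rw [e3]; exact W'.mem_marks.2 (by simp))
    rcases W.mem_marks.1 e4 with h | h | h | h
    · rw [h, k1] at e3
      rcases W'.mem_marks.1 ((hk _).1 mc) with h' | h' | h' | h'
      · rw [h', e3]
      · exact absurd h' e1
      · exact absurd h' e2
      · exact h'
    · rw [h, k2] at e3; linarith
    · rw [h, k3] at e3; linarith
    · rw [← h, e3]
  refine ⟨⟨?_, ?_, ?_, ?_⟩, fun i1 i2 => ?_, fun i1 i2 => ⟨?_, ?_, ?_, ?_, ?_⟩⟩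
  · rw [← h1, ← h2, h.lt_iff_lt]
  · rw [← h1, ← h2, h.injective.eq_iff]
  · rw [← h1, ← h3, h.lt_iff_lt]
  · rw [← h1, ← h3, h.injective.eq_iff]
  -- The upper arc from `a` lands at `2 lam + s`, which is left of `b = s` exactly when `lam < 0`.
  · obtain ⟨j1, j2⟩ := (kk _ ma).2 _ mb
    simp only [k2, k3, joins_upper_iff, i1, i2, true_and, exists_eq_right] at j1 j2
    constructor
    · constructor <;> intro h
      · linarith [j2.1 (by linarith)]
      · linarith [j2.2 (by linarith)]
    · constructor <;> intro h
      · linarith [j1.1 (by linarith)]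
      · linarith [j1.2 (by linarith)]
  · refine (W.encard_eq_iff W' hr hrs hr' i1 i2).1 ?_
    rwa [PWS.kindI_eq (W.kindI_of_gt hr hr' i1), PWS.kindI_eq (W'.kindI_of_gt hrs hr' i2)] at hc
  -- The upper arc from `b` lands at `2 lam - s`, which is left of `c = 3s` exactly when `lam < 2s`.
  · have j2 := ((kk _ mb).2 _ mc).2
    simp only [k3, k4, joins_upper_iff, i1, i2, true_and, exists_eq_right] at j2
    constructor <;> intro h
    · linarith [j2.1 (by linarith)]
    · linarith [j2.2 (by linarith)]
  · have j1 := ((kk _ mb).2 _ mc).1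
    simp only [k3, k4, joins_upper_iff, i1, i2, true_and] at j1
    constructor <;> intro h
    · linarith [j1.1 (by linarith)]
    · linarith [j1.2 (by linarith)]
  · rw [← k1, ← k4, k.lt_iff_lt]
  · rw [← k1, ← k4, k.injective.eq_iff]

end Portraits

/-! ### Strata -/

/-- The number of the stratum that contains a parameter. -/
def stratumIndex (L : ℝ → ℝ) (lam β : ℝ) : ℕ :=
  if β < 0 then 1 else if β = 0 then (if lam < 0 then 2 else if lam = 0 then 3 else 4)
  else if lam < -√β then 5 else if lam = -√β then 6 else if lam < √β then
    (if lam < 0 then 7 else if lam = 0 then 8 else 9)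
  else if lam = √β then 10 else if lam < L β then 11 else if lam = L β then 12
  else if lam < 2 * √β then 13 else if lam = 2 * √β then 14 else if lam < 3 * √β then 15
  else if lam = 3 * √β then 16 else 17

lemma exists_stratum (L : ℝ → ℝ) (lam β : ℝ) : ∃ k, Stratum L k lam β := by
  rcases lt_trichotomy β 0 with h | h | h
  · exact ⟨1, h⟩
  · rcases lt_trichotomy lam 0 with h' | h' | h'
    exacts [⟨2, h, h'⟩, ⟨3, h, h'⟩, ⟨4, h, h'⟩]
  rcases lt_trichotomy lam (-√β) with h1 | h1 | h1
  · exact ⟨5, h, h1⟩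
  · exact ⟨6, h, h1⟩
  rcases lt_trichotomy lam √β with h2 | h2 | h2
  · rcases lt_trichotomy lam 0 with h' | h' | h'
    exacts [⟨7, h, h1, h'⟩, ⟨8, h, h'⟩, ⟨9, h, h', h2⟩]
  · exact ⟨10, h, h2⟩
  rcases lt_trichotomy lam (L β) with h3 | h3 | h3
  · exact ⟨11, h, h2, h3⟩
  · exact ⟨12, h, h3⟩
  rcases lt_trichotomy lam (2 * √β) with h4 | h4 | h4
  · exact ⟨13, h, h3, h4⟩
  · exact ⟨14, h, h4⟩
  rcases lt_trichotomy lam (3 * √β) with h5 | h5 | h5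
  exacts [⟨15, h, h4, h5⟩, ⟨16, h, h5⟩, ⟨17, h, h5⟩]

lemma stratum_mem {L : ℝ → ℝ} {lam β : ℝ} {k : ℕ} (h : Stratum L k lam β) :
    k ∈ Finset.Icc 1 17 := by
  by_contra hk
  rw [Finset.mem_Icc, not_and_or, not_le, not_le] at hk
  rcases hk with hk | hk
  · obtain rfl : k = 0 := by omega
    exact h
  · obtain ⟨n, rfl⟩ : ∃ n, k = n + 18 := ⟨k - 18, by omega⟩
    exact h

/-- The index is a decision tree in the order of the strata, which makes disjointness automatic; the
bounds on `L` are what place stratum 12 in its branch. -/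
lemma eq_stratumIndex {L : ℝ → ℝ} {lam β : ℝ} {k : ℕ} (hL : 0 < β → √β < L β ∧ L β < 2 * √β)
    (h : Stratum L k lam β) : k = stratumIndex L lam β := by
  have hs : 0 < β → 0 < √β := Real.sqrt_pos.2
  obtain ⟨hk1, hk2⟩ := Finset.mem_Icc.1 (stratum_mem h)
  rw [stratumIndex]
  interval_cases k <;> simp only [Stratum] at h <;> grind (splits := 20)

/-! ### Equal strata have equal portraits -/

section Comparison

variable {lam lam' β β' r s s' c c' L p q p' q' : ℝ} {g g' G G' M M' : ℝ → ℝ}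

lemma Well.order_left (W : Well s g G M c L) (hr : 10 * s < r) (B : Balance lam r g p q)
    (hl : lam < -s) : p < lam ∧ lam < q ∧ q < -s := by
  have hs := W.pos
  obtain ⟨h1, h2⟩ := B.of_pos (W.out_left lam hl)
  exact ⟨h1, h2, (B.den_lt_iff ⟨by linarith, by linarith⟩).2 (by rw [W.at_left]; linarith)⟩

lemma Well.order_mid (W : Well s g G M c L) (hr : 10 * s < r) (B : Balance lam r g p q)
    (hl : lam ∈ Ioo (-s) s) : -s < q ∧ q < lam ∧ lam < p ∧ p < s := by
  have hs := W.pos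
  obtain ⟨h1, h2⟩ := B.of_neg (W.inner lam hl)
  exact ⟨(B.lt_den_iff ⟨by linarith, by linarith⟩).2 (by rw [W.at_left]; linarith [hl.1]), h2, h1,
    (B.num_lt_iff ⟨by linarith, by linarith⟩).2 (by rw [W.at_right]; linarith [hl.2])⟩

lemma Well.order_right (W : Well s g G M c L) (hr : 10 * s < r) (B : Balance lam r g p q)
    (hl : s < lam) : s < p ∧ p < lam ∧ lam < q := by
  have hs := W.pos
  obtain ⟨h1, h2⟩ := B.of_pos (W.out_right lam hl)
  exact ⟨(B.lt_num_iff ⟨by linarith, by linarith⟩).2 (by rw [W.at_right]; linarith), h1, h2⟩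

lemma Well.sameCount_big (W : Well s g G M c L) {L' : ℝ} (W' : Well s' g' G' M' c' L')
    (hr : 10 * s < r) (hrs : 10 * s' < r) (hr' : r ≤ 1 / 2) (hl : lam ∈ Icc (-s) s)
    (hl' : lam' ∈ Icc (-s') s') :
    (potentialField lam g).SameCount r (potentialField lam' g') :=
  PWS.sameCount_of_kindIII (W.canardsIn_of_mem hr hr' hl) (W'.canardsIn_of_mem hrs hr' hl')
    W.bigLoop_kindIII W'.bigLoop_kindIII

lemma Well.sameCount_right (W : Well s g G M c L) {L' : ℝ} (W' : Well s' g' G' M' c' L')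
    (hr : 10 * s < r) (hrs : 10 * s' < r) (hr' : r ≤ 1 / 2) (hl : s < lam) (hl' : s' < lam')
    (h1 : lam < L ↔ lam' < L') (h2 : lam = L ↔ lam' = L') :
    (potentialField lam g).SameCount r (potentialField lam' g') :=
  PWS.sameCount_of_kindI (W.kindI_of_gt hr hr' hl) (W'.kindI_of_gt hrs hr' hl')
    ((W.encard_eq_iff W' hr hrs hr' hl hl').2 ⟨h1, h2⟩)

lemma Well.samePortrait_of_stratum {L : ℝ → ℝ} {k : ℕ} (W : Well √β g G M c (L β))
    (W' : Well √β' g' G' M' c' (L β')) (hr : 10 * √β < r) (hrs : 10 * √β' < r) (hr' : r ≤ 1 / 2)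
    (B : Balance lam r g p q) (B' : Balance lam' r g' p' q') (h : Stratum L k lam β)
    (h' : Stratum L k lam' β') (hk : k ∈ Finset.Icc 5 17) :
    (potentialField lam g).SamePortrait r (potentialField lam' g') := by
  have hs := W.pos
  have hs' := W'.pos
  have hL := W.lt_L
  have hL' := W'.lt_L
  have hL2 := W.L_lt
  have hL2' := W'.L_lt
  obtain ⟨p1, p2⟩ := B.num_mem
  obtain ⟨q1, q2⟩ := B.den_mem
  obtain ⟨p1', p2'⟩ := B'.num_mem
  obtain ⟨q1', q2'⟩ := B'.den_mem
  -- For `lam > √β` the order of the points of the first list is always the same; only the list of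
  -- landing points varies.
  have right_case : √β < lam → √β' < lam' → (lam < L β ↔ lam' < L β') → (lam = L β ↔ lam' = L β') →
      ∀ l' : List (ℝ × ℝ), l'.IsChain (fun p q => p.1 < q.1 ∧ p.2 < q.2) →
      ((lam, lam') ∈ l' ∧ (-√β, -√β') ∈ l' ∧ (√β, √β') ∈ l' ∧ (3 * √β, 3 * √β') ∈ l' ∧
      (2 * lam + √β, 2 * lam' + √β') ∈ l' ∧ (2 * lam - √β, 2 * lam' - √β') ∈ l' ∧
      (3 * √β < lam → (2 * lam - 3 * √β, 2 * lam' - 3 * √β') ∈ l')) →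
      (potentialField lam g).SamePortrait r (potentialField lam' g') := by
    rintro i i' i1 i2 l' hl' ⟨m1, m2, m3, m4, m5, m6, m7⟩
    obtain ⟨o1, o2, o3⟩ := W.order_right hr B i
    obtain ⟨o1', o2', o3'⟩ := W'.order_right hrs B' i'
    refine W.samePortrait W' B B'
      (l := [(-r, -r), (-√β, -√β'), (√β, √β'), (p, p'), (lam, lam'), (q, q'), (r, r)])
      (l' := l') ?_ hl' (W.sameCount_right W' hr hrs hr' i i' i1 i2) (nlam := m1) (na := m2)
      (nb := m3) (nc := m4) (ra := fun _ => m5) (rb := fun _ => m6) (rc := m7)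
    simp only [List.isChain_cons_cons, List.isChain_singleton, and_true]
    and_intros <;> linarith
  have mid_case : lam ∈ Ioo (-√β) √β → lam' ∈ Ioo (-√β') √β' →
      ∀ l' : List (ℝ × ℝ), l'.IsChain (fun p q => p.1 < q.1 ∧ p.2 < q.2) →
      ((lam, lam') ∈ l' ∧ (-√β, -√β') ∈ l' ∧ (√β, √β') ∈ l' ∧ (3 * √β, 3 * √β') ∈ l' ∧
      (2 * lam + √β, 2 * lam' + √β') ∈ l') →
      (potentialField lam g).SamePortrait r (potentialField lam' g') := by
    rintro i i' l' hl' ⟨m1, m2, m3, m4, m5⟩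
    obtain ⟨o1, o2, o3, o4⟩ := W.order_mid hr B i
    obtain ⟨o1', o2', o3', o4'⟩ := W'.order_mid hrs B' i'
    obtain ⟨i1, i2⟩ := i
    obtain ⟨i1', i2'⟩ := i'
    refine W.samePortrait W' B B'
      (l := [(-r, -r), (-√β, -√β'), (q, q'), (lam, lam'), (p, p'), (√β, √β'), (r, r)])
      (l' := l') ?_ hl' (W.sameCount_big W' hr hrs hr' ⟨i1.le, i2.le⟩ ⟨i1'.le, i2'.le⟩)
      (nlam := m1) (na := m2) (nb := m3) (nc := m4) (ra := fun _ => m5)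
    simp only [List.isChain_cons_cons, List.isChain_singleton, and_true]
    and_intros <;> linarith
  rw [Finset.mem_Icc] at hk
  obtain ⟨hk1, hk2⟩ := hk
  interval_cases k <;> simp only [Stratum] at h h'
  · obtain ⟨o1, o2, o3⟩ := W.order_left hr B h.2
    obtain ⟨o1', o2', o3'⟩ := W'.order_left hrs B' h'.2
    have i := h.2
    have i' := h'.2
    refine W.samePortrait W' B B'
      (l := [(-r, -r), (p, p'), (lam, lam'), (q, q'), (-√β, -√β'), (√β, √β'), (r, r)])
      (l' := [(lam, lam'), (-√β, -√β'), (√β, √β'), (3 * √β, 3 * √β')]) ?_ ?_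
      (PWS.sameCount_of_empty (W.canardsIn_of_lt hr' i) (W'.canardsIn_of_lt hr' i'))
    all_goals
      simp only [List.isChain_cons_cons, List.isChain_singleton, and_true]
      and_intros <;> linarith
  · obtain ⟨-, rfl⟩ := h
    obtain ⟨-, rfl⟩ := h'
    obtain ⟨rfl, rfl⟩ := B.of_zero W.at_left
    obtain ⟨rfl, rfl⟩ := B'.of_zero W'.at_left
    refine W.samePortrait W' B B' (l := [(-r, -r), (-√β, -√β'), (√β, √β'), (r, r)])
      (l' := [(-√β, -√β'), (√β, √β'), (3 * √β, 3 * √β')]) ?_ ?_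
      (W.sameCount_big W' hr hrs hr' ⟨by linarith, by linarith⟩ ⟨by linarith, by linarith⟩)
    all_goals
      simp only [List.isChain_cons_cons, List.isChain_singleton, and_true]
      and_intros <;> linarith
  · obtain ⟨-, i1, i2⟩ := h
    obtain ⟨-, i1', i2'⟩ := h'
    refine mid_case ⟨i1, by linarith⟩ ⟨i1', by linarith⟩ [(-√β, -√β'), (lam, lam'),
      (2 * lam + √β, 2 * lam' + √β'), (√β, √β'), (3 * √β, 3 * √β')] ?_ (by simp)
    simp only [List.isChain_cons_cons, List.isChain_singleton, and_true]
    and_intros <;> linarith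
  · obtain ⟨-, rfl⟩ := h
    obtain ⟨-, rfl⟩ := h'
    refine mid_case ⟨by linarith, by linarith⟩ ⟨by linarith, by linarith⟩ [(-√β, -√β'), (0, 0),
      (√β, √β'), (3 * √β, 3 * √β')] ?_ (by simp)
    simp only [List.isChain_cons_cons, List.isChain_singleton, and_true]
    and_intros <;> linarith
  · obtain ⟨-, i1, i2⟩ := h
    obtain ⟨-, i1', i2'⟩ := h'
    refine mid_case ⟨by linarith, i2⟩ ⟨by linarith, i2'⟩ [(-√β, -√β'), (lam, lam'), (√β, √β'),
      (2 * lam + √β, 2 * lam' + √β'), (3 * √β, 3 * √β')] ?_ (by simp)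
    simp only [List.isChain_cons_cons, List.isChain_singleton, and_true]
    and_intros <;> linarith
  · obtain ⟨-, rfl⟩ := h
    obtain ⟨-, rfl⟩ := h'
    obtain ⟨rfl, rfl⟩ := B.of_zero W.at_right
    obtain ⟨rfl, rfl⟩ := B'.of_zero W'.at_right
    refine W.samePortrait W' B B' (l := [(-r, -r), (-√β, -√β'), (√β, √β'), (r, r)])
      (l' := [(-√β, -√β'), (√β, √β'), (3 * √β, 3 * √β')]) ?_ ?_
      (W.sameCount_big W' hr hrs hr' ⟨by linarith, by linarith⟩ ⟨by linarith, by linarith⟩)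
    all_goals
      simp only [List.isChain_cons_cons, List.isChain_singleton, and_true]
      and_intros <;> linarith
  all_goals
    obtain ⟨-, h⟩ := h
    obtain ⟨-, h'⟩ := h'
  -- Strata 11, 12 and 13 share one order of the marks and differ only in the number of cycles.
  iterate 3
    · refine right_case (by linarith) (by linarith) ?_ ?_ [(-√β, -√β'), (√β, √β'), (lam, lam'),
        (2 * lam - √β, 2 * lam' - √β'), (3 * √β, 3 * √β'), (2 * lam + √β, 2 * lam' + √β')] ?_
        ⟨by simp, by simp, by simp, by simp, by simp, by simp, fun _ => by linarith⟩
      · constructor <;> intro _ <;> linarith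
      · constructor <;> intro _ <;> linarith
      · simp only [List.isChain_cons_cons, List.isChain_singleton, and_true]
        and_intros <;> linarith
  · subst h h'
    refine right_case (by linarith) (by linarith) ?_ ?_ [(-√β, -√β'), (√β, √β'),
      (2 * √β, 2 * √β'), (3 * √β, 3 * √β'), (5 * √β, 5 * √β')] ?_
      ⟨by simp, by simp, by simp, by simp, by ring_nf; simp, by ring_nf; simp,
        fun _ => by linarith⟩
    · constructor <;> intro _ <;> linarith
    · constructor <;> intro _ <;> linarith
    · simp only [List.isChain_cons_cons, List.isChain_singleton, and_true]
      and_intros <;> linarith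
  · refine right_case (by linarith) (by linarith) ?_ ?_ [(-√β, -√β'), (√β, √β'), (lam, lam'),
      (3 * √β, 3 * √β'), (2 * lam - √β, 2 * lam' - √β'), (2 * lam + √β, 2 * lam' + √β')] ?_
      ⟨by simp, by simp, by simp, by simp, by simp, by simp, fun _ => by linarith⟩
    · constructor <;> intro _ <;> linarith
    · constructor <;> intro _ <;> linarith
    · simp only [List.isChain_cons_cons, List.isChain_singleton, and_true]
      and_intros <;> linarith
  · subst h h'
    refine right_case (by linarith) (by linarith) ?_ ?_ [(-√β, -√β'), (√β, √β'),
      (3 * √β, 3 * √β'), (5 * √β, 5 * √β'), (7 * √β, 7 * √β')] ?_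
      ⟨by simp, by simp, by simp, by simp, by ring_nf; simp, by ring_nf; simp,
        fun _ => by linarith⟩
    · constructor <;> intro _ <;> linarith
    · constructor <;> intro _ <;> linarith
    · simp only [List.isChain_cons_cons, List.isChain_singleton, and_true]
      and_intros <;> linarith
  · refine right_case (by linarith) (by linarith) ?_ ?_ [(-√β, -√β'), (√β, √β'),
      (3 * √β, 3 * √β'), (lam, lam'), (2 * lam - 3 * √β, 2 * lam' - 3 * √β'),
      (2 * lam - √β, 2 * lam' - √β'), (2 * lam + √β, 2 * lam' + √β')] ?_ (by simp)
    · constructor <;> intro _ <;> linarith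
    · constructor <;> intro _ <;> linarith
    · simp only [List.isChain_cons_cons, List.isChain_singleton, and_true]
      and_intros <;> linarith

lemma parabola_samePortrait_of_stratum {L : ℝ → ℝ} {k : ℕ} (hβ : β ≤ 0) (hβ' : β' ≤ 0)
    (B : Balance lam r (fun x => x ^ 2 - β) p q) (B' : Balance lam' r (fun x => x ^ 2 - β') p' q')
    (h : Stratum L k lam β) (h' : Stratum L k lam' β') (hk : k ∈ Finset.Icc 1 4) :
    (potentialField lam fun x => x ^ 2 - β).SamePortrait r
      (potentialField lam' fun x => x ^ 2 - β') := by
  obtain ⟨p1, p2⟩ := B.num_mem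
  obtain ⟨q1, q2⟩ := B.den_mem
  obtain ⟨p1', p2'⟩ := B'.num_mem
  obtain ⟨q1', q2'⟩ := B'.den_mem
  have hr : (0 : ℝ) ∈ Ioo (-r) r := ⟨by linarith, by linarith⟩
  have pos : lam ^ 2 - β ≠ 0 → 0 < lam ^ 2 - β := fun h =>
    lt_of_le_of_ne (by linarith [sq_nonneg lam]) h.symm
  have pos' : lam' ^ 2 - β' ≠ 0 → 0 < lam' ^ 2 - β' := fun h =>
    lt_of_le_of_ne (by linarith [sq_nonneg lam']) h.symm
  rw [Finset.mem_Icc] at hk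
  obtain ⟨hk1, hk2⟩ := hk
  interval_cases k <;> simp only [Stratum] at h h'
  · obtain ⟨o1, o2⟩ := B.of_pos (by linarith [sq_nonneg lam])
    obtain ⟨o1', o2'⟩ := B'.of_pos (by linarith [sq_nonneg lam'])
    refine parabola_samePortrait hβ hβ' (iff_of_false h.ne h'.ne) B B'
      (l := [(-r, -r), (p, p'), (lam, lam'), (q, q'), (r, r)]) (l' := [(lam, lam')]) ?_ (by simp)
    simp only [List.isChain_cons_cons, List.isChain_singleton, and_true]
    and_intros <;> linarith
  all_goals
    obtain ⟨rfl, h⟩ := h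
    obtain ⟨rfl, h'⟩ := h'
  · obtain ⟨o1, o2⟩ := B.of_pos (pos (by rw [sub_zero]; exact pow_ne_zero 2 h.ne))
    obtain ⟨o1', o2'⟩ := B'.of_pos (pos' (by rw [sub_zero]; exact pow_ne_zero 2 h'.ne))
    have o3 := (B.den_lt_iff hr).2 (by norm_num; exact h)
    have o3' := (B'.den_lt_iff hr).2 (by norm_num; exact h')
    refine parabola_samePortrait hβ hβ' Iff.rfl B B'
      (l := [(-r, -r), (p, p'), (lam, lam'), (q, q'), (0, 0), (r, r)])
      (l' := [(lam, lam'), (0, 0)]) ?_ ?_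
    all_goals
      simp only [List.isChain_cons_cons, List.isChain_singleton, and_true]
      and_intros <;> linarith
  · subst h h'
    obtain ⟨rfl, rfl⟩ := B.of_zero (by norm_num)
    obtain ⟨e1, e2⟩ := B'.of_zero (by norm_num)
    subst e1 e2
    refine parabola_samePortrait hβ hβ' Iff.rfl B B' (l := [(-r, -r), (0, 0), (r, r)])
      (l' := [(0, 0)]) ?_ (by simp)
    simp only [List.isChain_cons_cons, List.isChain_singleton, and_true]
    and_intros <;> linarith
  · obtain ⟨o1, o2⟩ := B.of_pos (pos (by rw [sub_zero]; exact pow_ne_zero 2 h.ne'))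
    obtain ⟨o1', o2'⟩ := B'.of_pos (pos' (by rw [sub_zero]; exact pow_ne_zero 2 h'.ne'))
    have o3 := (B.lt_num_iff hr).2 (by norm_num; exact h)
    have o3' := (B'.lt_num_iff hr).2 (by norm_num; exact h')
    refine parabola_samePortrait hβ hβ' Iff.rfl B B'
      (l := [(-r, -r), (0, 0), (p, p'), (lam, lam'), (q, q'), (r, r)])
      (l' := [(0, 0), (lam, lam'), (2 * lam, 2 * lam')]) ?_ ?_
    all_goals
      simp only [List.isChain_cons_cons, List.isChain_singleton, and_true]
      and_intros <;> linarith

end Comparison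

/-! ### Different strata have different portraits -/

section Distinction

variable {lam lam' β β' r s c c' p q p' q' : ℝ} {g g' G G' M M' : ℝ → ℝ}

lemma ite_congr_of_iff {P Q : Prop} [Decidable P] [Decidable Q] {a b a' b' : ℕ} (h : P ↔ Q)
    (h₁ : P → Q → a = a') (h₂ : ¬ P → ¬ Q → b = b') :
    (if P then a else b) = if Q then a' else b' := by
  by_cases hP : P
  · rw [if_pos hP, if_pos (h.1 hP), h₁ hP (h.1 hP)]
  · rw [if_neg hP, if_neg (mt h.2 hP), h₂ hP (mt h.2 hP)]

/-- A cusp in the square marks `β = 0`; together with `exists_visibleFoldY_iff` it lets the portrait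
determine the sign of `β`. -/
lemma exists_cuspY_iff {L : ℝ → ℝ} (hr : 0 < r)
    (hW : 0 < β → Well √β (lowerForce β) G M c (L β)) :
    (∃ x ∈ Ioo (-r) r, (potentialField lam (lowerForce β)).CuspY (x, 0)) ↔ β = 0 := by
  rcases le_or_gt β 0 with h | h
  · rw [lowerForce_of_nonpos h]
    simp only [parabola_cuspY_iff]
    exact ⟨fun ⟨_, _, _, h⟩ => h, fun h => ⟨0, ⟨by linarith, hr⟩, rfl, h⟩⟩
  · exact iff_of_false (fun ⟨_, _, h'⟩ => (hW h).not_cuspY h') h.ne'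

lemma exists_visibleFoldY_iff {L : ℝ → ℝ} (hs : 0 < β → 10 * √β < r)
    (hW : 0 < β → Well √β (lowerForce β) G M c (L β)) :
    (∃ x ∈ Ioo (-r) r, (potentialField lam (lowerForce β)).VisibleFoldY (x, 0)) ↔ 0 < β := by
  rcases le_or_gt β 0 with h | h
  · rw [lowerForce_of_nonpos h]
    exact iff_of_false (fun ⟨_, _, h'⟩ => parabola_not_visibleFoldY h h') (not_lt.2 h)
  · have h1 := hs h
    have h2 := (hW h).pos
    exact iff_of_true ⟨-√β, ⟨by linarith, by linarith⟩, (hW h).visibleFoldY_iff.2 rfl⟩ h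

/-- The portrait determines every test of the decision tree, so the two trees are traversed in
parallel. -/
lemma stratumIndex_eq_of_samePortrait {L : ℝ → ℝ} (hr : 0 < r) (hr' : r ≤ 1 / 2)
    (hl : lam ∈ Ioo (-r) r) (hs : 0 < β → 10 * √β < r) (hs' : 0 < β' → 10 * √β' < r)
    (hW : 0 < β → Well √β (lowerForce β) G M c (L β))
    (hW' : 0 < β' → Well √β' (lowerForce β') G' M' c' (L β'))
    (h : (potentialField lam (lowerForce β)).SamePortrait r
      (potentialField lam' (lowerForce β'))) : stratumIndex L lam β = stratumIndex L lam' β' := by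
  have hz : β = 0 ↔ β' = 0 := by
    rw [← exists_cuspY_iff hr hW (lam := lam), ← exists_cuspY_iff hr hW' (lam := lam')]
    exact h.exists_iff fun x z hxz => hxz.2.2.2.2.2.2
  have hp : 0 < β ↔ 0 < β' := by
    rw [← exists_visibleFoldY_iff hs hW (lam := lam), ← exists_visibleFoldY_iff hs' hW' (lam := lam')]
    exact h.exists_iff fun x z hxz => hxz.2.2.2.2.1
  have hn : β < 0 ↔ β' < 0 := by
    rw [← not_le, ← not_le, le_iff_lt_or_eq, le_iff_lt_or_eq, hp, eq_comm, hz, eq_comm]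
  refine ite_congr_of_iff hn (fun _ _ => rfl) fun n1 n1' => ite_congr_of_iff hz (fun e e' => ?_)
    fun n2 n2' => ?_
  · rw [lowerForce_of_nonpos e.le, lowerForce_of_nonpos e'.le, e, e'] at h
    simp only [sub_zero] at h
    obtain ⟨h1, h2⟩ := parabola_portrait_data hr hl h
    exact ite_congr_of_iff h1 (fun _ _ => rfl) fun _ _ => ite_congr_of_iff h2 (fun _ _ => rfl)
      fun _ _ => rfl
  · have hβ : 0 < β := lt_of_le_of_ne (not_lt.1 n1) (Ne.symm n2)
    have hβ' := hp.1 hβ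
    obtain ⟨⟨d1, d2, d3, d4⟩, d5, d6⟩ :=
      (hW hβ).portrait_data (hW' hβ') (hs hβ) (hs' hβ') hr' hl h
    refine ite_congr_of_iff d1 (fun _ _ => rfl) fun m1 m1' => ite_congr_of_iff d2 (fun _ _ => rfl)
      fun m2 m2' => ite_congr_of_iff d3 (fun _ _ => ?_) fun m3 m3' => ite_congr_of_iff d4
      (fun _ _ => rfl) fun m4 m4' => ?_
    · obtain ⟨e1, e2⟩ := d5 (lt_of_le_of_ne (not_lt.1 m1) (Ne.symm m2))
        (lt_of_le_of_ne (not_lt.1 m1') (Ne.symm m2'))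
      exact ite_congr_of_iff e1 (fun _ _ => rfl) fun _ _ => ite_congr_of_iff e2 (fun _ _ => rfl)
        fun _ _ => rfl
    · obtain ⟨⟨e1, e2⟩, e3, e4, e5, e6⟩ := d6 (lt_of_le_of_ne (not_lt.1 m3) (Ne.symm m4))
        (lt_of_le_of_ne (not_lt.1 m3') (Ne.symm m4'))
      exact ite_congr_of_iff e1 (fun _ _ => rfl) fun _ _ => ite_congr_of_iff e2 (fun _ _ => rfl)
        fun _ _ => ite_congr_of_iff e3 (fun _ _ => rfl) fun _ _ => ite_congr_of_iff e4
        (fun _ _ => rfl) fun _ _ => ite_congr_of_iff e5 (fun _ _ => rfl) fun _ _ =>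
        ite_congr_of_iff e6 (fun _ _ => rfl) fun _ _ => rfl

theorem samePortrait_iff {L : ℝ → ℝ} (hL : ∀ β, 0 < β → √β < L β ∧ L β < 2 * √β) (hr : 0 < r)
    (hr' : r ≤ 1 / 2) (hs : 0 < β → 10 * √β < r) (hs' : 0 < β' → 10 * √β' < r)
    (hW : 0 < β → Well √β (lowerForce β) G M c (L β))
    (hW' : 0 < β' → Well √β' (lowerForce β') G' M' c' (L β'))
    (B : Balance lam r (lowerForce β) p q) (B' : Balance lam' r (lowerForce β') p' q') {k k' : ℕ}
    (hk : Stratum L k lam β) (hk' : Stratum L k' lam' β') :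
    (potentialField lam (lowerForce β)).SamePortrait r (potentialField lam' (lowerForce β')) ↔
      k = k' := by
  constructor
  · intro h
    rw [eq_stratumIndex (hL β) hk, eq_stratumIndex (hL β') hk']
    exact stratumIndex_eq_of_samePortrait hr hr' B.mem hs hs' hW hW' h
  · rintro rfl
    have h17 : k ∈ Finset.Icc 1 17 := stratum_mem hk
    rw [Finset.mem_Icc] at h17
    rcases le_or_gt k 4 with h4 | h4
    · have hβ : ∀ {lam β}, Stratum L k lam β → β ≤ 0 := by
        intro lam β h
        obtain ⟨h1, -⟩ := h17
        interval_cases k <;> simp only [Stratum] at h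
        exacts [h.le, h.1.le, h.1.le, h.1.le]
      rw [lowerForce_of_nonpos (hβ hk)] at B ⊢
      rw [lowerForce_of_nonpos (hβ hk')] at B' ⊢
      exact parabola_samePortrait_of_stratum (hβ hk) (hβ hk') B B' hk hk'
        (Finset.mem_Icc.2 ⟨h17.1, h4⟩)
    · have hβ : ∀ {lam β}, Stratum L k lam β → 0 < β := by
        intro lam β h
        obtain ⟨-, h1⟩ := h17
        interval_cases k <;> exact h.1
      exact (hW (hβ hk)).samePortrait_of_stratum (hW' (hβ hk')) (hs (hβ hk)) (hs' (hβ hk')) hr' B B'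
        hk hk' (Finset.mem_Icc.2 ⟨h4, h17.2⟩)

end Distinction

/-! ### The parameters -/

section Parameters

variable {lam β r s c L p q x : ℝ} {g G M : ℝ → ℝ}

/-- The threshold is chosen before `r`, once for all `β > 0`. Where `√β` is too large for the
analysis, the value `3/2 √β` only serves to satisfy the bounds. -/
lemma exists_threshold : ∃ L : ℝ → ℝ, (∀ β, 0 < β → √β < L β ∧ L β < 2 * √β) ∧
    ∀ β, 0 < β → √β < 1 / 10000 →
      ∃ G M c, Well √β (lowerForce β) G M c (L β) := by
  have : ∀ β : ℝ, ∃ l : ℝ, 0 < β → (√β < l ∧ l < 2 * √β) ∧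
      (√β < 1 / 10000 → ∃ G M c, Well √β (lowerForce β) G M c l) := by
    intro β
    by_cases h : 0 < β
    · have hs := Real.sqrt_pos.2 h
      by_cases h' : √β < 1 / 10000
      · obtain ⟨M, c, l, W⟩ := exists_well hs h'
        rw [← lowerForce_of_pos h] at W
        exact ⟨l, fun _ => ⟨⟨W.lt_L, W.L_lt⟩, fun _ => ⟨_, M, c, W⟩⟩⟩
      · exact ⟨3 / 2 * √β, fun _ => ⟨⟨by linarith, by linarith⟩, fun h => absurd h h'⟩⟩
    · exact ⟨0, fun h' => absurd h' h⟩
  choose L hL using this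
  exact ⟨L, fun β h => (hL β h).1, fun β h => (hL β h).2⟩

lemma exists_stratum_near {L : ℝ → ℝ} (hL : ∀ β, 0 < β → √β < L β ∧ L β < 2 * √β) {k : ℕ}
    (hk : k ∈ Finset.Icc 1 17) {ε : ℝ} (hε : 0 < ε) :
    ∃ lam β, |lam| < ε ∧ |β| < ε ∧ Stratum L k lam β := by
  obtain ⟨s, hs, h1, h2⟩ : ∃ s > 0, 4 * s < ε ∧ s < 1 :=
    -- The representatives have `β = s²` or `|β| ≤ s`, and `|lam| ≤ 4s`, so `4s < ε` and `s < 1`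
    -- suffice.
    ⟨min ε 1 / 5, by positivity, by linarith [min_le_left ε 1], by linarith [min_le_right ε 1]⟩
  have hβ : 0 < s ^ 2 := by positivity
  have e : √(s ^ 2) = s := Real.sqrt_sq hs.le
  obtain ⟨l1, l2⟩ := hL _ hβ
  rw [e] at l1 l2
  have hβ' : |s ^ 2| < ε := by rw [abs_of_pos hβ]; nlinarith
  have key : ∀ lam, -(2 * s) ≤ lam → lam ≤ 4 * s → |lam| < ε := fun lam h h' =>
    abs_lt.2 ⟨by linarith, by linarith⟩
  have h0 : |(0 : ℝ)| < ε := by rwa [abs_zero]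
  have hpos : |s| < ε := key s (by linarith) (by linarith)
  have hneg : |-s| < ε := key (-s) (by linarith) (by linarith)
  rw [Finset.mem_Icc] at hk
  obtain ⟨hk1, hk2⟩ := hk
  interval_cases k
  · exact ⟨0, -s, h0, hneg, neg_lt_zero.2 hs⟩
  · exact ⟨-s, 0, hneg, h0, rfl, neg_lt_zero.2 hs⟩
  · exact ⟨0, 0, h0, h0, rfl, rfl⟩
  · exact ⟨s, 0, hpos, h0, rfl, hs⟩
  · exact ⟨-(2 * s), s ^ 2, key _ le_rfl (by linarith), hβ', hβ, by rw [e]; linarith⟩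
  · exact ⟨-s, s ^ 2, hneg, hβ', hβ, by rw [e]⟩
  · exact ⟨-(s / 2), s ^ 2, key _ (by linarith) (by linarith), hβ', hβ, by rw [e]; linarith,
      by linarith⟩
  · exact ⟨0, s ^ 2, h0, hβ', hβ, rfl⟩
  · exact ⟨s / 2, s ^ 2, key _ (by linarith) (by linarith), hβ', hβ, by linarith,
      by rw [e]; linarith⟩
  · exact ⟨s, s ^ 2, hpos, hβ', hβ, e.symm⟩
  · exact ⟨(s + L (s ^ 2)) / 2, s ^ 2, key _ (by linarith) (by linarith), hβ', hβ,
      by rw [e]; linarith, by linarith⟩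
  · exact ⟨L (s ^ 2), s ^ 2, key _ (by linarith) (by linarith), hβ', hβ, rfl⟩
  · exact ⟨(L (s ^ 2) + 2 * s) / 2, s ^ 2, key _ (by linarith) (by linarith), hβ', hβ,
      by linarith, by rw [e]; linarith⟩
  · exact ⟨2 * s, s ^ 2, key _ (by linarith) (by linarith), hβ', hβ, by rw [e]⟩
  · exact ⟨5 / 2 * s, s ^ 2, key _ (by linarith) (by linarith), hβ', hβ, by rw [e]; linarith,
      by rw [e]; linarith⟩
  · exact ⟨3 * s, s ^ 2, key _ (by linarith) (by linarith), hβ', hβ, by rw [e]⟩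
  · exact ⟨4 * s, s ^ 2, key _ (by linarith) le_rfl, hβ', hβ, by rw [e]; linarith⟩

lemma exists_balance_lowerForce {L : ℝ → ℝ} (hr : 0 < r) (hr' : r ≤ 1 / 2)
    (hW : 0 < β → Well √β (lowerForce β) G M c (L β)) (hs : 0 < β → 10 * √β < r)
    (hβ : -(r / 8) < β) (hl : lam ∈ Ioo (-(r / 4)) (r / 4)) :
    ∃ p q, Balance lam r (lowerForce β) p q := by
  have hsq : (r / 2) ^ 2 ≤ r / 8 := by nlinarith
  have hsq0 : 0 ≤ (r / 2) ^ 2 := sq_nonneg _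
  have hl' : lam ∈ Ioo (-(r / 2 / 2)) (r / 2 / 2) := by
    rwa [show r / 2 / 2 = r / 4 by ring]
  rcases le_or_gt β 0 with h | h
  · rw [lowerForce_of_nonpos h]
    refine exists_balance (ρ := r / 2) (by fun_prop) parabola_add parabola_sub (by linarith)
      (by linarith) hr' ?_ ?_ hl'
    · exact ⟨by linarith, by linarith⟩
    · rw [neg_sq]; exact ⟨by linarith, by linarith⟩
  · have W := hW h
    have h1 := hs h
    have h2 := W.pos
    have h3 : √β ^ 2 ≤ (r / 2) ^ 2 := pow_le_pow_left₀ h2.le (by linarith) 2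
    have h4 := sq_nonneg √β
    -- At distance `r / 2` from the origin the bump has vanished, as `4 √β < r / 2`, and the force
    -- is the parabola.
    have e : ∀ x, |x| = r / 2 → lowerForce β x ∈ Icc 0 (r / 2 / 2) := by
      intro x hx
      rw [lowerForce_of_pos h, force_far h2 (by rw [hx]; linarith), ← sq_abs, hx]
      exact ⟨by linarith, by linarith⟩
    exact exists_balance W.cont W.mono_add W.mono_sub (by linarith) (by linarith) hr'
      (e _ (abs_of_pos (by linarith))) (e _ (by rw [abs_neg]; exact abs_of_pos (by linarith))) hl'

lemma regions_of {E S C : Set ℝ} (hE : ∀ x, (x < lam ∧ 0 < g x) ↔ x ∈ E)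
    (hS : ∀ x, (lam < x ∧ g x < 0) ↔ x ∈ S)
    (hC : ∀ x, ((x < lam ∧ g x < 0) ∨ (lam < x ∧ 0 < g x)) ↔ x ∈ C) :
    (potentialField lam g).Regions E S C := by
  refine ⟨?_, ?_, ?_⟩ <;> ext x
  · rw [mem_ofPred_eq, mem_escaping, hE]
  · rw [mem_ofPred_eq, mem_slidingRegion, hS]
  · rw [mem_ofPred_eq, mem_sewing, hC]

lemma Well.regions_of (W : Well s g G M c L) {E S C : Set ℝ}
    (hE : ∀ x, (x < lam ∧ (x < -s ∨ s < x)) ↔ x ∈ E)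
    (hS : ∀ x, (lam < x ∧ -s < x ∧ x < s) ↔ x ∈ S)
    (hC : ∀ x, ((x < lam ∧ -s < x ∧ x < s) ∨ (lam < x ∧ (x < -s ∨ s < x))) ↔ x ∈ C) :
    (potentialField lam g).Regions E S C :=
  _root_.regions_of (fun x => by rw [W.pos_iff, hE])
    (fun x => by rw [W.neg_iff, ← hS, mem_Ioo])
    (fun x => by rw [W.pos_iff, W.neg_iff, ← hC, mem_Ioo])

end Parameters

/-! ### The individual assertions of the theorem -/

section Clauses

variable {lam β r c p q : ℝ} {G M : ℝ → ℝ} {L : ℝ → ℝ}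

lemma contact_clause (hW : 0 < β → Well √β (lowerForce β) G M c (L β)) :
    (∀ x, lieOne (potentialField lam (lowerForce β)).X (x, 0) = 0 ↔ x = lam) ∧
    (potentialField lam (lowerForce β)).InvisibleFoldX (lam, 0) ∧
    (β < 0 → ∀ x, lieOne (potentialField lam (lowerForce β)).Y (x, 0) < 0) ∧
    (β = 0 → (∀ x, lieOne (potentialField lam (lowerForce β)).Y (x, 0) = 0 ↔ x = 0) ∧
      (potentialField lam (lowerForce β)).CuspY (0, 0)) ∧
    (0 < β → (∀ x, lieOne (potentialField lam (lowerForce β)).Y (x, 0) = 0 ↔ x = -√β ∨ x = √β) ∧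
      (potentialField lam (lowerForce β)).VisibleFoldY (-√β, 0) ∧
      (potentialField lam (lowerForce β)).InvisibleFoldY (√β, 0) ∧
      (∀ x, (potentialField lam (lowerForce β)).Joins .lower x (-√β) ↔ x = 3 * √β)) := by
  refine ⟨fun x => by rw [lieOne_X, sub_eq_zero, eq_comm], invisibleFoldX_iff.2 rfl, fun h x => ?_,
    ?_, fun h => ⟨fun x => by rw [lieOne_Y, neg_eq_zero, (hW h).zero_iff],
      (hW h).visibleFoldY_iff.2 rfl, (hW h).invisibleFoldY_iff.2 rfl,
      fun x => (hW h).joins_fold_iff⟩⟩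
  · rw [lieOne_Y, lowerForce_of_nonpos h.le]
    linarith [sq_nonneg x]
  · rintro rfl
    rw [lowerForce_of_nonpos le_rfl]
    exact ⟨fun x => by rw [lieOne_Y]; simp, parabola_cuspY_iff.2 ⟨rfl, rfl⟩⟩

lemma stratum_right (hL : ∀ β, 0 < β → √β < L β ∧ L β < 2 * √β)
    (h : ∃ k ∈ Finset.Icc 11 17, Stratum L k lam β) : 0 < β ∧ √β < lam := by
  obtain ⟨k, hk, h⟩ := h
  obtain ⟨hk1, hk2⟩ := Finset.mem_Icc.1 hk
  have h0 : 0 < β := by interval_cases k <;> exact h.1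
  obtain ⟨h1, h2⟩ := hL β h0
  refine ⟨h0, ?_⟩
  interval_cases k <;> obtain ⟨-, h⟩ := h <;> linarith

lemma stratum_mid (h : ∃ k ∈ Finset.Icc 6 10, Stratum L k lam β) :
    0 < β ∧ lam ∈ Icc (-√β) √β := by
  obtain ⟨k, hk, h⟩ := h
  obtain ⟨hk1, hk2⟩ := Finset.mem_Icc.1 hk
  have h0 : 0 < β := by interval_cases k <;> exact h.1
  have hs := Real.sqrt_pos.2 h0
  refine ⟨h0, ?_⟩
  interval_cases k <;> obtain ⟨-, h⟩ := h <;> constructor <;> linarith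

lemma stratum_inner (h : Stratum L 7 lam β ∨ Stratum L 8 lam β ∨ Stratum L 9 lam β) :
    0 < β ∧ lam ∈ Ioo (-√β) √β := by
  have h0 : 0 < β := by rcases h with h | h | h <;> exact h.1
  have hs := Real.sqrt_pos.2 h0
  refine ⟨h0, ?_⟩
  rcases h with ⟨-, h⟩ | ⟨-, h⟩ | ⟨-, h⟩ <;> constructor <;> linarith

/-- Strata 3, 6 and 10 are exactly those in which the contact point of `X` is also one of `Y`. -/
lemma stratum_zero (hW : 0 < β → Well √β (lowerForce β) G M c (L β)) :
    (∃ k ∈ ({3, 6, 10} : Finset ℕ), Stratum L k lam β) ↔ lowerForce β lam = 0 := by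
  constructor
  · rintro ⟨k, hk, h⟩
    simp only [Finset.mem_insert, Finset.mem_singleton] at hk
    rcases hk with rfl | rfl | rfl
    · obtain ⟨rfl, rfl⟩ := h
      rw [lowerForce_of_nonpos le_rfl]; norm_num
    · exact (hW h.1).zero_iff.2 (Or.inl h.2)
    · exact (hW h.1).zero_iff.2 (Or.inr h.2)
  · intro h
    rcases le_or_gt β 0 with h0 | h0
    · rw [lowerForce_of_nonpos h0] at h
      have h1 := sq_nonneg lam
      exact ⟨3, by simp, by linarith, by rw [← pow_eq_zero_iff two_ne_zero]; linarith⟩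
    · rcases (hW h0).zero_iff.1 h with h | h
      · exact ⟨6, by simp, h0, h⟩
      · exact ⟨10, by simp, h0, h⟩

lemma stratum_pos (hL : ∀ β, 0 < β → √β < L β ∧ L β < 2 * √β)
    (hW : 0 < β → Well √β (lowerForce β) G M c (L β))
    (h : ∃ k ∈ ({1, 2, 4, 5, 11, 12, 13, 14, 15, 16, 17} : Finset ℕ), Stratum L k lam β) :
    0 < lowerForce β lam := by
  by_cases hr : ∃ k ∈ Finset.Icc 11 17, Stratum L k lam β
  · obtain ⟨h0, h1⟩ := stratum_right hL hr
    exact (hW h0).out_right _ h1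
  obtain ⟨k, hk, h⟩ := h
  have hk' : k = 1 ∨ k = 2 ∨ k = 4 ∨ k = 5 := by
    by_contra hc
    refine hr ⟨k, ?_, h⟩
    simp only [Finset.mem_insert, Finset.mem_singleton] at hk
    rw [Finset.mem_Icc]
    omega
  rcases hk' with rfl | rfl | rfl | rfl
  · have h : β < 0 := h
    rw [lowerForce_of_nonpos h.le]
    linarith [sq_nonneg lam]
  · obtain ⟨rfl, h⟩ := h
    rw [lowerForce_of_nonpos le_rfl]
    simp only [sub_zero]
    exact (even_two.pow_pos h.ne)
  · obtain ⟨rfl, h⟩ := h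
    rw [lowerForce_of_nonpos le_rfl]
    simp only [sub_zero]
    exact pow_pos h 2
  · exact (hW h.1).out_left _ h.2

lemma canardsIn_eq_empty (hL : ∀ β, 0 < β → √β < L β ∧ L β < 2 * √β)
    (hW : 0 < β → Well √β (lowerForce β) G M c (L β)) (hs : 0 < β → 10 * √β < r)
    (hr' : r ≤ 1 / 2)
    (h : ∃ k ∈ ({1, 2, 3, 4, 5, 13, 14, 15, 16, 17} : Finset ℕ), Stratum L k lam β) :
    (potentialField lam (lowerForce β)).canardsIn (square r) = ∅ := by
  rcases le_or_gt β 0 with h0 | h0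
  · rw [lowerForce_of_nonpos h0]; exact parabola_canardsIn h0
  have h1 := Real.sqrt_pos.2 h0
  obtain ⟨h2, h3⟩ := hL β h0
  have key : lam < -√β ∨ L β < lam := by
    obtain ⟨k, hk, h⟩ := h
    simp only [Finset.mem_insert, Finset.mem_singleton] at hk
    rcases hk with rfl | rfl | rfl | rfl | rfl | rfl | rfl | rfl | rfl | rfl
    · exact absurd h0 (not_lt.2 (le_of_lt h))
    · exact absurd h.1 h0.ne'
    · exact absurd h.1 h0.ne'
    · exact absurd h.1 h0.ne'
    · exact Or.inl h.2
    · exact Or.inr h.2.1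
    · exact Or.inr (by linarith [h.2])
    · exact Or.inr (by linarith [h.2.1])
    · exact Or.inr (by linarith [h.2])
    · exact Or.inr (by linarith [h.2])
  rcases key with h | h
  · exact (hW h0).canardsIn_of_lt hr' h
  · exact (hW h0).canardsIn_of_gt (hs h0) hr' h

lemma bigLoop_clause (hW : 0 < β → Well √β (lowerForce β) G M c (L β)) (hs : 0 < β → 10 * √β < r)
    (hr' : r ≤ 1 / 2) (h : ∃ k ∈ Finset.Icc 6 10, Stratum L k lam β) :
    ∃ Γ, (potentialField lam (lowerForce β)).canardsIn (square r) = {Γ} ∧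
      (potentialField lam (lowerForce β)).KindIII Γ ∧ (-√β, 0) ∈ Γ ∧ (3 * √β, 0) ∈ Γ ∧
      (Stratum L 6 lam β → ¬ (potentialField lam (lowerForce β)).Hyperbolic Γ) ∧
      (Stratum L 7 lam β ∨ Stratum L 8 lam β ∨ Stratum L 9 lam β →
        (potentialField lam (lowerForce β)).Hyperbolic Γ ∧
        (potentialField lam (lowerForce β)).IsRepeller Γ) ∧
      (Stratum L 10 lam β →
        (potentialField lam (lowerForce β)).IsRepeller Γ ∧ (√β, 0) ∈ insideOf Γ ∧
        ∀ γ, (potentialField lam (lowerForce β)).IsTrajectory γ → γ 0 ∈ insideOf Γ →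
          Tendsto γ atTop (𝓝 (√β, 0))) := by
  obtain ⟨h0, hl⟩ := stratum_mid h
  have W := hW h0
  have hpos := W.pos
  refine ⟨bigLoop √β lam G, W.canardsIn_of_mem (hs h0) hr' hl, W.bigLoop_kindIII,
    Well.fold_mem_bigLoop, W.right_mem_bigLoop, ?_, fun h => ?_, ?_⟩
  · rintro ⟨-, rfl⟩
    exact W.bigLoop_not_hyperbolic (hs h0) hr'
  · obtain ⟨-, i1, i2⟩ := stratum_inner h
    exact ⟨W.bigLoop_hyperbolic ⟨i1, i2⟩, W.isRepeller_bigLoop ⟨i1, i2.le⟩⟩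
  · rintro ⟨-, rfl⟩
    refine ⟨W.isRepeller_bigLoop ⟨by linarith, le_rfl⟩, W.focus_mem_insideOf, fun γ hγ h => ?_⟩
    rw [W.insideOf_bigLoop] at h
    exact W.tendsto_focus hγ h

lemma parabola_regions {E S C : Set ℝ} (hβ : β ≤ 0)
    (hE : ∀ x, (x < lam ∧ ¬ (x = 0 ∧ β = 0)) ↔ x ∈ E) (hS : S = ∅)
    (hC : ∀ x, (lam < x ∧ ¬ (x = 0 ∧ β = 0)) ↔ x ∈ C) :
    (potentialField lam (lowerForce β)).Regions E S C := by
  have e : ∀ x : ℝ, 0 < x ^ 2 - β ↔ ¬ (x = 0 ∧ β = 0) := by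
    intro x
    constructor
    · rintro h ⟨rfl, rfl⟩; norm_num at h
    · intro h
      refine lt_of_le_of_ne (by linarith [sq_nonneg x]) fun h' => h ⟨?_, by linarith [sq_nonneg x]⟩
      rw [← pow_eq_zero_iff two_ne_zero]; linarith [sq_nonneg x]
  have e' : ∀ x : ℝ, ¬ x ^ 2 - β < 0 := fun x => not_lt.2 (by linarith [sq_nonneg x])
  rw [lowerForce_of_nonpos hβ]
  refine regions_of (fun x => by rw [e, hE]) (fun x => ?_) fun x => ?_
  · rw [hS]; exact iff_of_false (fun h => e' x h.2) (notMem_empty x)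
  · rw [e, ← hC]
    exact ⟨fun h => h.resolve_left fun h => e' x h.2, Or.inr⟩

lemma regions_flat (B : Balance lam r (lowerForce β) p q) :
    (Stratum L 1 lam β → (potentialField lam (lowerForce β)).Regions (Iio lam) ∅ (Ioi lam) ∧
      p = (-1 + √(1 + 4 * β + 4 * lam)) / 2 ∧ q = (1 - √(1 + 4 * β - 4 * lam)) / 2) ∧
    (Stratum L 2 lam β → (potentialField lam (lowerForce β)).Regions (Iio lam) ∅ (Ioo lam 0 ∪ Ioi 0)) ∧
    (Stratum L 3 lam β → (potentialField lam (lowerForce β)).Regions (Iio 0) ∅ (Ioi 0)) ∧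
    (Stratum L 4 lam β → (potentialField lam (lowerForce β)).Regions (Iio 0 ∪ Ioo 0 lam) ∅ (Ioi lam)) := by
  have hle := B.le
  refine ⟨fun h => ?_, ?_, ?_, ?_⟩
  · have h : β < 0 := h
    refine ⟨parabola_regions h.le (fun x => ?_) rfl fun x => ?_, ?_, ?_⟩
    · simp [h.ne]
    · simp [h.ne]
    · have e := B.num_eq
      rw [lowerForce_of_nonpos h.le] at e
      -- The equation for `p` is quadratic, and `|p| < 1/2` selects the root.
      rw [show 1 + 4 * β + 4 * lam = (2 * p + 1) ^ 2 by linear_combination -4 * e,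
        Real.sqrt_sq (by linarith [B.num_mem.1])]
      ring
    · have e := B.den_eq
      rw [lowerForce_of_nonpos h.le] at e
      rw [show 1 + 4 * β - 4 * lam = (1 - 2 * q) ^ 2 by linear_combination 4 * e,
        Real.sqrt_sq (by linarith [B.den_mem.2])]
      ring
  · rintro ⟨rfl, h⟩
    refine parabola_regions le_rfl (fun x => ?_) rfl fun x => ?_ <;>
      simp only [mem_union, mem_Ioo, mem_Iio, mem_Ioi] <;> grind
  · rintro ⟨rfl, rfl⟩
    refine parabola_regions le_rfl (fun x => ?_) rfl fun x => ?_ <;>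
      simp only [mem_Iio, mem_Ioi] <;> grind
  · rintro ⟨rfl, h⟩
    refine parabola_regions le_rfl (fun x => ?_) rfl fun x => ?_ <;>
      simp only [mem_union, mem_Ioo, mem_Iio, mem_Ioi] <;> grind

lemma regions_folded (hL : ∀ β, 0 < β → √β < L β ∧ L β < 2 * √β)
    (hW : 0 < β → Well √β (lowerForce β) G M c (L β)) (hs : 0 < β → 10 * √β < r)
    (B : Balance lam r (lowerForce β) p q) :
    (Stratum L 5 lam β → (potentialField lam (lowerForce β)).Regions (Iio lam) (Ioo (-√β) √β)
      (Ioo lam (-√β) ∪ Ioi √β) ∧ q < -√β) ∧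
    (Stratum L 6 lam β → (potentialField lam (lowerForce β)).Regions (Iio (-√β)) (Ioo (-√β) √β) (Ioi √β)) ∧
    (Stratum L 7 lam β ∨ Stratum L 8 lam β ∨ Stratum L 9 lam β →
      (potentialField lam (lowerForce β)).Regions (Iio (-√β)) (Ioo lam √β) (Ioo (-√β) lam ∪ Ioi √β) ∧
      p ∈ Ioo lam √β ∧ (potentialField lam (lowerForce β)).SigmaAttractor p ∧ q ∈ Ioo (-√β) lam) ∧
    (Stratum L 10 lam β →
      (potentialField lam (lowerForce β)).Regions (Iio (-√β)) ∅ (Ioo (-√β) √β ∪ Ioi √β)) ∧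
    ((∃ k ∈ Finset.Icc 11 17, Stratum L k lam β) →
      (potentialField lam (lowerForce β)).Regions (Iio (-√β) ∪ Ioo √β lam) ∅ (Ioo (-√β) √β ∪ Ioi lam) ∧
      √β < p) := by
  refine ⟨?_, ?_, fun h => ?_, ?_, fun h => ?_⟩
  · rintro ⟨h0, h⟩
    have W := hW h0
    have hpos := W.pos
    refine ⟨W.regions_of (fun x => ?_) (fun x => ?_) fun x => ?_,
      (W.order_left (hs h0) B h).2.2⟩ <;>
      simp only [mem_union, mem_Ioo, mem_Iio, mem_Ioi] <;> grind
  · rintro ⟨h0, rfl⟩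
    have W := hW h0
    have hpos := W.pos
    refine W.regions_of (fun x => ?_) (fun x => ?_) fun x => ?_ <;>
      simp only [mem_Ioo, mem_Iio, mem_Ioi] <;> grind
  · obtain ⟨h0, hm⟩ := stratum_inner h
    have W := hW h0
    have hpos := W.pos
    obtain ⟨o1, o2, o3, o4⟩ := W.order_mid (hs h0) B hm
    obtain ⟨i1, i2⟩ := hm
    refine ⟨W.regions_of (fun x => ?_) (fun x => ?_) fun x => ?_, ⟨o3, o4⟩,
      B.sigmaAttractor o3, o1, o2⟩ <;>
      simp only [mem_union, mem_Ioo, mem_Iio, mem_Ioi] <;> grind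
  · rintro ⟨h0, rfl⟩
    have W := hW h0
    have hpos := W.pos
    refine W.regions_of (fun x => ?_) (fun x => ?_) fun x => ?_ <;>
      simp only [mem_union, mem_Ioo, mem_Iio, mem_Ioi, mem_empty_iff_false] <;> grind
  · obtain ⟨h0, h1⟩ := stratum_right hL h
    have W := hW h0
    have hpos := W.pos
    refine ⟨W.regions_of (fun x => ?_) (fun x => ?_) fun x => ?_,
      (W.order_right (hs h0) B h1).1⟩ <;>
      simp only [mem_union, mem_Ioo, mem_Iio, mem_Ioi, mem_empty_iff_false] <;> grind

end Clauses

/-! ### Assembly -/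

theorem theorem1 :
    ∃ L : ℝ → ℝ, ∀ r : ℝ, 0 < r → r ≤ 1 / 2 →
    ∃ lam₀ > 0, ∃ β₀ > 0, 3 * √β₀ < lam₀ ∧
    (∀ β ∈ Ioo 0 β₀, √β < L β ∧ L β < 2 * √β) ∧
    -- the strata partition the parameter rectangle, and each of them accumulates at the origin
    (∀ lam ∈ Ioo (-lam₀) lam₀, ∀ β ∈ Ioo (-β₀) β₀, ∃! k, Stratum L k lam β) ∧
    (∀ k ∈ Finset.Icc 1 17, ∀ ε > 0, ∃ lam β, |lam| < ε ∧ |β| < ε ∧ Stratum L k lam β) ∧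
    -- the phase portraits are essentially the same exactly in the same stratum
    (∀ lam ∈ Ioo (-lam₀) lam₀, ∀ β ∈ Ioo (-β₀) β₀,
      ∀ lam' ∈ Ioo (-lam₀) lam₀, ∀ β' ∈ Ioo (-β₀) β₀, ∀ k k' : ℕ,
      Stratum L k lam β → Stratum L k' lam' β' →
      ((family lam β).SamePortrait r (family lam' β') ↔ k = k')) ∧
    -- contact points, for all parameters
    (∀ lam ∈ Ioo (-lam₀) lam₀, ∀ β ∈ Ioo (-β₀) β₀,
      (∀ x, lieOne (family lam β).X (x, 0) = 0 ↔ x = lam) ∧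
      (family lam β).InvisibleFoldX (lam, 0) ∧
      (β < 0 → ∀ x, lieOne (family lam β).Y (x, 0) < 0) ∧
      (β = 0 → (∀ x, lieOne (family lam β).Y (x, 0) = 0 ↔ x = 0) ∧
        (family lam β).CuspY (0, 0)) ∧
      (0 < β → (∀ x, lieOne (family lam β).Y (x, 0) = 0 ↔ x = -√β ∨ x = √β) ∧
        (family lam β).VisibleFoldY (-√β, 0) ∧ (family lam β).InvisibleFoldY (√β, 0) ∧
        (∀ x, (family lam β).Joins .lower x (-√β) ↔ x = 3 * √β))) ∧
    -- the individual strata: regions, pseudo equilibria, canard cycles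
    (∀ lam ∈ Ioo (-lam₀) lam₀, ∀ β ∈ Ioo (-β₀) β₀,
      ∃ p q : ℝ, (family lam β).DirZeros r p q ∧
      (Stratum L 1 lam β → (family lam β).Regions (Iio lam) ∅ (Ioi lam) ∧
        p = (-1 + √(1 + 4 * β + 4 * lam)) / 2 ∧ q = (1 - √(1 + 4 * β - 4 * lam)) / 2) ∧
      (Stratum L 2 lam β → (family lam β).Regions (Iio lam) ∅ (Ioo lam 0 ∪ Ioi 0)) ∧
      (Stratum L 3 lam β → (family lam β).Regions (Iio 0) ∅ (Ioi 0)) ∧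
      (Stratum L 4 lam β → (family lam β).Regions (Iio 0 ∪ Ioo 0 lam) ∅ (Ioi lam)) ∧
      (Stratum L 5 lam β → (family lam β).Regions (Iio lam) (Ioo (-√β) √β)
        (Ioo lam (-√β) ∪ Ioi √β) ∧ q < -√β) ∧
      (Stratum L 6 lam β → (family lam β).Regions (Iio (-√β)) (Ioo (-√β) √β) (Ioi √β)) ∧
      (Stratum L 7 lam β ∨ Stratum L 8 lam β ∨ Stratum L 9 lam β →
        (family lam β).Regions (Iio (-√β)) (Ioo lam √β) (Ioo (-√β) lam ∪ Ioi √β) ∧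
        p ∈ Ioo lam √β ∧ (family lam β).SigmaAttractor p ∧ q ∈ Ioo (-√β) lam) ∧
      (Stratum L 10 lam β →
        (family lam β).Regions (Iio (-√β)) ∅ (Ioo (-√β) √β ∪ Ioi √β)) ∧
      ((∃ k ∈ Finset.Icc 11 17, Stratum L k lam β) →
        (family lam β).Regions (Iio (-√β) ∪ Ioo √β lam) ∅ (Ioo (-√β) √β ∪ Ioi lam) ∧
        √β < p) ∧
      -- pseudo equilibria
      ((∃ k ∈ ({3, 6, 10} : Finset ℕ), Stratum L k lam β) →
        p = lam ∧ q = lam ∧ (family lam β).Pseudos r ∅ ∅) ∧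
      ((∃ k ∈ ({3, 6, 10} : Finset ℕ), Stratum L k lam β) ∨
        (family lam β).Pseudos r {p} {q}) ∧
      ((∃ k ∈ ({1, 2, 4, 5, 11, 12, 13, 14, 15, 16, 17} : Finset ℕ), Stratum L k lam β) →
        p < lam ∧ (family lam β).SigmaRepeller p ∧ lam < q) ∧
      -- canard cycles of kind III, and the strata without canard cycles
      ((∃ k ∈ ({1, 2, 3, 4, 5, 13, 14, 15, 16, 17} : Finset ℕ), Stratum L k lam β) →
        (family lam β).canardsIn (square r) = ∅) ∧
      ((∃ k ∈ Finset.Icc 6 10, Stratum L k lam β) →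
        ∃ Γ, (family lam β).canardsIn (square r) = {Γ} ∧ (family lam β).KindIII Γ ∧
          (-√β, 0) ∈ Γ ∧ (3 * √β, 0) ∈ Γ ∧
          (Stratum L 6 lam β → ¬ (family lam β).Hyperbolic Γ) ∧
          (Stratum L 7 lam β ∨ Stratum L 8 lam β ∨ Stratum L 9 lam β →
            (family lam β).Hyperbolic Γ ∧ (family lam β).IsRepeller Γ) ∧
          (Stratum L 10 lam β →
            (family lam β).IsRepeller Γ ∧ (√β, 0) ∈ insideOf Γ ∧
            ∀ γ, (family lam β).IsTrajectory γ → γ 0 ∈ insideOf Γ →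
              Tendsto γ atTop (𝓝 (√β, 0))))) ∧
    -- the two canard cycles of kind I: birth, growth and collision
    (∀ β ∈ Ioo 0 β₀, ∃ (Γ₁ Γ₂ : ℝ → Set (ℝ × ℝ)) (Γ₀ Γc : Set (ℝ × ℝ)),
      (family (√β) β).canardsIn (square r) = {Γ₀} ∧
      (∀ lam ∈ Ioo √β (L β),
        (family lam β).canardsIn (square r) = {Γ₁ lam, Γ₂ lam} ∧
        (family lam β).KindI (Γ₁ lam) ∧ (family lam β).KindI (Γ₂ lam) ∧
        (family lam β).IsAttractor (Γ₁ lam) ∧ (family lam β).IsRepeller (Γ₂ lam) ∧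
        Γ₁ lam ⊆ insideOf (Γ₂ lam)) ∧
      (∀ lam ∈ Ioo √β (L β), ∀ lam' ∈ Ioo √β (L β), lam < lam' →
        Γ₁ lam ⊆ insideOf (Γ₁ lam') ∧ Γ₂ lam' ⊆ insideOf (Γ₂ lam)) ∧
      Tendsto (fun lam => Metric.hausdorffEDist (Γ₁ lam) {(√β, 0)}) (𝓝[>] √β) (𝓝 0) ∧
      Tendsto (fun lam => Metric.hausdorffEDist (Γ₂ lam) Γ₀) (𝓝[>] √β) (𝓝 0) ∧
      Tendsto (fun lam => Metric.hausdorffEDist (Γ₁ lam) Γc) (𝓝[<] (L β)) (𝓝 0) ∧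
      Tendsto (fun lam => Metric.hausdorffEDist (Γ₂ lam) Γc) (𝓝[<] (L β)) (𝓝 0) ∧
      (family (L β) β).canardsIn (square r) = {Γc} ∧
      (family (L β) β).KindI Γc ∧ ¬ (family (L β) β).Hyperbolic Γc ∧
      (family (L β) β).AttractsFrom Γc (insideOf Γc) ∧
      (family (L β) β).RepelsFrom Γc (outsideOf Γc)) := by
  obtain ⟨L, hL, hwell⟩ := exists_threshold
  refine ⟨L, fun r hr hr' => ?_⟩
  -- With `lam₀ = r / 4` and `β₀ = s₀²`, the two bounds on `s₀` give the smallness required of a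
  -- `Well`, the inequality `10 √β < r` that keeps the cycles in the square, and `3 √β₀ < lam₀`.
  obtain ⟨s₀, hs₀, hs1, hs2⟩ : ∃ s₀ > 0, s₀ < 1 / 10000 ∧ 12 * s₀ < r / 8 :=
    ⟨min (1 / 20000) (r / 100), by positivity, by linarith [min_le_left (1 / 20000 : ℝ) (r / 100)],
      by linarith [min_le_right (1 / 20000 : ℝ) (r / 100)]⟩
  have hsqrt : ∀ β ∈ Ioo (-(s₀ ^ 2)) (s₀ ^ 2), 0 < β → √β < s₀ := fun β hβ _ =>
    (Real.sqrt_lt' hs₀).2 hβ.2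
  have hs : ∀ β ∈ Ioo (-(s₀ ^ 2)) (s₀ ^ 2), 0 < β → 10 * √β < r := fun β hβ h => by
    linarith [hsqrt β hβ h]
  have hW : ∀ β : ℝ, ∃ G M c, β ∈ Ioo (-(s₀ ^ 2)) (s₀ ^ 2) → 0 < β →
      Well √β (lowerForce β) G M c (L β) := by
    intro β
    by_cases h : β ∈ Ioo (-(s₀ ^ 2)) (s₀ ^ 2) ∧ 0 < β
    · obtain ⟨G, M, c, W⟩ := hwell β h.2 (by linarith [hsqrt β h.1 h.2])
      exact ⟨G, M, c, fun _ _ => W⟩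
    · exact ⟨0, 0, 0, fun h1 h2 => absurd ⟨h1, h2⟩ h⟩
  choose G M c hW using hW
  have hB : ∀ lam ∈ Ioo (-(r / 4)) (r / 4), ∀ β ∈ Ioo (-(s₀ ^ 2)) (s₀ ^ 2),
      ∃ p q, Balance lam r (lowerForce β) p q := fun lam hl β hβ =>
    exists_balance_lowerForce hr hr' (hW β hβ) (hs β hβ) (by nlinarith [hβ.1]) hl
  simp only [family_eq]
  refine ⟨r / 4, by positivity, s₀ ^ 2, by positivity, ?_, fun β hβ => hL β hβ.1,
    fun lam _ β _ => ?_, fun k hk ε hε => exists_stratum_near hL hk hε,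
    fun lam hl β hβ lam' hl' β' hβ' k k' hk hk' => ?_, fun lam _ β hβ => contact_clause (hW β hβ),
    fun lam hl β hβ => ?_, fun β hβ => ?_⟩
  · rw [Real.sqrt_sq hs₀.le]; linarith
  · obtain ⟨k, hk⟩ := exists_stratum L lam β
    exact ⟨k, hk, fun k' hk' => by rw [eq_stratumIndex (hL β) hk, eq_stratumIndex (hL β) hk']⟩
  · obtain ⟨p, q, B⟩ := hB lam hl β hβ
    obtain ⟨p', q', B'⟩ := hB lam' hl' β' hβ'
    exact samePortrait_iff hL hr hr' (hs β hβ) (hs β' hβ') (hW β hβ) (hW β' hβ') B B' hk hk'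
  · obtain ⟨p, q, B⟩ := hB lam hl β hβ
    have hWβ := hW β hβ
    obtain ⟨f1, f2, f3, f4⟩ := regions_flat B
    obtain ⟨f5, f6, f7, f8, f9⟩ := regions_folded hL hWβ (hs β hβ) B
    refine ⟨p, q, B.dirZeros, f1, f2, f3, f4, f5, f6, f7, f8, f9,
      fun h => ?_, ?_, fun h => ?_, canardsIn_eq_empty hL hWβ (hs β hβ) hr',
      bigLoop_clause hWβ (hs β hβ) hr'⟩
    · have hz := (stratum_zero hWβ).1 h
      exact ⟨(B.of_zero hz).1, (B.of_zero hz).2, B.pseudos_of_zero hz⟩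
    · rw [stratum_zero hWβ]
      exact or_iff_not_imp_left.2 B.pseudos_of_ne
    · obtain ⟨h1, h2⟩ := B.of_pos (stratum_pos hL hWβ h)
      exact ⟨h1, B.sigmaRepeller h1, h2⟩
  · have hβ' : β ∈ Ioo (-(s₀ ^ 2)) (s₀ ^ 2) := ⟨by linarith [hβ.1, sq_nonneg s₀], hβ.2⟩
    have W := hW β hβ' hβ.1
    have hpos := W.pos
    have hr₁ := hs β hβ' hβ.1
    obtain ⟨Γ₁, Γ₂, h1, h2, h3, h4, h5, h6⟩ := W.two_cycles hr₁ hr'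
    exact ⟨Γ₁, Γ₂, _, _, W.canardsIn_of_mem hr₁ hr' ⟨by linarith, le_rfl⟩, h1, h2, h3, h4, h5, h6,
      W.canardsIn_collision hr₁ hr', W.kindI_loop W.c_mem W.lt_L W.mid_c,
      W.semistable_not_hyperbolic, W.semistable.1, W.semistable.2⟩

end
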